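/- **Theorem 1.1.** Every convex contact cobordism $(M^{2n+1},\xi,X,\phi)$ is strictly convex homotopic to a convex contact handlebody. *Convex contact cobordisms.* $M$ is a smooth compact Hausdorff manifold of dimension $2n+1$ ($n\ge 0$, not necessarily connected or nonempty) with boundary $\partial M=\partial_-M\sqcup\partial_+M$, where each of $\partial_\pm M$ may be empty; $\xi=\ker\alpha$ is a cooriented contact structure; $X$ is a contact vector field ($\mathcal L_X\alpha=\mu\alpha$); $\phi$ is a Morse function; $(X,\phi)$ is gradient-like, i.e. $d\phi(X)\ge\delta(|X|^2+|d\phi|^2)$ for a Riemannian metric and some $\delta>0$; and each nonempty $\partial_\pm M$ is a regular level set of $\phi$, with $\phi$ attaining its minimum on $\partial_-M$ and its maximum on $\partial_+M$. It is *cylindrical* if $\phi$ has no critical points (the empty cobordism is allowed). *Strict convex homotopy.* A family $(\xi_t,X_t,\phi_t)$, $t\in[0,1]$, smooth on $[0,1]\times M$, such that $(M,\xi_t,X_t,\phi_t)$ is a convex contact cobordism for every $t$, with $\partial_\pm M$ fixed. In particular every $\phi_t$ is Morse, so there are no birth-death singularities; $\xi_t$ may vary. *Standard models.* On $\mathbb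 R^{2n+1}$ with $\alpha=dz+\frac12\sum_i(x_i\,dy_i-y_i\,dx_i)$ put, for $0\le k\le n$, $$X_k=z\partial_z+\sum_{i\le k}(-x_i\partial_{x_i}+2y_i\partial_{y_i})+\tfrac12\sum_{i>k}(x_i\partial_{x_i}+y_i\partial_{y_i}),\qquad \phi_k=z^2+\sum_{i\le k}(-x_i^2+y_i^2)+\sum_{i>k}(x_i^2+y_i^2),$$ and for $n+1\le k\le 2n+1$ put $X_k=-X_{2n+1-k}$, $\phi_k=-\phi_{2n+1-k}$. For $0\le j\le n$ let $r_{L,j}^2=\sum_{i\le j}x_i^2$ and $r_{C,j}^2=z^2+\sum_i y_i^2+\sum_{i>j}x_i^2$. Put $f_k=(r_{L,k},r_{C,k})$ for $k\le n$ (subcritical) and $f_k=(r_{C,2n+1-k},r_{L,2n+1-k})$ for $k\ge n+1$ (supercritical). *Handles.* Fix any $\delta>0$ and any positive smooth even function $\chi$ on $[-1-\delta,1+\delta]$ that is nondecreasing on $[0,1+\delta]$, satisfies $\chi(p)\ge\sqrt{p^2-1}$ for $1\le p\le 1+\delta$, and equals $\sqrt{p^2-1}$ near the endpoints. Let $S=\{(p,q):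 |p|\le 1+\delta,\ |q|\le\chi(p),\ p^2-q^2\le 1\}$. The handle of index $k$ and size $\varepsilon>0$ is $H=f_k^{-1}(\varepsilon S)$ with the structure $(\ker\alpha,X_k,\phi_k)$; its attaching region is $R=H\cap f_k^{-1}(\{p^2-q^2=\varepsilon^2\})\subset\phi_k^{-1}(-\varepsilon^2)$. *Handle attachment.* A convex contact cobordism $M'$ is obtained from $M$ by attaching a handle of index $k$ if $M'$ contains smoothly embedded codimension-zero copies of $M$ and, for some $\varepsilon>0$, of $H$ (the latter extending to an embedding, into $\mathbb R^{2n+1}$, of a neighborhood in $M'$), compatible with the cooriented contact structures, the contact vector fields and the Morse functions (on $H$ up to adding a constant to $\phi_k$; on the neighborhood of $H$ only the contact structure and vector field need match), such that $\partial_-M'=\partial_-M$, $M\cap H=R\subset\partial_+M$, and all critical points of $M'$ lie in $M\cup H$ (so that the rest of $M'$ is a collar above $M\cup H$ that makes the upper boundary level). A *convex contact handlebody* is a convex contact cobordism obtained from a cylindrical one by finitely many such attachments, with indices $0\le k\le 2n+1$. -/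

import Mathlib

open Set Bundle
open scoped Manifold ContDiff

universe u

noncomputable section

namespace ConvexContact

/-! ### One-forms, vector fields and functions on a manifold with boundary -/

section Calculus

variable {E : Type*} [NormedAddCommGroup E] [NormedSpace ℝ E]
  {H : Type*} [TopologicalSpace H] (I : ModelWithCorners ℝ E H)
  {M : Type*} [TopologicalSpace M] [ChartedSpace H M]

/-- The differential of a real function at a point, as a covector. -/
def dfun (φ : M → ℝ) (x : M) : TangentSpace I x →L[ℝ] ℝ :=
  mfderiv I 𝓘(ℝ, ℝ) φ x

/-- The one-form `α` read in the preferred chart at `x` (its pullback by the inverse chart). -/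
def chartForm (α : ∀ x : M, TangentSpace I x →L[ℝ] ℝ) (x : M) (y : E) : E →L[ℝ] ℝ :=
  (α ((extChartAt I x).symm y)).comp
    (mfderivWithin 𝓘(ℝ, E) I (extChartAt I x).symm (range I) y)

/-- The exterior derivative `dα` at `x`, computed in the preferred chart at `x`:
`dα(u, v) = (D_u a)(v) - (D_v a)(u)`, where `a` is the coordinate expression of `α`. -/
def extDer (α : ∀ x : M, TangentSpace I x →L[ℝ] ℝ) (x : M) (u v : TangentSpace I x) : ℝ :=
  let D : E →L[ℝ] E →L[ℝ] ℝ := fderivWithin ℝ (chartForm I α x) (range I) (extChartAt I x x)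
  let u' : E := mfderiv I 𝓘(ℝ, E) (extChartAt I x) x u
  let v' : E := mfderiv I 𝓘(ℝ, E) (extChartAt I x) x v
  D u' v' - D v' u'

/-- The Lie derivative `L_X α = d(α(X)) + i_X dα`. -/
def lieDer (X : ∀ x : M, TangentSpace I x) (α : ∀ x : M, TangentSpace I x →L[ℝ] ℝ)
    (x : M) (v : TangentSpace I x) : ℝ :=
  dfun I (fun y => α y (X y)) x v + extDer I α x (X x) v

/-- A contact form: it vanishes nowhere and `dα` is nondegenerate on the hyperplanes `ker α`
(in dimension `2n+1`, this says `α ∧ (dα)^n ≠ 0` everywhere). -/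
def IsContactForm (α : ∀ x : M, TangentSpace I x →L[ℝ] ℝ) : Prop :=
  ∀ x : M, α x ≠ 0 ∧
    ∀ v : TangentSpace I x, α x v = 0 →
      (∀ w : TangentSpace I x, α x w = 0 → extDer I α x v w = 0) → v = 0

/-- A contact vector field for `ker α`: `L_X α = μ α` for some function `μ`. -/
def IsContactField (α : ∀ x : M, TangentSpace I x →L[ℝ] ℝ) (X : ∀ x : M, TangentSpace I x) :
    Prop :=
  ∃ μ : M → ℝ, ∀ (x : M) (v : TangentSpace I x), lieDer I X α x v = μ x * α x v

/-- The Hessian of `φ` in the preferred chart at `x`; meaningful at critical points. -/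
def chartHessian (φ : M → ℝ) (x : M) : E →L[ℝ] E →L[ℝ] ℝ :=
  fderivWithin ℝ (fderivWithin ℝ (φ ∘ (extChartAt I x).symm) (range I)) (range I)
    (extChartAt I x x)

/-- All critical points of `φ` are nondegenerate. -/
def IsMorse (φ : M → ℝ) : Prop :=
  ∀ x : M, dfun I φ x = 0 → ∀ u : E, (∀ v : E, chartHessian I φ x u v = 0) → u = 0

/-- `(X, φ)` is a gradient-like (Lyapunov) pair: for some Riemannian metric and some `δ > 0`,
`dφ(X) ≥ δ (|X|² + |dφ|²)`. The dual norm `|dφ|` is the supremum of `dφ(v)` over `|v| ≤ 1`.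
On a compact manifold the choice of the metric does not matter. -/
def IsGradientLike [IsManifold I ∞ M] (X : ∀ x : M, TangentSpace I x) (φ : M → ℝ) : Prop :=
  ∃ g : ContMDiffRiemannianMetric I ∞ E (fun x : M => TangentSpace I x),
    ∃ δ : ℝ, 0 < δ ∧ ∀ (x : M) (v : TangentSpace I x), g.inner x v v ≤ 1 →
      δ * (g.inner x (X x) (X x) + (dfun I φ x v) ^ 2) ≤ dfun I φ x (X x)

end Calculus

/-! ### Cobordisms and convex contact structures -/

/-- A smooth cobordism of dimension `2n+1`: a compact manifold with boundary, whose boundary is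
divided into a lower part `bot` and an upper part `top`, either of which may be empty. -/
structure Cobordism (n : ℕ) : Type (u + 1) where
  carrier : Type u
  [topology : TopologicalSpace carrier]
  [charts : ChartedSpace (EuclideanHalfSpace (2 * n + 1)) carrier]
  [smooth : IsManifold (𝓡∂ (2 * n + 1)) ∞ carrier]
  [hausdorff : T2Space carrier]
  [compact : CompactSpace carrier]
  bot : Set carrier
  top : Set carrier
  boundary_eq : (𝓡∂ (2 * n + 1)).boundary carrier = bot ∪ top
  disjoint_bot_top : Disjoint bot top

attribute [instance] Cobordism.topology Cobordism.charts Cobordism.smooth Cobordism.hausdorff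
  Cobordism.compact

/-- The tangent space of a cobordism at a point. -/
abbrev Cobordism.T {n : ℕ} (C : Cobordism n) (x : C.carrier) : Type :=
  TangentSpace (𝓡∂ (2 * n + 1)) x

/-- A convex contact structure on a cobordism. The cooriented contact structure is `ξ = ker α`;
the contact form `α` matters only up to multiplication by a positive function. -/
structure ConvexStructure {n : ℕ} (C : Cobordism n) where
  /-- a contact form for `ξ`, inducing its coorientation -/
  α : ∀ x : C.carrier, C.T x →L[ℝ] ℝ
  /-- the contact vector field -/
  X : ∀ x : C.carrier, C.T x
  /-- the Morse function -/
  φ : C.carrier → ℝ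
  smooth_form : ContMDiff (𝓡∂ (2 * n + 1))
    ((𝓡∂ (2 * n + 1)).prod 𝓘(ℝ, EuclideanSpace ℝ (Fin (2 * n + 1)) →L[ℝ] ℝ)) ∞
    (fun x : C.carrier =>
      TotalSpace.mk' (EuclideanSpace ℝ (Fin (2 * n + 1)) →L[ℝ] ℝ)
        (E := fun x : C.carrier => C.T x →L[ℝ] ℝ) x (α x))
  smooth_field : ContMDiff (𝓡∂ (2 * n + 1)) (𝓡∂ (2 * n + 1)).tangent ∞
    (fun x : C.carrier => (⟨x, X x⟩ : TangentBundle (𝓡∂ (2 * n + 1)) C.carrier))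
  smooth_fun : ContMDiff (𝓡∂ (2 * n + 1)) 𝓘(ℝ, ℝ) ∞ φ
  contact_form : IsContactForm (𝓡∂ (2 * n + 1)) α
  contact_field : IsContactField (𝓡∂ (2 * n + 1)) α X
  morse : IsMorse (𝓡∂ (2 * n + 1)) φ
  gradient_like : IsGradientLike (𝓡∂ (2 * n + 1)) X φ
  /-- the lower boundary is a regular level set, on which `φ` attains its minimum -/
  bot_level : C.bot = ∅ ∨ ∃ c : ℝ, C.bot = φ ⁻¹' {c} ∧ ∀ y, c ≤ φ y
  bot_regular : ∀ x ∈ C.bot, dfun (𝓡∂ (2 * n + 1)) φ x ≠ 0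
  /-- the upper boundary is a regular level set, on which `φ` attains its maximum -/
  top_level : C.top = ∅ ∨ ∃ c : ℝ, C.top = φ ⁻¹' {c} ∧ ∀ y, φ y ≤ c
  top_regular : ∀ x ∈ C.top, dfun (𝓡∂ (2 * n + 1)) φ x ≠ 0

/-- A strict convex homotopy from `S₀` to `S₁`: a family of convex contact structures on the same
cobordism, indexed by `[0,1]` and jointly smooth on `[0,1] × M`. Every member is convex, so in
particular every function of the family is Morse; the contact structure may vary. -/
def StrictlyConvexHomotopic {n : ℕ} {C : Cobordism n} (S₀ S₁ : ConvexStructure C) : Prop :=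
  ∃ F : Icc (0 : ℝ) 1 → ConvexStructure C, F 0 = S₀ ∧ F 1 = S₁ ∧
    ContMDiff ((𝓡∂ 1).prod (𝓡∂ (2 * n + 1)))
      ((𝓡∂ (2 * n + 1)).prod 𝓘(ℝ, EuclideanSpace ℝ (Fin (2 * n + 1)) →L[ℝ] ℝ)) ∞
      (fun p : Icc (0 : ℝ) 1 × C.carrier =>
        TotalSpace.mk' (EuclideanSpace ℝ (Fin (2 * n + 1)) →L[ℝ] ℝ)
          (E := fun x : C.carrier => C.T x →L[ℝ] ℝ) p.2 ((F p.1).α p.2)) ∧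
    ContMDiff ((𝓡∂ 1).prod (𝓡∂ (2 * n + 1))) (𝓡∂ (2 * n + 1)).tangent ∞
      (fun p : Icc (0 : ℝ) 1 × C.carrier =>
        (⟨p.2, (F p.1).X p.2⟩ : TangentBundle (𝓡∂ (2 * n + 1)) C.carrier)) ∧
    ContMDiff ((𝓡∂ 1).prod (𝓡∂ (2 * n + 1))) 𝓘(ℝ, ℝ) ∞
      (fun p : Icc (0 : ℝ) 1 × C.carrier => (F p.1).φ p.2)

/-- A convex contact cobordism is cylindrical if it has no critical points. -/
def IsCylindrical {n : ℕ} {C : Cobordism n} (S : ConvexStructure C) : Prop :=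
  ∀ x : C.carrier, dfun (𝓡∂ (2 * n + 1)) S.φ x ≠ 0

/-! ### The standard convex contact structures on `ℝ^(2n+1)` -/

/-- `ℝ^(2n+1)` with coordinates `(x, y, z)`. -/
abbrev Std (n : ℕ) : Type := (Fin n → ℝ) × (Fin n → ℝ) × ℝ

/-- `dz + ½ ∑ (x_i dy_i - y_i dx_i)`, evaluated at the point `p` on the vector `w`. -/
def stdForm {n : ℕ} (p w : Std n) : ℝ :=
  w.2.2 + (1 / 2) * ∑ i, (p.1 i * w.2.1 i - p.2.1 i * w.1 i)

/-- `z ∂_z + ∑_{i ≤ k} (-x_i ∂_{x_i} + 2 y_i ∂_{y_i}) + ½ ∑_{i > k} (x_i ∂_{x_i} + y_i ∂_{y_i})`. -/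
def subField {n : ℕ} (k : ℕ) (p : Std n) : Std n :=
  (fun i => if (i : ℕ) < k then -p.1 i else (1 / 2) * p.1 i,
   fun i => if (i : ℕ) < k then 2 * p.2.1 i else (1 / 2) * p.2.1 i,
   p.2.2)

/-- The radius in the isotropic directions `x_1, …, x_k`. -/
def radL {n : ℕ} (k : ℕ) (p : Std n) : ℝ :=
  Real.sqrt (∑ i : Fin n, if (i : ℕ) < k then (p.1 i) ^ 2 else 0)

/-- The radius in the complementary, coisotropic directions. -/
def radC {n : ℕ} (k : ℕ) (p : Std n) : ℝ :=
  Real.sqrt ((p.2.2) ^ 2 + ∑ i : Fin n, (p.2.1 i) ^ 2 +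
    ∑ i : Fin n, if (i : ℕ) < k then 0 else (p.1 i) ^ 2)

/-- `z² + ∑_{i ≤ k} (-x_i² + y_i²) + ∑_{i > k} (x_i² + y_i²)`. -/
def subFun {n : ℕ} (k : ℕ) (p : Std n) : ℝ :=
  (p.2.2) ^ 2 + ∑ i : Fin n,
    ((if (i : ℕ) < k then -(p.1 i) ^ 2 else (p.1 i) ^ 2) + (p.2.1 i) ^ 2)

/-- The vector field of the standard convex contact structure of index `k ≤ 2n+1`: subcritical
for `k ≤ n`, and the negative of the model of index `2n+1-k` for `k ≥ n+1`. -/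
def stdField {n : ℕ} (k : ℕ) (p : Std n) : Std n :=
  if k ≤ n then subField k p else -subField (2 * n + 1 - k) p

/-- The Morse function of the standard convex contact structure of index `k ≤ 2n+1`. -/
def stdFun {n : ℕ} (k : ℕ) (p : Std n) : ℝ :=
  if k ≤ n then subFun k p else -subFun (2 * n + 1 - k) p

/-- The map `(r_L, r_C)` (subcritical case) or `(r_C, r_L)` (supercritical case): the radius in
the descending directions, followed by the radius in the ascending directions. -/
def stdRadii {n : ℕ} (k : ℕ) (p : Std n) : ℝ × ℝ :=
  if k ≤ n then (radL k p, radC k p) else (radC (2 * n + 1 - k) p, radL (2 * n + 1 - k) p)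

/-! ### Handles -/

/-- A profile for the handles: a number `δ > 0` and a positive smooth even function `χ` on
`[-1-δ, 1+δ]`, nondecreasing on `[0, 1+δ]`, which lies above the hyperbola `p² - q² = 1` and
coincides with it near the endpoints. -/
structure HandleProfile where
  δ : ℝ
  χ : ℝ → ℝ
  δ_pos : 0 < δ
  smooth : ContDiffOn ℝ ∞ χ (Icc (-(1 + δ)) (1 + δ))
  even : ∀ p ∈ Icc (-(1 + δ)) (1 + δ), χ (-p) = χ p
  mono : MonotoneOn χ (Icc 0 (1 + δ))
  pos : 0 < χ 0
  above : ∀ p ∈ Icc 1 (1 + δ), Real.sqrt (p ^ 2 - 1) ≤ χ p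
  eq_near_end : ∃ η, 0 < η ∧ η < δ ∧ ∀ p ∈ Icc (1 + δ - η) (1 + δ), χ p = Real.sqrt (p ^ 2 - 1)

/-- The planar region `S`, bounded by the hyperbola `p² - q² = 1` and the graphs of `±χ`. -/
def HandleProfile.region (P : HandleProfile) : Set (ℝ × ℝ) :=
  {s | |s.1| ≤ 1 + P.δ ∧ |s.2| ≤ P.χ s.1 ∧ s.1 ^ 2 - s.2 ^ 2 ≤ 1}

/-- The standard handle of index `k` and size `ε`: the preimage of `ε S` under the radii. -/
def handle (P : HandleProfile) (n k : ℕ) (ε : ℝ) : Set (Std n) :=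
  {p | (ε⁻¹ * (stdRadii k p).1, ε⁻¹ * (stdRadii k p).2) ∈ P.region}

/-- The attaching region of the handle: its lower boundary, on the level `-ε²` of the standard
Morse function, that is, over the hyperbola `p² - q² = ε²`. -/
def attachingRegion (P : HandleProfile) (n k : ℕ) (ε : ℝ) : Set (Std n) :=
  {p ∈ handle P n k ε | (stdRadii k p).1 ^ 2 - (stdRadii k p).2 ^ 2 = ε ^ 2}

/-- `(C', S')` is obtained from `(C, S)` by attaching a standard handle of index `k`.
The result contains a copy of `C` and a copy of the handle of index `k`, meeting exactly along the
attaching region of the handle, which lies in the upper boundary of `C`. Their union is the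
pre-handle attachment. The rest of `C'` is a collar above the union, which makes the new upper
boundary a level set: it contains no critical points. (Being nonzero there and pointing out of the
union, the field then flows the upper boundary of the union to the upper boundary of `C'`.) -/
def IsHandleAttachment (P : HandleProfile) {n : ℕ} (k : ℕ) {C C' : Cobordism n}
    (S : ConvexStructure C) (S' : ConvexStructure C') : Prop :=
  ∃ (ι : C.carrier → C'.carrier) (O : Set C'.carrier) (g : C'.carrier → Std n) (ε c : ℝ),
    -- `ι` is a smooth embedding of codimension zero respecting the lower boundaries
    ContMDiff (𝓡∂ (2 * n + 1)) (𝓡∂ (2 * n + 1)) ∞ ι ∧ Function.Injective ι ∧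
    (∀ x, Function.Bijective (mfderiv (𝓡∂ (2 * n + 1)) (𝓡∂ (2 * n + 1)) ι x)) ∧
    ι '' C.bot = C'.bot ∧
    -- it respects the cooriented contact structures, the vector fields and the functions
    (∀ x, ∃ f : ℝ, 0 < f ∧ ∀ v : C.T x,
      S'.α (ι x) (mfderiv (𝓡∂ (2 * n + 1)) (𝓡∂ (2 * n + 1)) ι x v) = f * S.α x v) ∧
    (∀ x, mfderiv (𝓡∂ (2 * n + 1)) (𝓡∂ (2 * n + 1)) ι x (S.X x) = S'.X (ι x)) ∧
    (∀ x, S'.φ (ι x) = S.φ x) ∧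
    -- `g` is a smooth embedding of the open set `O` in the model, whose image contains the handle
    0 < ε ∧ IsOpen O ∧ ContMDiffOn (𝓡∂ (2 * n + 1)) 𝓘(ℝ, Std n) ∞ g O ∧
    Topology.IsEmbedding (O.domRestrict g) ∧
    (∀ x ∈ O, Function.Bijective (mfderiv (𝓡∂ (2 * n + 1)) 𝓘(ℝ, Std n) g x)) ∧
    handle P n k ε ⊆ g '' O ∧
    -- it respects the cooriented contact structures and the vector fields, and on the handle also
    -- the functions up to a constant
    (∀ x ∈ O, ∃ f : ℝ, 0 < f ∧ ∀ v : C'.T x,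
      stdForm (g x) (mfderiv (𝓡∂ (2 * n + 1)) 𝓘(ℝ, Std n) g x v) = f * S'.α x v) ∧
    (∀ x ∈ O, mfderiv (𝓡∂ (2 * n + 1)) 𝓘(ℝ, Std n) g x (S'.X x) = stdField k (g x)) ∧
    (∀ x ∈ O, g x ∈ handle P n k ε → S'.φ x = stdFun k (g x) + c) ∧
    -- the copy of `C` and the handle meet along the attaching region, in the upper boundary of `C`
    range ι ∩ (O ∩ g ⁻¹' handle P n k ε) = O ∩ g ⁻¹' attachingRegion P n k ε ∧
    O ∩ g ⁻¹' attachingRegion P n k ε ⊆ ι '' C.top ∧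
    -- there are no further critical points
    (∀ x, dfun (𝓡∂ (2 * n + 1)) S'.φ x = 0 → x ∈ range ι ∪ (O ∩ g ⁻¹' handle P n k ε))

/-- Convex contact handlebodies: the convex contact cobordisms obtained from a cylindrical one by
finitely many attachments of standard subcritical and supercritical handles. The cylindrical
cobordism may be empty. -/
inductive IsHandlebody (P : HandleProfile) {n : ℕ} :
    ∀ {C : Cobordism n}, ConvexStructure C → Prop
  | cylinder {C : Cobordism n} (S : ConvexStructure C) (h : IsCylindrical S) : IsHandlebody P S
  | attach {C C' : Cobordism n} (S : ConvexStructure C) (S' : ConvexStructure C')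
      (hS : IsHandlebody P S) (k : ℕ) (hk : k ≤ 2 * n + 1)
      (h : IsHandleAttachment P k S S') : IsHandlebody P S'

end ConvexContact

end

open Set Bundle
open scoped Manifold ContDiff Topology

noncomputable section

namespace ConvexContact

/-! The theorem splits into a local normal form at each critical point, reached by strict
homotopies, and a global induction which cuts the manifold along regular levels.

Reduction to pointwise conditions. For a Morse function on a compact manifold whose critical points
are interior, being gradient-like is equivalent to a condition at each point, `LyapunovAt`: away
from the zeros `dφ(X) > 0`, and at a zero `dφ(X)` grows at least quadratically in the distance. This
condition does not mention a metric, it is local, and it implies nondegeneracy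
(`lyapunovAt_of_isGradientLike`, `isGradientLike_of_lyapunovAt`,
`LyapunovAt.hessian_nondegenerate`). Hence a structure can be changed inside a coordinate system and
glued back (`ConvexStructure.glue`, `Presents.exists_of_move`).

Linear algebra at a critical point. Let `A` be the linearisation of `X`, `q` the Hessian of `φ` and
`ξ = ker α`. Then `q(v, Av) > 0` for `v ≠ 0` (`fderiv_fderiv_pos`), and differentiating the equation
of a contact field gives `α(Av) = m α(v)` and, on `ξ`, `dα(Au, v) + dα(u, Av) = m dα(u, v)`
(`exists_linear_factor`). As `A` is invertible, `m ≠ 0`. The opposite field and function have factor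
`-m`, and this exchanges the models of index `k` and `2n+1-k`, so let `m > 0`. There is an
`A`-invariant subspace `E` of `ξ` on which `q` is negative and whose `q`-orthogonal complement in
`ξ` is positive (`exists_invariant_negative`). It is isotropic, since `A` contracts it while scaling
`dα` by `m ≥ 0` (`eq_zero_of_conformal_contraction`). In a symplectic basis adapted to `E`
(`exists_symplectic_basis`), `A` preserves a flag, and a weighted block diagonal quadratic form `B`
is a Lyapunov function both for `A` and for a diagonal model field (`exists_block_lyapunov`). No
normal form of `A` itself is needed.

Nonlinear part (`LocalData.Valid.exists_moves_std`). The contact form is made standard near the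
point; then the function becomes `B(w, w)/2`; then the field is interpolated linearly to the
diagonal field; then the function becomes the standard one; finally the two parameters of the
diagonal field become 1. The order matters: the inequality `df(X) ≥ c|w|²` is linear in `f` and in
`X` separately, so a segment of functions with a fixed field, or of fields with a fixed function, is
harmless as soon as its ends are. All changes are cut off by functions with `|w| |dσ| ≤ η`, where
`η` is as small as desired on arbitrarily small balls (`exists_cutoff`); a term of second order
multiplied by such a cutoff disturbs the inequality by `O(η |w|²)` only. Two steps need more care.
Changing the contact form would change the linear part of the field, so the Hamiltonian is corrected
at the same time (`LocalData.Valid.exists_move_form`). Changing `m` alters the Hamiltonian `m z` to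
first order and requires an anisotropic cutoff (`reeb_cutoff_estimate`).

Global part. Treating the critical points one by one, and adding small constants near them, makes
all of them standard with distinct values (`ConvexStructure.exists_standard`). Let `p` be the
highest one, `ε` small and `c = φ(p) - ε²`. The sublevel of `c` is a cobordism with one critical
point less. On the standard handle of size `ε` at `p` the function is at least `c`, with equality
exactly on the attaching region, so the whole manifold arises from the sublevel by a handle
attachment (`ConvexStructure.IsStandardNear.exists_attach`). Induction on the number of critical
points ends with a cylindrical cobordism. -/

/-- A shortcut instance: the general search is slow. -/
instance normedAddCommGroupBilinear {E F G : Type*} [NormedAddCommGroup E] [NormedSpace ℝ E]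
    [NormedAddCommGroup F] [NormedSpace ℝ F] [NormedAddCommGroup G] [NormedSpace ℝ G] :
    NormedAddCommGroup (E →L[ℝ] F →L[ℝ] G) :=
  ContinuousLinearMap.toNormedAddCommGroup

/-- A shortcut instance: the general search is slow. -/
instance normedSpaceBilinear {E F G : Type*} [NormedAddCommGroup E] [NormedSpace ℝ E]
    [NormedAddCommGroup F] [NormedSpace ℝ F] [NormedAddCommGroup G] [NormedSpace ℝ G] :
    NormedSpace ℝ (E →L[ℝ] F →L[ℝ] G) :=
  ContinuousLinearMap.toNormedSpace

/-! ### Derivatives of charts. -/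

section Charts

variable {E : Type*} [NormedAddCommGroup E] [NormedSpace ℝ E]
  {H : Type*} [TopologicalSpace H] (I : ModelWithCorners ℝ E H)
  {M : Type*} [TopologicalSpace M] [ChartedSpace H M]

/-- The derivative at `x` of the preferred extended chart at `x₀`. -/
def chartD (x₀ x : M) : TangentSpace I x →L[ℝ] E := mfderiv I 𝓘(ℝ, E) (extChartAt I x₀) x

/-- The derivative of the inverse of the preferred extended chart at `x₀`, over the point `x`. -/
def chartDsymm (x₀ x : M) : E →L[ℝ] TangentSpace I x :=
  mfderivWithin 𝓘(ℝ, E) I (extChartAt I x₀).symm (range I) (extChartAt I x₀ x)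

variable [IsManifold I 1 M]

lemma chartD_comp_chartDsymm {x₀ x : M} (hx : x ∈ (extChartAt I x₀).source) :
    (chartD I x₀ x).comp (chartDsymm I x₀ x) = ContinuousLinearMap.id ℝ E :=
  mfderiv_extChartAt_comp_mfderivWithin_extChartAt_symm' hx

lemma chartDsymm_comp_chartD {x₀ x : M} (hx : x ∈ (extChartAt I x₀).source) :
    (chartDsymm I x₀ x).comp (chartD I x₀ x) = ContinuousLinearMap.id ℝ (TangentSpace I x) :=
  mfderivWithin_extChartAt_symm_comp_mfderiv_extChartAt' hx

lemma chartD_self (x : M) : chartD I x x = ContinuousLinearMap.id ℝ E :=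
  mfderiv_extChartAt_self

lemma chartDsymm_self (x : M) : chartDsymm I x x = ContinuousLinearMap.id ℝ E := by
  have h := chartD_comp_chartDsymm I (mem_extChartAt_source (I := I) x)
  rw [chartD_self] at h
  exact h

@[simp] lemma chartD_chartDsymm {x₀ x : M} (hx : x ∈ (extChartAt I x₀).source) (v : E) :
    chartD I x₀ x (chartDsymm I x₀ x v) = v :=
  congrArg (fun f : E →L[ℝ] E => f v) (chartD_comp_chartDsymm I hx)

@[simp] lemma chartDsymm_chartD {x₀ x : M} (hx : x ∈ (extChartAt I x₀).source)
    (v : TangentSpace I x) : chartDsymm I x₀ x (chartD I x₀ x v) = v :=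
  congrArg (fun f : TangentSpace I x →L[ℝ] TangentSpace I x => f v) (chartDsymm_comp_chartD I hx)

end Charts

/-! ### Smoothness of forms and fields along maps, and naturality of the exterior derivative. -/

section Smoothness

variable {E : Type*} [NormedAddCommGroup E] [NormedSpace ℝ E]
  {H : Type*} [TopologicalSpace H] {I : ModelWithCorners ℝ E H}
  {M : Type*} [TopologicalSpace M] [ChartedSpace H M] [IsManifold I ∞ M]
  {E' : Type*} [NormedAddCommGroup E'] [NormedSpace ℝ E']
  {H' : Type*} [TopologicalSpace H'] {J : ModelWithCorners ℝ E' H'}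
  {N : Type*} [TopologicalSpace N] [ChartedSpace H' N] [IsManifold J ∞ N]
  {EQ : Type*} [NormedAddCommGroup EQ] [NormedSpace ℝ EQ]
  {HQ : Type*} [TopologicalSpace HQ] {K : ModelWithCorners ℝ EQ HQ}
  {Q : Type*} [TopologicalSpace Q] [ChartedSpace HQ Q]

/-- A field of covectors along a map, as a map to the cotangent bundle. -/
abbrev formSec (I : ModelWithCorners ℝ E H) {b : Q → M}
    (α : ∀ q, TangentSpace I (b q) →L[ℝ] ℝ) (q : Q) :
    TotalSpace (E →L[ℝ] ℝ) (fun x : M => TangentSpace I x →L[ℝ] ℝ) :=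
  TotalSpace.mk' (E →L[ℝ] ℝ) (E := fun x : M => TangentSpace I x →L[ℝ] ℝ) (b q) (α q)

lemma eventually_mem_source {b : Q → M} {q₀ : Q} (hb : ContinuousAt b q₀) :
    ∀ᶠ q in 𝓝 q₀, b q ∈ (extChartAt I (b q₀)).source :=
  hb.eventually (extChartAt_source_mem_nhds (I := I) (b q₀))

/-- The bundle is trivialised by the one chart at `b q₀`, which turns smoothness of a covector field
into smoothness of a map to a fixed normed space. The base map `b` is arbitrary, so that families
over a parameter manifold are covered as well. -/
lemma contMDiffAt_form_iff {b : Q → M} {α : ∀ q, TangentSpace I (b q) →L[ℝ] ℝ} {q₀ : Q} :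
    ContMDiffAt K (I.prod 𝓘(ℝ, E →L[ℝ] ℝ)) ∞ (formSec I α) q₀ ↔
      ContMDiffAt K I ∞ b q₀ ∧ ContMDiffAt K 𝓘(ℝ, E →L[ℝ] ℝ) ∞
        (fun q => (α q).comp (chartDsymm I (b q₀) (b q))) q₀ := by
  have : IsManifold I 1 M := .of_le (n := ∞) (by simp)
  rw [contMDiffAt_hom_bundle]
  refine and_congr_right fun hb => ?_
  refine Filter.EventuallyEq.contMDiffAt_iff ?_
  filter_upwards [eventually_mem_source (I := I) hb.continuousAt] with q hq
  rw [extChartAt_source] at hq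
  simp only [formSec, TotalSpace.mk', ContinuousLinearMap.inCoordinates]
  rw [TangentBundle.symmL_trivializationAt hq]
  ext v
  simp [chartDsymm]

lemma contMDiffAt_field_iff {b : Q → M} {X : ∀ q, TangentSpace I (b q)} {q₀ : Q} :
    ContMDiffAt K I.tangent ∞ (fun q => (⟨b q, X q⟩ : TangentBundle I M)) q₀ ↔
      ContMDiffAt K I ∞ b q₀ ∧ ContMDiffAt K 𝓘(ℝ, E) ∞
        (fun q => chartD I (b q₀) (b q) (X q)) q₀ := by
  have : IsManifold I 1 M := .of_le (n := ∞) (by simp)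
  rw [contMDiffAt_totalSpace]
  refine and_congr_right fun hb => ?_
  refine Filter.EventuallyEq.contMDiffAt_iff ?_
  filter_upwards [eventually_mem_source (I := I) hb.continuousAt] with q hq
  have hq' := hq
  rw [extChartAt_source] at hq
  rw [chartD, ← TangentBundle.continuousLinearMapAt_trivializationAt hq,
    Trivialization.continuousLinearMapAt_apply, Trivialization.linearMapAt_apply, if_pos]
  simpa using hq

/-- The expression of the derivative of `F` in charts. -/
lemma contMDiffAt_mfderiv_inCharts {F : M → N} {x₀ : M} (hF : ContMDiffAt I J ∞ F x₀) :
    ContMDiffAt I 𝓘(ℝ, E →L[ℝ] E') ∞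
      (fun x => (chartD J (F x₀) (F x)).comp
        ((mfderiv I J F x).comp (chartDsymm I x₀ x))) x₀ := by
  have : IsManifold I 1 M := .of_le (n := ∞) (by simp)
  have : IsManifold J 1 N := .of_le (n := ∞) (by simp)
  refine (hF.mfderiv_const (m := ∞) (by simp)).congr_of_eventuallyEq ?_
  filter_upwards [eventually_mem_source (I := I) (continuousAt_id (x := x₀)),
    eventually_mem_source (I := J) hF.continuousAt] with x h1 h2
  rw [extChartAt_source] at h1 h2
  rw [inTangentCoordinates_eq_mfderiv_comp h1 h2]
  rfl

omit [IsManifold I ∞ M] in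
lemma contMDiffAt_clm_inverse [CompleteSpace E] {D : Q → E →L[ℝ] E'} {q₀ : Q}
    (hD : ContMDiffAt K 𝓘(ℝ, E →L[ℝ] E') ∞ D q₀) (h : (D q₀).IsInvertible) :
    ContMDiffAt K 𝓘(ℝ, E' →L[ℝ] E) ∞ (fun q => (D q).inverse) q₀ := by
  obtain ⟨e, he⟩ := h
  have h1 : ContMDiffAt 𝓘(ℝ, E →L[ℝ] E') 𝓘(ℝ, E' →L[ℝ] E) ∞
      (ContinuousLinearMap.inverse : (E →L[ℝ] E') → E' →L[ℝ] E) (D q₀) := by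
    rw [contMDiffAt_iff_contDiffAt, ← he]
    exact contDiffAt_map_inverse e
  exact h1.comp q₀ hD

lemma eventually_isInvertible [CompleteSpace E] {D : Q → E →L[ℝ] E'} {q₀ : Q}
    (hD : ContinuousAt D q₀) (h : (D q₀).IsInvertible) : ∀ᶠ q in 𝓝 q₀, (D q).IsInvertible := by
  obtain ⟨e, he⟩ := h
  have := ContinuousLinearEquiv.nhds (𝕜 := ℝ) e
  rw [he] at this
  filter_upwards [hD this] with q hq
  obtain ⟨e', he'⟩ := hq
  exact ⟨e', he'⟩

/-- Inserting the identity `chartDsymm ∘ chartD` between the form and the derivative of `F` exhibits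
the pullback in charts as a composition of two smooth operator families. -/
lemma contMDiffAt_pullback_form {b : Q → M} {q₀ : Q} {F : M → N}
    {β : ∀ q, TangentSpace J (F (b q)) →L[ℝ] ℝ}
    (hb : ContMDiffAt K I ∞ b q₀) (hF : ContMDiffAt I J ∞ F (b q₀))
    (hβ : ContMDiffAt K (J.prod 𝓘(ℝ, E' →L[ℝ] ℝ)) ∞ (formSec J (b := fun q => F (b q)) β) q₀) :
    ContMDiffAt K (I.prod 𝓘(ℝ, E →L[ℝ] ℝ)) ∞
      (formSec I (b := b) (fun q => (β q).comp (mfderiv I J F (b q)))) q₀ := by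
  have : IsManifold I 1 M := .of_le (n := ∞) (by simp)
  have : IsManifold J 1 N := .of_le (n := ∞) (by simp)
  rw [contMDiffAt_form_iff] at hβ ⊢
  refine ⟨hb, ?_⟩
  have h1 := (contMDiffAt_mfderiv_inCharts hF).comp q₀ hb
  refine (hβ.2.clm_comp h1).congr_of_eventuallyEq ?_
  filter_upwards [eventually_mem_source (I := J) hβ.1.continuousAt] with q hq
  ext v
  simp [chartDsymm_chartD J hq]

lemma contMDiffAt_pushforward_field {b : Q → M} {q₀ : Q} {F : M → N}
    {X : ∀ q, TangentSpace I (b q)} (hF : ContMDiffAt I J ∞ F (b q₀))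
    (hX : ContMDiffAt K I.tangent ∞ (fun q => (⟨b q, X q⟩ : TangentBundle I M)) q₀) :
    ContMDiffAt K J.tangent ∞
      (fun q => (⟨F (b q), mfderiv I J F (b q) (X q)⟩ : TangentBundle J N)) q₀ := by
  have : IsManifold I 1 M := .of_le (n := ∞) (by simp)
  have : IsManifold J 1 N := .of_le (n := ∞) (by simp)
  rw [contMDiffAt_field_iff] at hX ⊢
  refine ⟨hF.comp q₀ hX.1, ?_⟩
  have h1 := (contMDiffAt_mfderiv_inCharts hF).comp q₀ hX.1
  refine (h1.clm_apply hX.2).congr_of_eventuallyEq ?_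
  filter_upwards [eventually_mem_source (I := I) hX.1.continuousAt] with q hq
  simp [chartDsymm_chartD I hq]

lemma isInvertible_of_bijective [FiniteDimensional ℝ E] {D : E →L[ℝ] E'}
    (h : Function.Bijective D) : D.IsInvertible := by
  let e := LinearEquiv.ofBijective D.toLinearMap h
  have : FiniteDimensional ℝ E' := e.finiteDimensional
  exact ⟨e.toContinuousLinearEquiv, by ext; rfl⟩

lemma isInvertible_chartD {x₀ x : M} (hx : x ∈ (extChartAt I x₀).source) :
    Function.Bijective (chartD I x₀ x) := by
  have : IsManifold I 1 M := .of_le (n := ∞) (by simp)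
  exact ⟨fun u v h => by simpa [chartDsymm_chartD I hx] using congrArg (chartDsymm I x₀ x) h,
    fun v => ⟨_, chartD_chartDsymm I hx v⟩⟩

lemma isInvertible_chartDsymm {x₀ x : M} (hx : x ∈ (extChartAt I x₀).source) :
    Function.Bijective (chartDsymm I x₀ x) := by
  have : IsManifold I 1 M := .of_le (n := ∞) (by simp)
  exact ⟨fun u v h => by simpa [chartD_chartDsymm I hx] using congrArg (chartD I x₀ x) h,
    fun v => ⟨_, chartDsymm_chartD I hx v⟩⟩

/-- The field is recovered from its image by the inverse of the derivative of `F` in charts.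
Invertibility is an open condition and inversion of operators is smooth, so bijectivity at the base
point is enough. -/
lemma contMDiffAt_pullback_field [FiniteDimensional ℝ E] {b : Q → M} {q₀ : Q} {F : M → N}
    {X : ∀ q, TangentSpace I (b q)}
    (hb : ContMDiffAt K I ∞ b q₀) (hF : ContMDiffAt I J ∞ F (b q₀))
    (hbij : Function.Bijective (mfderiv I J F (b q₀)))
    (hX : ContMDiffAt K J.tangent ∞
      (fun q => (⟨F (b q), mfderiv I J F (b q) (X q)⟩ : TangentBundle J N)) q₀) :
    ContMDiffAt K I.tangent ∞ (fun q => (⟨b q, X q⟩ : TangentBundle I M)) q₀ := by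
  have : IsManifold I 1 M := .of_le (n := ∞) (by simp)
  have : IsManifold J 1 N := .of_le (n := ∞) (by simp)
  have : CompleteSpace E := FiniteDimensional.complete ℝ E
  rw [contMDiffAt_field_iff] at hX ⊢
  refine ⟨hb, ?_⟩
  have h1 := (contMDiffAt_mfderiv_inCharts hF).comp q₀ hb
  have hinv : ((chartD J (F (b q₀)) (F (b q₀))).comp
        ((mfderiv I J F (b q₀)).comp (chartDsymm I (b q₀) (b q₀)))).IsInvertible := by
    refine isInvertible_of_bijective ?_
    exact (isInvertible_chartD (mem_extChartAt_source (I := J) _)).comp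
      (hbij.comp (isInvertible_chartDsymm (mem_extChartAt_source (I := I) _)))
  refine ((contMDiffAt_clm_inverse h1 hinv).clm_apply hX.2).congr_of_eventuallyEq ?_
  filter_upwards [eventually_mem_source (I := I) hb.continuousAt,
    eventually_isInvertible h1.continuousAt hinv] with q hq hq'
  obtain ⟨e, he⟩ := hq'
  have h2 : chartD J (F (b q₀)) (F (b q)) (mfderiv I J F (b q) (X q)) =
      e (chartD I (b q₀) (b q) (X q)) := by
    have := congrArg (fun f : E →L[ℝ] E' => f (chartD I (b q₀) (b q) (X q))) he
    simp only [Function.comp] at this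
    erw [this]
    simp [chartDsymm_chartD I hq]
  rw [h2]
  simp only [Function.comp] at he
  erw [Function.comp, ← he]
  simp

lemma contMDiffAt_iff_source {f : M → E'} {x : M} :
    ContMDiffAt I 𝓘(ℝ, E') ∞ f x ↔ ContinuousAt f x ∧
      ContDiffWithinAt ℝ ∞ (f ∘ (extChartAt I x).symm) (range I) (extChartAt I x x) := by
  rw [contMDiffAt_iff]
  exact Iff.rfl

lemma eventually_mem_target (x : M) :
    ∀ᶠ y in 𝓝[range I] (extChartAt I x x), y ∈ (extChartAt I x).target :=
  extChartAt_target_mem_nhdsWithin x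

lemma contDiffWithinAt_chartForm {α : ∀ x : M, TangentSpace I x →L[ℝ] ℝ} {x : M}
    (hα : ContMDiffAt I (I.prod 𝓘(ℝ, E →L[ℝ] ℝ)) ∞ (formSec I (b := id) α) x) :
    ContDiffWithinAt ℝ ∞ (chartForm I α x) (range I) (extChartAt I x x) := by
  have h := (contMDiffAt_form_iff.1 hα).2
  have h := (contMDiffAt_iff_source.1 h).2
  refine h.congr_of_eventuallyEq_of_mem ?_ (mem_range_self _)
  filter_upwards [eventually_mem_target (I := I) x] with y hy
  simp only [chartForm, chartDsymm, Function.comp, id]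
  rw [(extChartAt I x).right_inv hy]

lemma extDer_eq {α : ∀ x : M, TangentSpace I x →L[ℝ] ℝ} {x : M} (u v : TangentSpace I x) :
    extDer I α x u v =
      fderivWithin ℝ (chartForm I α x) (range I) (extChartAt I x x) u v -
      fderivWithin ℝ (chartForm I α x) (range I) (extChartAt I x x) v u := by
  have : IsManifold I 1 M := .of_le (n := ∞) (by simp)
  have h : (mfderiv I 𝓘(ℝ, E) (extChartAt I x) x : E →L[ℝ] E) = ContinuousLinearMap.id ℝ E :=
    chartD_self I x
  simp only [extDer]
  erw [h]
  rfl

/-- The expression of a map in charts. -/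
lemma contDiffWithinAt_writtenIn {F : M → N} {x : M} (hF : ContMDiffAt I J ∞ F x) :
    ContDiffWithinAt ℝ ∞ (writtenInExtChartAt I J x F) (range I) (extChartAt I x x) :=
  (contMDiffAt_iff.1 hF).2

lemma mfderiv_eq_fderivWithin {F : M → N} {x : M} (hF : ContMDiffAt I J ∞ F x) :
    (mfderiv I J F x : E →L[ℝ] E') =
      fderivWithin ℝ (writtenInExtChartAt I J x F) (range I) (extChartAt I x x) := by
  rw [mfderiv]
  exact if_pos (hF.mdifferentiableAt (by simp))

lemma eventually_fderivWithin_writtenIn {F : M → N} {x : M} (hF : ContMDiffAt I J ∞ F x) :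
    ∀ᶠ y in 𝓝[range I] (extChartAt I x x),
      fderivWithin ℝ (writtenInExtChartAt I J x F) (range I) y =
        (chartD J (F x) (F ((extChartAt I x).symm y))).comp
          ((mfderiv I J F ((extChartAt I x).symm y)).comp
            (mfderivWithin 𝓘(ℝ, E) I (extChartAt I x).symm (range I) y)) := by
  have : IsManifold I 1 M := .of_le (n := ∞) (by simp)
  have : IsManifold J 1 N := .of_le (n := ∞) (by simp)
  have hc : Filter.Tendsto (extChartAt I x).symm (𝓝[range I] (extChartAt I x x)) (𝓝 x) := by
    have := (continuousAt_extChartAt_symm (I := I) x).tendsto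
    rw [extChartAt_to_inv] at this
    exact this.mono_left nhdsWithin_le_nhds
  have h1 : ∀ᶠ z in 𝓝 x, ContMDiffAt I J 1 F z :=
    contMDiffAt_iff_contMDiffAt_nhds (by simp) |>.1 (hF.of_le (m := 1) (by simp))
  have h2 := eventually_mem_source (I := J) hF.continuousAt
  filter_upwards [eventually_mem_target (I := I) x, hc.eventually h1, hc.eventually h2,
    self_mem_nhdsWithin] with y hy h1 h2 hyr
  have d1 : MDifferentiableWithinAt 𝓘(ℝ, E) I (extChartAt I x).symm (range I) y :=
    mdifferentiableWithinAt_extChartAt_symm hy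
  have d2 : MDifferentiableAt I J F ((extChartAt I x).symm y) := h1.mdifferentiableAt (by simp)
  have d3 : MDifferentiableAt J 𝓘(ℝ, E') (extChartAt J (F x)) (F ((extChartAt I x).symm y)) :=
    mdifferentiableAt_extChartAt (by simpa using h2)
  have hu : UniqueMDiffWithinAt 𝓘(ℝ, E) (range I) y :=
    (I.uniqueDiffOn y hyr).uniqueMDiffWithinAt
  rw [← mfderivWithin_eq_fderivWithin]
  have hs : (writtenInExtChartAt I J x F) =
      (extChartAt J (F x)) ∘ (F ∘ (extChartAt I x).symm) := rfl
  rw [hs, mfderiv_comp_mfderivWithin y (g := extChartAt J (F x)) d3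
      (d2.comp_mdifferentiableWithinAt y d1) hu,
    mfderiv_comp_mfderivWithin y d2 d1 hu]
  rfl

lemma chartForm_pullback {F : M → N} {x : M} (hF : ContMDiffAt I J ∞ F x)
    {α : ∀ x : M, TangentSpace I x →L[ℝ] ℝ} {β : ∀ y : N, TangentSpace J y →L[ℝ] ℝ}
    (h : ∀ᶠ z in 𝓝 x, α z = (β (F z)).comp (mfderiv I J F z)) :
    ∀ᶠ y in 𝓝[range I] (extChartAt I x x),
      chartForm I α x y = (chartForm J β (F x) (writtenInExtChartAt I J x F y)).comp
        (fderivWithin ℝ (writtenInExtChartAt I J x F) (range I) y) := by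
  have : IsManifold I 1 M := .of_le (n := ∞) (by simp)
  have : IsManifold J 1 N := .of_le (n := ∞) (by simp)
  have hc : Filter.Tendsto (extChartAt I x).symm (𝓝[range I] (extChartAt I x x)) (𝓝 x) := by
    have := (continuousAt_extChartAt_symm (I := I) x).tendsto
    rw [extChartAt_to_inv] at this
    exact this.mono_left nhdsWithin_le_nhds
  filter_upwards [hc.eventually h, eventually_fderivWithin_writtenIn hF,
    hc.eventually (eventually_mem_source (I := J) hF.continuousAt)] with y h1 h2 h3
  rw [h2]
  have e1 : (extChartAt J (F x)).symm (writtenInExtChartAt I J x F y) =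
      F ((extChartAt I x).symm y) := (extChartAt J (F x)).left_inv h3
  let βf : N → E' →L[ℝ] ℝ := fun z => β z
  have e3 : βf ((extChartAt J (F x)).symm (writtenInExtChartAt I J x F y)) =
      βf (F ((extChartAt I x).symm y)) := congrArg βf e1
  ext v
  simp only [chartForm]
  rw [h1]
  exact (congrArg₂ (fun (f : E' →L[ℝ] ℝ) (w : E') => f w) e3 (chartDsymm_chartD J h3 _)).symm

/-- `D` is the product rule for `y ↦ b(F y) ∘ F'(y)`. Its term with the second derivative of `F` is
symmetric and drops out on antisymmetrising. -/
lemma pullback_antisymm {b : E' →L[ℝ] ℝ} {Db : E' →L[ℝ] E' →L[ℝ] ℝ} {F' : E →L[ℝ] E'}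
    {F'' : E →L[ℝ] E →L[ℝ] E'} (u v : E) (h : F'' u v = F'' v u) {D : E →L[ℝ] E →L[ℝ] ℝ}
    (hD : D = ((ContinuousLinearMap.compL ℝ E E' ℝ) b).comp F'' +
      ((ContinuousLinearMap.compL ℝ E E' ℝ).flip F').comp (Db.comp F')) :
    D u v - D v u = Db (F' u) (F' v) - Db (F' v) (F' u) := by
  simp [hD, h]

/-- The exterior derivative commutes with pullbacks. -/
lemma extDer_pullback {F : M → N} {x : M} (hF : ContMDiffAt I J ∞ F x)
    {α : ∀ x : M, TangentSpace I x →L[ℝ] ℝ} {β : ∀ y : N, TangentSpace J y →L[ℝ] ℝ}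
    (hβ : ContMDiffAt J (J.prod 𝓘(ℝ, E' →L[ℝ] ℝ)) ∞ (formSec J (b := id) β) (F x))
    (h : ∀ᶠ z in 𝓝 x, α z = (β (F z)).comp (mfderiv I J F z)) (u v : TangentSpace I x) :
    extDer I α x u v = extDer J β (F x) (mfderiv I J F x u) (mfderiv I J F x v) := by
  set Fh := writtenInExtChartAt I J x F with hFh
  set e := extChartAt I x x with he
  have hFe : Fh e = extChartAt J (F x) (F x) := by simp [hFh, he, writtenInExtChartAt]
  have hFs := contDiffWithinAt_writtenIn hF
  have her : e ∈ range I := mem_range_self _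
  have hmap : MapsTo Fh (range I) (range J) := fun y _ => mem_range_self _
  have hb := contDiffWithinAt_chartForm hβ
  rw [← hFe] at hb
  have hbd : HasFDerivWithinAt (chartForm J β (F x))
      (fderivWithin ℝ (chartForm J β (F x)) (range J) (Fh e)) (range J) (Fh e) :=
    (hb.differentiableWithinAt (by simp)).hasFDerivWithinAt
  have hFd : HasFDerivWithinAt Fh (fderivWithin ℝ Fh (range I) e) (range I) e :=
    (hFs.differentiableWithinAt (by simp)).hasFDerivWithinAt
  have hDd : HasFDerivWithinAt (fderivWithin ℝ Fh (range I))
      (fderivWithin ℝ (fderivWithin ℝ Fh (range I)) (range I) e) (range I) e :=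
    ((hFs.fderivWithin_right (m := 1) I.uniqueDiffOn (by norm_cast)
      her).differentiableWithinAt (by simp)).hasFDerivWithinAt
  -- At boundary points the symmetry of the second derivative needs that the range of the model lies
  -- in the closure of its interior.
  have hsymm : IsSymmSndFDerivWithinAt ℝ Fh (range I) e := by
    refine hFs.isSymmSndFDerivWithinAt (by simp; norm_cast) I.uniqueDiffOn ?_ her
    exact I.range_subset_closure_interior her
  have hcomp := (hbd.comp e hFd hmap).clm_comp hDd
  have heq := chartForm_pullback hF h
  have hder := (hcomp.congr_of_eventuallyEq heq
    (heq.self_of_nhdsWithin her)).fderivWithin (I.uniqueDiffOn e her)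
  rw [extDer_eq, extDer_eq, ← he, ← hFe, mfderiv_eq_fderivWithin hF]
  exact pullback_antisymm (E := E) (E' := E') u v (hsymm u v) hder

lemma dfun_comp {F : M → N} {x : M} (hF : ContMDiffAt I J ∞ F x) {f : N → ℝ} {g : M → ℝ}
    (hf : ContMDiffAt J 𝓘(ℝ, ℝ) ∞ f (F x)) (h : ∀ᶠ z in 𝓝 x, g z = f (F z)) :
    dfun I g x = (dfun J f (F x)).comp (mfderiv I J F x) := by
  have h' : g =ᶠ[𝓝 x] f ∘ F := h
  rw [dfun, h'.mfderiv_eq, mfderiv_comp x (hf.mdifferentiableAt (by simp))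
    (hF.mdifferentiableAt (by simp))]
  rfl

end Smoothness

/-- A positive function, continuous and homogeneous of degree two, bounds the squared norm. -/
lemma exists_quadratic_lower_bound {E : Type*} [NormedAddCommGroup E] [NormedSpace ℝ E]
    [FiniteDimensional ℝ E] {f : E → ℝ} (hc : Continuous f)
    (hom : ∀ (s : ℝ) (v : E), f (s • v) = s ^ 2 * f v) (hpos : ∀ v, v ≠ 0 → 0 < f v) :
    ∃ c : ℝ, 0 < c ∧ ∀ v, c * ‖v‖ ^ 2 ≤ f v := by
  have : ProperSpace E := FiniteDimensional.proper ℝ E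
  have h0 : f 0 = 0 := by simpa using hom 0 0
  rcases (Metric.sphere (0 : E) 1).eq_empty_or_nonempty with he | hne
  · refine ⟨1, one_pos, fun v => ?_⟩
    by_cases hv : v = 0
    · simp [hv, h0]
    · exfalso
      have : (‖v‖⁻¹ • v) ∈ Metric.sphere (0 : E) 1 := by
        simp [norm_smul, hv]
      simp [he] at this
  · obtain ⟨u, hu, hmin⟩ := (isCompact_sphere (0 : E) 1).exists_isMinOn hne hc.continuousOn
    have hu0 : u ≠ 0 := by
      rintro rfl; simp at hu
    refine ⟨f u, hpos u hu0, fun v => ?_⟩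
    by_cases hv : v = 0
    · simp [hv, h0]
    · have h1 : (‖v‖⁻¹ • v) ∈ Metric.sphere (0 : E) 1 := by simp [norm_smul, hv]
      have h2 : f u ≤ f (‖v‖⁻¹ • v) := hmin h1
      rw [hom] at h2
      have h3 : 0 < ‖v‖ := norm_pos_iff.2 hv
      calc f u * ‖v‖ ^ 2 ≤ (‖v‖⁻¹ ^ 2 * f v) * ‖v‖ ^ 2 := by gcongr
        _ = f v := by field_simp

/-! ### Riemannian metrics in charts and their pullbacks. -/

section Metric

variable {E : Type*} [NormedAddCommGroup E] [NormedSpace ℝ E]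
  {H : Type*} [TopologicalSpace H] {I : ModelWithCorners ℝ E H}
  {M : Type*} [TopologicalSpace M] [ChartedSpace H M]
  {E' : Type*} [NormedAddCommGroup E'] [NormedSpace ℝ E']
  {H' : Type*} [TopologicalSpace H'] {J : ModelWithCorners ℝ E' H'}
  {N : Type*} [TopologicalSpace N] [ChartedSpace H' N]

/-- The pullback of a bilinear form. -/
def bilPull (B : E' →L[ℝ] E' →L[ℝ] ℝ) (A : E →L[ℝ] E') : E →L[ℝ] E →L[ℝ] ℝ :=
  ((ContinuousLinearMap.compL ℝ E E' ℝ).flip A).comp (B.comp A)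

@[simp] lemma bilPull_apply (B : E' →L[ℝ] E' →L[ℝ] ℝ) (A : E →L[ℝ] E') (u v : E) :
    bilPull B A u v = B (A u) (A v) := rfl

variable (I) in
/-- A bilinear form on the tangent space, read in the preferred chart at `x₀`. -/
def bilChart (x₀ x : M) (B : TangentSpace I x →L[ℝ] TangentSpace I x →L[ℝ] ℝ) :
    E →L[ℝ] E →L[ℝ] ℝ :=
  bilPull (E' := E) B (chartDsymm I x₀ x)

lemma bilChart_apply (x₀ x : M) (B : TangentSpace I x →L[ℝ] TangentSpace I x →L[ℝ] ℝ) (u v : E) :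
    bilChart I x₀ x B u v = B (chartDsymm I x₀ x u) (chartDsymm I x₀ x v) := rfl

variable [IsManifold I ∞ M] [IsManifold J ∞ N]

lemma contMDiffAt_metric_iff {G : ∀ x : M, TangentSpace I x →L[ℝ] TangentSpace I x →L[ℝ] ℝ}
    {x₀ : M} :
    ContMDiffAt I (I.prod 𝓘(ℝ, E →L[ℝ] E →L[ℝ] ℝ)) ∞
      (fun x => TotalSpace.mk' (E →L[ℝ] E →L[ℝ] ℝ)
        (E := fun x : M => TangentSpace I x →L[ℝ] TangentSpace I x →L[ℝ] ℝ) x (G x)) x₀ ↔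
      ContMDiffAt I 𝓘(ℝ, E →L[ℝ] E →L[ℝ] ℝ) ∞ (fun x => bilChart I x₀ x (G x)) x₀ := by
  have : IsManifold I 1 M := .of_le (n := ∞) (by simp)
  rw [contMDiffAt_hom_bundle]
  refine (and_iff_right contMDiffAt_id).trans ?_
  refine Filter.EventuallyEq.contMDiffAt_iff ?_
  filter_upwards [eventually_mem_source (I := I) (continuousAt_id (x := x₀))] with q hq
  have hq' : q ∈ (chartAt H x₀).source := by simpa using hq
  simp only [ContinuousLinearMap.inCoordinates]
  rw [TangentBundle.symmL_trivializationAt hq']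
  ext u v
  rw [bilChart_apply]
  simp only [ContinuousLinearMap.comp_apply]
  rw [Trivialization.continuousLinearMapAt_apply, Trivialization.linearMapAt_apply, if_pos]
  · rw [hom_trivializationAt_apply]
    simp only [ContinuousLinearMap.inCoordinates]
    rw [TangentBundle.symmL_trivializationAt hq']
    simp [chartDsymm]
    rfl
  · simpa using hq'

/-- In finite dimension positivity already gives coercivity, which bounds the unit ball of the form.
A pulled back Riemannian metric needs this. -/
lemma isVonNBounded_posDef [FiniteDimensional ℝ E] (B : E →L[ℝ] E →L[ℝ] ℝ)
    (hpos : ∀ v, v ≠ 0 → 0 < B v v) : Bornology.IsVonNBounded ℝ {v : E | B v v < 1} := by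
  obtain ⟨c, hc, h⟩ := exists_quadratic_lower_bound (f := fun v => B v v) (by fun_prop)
    (fun s v => by simp; ring) hpos
  refine NormedSpace.isVonNBounded_of_isBounded ℝ ?_
  refine (Metric.isBounded_ball (x := (0 : E)) (r := c⁻¹ + 1)).subset fun v hv => ?_
  have h1 := h v
  simp only [mem_ofPred_eq] at hv
  rw [mem_ball_zero_iff]
  by_contra hcon
  push Not at hcon
  have h2 : 1 ≤ c * ‖v‖ := by
    calc 1 = c * c⁻¹ := by field_simp
      _ ≤ c * ‖v‖ := by gcongr; linarith
  have h3 : 1 ≤ ‖v‖ := le_trans (by have := inv_pos.2 hc; linarith) hcon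
  nlinarith

/-- The pullback of a Riemannian metric by an immersion. -/
def pullbackMetric [FiniteDimensional ℝ E] {F : M → N} (hF : ContMDiff I J ∞ F)
    (hinj : ∀ x, Function.Injective (mfderiv I J F x))
    (g : ContMDiffRiemannianMetric J ∞ E' (fun x : N => TangentSpace J x)) :
    ContMDiffRiemannianMetric I ∞ E (fun x : M => TangentSpace I x) where
  inner x := bilPull (E := E) (E' := E') (g.inner (F x)) (mfderiv I J F x)
  symm x v w := g.symm (F x) (mfderiv I J F x v) (mfderiv I J F x w)
  pos x v hv := g.pos (F x) (mfderiv I J F x v) fun h =>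
    hv (hinj x (h.trans (map_zero (mfderiv I J F x)).symm))
  isVonNBounded x := isVonNBounded_posDef
    (bilPull (E := E) (E' := E') (g.inner (F x)) (mfderiv I J F x))
    fun v hv => g.pos (F x) (mfderiv I J F x v) fun h =>
    hv (hinj x (h.trans (map_zero (mfderiv I J F x)).symm))
  contMDiff x := by
    have : IsManifold I 1 M := .of_le (n := ∞) (by simp)
    have : IsManifold J 1 N := .of_le (n := ∞) (by simp)
    refine contMDiffAt_metric_iff.2 ?_
    have h1 := (contMDiffAt_metric_iff.1 (g.contMDiff (F x))).comp x (hF x)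
    have h2 := contMDiffAt_mfderiv_inCharts (hF x)
    have hb : ContDiff ℝ ∞ (fun p : (E' →L[ℝ] E' →L[ℝ] ℝ) × (E →L[ℝ] E') =>
        bilPull p.1 p.2) := by
      unfold bilPull
      fun_prop
    have h3 := (hb.contMDiff.contMDiffAt (x := _)).comp x (h1.prodMk_space h2)
    refine h3.congr_of_eventuallyEq ?_
    filter_upwards [eventually_mem_source (I := J) (hF x).continuousAt] with q hq
    ext u v
    have e : ∀ u : E, chartDsymm J (F x) (F q) (chartD J (F x) (F q)
      ((mfderiv I J F q) (chartDsymm I x q u))) = (mfderiv I J F q) (chartDsymm I x q u) :=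
      fun u => chartDsymm_chartD J hq _
    simp only [Function.comp, bilPull_apply, bilChart_apply, ContinuousLinearMap.comp_apply]
    rw [e, e]
    rfl

end Metric

lemma eventually_norm_sub_lt {X F : Type*} [TopologicalSpace X] [NormedAddCommGroup F]
    {f : X → F} {x : X} (hf : ContinuousAt f x) {ε : ℝ} (hε : 0 < ε) :
    ∀ᶠ y in 𝓝 x, ‖f y - f x‖ < ε := by
  simpa [dist_eq_norm] using Metric.tendsto_nhds.1 hf ε hε

/-! ### The defining conditions at a point: invariance under pullback, and the Lyapunov inequality.
-/

section Pointwise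

variable {E : Type*} [NormedAddCommGroup E] [NormedSpace ℝ E]
  {H : Type*} [TopologicalSpace H] {I : ModelWithCorners ℝ E H}
  {M : Type*} [TopologicalSpace M] [ChartedSpace H M]
  {E' : Type*} [NormedAddCommGroup E'] [NormedSpace ℝ E']
  {H' : Type*} [TopologicalSpace H'] {J : ModelWithCorners ℝ E' H'}
  {N : Type*} [TopologicalSpace N] [ChartedSpace H' N]
  {EQ : Type*} [NormedAddCommGroup EQ] [NormedSpace ℝ EQ]
  {HQ : Type*} [TopologicalSpace HQ] {K : ModelWithCorners ℝ EQ HQ}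
  {Q : Type*} [TopologicalSpace Q] [ChartedSpace HQ Q]

variable (I) in
/-- The contact condition at a point. -/
def ContactFormAt (α : ∀ x : M, TangentSpace I x →L[ℝ] ℝ) (x : M) : Prop :=
  α x ≠ 0 ∧ ∀ v : TangentSpace I x, α x v = 0 →
    (∀ w : TangentSpace I x, α x w = 0 → extDer I α x v w = 0) → v = 0

variable (I) in
/-- The equation of a contact field at a point. -/
def ContactFieldAt (α : ∀ x : M, TangentSpace I x →L[ℝ] ℝ) (X : ∀ x : M, TangentSpace I x)
    (x : M) : Prop :=
  ∃ m : ℝ, ∀ v : TangentSpace I x, lieDer I X α x v = m * α x v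

variable (I) in
/-- The pointwise Lyapunov condition: away from the common zeros of `X` and `dφ` the function
increases along the field, and at such a zero it does so with a quadratic rate. -/
def LyapunovAt (X : ∀ x : M, TangentSpace I x) (φ : M → ℝ) (x : M) : Prop :=
  0 < dfun I φ x (X x) ∨ (X x = 0 ∧ dfun I φ x = 0 ∧ ∃ c : ℝ, 0 < c ∧ ∀ᶠ y in 𝓝 x,
    c * ‖extChartAt I x y - extChartAt I x x‖ ^ 2 ≤ dfun I φ y (X y))

variable [IsManifold I ∞ M] [IsManifold J ∞ N]

lemma contMDiffAt_form_apply {b : Q → M} {α : ∀ q, TangentSpace I (b q) →L[ℝ] ℝ}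
    {X : ∀ q, TangentSpace I (b q)} {q₀ : Q}
    (hα : ContMDiffAt K (I.prod 𝓘(ℝ, E →L[ℝ] ℝ)) ∞ (formSec I α) q₀)
    (hX : ContMDiffAt K I.tangent ∞ (fun q => (⟨b q, X q⟩ : TangentBundle I M)) q₀) :
    ContMDiffAt K 𝓘(ℝ, ℝ) ∞ (fun q => α q (X q)) q₀ := by
  have : IsManifold I 1 M := .of_le (n := ∞) (by simp)
  have hα := contMDiffAt_form_iff.1 hα
  have hX := contMDiffAt_field_iff.1 hX
  refine (hα.2.clm_apply hX.2).congr_of_eventuallyEq ?_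
  filter_upwards [eventually_mem_source (I := I) hX.1.continuousAt] with q hq
  exact congrArg (α q) (chartDsymm_chartD I hq _).symm

lemma lieDer_pullback {F : M → N} {x : M} (hF : ContMDiffAt I J ∞ F x)
    {α : ∀ x : M, TangentSpace I x →L[ℝ] ℝ} {β : ∀ y : N, TangentSpace J y →L[ℝ] ℝ}
    {X : ∀ x : M, TangentSpace I x} {Y : ∀ y : N, TangentSpace J y}
    (hβ : ContMDiffAt J (J.prod 𝓘(ℝ, E' →L[ℝ] ℝ)) ∞ (formSec J (b := id) β) (F x))
    (hY : ContMDiffAt J J.tangent ∞ (fun q => (⟨q, Y q⟩ : TangentBundle J N)) (F x))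
    (h : ∀ᶠ z in 𝓝 x, α z = (β (F z)).comp (mfderiv I J F z))
    (hXY : ∀ᶠ z in 𝓝 x, mfderiv I J F z (X z) = Y (F z)) (v : TangentSpace I x) :
    lieDer I X α x v = lieDer J Y β (F x) (mfderiv I J F x v) := by
  have h1 : dfun I (fun y => α y (X y)) x =
      (dfun J (fun y => β y (Y y)) (F x)).comp (mfderiv I J F x) := by
    refine dfun_comp hF (contMDiffAt_form_apply hβ hY) ?_
    filter_upwards [h, hXY] with z h1 h2
    rw [h1, ← h2]
    rfl
  simp only [lieDer]
  rw [h1, extDer_pullback hF hβ h, hXY.self_of_nhds]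
  rfl

lemma contactFormAt_pullback {F : M → N} {x : M} (hF : ContMDiffAt I J ∞ F x)
    (hbij : Function.Bijective (mfderiv I J F x))
    {α : ∀ x : M, TangentSpace I x →L[ℝ] ℝ} {β : ∀ y : N, TangentSpace J y →L[ℝ] ℝ}
    (hβ : ContMDiffAt J (J.prod 𝓘(ℝ, E' →L[ℝ] ℝ)) ∞ (formSec J (b := id) β) (F x))
    (h : ∀ᶠ z in 𝓝 x, α z = (β (F z)).comp (mfderiv I J F z)) :
    ContactFormAt I α x ↔ ContactFormAt J β (F x) := by
  have hx := h.self_of_nhds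
  have hv : ∀ v, α x v = β (F x) (mfderiv I J F x v) := fun v => by rw [hx]; rfl
  have h0 : α x = 0 ↔ β (F x) = 0 := by
    constructor
    · intro h; ext w
      obtain ⟨v, rfl⟩ := hbij.2 w
      rw [← hv, h]; rfl
    · intro h; ext v
      rw [hv, h]; rfl
  refine and_congr (not_congr h0) ?_
  constructor
  · intro hc w hw hd
    obtain ⟨v, rfl⟩ := hbij.2 w
    rw [hc v ((hv v).trans hw) fun u hu => ?_]
    · exact map_zero _
    · rw [extDer_pullback hF hβ h]
      exact hd _ ((hv u).symm.trans hu)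
  · intro hc v hw hd
    apply hbij.1
    rw [hc _ ((hv v).symm.trans hw) fun w hw => ?_]
    · exact (map_zero _).symm
    · obtain ⟨u, rfl⟩ := hbij.2 w
      rw [← extDer_pullback hF hβ h]
      exact hd _ ((hv u).trans hw)

lemma contactFieldAt_pullback {F : M → N} {x : M} (hF : ContMDiffAt I J ∞ F x)
    (hbij : Function.Bijective (mfderiv I J F x))
    {α : ∀ x : M, TangentSpace I x →L[ℝ] ℝ} {β : ∀ y : N, TangentSpace J y →L[ℝ] ℝ}
    {X : ∀ x : M, TangentSpace I x} {Y : ∀ y : N, TangentSpace J y}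
    (hβ : ContMDiffAt J (J.prod 𝓘(ℝ, E' →L[ℝ] ℝ)) ∞ (formSec J (b := id) β) (F x))
    (hY : ContMDiffAt J J.tangent ∞ (fun q => (⟨q, Y q⟩ : TangentBundle J N)) (F x))
    (h : ∀ᶠ z in 𝓝 x, α z = (β (F z)).comp (mfderiv I J F z))
    (hXY : ∀ᶠ z in 𝓝 x, mfderiv I J F z (X z) = Y (F z)) :
    ContactFieldAt I α X x ↔ ContactFieldAt J β Y (F x) := by
  have hx := h.self_of_nhds
  have hv : ∀ v, α x v = β (F x) (mfderiv I J F x v) := fun v => by rw [hx]; rfl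
  refine exists_congr fun m => ?_
  constructor
  · intro hm w
    obtain ⟨v, rfl⟩ := hbij.2 w
    rw [← lieDer_pullback hF hβ hY h hXY, hm, hv]
  · intro hm v
    rw [lieDer_pullback hF hβ hY h hXY, hm, hv]

/-- A smooth map into a normed space is Lipschitz at a point, in a chart. -/
lemma exists_norm_sub_le {f : M → E'} {x : M} (hf : ContMDiffAt I 𝓘(ℝ, E') ∞ f x) :
    ∃ C : ℝ, 0 < C ∧ ∀ᶠ y in 𝓝 x, ‖f y - f x‖ ≤ C * ‖extChartAt I x y - extChartAt I x x‖ := by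
  have h := (contMDiffAt_iff_source.1 hf).2.differentiableWithinAt (by simp)
  obtain ⟨C, hC, hb⟩ := h.hasFDerivWithinAt.isBigO_sub.exists_pos
  refine ⟨C, hC, ?_⟩
  have hb' := hb.bound
  have hc : Filter.Tendsto (extChartAt I x) (𝓝 x) (𝓝[range I] (extChartAt I x x)) :=
    tendsto_nhdsWithin_iff.2 ⟨continuousAt_extChartAt x, .of_forall fun y => mem_range_self _⟩
  filter_upwards [hc.eventually hb', extChartAt_source_mem_nhds (I := I) x] with y hy hys
  simp only [Function.comp, (extChartAt I x).left_inv hys, extChartAt_to_inv] at hy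
  exact hy

-- In finite dimension an injective derivative is bounded below, and this bound dominates the
-- remainder near the point.
omit [IsManifold I ∞ M] in
lemma _root_.HasFDerivWithinAt.exists_le_norm_sub [FiniteDimensional ℝ E] {f : E → E'}
    {D : E →L[ℝ] E'} {s : Set E} {x : E} (h : HasFDerivWithinAt f D s x)
    (hD : Function.Injective D) :
    ∃ C : ℝ, 0 < C ∧ ∀ᶠ y in 𝓝[s] x, ‖y - x‖ ≤ C * ‖f y - f x‖ := by
  obtain ⟨c, hc, hq⟩ := exists_quadratic_lower_bound (f := fun v => ‖D v‖ ^ 2) (by fun_prop)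
    (fun r v => by simp [norm_smul, mul_pow]) fun v hv => by
      have : D v ≠ 0 := fun h => hv (hD (by simpa using h))
      positivity
  have hs : 0 < Real.sqrt c := Real.sqrt_pos.2 hc
  have hq' : ∀ v, Real.sqrt c * ‖v‖ ≤ ‖D v‖ := fun v => by
    refine le_of_sq_le_sq ?_ (norm_nonneg _)
    rw [mul_pow, Real.sq_sqrt hc.le]
    exact hq v
  refine ⟨2 / Real.sqrt c, by positivity, ?_⟩
  filter_upwards [h.isLittleO.def (half_pos hs)] with y hy
  have h1 := hq' (y - x)
  have h2 : ‖D (y - x)‖ ≤ ‖f y - f x - D (y - x)‖ + ‖f y - f x‖ := by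
    rw [norm_sub_rev (f y - f x)]
    simpa using norm_add_le (D (y - x) - (f y - f x)) (f y - f x)
  rw [div_mul_eq_mul_div, le_div_iff₀ hs]
  nlinarith

/-- The growth in `LyapunovAt` is measured in the preferred chart at the point; this compares
distances in the charts at the source and at the target. -/
lemma exists_le_chart_norm [FiniteDimensional ℝ E] {F : M → N} {x : M}
    (hF : ContMDiffAt I J ∞ F x) (hinj : Function.Injective (mfderiv I J F x)) :
    ∃ C : ℝ, 0 < C ∧ ∀ᶠ y in 𝓝 x, ‖extChartAt I x y - extChartAt I x x‖ ≤
      C * ‖extChartAt J (F x) (F y) - extChartAt J (F x) (F x)‖ := by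
  have h := ((contDiffWithinAt_writtenIn hF).differentiableWithinAt (by simp)).hasFDerivWithinAt
  rw [← mfderiv_eq_fderivWithin hF] at h
  obtain ⟨C, hC, hb⟩ := h.exists_le_norm_sub hinj
  refine ⟨C, hC, ?_⟩
  have hc : Filter.Tendsto (extChartAt I x) (𝓝 x) (𝓝[range I] (extChartAt I x x)) :=
    tendsto_nhdsWithin_iff.2 ⟨continuousAt_extChartAt x, .of_forall fun y => mem_range_self _⟩
  filter_upwards [hc.eventually hb, extChartAt_source_mem_nhds (I := I) x] with y hy hys
  simp only [writtenInExtChartAt, Function.comp, (extChartAt I x).left_inv hys,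
    extChartAt_to_inv] at hy
  exact hy

/-- The Lyapunov condition pulls back under immersions of codimension zero. -/
lemma LyapunovAt.pullback [FiniteDimensional ℝ E] {F : M → N} {x : M} (hF : ContMDiffAt I J ∞ F x)
    (hbij : Function.Bijective (mfderiv I J F x))
    {X : ∀ x : M, TangentSpace I x} {Y : ∀ y : N, TangentSpace J y} {φ : M → ℝ} {f : N → ℝ}
    (hf : ∀ᶠ y in 𝓝 (F x), ContMDiffAt J 𝓘(ℝ, ℝ) ∞ f y) (h : ∀ᶠ z in 𝓝 x, φ z = f (F z))
    (hFe : ∀ᶠ z in 𝓝 x, ContMDiffAt I J ∞ F z)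
    (hXY : ∀ᶠ z in 𝓝 x, mfderiv I J F z (X z) = Y (F z)) (hL : LyapunovAt J Y f (F x)) :
    LyapunovAt I X φ x := by
  have hd : ∀ᶠ z in 𝓝 x, dfun I φ z = (dfun J f (F z)).comp (mfderiv I J F z) := by
    filter_upwards [hF.continuousAt.eventually hf, h.eventually_nhds, hFe] with z h1 h2 h3
    exact dfun_comp h3 h1 h2
  have hdX : ∀ᶠ z in 𝓝 x, dfun I φ z (X z) = dfun J f (F z) (Y (F z)) := by
    filter_upwards [hd, hXY] with z h1 h2
    rw [h1, ← h2]
    rfl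
  rcases hL with hL | ⟨hY0, hf0, c, hc, hL⟩
  · exact Or.inl (hdX.self_of_nhds ▸ hL)
  · refine Or.inr ⟨?_, ?_, ?_⟩
    · apply hbij.1
      rw [hXY.self_of_nhds, hY0]
      exact (map_zero _).symm
    · rw [hd.self_of_nhds, hf0]
      rfl
    · obtain ⟨C, hC, hle⟩ := exists_le_chart_norm hF hbij.1
      refine ⟨c / C ^ 2, by positivity, ?_⟩
      filter_upwards [hle, hdX, hF.continuousAt.eventually hL] with y h1 h2 h3
      rw [h2]
      refine le_trans ?_ h3
      rw [div_mul_eq_mul_div, mul_div_assoc]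
      gcongr
      rw [div_le_iff₀ (by positivity)]
      calc _ ≤ (C * ‖extChartAt J (F x) (F y) - extChartAt J (F x) (F x)‖) ^ 2 := by gcongr
        _ = _ := by ring

omit [IsManifold J ∞ N] in
lemma chartD_model (y₀ y : E') : chartD 𝓘(ℝ, E') y₀ y = ContinuousLinearMap.id ℝ E' := by
  change mfderiv 𝓘(ℝ, E') 𝓘(ℝ, E') (extChartAt 𝓘(ℝ, E') y₀) y = _
  rw [extChartAt_model_space_eq_id]
  exact mfderiv_id

lemma contMDiffAt_dfun {φ : M → ℝ} {x : M} (hφ : ContMDiffAt I 𝓘(ℝ, ℝ) ∞ φ x) :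
    ContMDiffAt I 𝓘(ℝ, E →L[ℝ] ℝ) ∞ (fun y => (dfun I φ y).comp (chartDsymm I x y)) x := by
  refine (contMDiffAt_mfderiv_inCharts hφ).congr_of_eventuallyEq (.of_forall fun y => ?_)
  simp only [chartD_model]
  rfl

/-- The coefficients of the metric in the chart are continuous and positive definite at `x`, so near
`x` the metric is uniformly comparable with the norm of the chart. -/
lemma exists_metric_bounds [FiniteDimensional ℝ E]
    (g : ContMDiffRiemannianMetric I ∞ E (fun x : M => TangentSpace I x)) (x : M) :
    ∃ C : ℝ, 0 < C ∧ ∀ᶠ y in 𝓝 x, ∀ w : TangentSpace I y,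
      g.inner y w w ≤ C * ‖chartD I x y w‖ ^ 2 ∧ ‖chartD I x y w‖ ^ 2 ≤ C * g.inner y w w := by
  have : IsManifold I 1 M := .of_le (n := ∞) (by simp)
  set G : M → E →L[ℝ] E →L[ℝ] ℝ := fun y => bilChart I x y (g.inner y) with hG
  have hc : ContinuousAt G x := (contMDiffAt_metric_iff.1 (g.contMDiff x)).continuousAt
  have hGy : ∀ᶠ y in 𝓝 x, ∀ w : TangentSpace I y,
      g.inner y w w = G y (chartD I x y w) (chartD I x y w) := by
    filter_upwards [extChartAt_source_mem_nhds (I := I) x] with y hy w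
    rw [hG]
    simp only [bilChart_apply]
    rw [chartDsymm_chartD I hy]
  obtain ⟨c, hc0, hcb⟩ := exists_quadratic_lower_bound (f := fun v => G x v v) (by fun_prop)
    (fun s v => by simp; ring) fun v hv => by
      refine g.pos x _ fun h => hv ?_
      have : chartDsymm I x x v = v := by rw [chartDsymm_self]; rfl
      exact this.symm.trans h
  have hnear : ∀ᶠ y in 𝓝 x, ‖G y - G x‖ < c / 2 := by
    exact eventually_norm_sub_lt hc (half_pos hc0)
  refine ⟨‖G x‖ + c / 2 + 2 / c, by positivity, ?_⟩
  filter_upwards [hGy, hnear] with y h1 h2 w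
  rw [h1]
  set u := chartD I x y w
  have h3 : |G y u u - G x u u| ≤ c / 2 * ‖u‖ ^ 2 := by
    have := (G y - G x).le_opNorm₂ u u
    rw [Real.norm_eq_abs] at this
    calc _ ≤ ‖G y - G x‖ * ‖u‖ * ‖u‖ := this
      _ ≤ c / 2 * ‖u‖ * ‖u‖ := by gcongr
      _ = _ := by ring
  have h4 : |G x u u| ≤ ‖G x‖ * ‖u‖ ^ 2 := by
    have := (G x).le_opNorm₂ u u
    rw [Real.norm_eq_abs] at this
    calc _ ≤ _ := this
      _ = _ := by ring
  have h5 := hcb u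
  obtain ⟨h3a, h3b⟩ := abs_le.1 h3
  have h4b := (abs_le.1 h4).2
  have hu := sq_nonneg ‖u‖
  constructor
  · have : 0 ≤ 2 / c * ‖u‖ ^ 2 := by positivity
    nlinarith
  · have h6 : c / 2 * ‖u‖ ^ 2 ≤ G y u u := by linarith
    have h7 : 0 ≤ G y u u := le_trans (by positivity) h6
    have h8 : ‖u‖ ^ 2 ≤ 2 / c * G y u u := by
      rw [div_mul_eq_mul_div, le_div_iff₀ hc0]; linarith
    have h9 : 0 ≤ (‖G x‖ + c / 2) * G y u u := by positivity
    nlinarith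

/-- Where `dφ(X) > 0`, continuity suffices. At a common zero both `X` and `dφ` are `O(r)` in the
distance `r`, so `|X|² + |dφ|²` is `O(r²)` and is dominated by the growth `c r²`. -/
lemma LyapunovAt.exists_gradient_bound [FiniteDimensional ℝ E]
    (g : ContMDiffRiemannianMetric I ∞ E (fun x : M => TangentSpace I x))
    {X : ∀ x : M, TangentSpace I x} {φ : M → ℝ} {x : M}
    (hX : ContMDiffAt I I.tangent ∞ (fun q => (⟨q, X q⟩ : TangentBundle I M)) x)
    (hφ : ContMDiffAt I 𝓘(ℝ, ℝ) ∞ φ x) (hL : LyapunovAt I X φ x) :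
    ∃ δ : ℝ, 0 < δ ∧ ∀ᶠ y in 𝓝 x, ∀ v : TangentSpace I y, g.inner y v v ≤ 1 →
      δ * (g.inner y (X y) (X y) + (dfun I φ y v) ^ 2) ≤ dfun I φ y (X y) := by
  have : IsManifold I 1 M := .of_le (n := ∞) (by simp)
  obtain ⟨C, hC, hb⟩ := exists_metric_bounds g x
  set Xh : M → E := fun y => chartD I x y (X y) with hXh
  set dh : M → E →L[ℝ] ℝ := fun y => (dfun I φ y).comp (chartDsymm I x y) with hdh
  have hXs : ContMDiffAt I 𝓘(ℝ, E) ∞ Xh x := (contMDiffAt_field_iff.1 hX).2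
  have hds : ContMDiffAt I 𝓘(ℝ, E →L[ℝ] ℝ) ∞ dh x := contMDiffAt_dfun hφ
  suffices h : ∃ δ : ℝ, 0 < δ ∧ ∀ᶠ y in 𝓝 x,
      δ * (C * ‖Xh y‖ ^ 2 + C * ‖dh y‖ ^ 2) ≤ dfun I φ y (X y) by
    obtain ⟨δ, hδ, h⟩ := h
    refine ⟨δ, hδ, ?_⟩
    filter_upwards [h, hb, extChartAt_source_mem_nhds (I := I) x] with y h1 h2 hy v hv
    refine le_trans ?_ h1
    gcongr
    · exact (h2 _).1
    · have e : dfun I φ y v = dh y (chartD I x y v) :=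
        congrArg (dfun I φ y) (chartDsymm_chartD I hy v).symm
      have h3 := (dh y).le_opNorm (chartD I x y v)
      rw [Real.norm_eq_abs] at h3
      rw [e, ← sq_abs]
      calc _ ≤ (‖dh y‖ * ‖chartD I x y v‖) ^ 2 := by gcongr
        _ = ‖dh y‖ ^ 2 * ‖chartD I x y v‖ ^ 2 := by ring
        _ ≤ ‖dh y‖ ^ 2 * (C * g.inner y v v) := by gcongr; exact (h2 v).2
        _ ≤ ‖dh y‖ ^ 2 * (C * 1) := by gcongr
        _ = _ := by ring
  have hdX : ∀ᶠ y in 𝓝 x, dfun I φ y (X y) = dh y (Xh y) := by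
    filter_upwards [extChartAt_source_mem_nhds (I := I) x] with y hy
    exact congrArg (dfun I φ y) (chartDsymm_chartD I hy _).symm
  rcases hL with hL | ⟨hX0, hd0, c, hc, hL⟩
  · rw [hdX.self_of_nhds] at hL
    have hc1 : ContinuousAt (fun y => dh y (Xh y)) x :=
      hds.continuousAt.clm_apply hXs.continuousAt
    have hc2 : ContinuousAt (fun y => C * ‖Xh y‖ ^ 2 + C * ‖dh y‖ ^ 2) x := by
      have := hXs.continuousAt.norm.pow 2
      have h2 := hds.continuousAt.norm.pow 2
      exact (continuousAt_const.mul this).add (continuousAt_const.mul h2)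
    set A := dh x (Xh x) with hA
    set B := C * ‖Xh x‖ ^ 2 + C * ‖dh x‖ ^ 2 with hB
    have hB0 : 0 ≤ B := by positivity
    refine ⟨A / 2 / (B + 1), by positivity, ?_⟩
    filter_upwards [hdX, hc1.eventually (lt_mem_nhds (show A / 2 < _ by linarith)),
      hc2.eventually (gt_mem_nhds (show B < B + 1 by linarith))] with y h1 h2 h3
    rw [h1]
    refine le_trans ?_ h2.le
    rw [div_mul_eq_mul_div, div_le_iff₀ (by positivity)]
    gcongr
  · have hXx : Xh x = 0 := by
      rw [hXh]; simp only [hX0]; exact map_zero _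
    have hdx : dh x = 0 := by
      rw [hdh]; simp only [hd0]; rfl
    obtain ⟨C1, hC1, h1⟩ := exists_norm_sub_le hXs
    obtain ⟨C2, hC2, h2⟩ := exists_norm_sub_le hds
    refine ⟨c / (C * C1 ^ 2 + C * C2 ^ 2), by positivity, ?_⟩
    filter_upwards [h1, h2, hL] with y h1 h2 h3
    rw [hXx, sub_zero] at h1
    rw [hdx, sub_zero] at h2
    refine le_trans ?_ h3
    rw [div_mul_eq_mul_div, div_le_iff₀ (by positivity)]
    set r := ‖extChartAt I x y - extChartAt I x x‖
    calc c * (C * ‖Xh y‖ ^ 2 + C * ‖dh y‖ ^ 2)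
        ≤ c * (C * (C1 * r) ^ 2 + C * (C2 * r) ^ 2) := by gcongr
      _ = _ := by ring

/-- The local constants are combined by compactness. Any metric will do, which is why `g` is an
argument. -/
lemma isGradientLike_of_lyapunovAt [FiniteDimensional ℝ E] [CompactSpace M]
    (g : ContMDiffRiemannianMetric I ∞ E (fun x : M => TangentSpace I x))
    {X : ∀ x : M, TangentSpace I x} {φ : M → ℝ}
    (hX : ContMDiff I I.tangent ∞ (fun q => (⟨q, X q⟩ : TangentBundle I M)))
    (hφ : ContMDiff I 𝓘(ℝ, ℝ) ∞ φ) (hL : ∀ x, LyapunovAt I X φ x) :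
    IsGradientLike I X φ := by
  refine ⟨g, ?_⟩
  have hg : ∀ (x : M) (v : TangentSpace I x), 0 ≤ g.inner x v v := fun x v => by
    by_cases hv : v = 0
    · rw [hv]; simp
    · exact (g.pos x v hv).le
  have key := isCompact_univ.induction_on (p := fun s : Set M => ∃ δ : ℝ, 0 < δ ∧ ∀ y ∈ s,
    ∀ v : TangentSpace I y, g.inner y v v ≤ 1 →
      δ * (g.inner y (X y) (X y) + (dfun I φ y v) ^ 2) ≤ dfun I φ y (X y))
    ⟨1, one_pos, by simp⟩
    (fun s t hst ⟨δ, hδ, h⟩ => ⟨δ, hδ, fun y hy => h y (hst hy)⟩) ?_ ?_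
  · obtain ⟨δ, hδ, h⟩ := key
    exact ⟨δ, hδ, fun x v => h x (mem_univ x) v⟩
  · rintro s t ⟨δ, hδ, h⟩ ⟨δ', hδ', h'⟩
    refine ⟨min δ δ', lt_min hδ hδ', ?_⟩
    have hn : ∀ (y : M) (v : TangentSpace I y),
        0 ≤ g.inner y (X y) (X y) + (dfun I φ y v) ^ 2 := fun y v =>
      add_nonneg (hg _ _) (sq_nonneg _)
    rintro y (hy | hy) v hv
    · exact (mul_le_mul_of_nonneg_right (min_le_left _ _) (hn y v)).trans (h y hy v hv)
    · exact (mul_le_mul_of_nonneg_right (min_le_right _ _) (hn y v)).trans (h' y hy v hv)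
  · intro x _
    obtain ⟨δ, hδ, h⟩ := (hL x).exists_gradient_bound g (hX x) (hφ x)
    exact ⟨_, nhdsWithin_le_nhds h, δ, hδ, fun y hy => hy⟩

end Pointwise

/-! ### The Morse condition and the Lyapunov condition imply each other. -/

section Morse

variable {E : Type*} [NormedAddCommGroup E] [NormedSpace ℝ E]
  {H : Type*} [TopologicalSpace H] {I : ModelWithCorners ℝ E H}
  {M : Type*} [TopologicalSpace M] [ChartedSpace H M] [IsManifold I ∞ M]

lemma tendsto_extChartAt (x : M) :
    Filter.Tendsto (extChartAt I x) (𝓝 x) (𝓝[range I] (extChartAt I x x)) :=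
  tendsto_nhdsWithin_iff.2 ⟨continuousAt_extChartAt x, .of_forall fun _ => mem_range_self _⟩

lemma tendsto_extChartAt_symm (x : M) :
    Filter.Tendsto (extChartAt I x).symm (𝓝[range I] (extChartAt I x x)) (𝓝 x) := by
  have := (continuousAt_extChartAt_symm (I := I) x).tendsto
  rw [extChartAt_to_inv] at this
  exact this.mono_left nhdsWithin_le_nhds

/-- The differential in charts, and its derivative at the base point. -/
lemma hasFDerivWithinAt_chartHessian {φ : M → ℝ} {x : M} (hφ : ContMDiffAt I 𝓘(ℝ, ℝ) ∞ φ x) :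
    HasFDerivWithinAt (fderivWithin ℝ (φ ∘ (extChartAt I x).symm) (range I))
      (chartHessian I φ x) (range I) (extChartAt I x x) := by
  have hs := (contMDiffAt_iff_source.1 hφ).2
  exact ((hs.fderivWithin_right (m := 1) I.uniqueDiffOn (by norm_cast)
    (mem_range_self _)).differentiableWithinAt (by simp)).hasFDerivWithinAt

lemma eventually_dfun_eq {φ : M → ℝ} {x : M} (hφ : ContMDiffAt I 𝓘(ℝ, ℝ) ∞ φ x) :
    ∀ᶠ y in 𝓝 x, (dfun I φ y).comp (chartDsymm I x y) =
      fderivWithin ℝ (φ ∘ (extChartAt I x).symm) (range I) (extChartAt I x y) := by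
  filter_upwards [(tendsto_extChartAt (I := I) x).eventually
    (eventually_fderivWithin_writtenIn hφ), extChartAt_source_mem_nhds (I := I) x] with y hy hys
  have e : (extChartAt I x).symm (extChartAt I x y) = y := (extChartAt I x).left_inv hys
  have hw : writtenInExtChartAt I 𝓘(ℝ, ℝ) x φ = φ ∘ (extChartAt I x).symm := by
    rfl
  rw [hw] at hy
  rw [hy, chartD_model]
  simp only [dfun, chartDsymm]
  rw [e]
  rfl

/-- The Morse condition enters here: the Hessian is injective, so `|dφ|` is at least a multiple of
the distance to a critical point, and the gradient-like inequality bounds `dφ(X)` below by a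
multiple of `|dφ|²`. -/
lemma lyapunovAt_of_isGradientLike [FiniteDimensional ℝ E] {X : ∀ x : M, TangentSpace I x}
    {φ : M → ℝ} (hφ : ContMDiff I 𝓘(ℝ, ℝ) ∞ φ) (hg : IsGradientLike I X φ) (hm : IsMorse I φ)
    (x : M) : LyapunovAt I X φ x := by
  obtain ⟨g, δ, hδ, hg⟩ := hg
  have h0 : ∀ y, δ * g.inner y (X y) (X y) ≤ dfun I φ y (X y) := fun y => by
    simpa using hg y 0 (by simp)
  have hgn : ∀ (x : M) (v : TangentSpace I x), 0 ≤ g.inner x v v := fun x v => by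
    by_cases hv : v = 0
    · rw [hv]; simp
    · exact (g.pos x v hv).le
  have hnn : 0 ≤ dfun I φ x (X x) := (mul_nonneg hδ.le (hgn x _)).trans (h0 x)
  rcases hnn.lt_or_eq with hlt | heq
  · exact Or.inl hlt
  obtain ⟨C, hC, hb⟩ := exists_metric_bounds g x
  have hest : ∀ᶠ y in 𝓝 x, ‖(dfun I φ y).comp (chartDsymm I x y)‖ ^ 2 ≤
      C / δ * dfun I φ y (X y) := by
    filter_upwards [hb, extChartAt_source_mem_nhds (I := I) x] with y hy hys
    have hnn : 0 ≤ C / δ * dfun I φ y (X y) :=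
      mul_nonneg (by positivity) ((mul_nonneg hδ.le (hgn y _)).trans (h0 y))
    have : IsManifold I 1 M := .of_le (n := ∞) (by simp)
    rw [← Real.sqrt_le_sqrt_iff hnn, Real.sqrt_sq (norm_nonneg _)]
    refine ContinuousLinearMap.opNorm_le_of_unit_norm (Real.sqrt_nonneg _) fun u hu => ?_
    refine Real.le_sqrt_of_sq_le ?_
    rw [Real.norm_eq_abs, sq_abs]
    have h1 := (hy (chartDsymm I x y u)).1
    rw [chartD_chartDsymm I hys, hu] at h1
    -- A unit vector of the chart has squared length at most `C` in the metric; after scaling by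
    -- `C^(-1/2)` it is an admissible test vector.
    have h2 := hg y ((Real.sqrt C)⁻¹ • chartDsymm I x y u) (by
      simp only [map_smul, smul_apply, smul_eq_mul]
      rw [← mul_assoc, ← mul_inv, Real.mul_self_sqrt hC.le, inv_mul_le_iff₀ hC]
      linarith)
    rw [map_smul, smul_eq_mul, mul_pow, inv_pow, Real.sq_sqrt hC.le] at h2
    have h3 : δ * (C⁻¹ * (dfun I φ y (chartDsymm I x y u)) ^ 2) ≤ dfun I φ y (X y) := by
      have := mul_nonneg hδ.le (hgn y (X y))
      nlinarith
    change (dfun I φ y (chartDsymm I x y u)) ^ 2 ≤ _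
    rw [div_mul_eq_mul_div, le_div_iff₀ hδ]
    calc _ = C * (δ * (C⁻¹ * (dfun I φ y (chartDsymm I x y u)) ^ 2)) := by field_simp
      _ ≤ _ := by gcongr
  have hX0 : X x = 0 := by
    by_contra hne
    have := h0 x
    rw [← heq] at this
    have := mul_pos hδ (g.pos x _ hne)
    linarith
  have hd0' : (dfun I φ x).comp (chartDsymm I x x) = 0 := by
    have := hest.self_of_nhds
    rw [← heq, mul_zero] at this
    exact norm_eq_zero.1 (pow_eq_zero_iff two_ne_zero |>.1 (le_antisymm this (sq_nonneg _)))
  have hd0 : dfun I φ x = 0 := by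
    have : IsManifold I 1 M := .of_le (n := ∞) (by simp)
    rw [chartDsymm_self] at hd0'
    exact hd0'
  refine Or.inr ⟨hX0, hd0, ?_⟩
  have hder := hasFDerivWithinAt_chartHessian (hφ x)
  have hinj : Function.Injective (chartHessian I φ x) := by
    refine (injective_iff_map_eq_zero _).2 fun u hu => hm x hd0 u fun v => by rw [hu]; rfl
  obtain ⟨K, hK, hKb⟩ := hder.exists_le_norm_sub hinj
  have heq := eventually_dfun_eq (hφ x)
  refine ⟨(C / δ)⁻¹ * (K ^ 2)⁻¹, by positivity, ?_⟩
  filter_upwards [(tendsto_extChartAt (I := I) x).eventually hKb, heq, hest] with y h1 h2 h3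
  rw [← h2, ← heq.self_of_nhds, hd0', sub_zero] at h1
  rw [mul_assoc, inv_mul_le_iff₀ (by positivity), inv_mul_le_iff₀ (by positivity)]
  calc _ ≤ (K * ‖(dfun I φ y).comp (chartDsymm I x y)‖) ^ 2 := by gcongr
    _ = K ^ 2 * ‖(dfun I φ y).comp (chartDsymm I x y)‖ ^ 2 := by ring
    _ ≤ _ := by gcongr

/-- The Lyapunov condition at an interior critical point forces it to be nondegenerate. -/
lemma LyapunovAt.hessian_nondegenerate {X : ∀ x : M, TangentSpace I x}
    {φ : M → ℝ} {x : M} (hL : LyapunovAt I X φ x)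
    (hX : ContMDiffAt I I.tangent ∞ (fun q => (⟨q, X q⟩ : TangentBundle I M)) x)
    (hφ : ContMDiffAt I 𝓘(ℝ, ℝ) ∞ φ x)
    (hx : I.IsInteriorPoint x) (hd : dfun I φ x = 0) (u : E)
    (hu : ∀ v, chartHessian I φ x u v = 0) : u = 0 := by
  have : IsManifold I 1 M := .of_le (n := ∞) (by simp)
  rcases hL with hL | ⟨hX0, -, c, hc, hL⟩
  · rw [hd] at hL; exact absurd hL (lt_irrefl _)
  by_contra hne
  have hun : 0 < ‖u‖ := norm_pos_iff.2 hne
  have hr : range I ∈ 𝓝 (extChartAt I x x) := range_mem_nhds_isInteriorPoint hx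
  have hder := (hasFDerivWithinAt_chartHessian hφ).hasFDerivAt hr
  have hXs : ContMDiffAt I 𝓘(ℝ, E) ∞ (fun y => chartD I x y (X y)) x :=
    (contMDiffAt_field_iff.1 hX).2
  obtain ⟨C, hC, hCb⟩ := exists_norm_sub_le hXs
  have h0 : fderivWithin ℝ (φ ∘ (extChartAt I x).symm) (range I) (extChartAt I x x) = 0 := by
    rw [← (eventually_dfun_eq hφ).self_of_nhds, hd]; rfl
  -- Growth `c r²` together with `X = O(r)` forces `|dφ| ≥ (c/C) r`. In a direction of the kernel of
  -- the Hessian, however, `dφ = o(r)`; below, half of the bound, `c/(2C)`, already gives the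
  -- contradiction.
  have hall : ∀ᶠ y in 𝓝 x, c * ‖extChartAt I x y - extChartAt I x x‖ ^ 2 ≤
      ‖fderivWithin ℝ (φ ∘ (extChartAt I x).symm) (range I) (extChartAt I x y)‖ *
        (C * ‖extChartAt I x y - extChartAt I x x‖) := by
    filter_upwards [hL, hCb, eventually_dfun_eq hφ, extChartAt_source_mem_nhds (I := I) x]
      with y h1 h2 h3 hys
    rw [hX0, show chartD I x x (0 : TangentSpace I x) = 0 from map_zero _, sub_zero] at h2
    refine h1.trans ?_
    have e : dfun I φ y (X y) = (dfun I φ y).comp (chartDsymm I x y) (chartD I x y (X y)) :=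
      congrArg (dfun I φ y) (chartDsymm_chartD I hys _).symm
    rw [e, h3]
    have h4 := (fderivWithin ℝ (φ ∘ (extChartAt I x).symm) (range I)
      (extChartAt I x y)).le_opNorm (chartD I x y (X y))
    rw [Real.norm_eq_abs] at h4
    refine (le_abs_self _).trans (h4.trans ?_)
    gcongr
  have hts : Filter.Tendsto (fun s : ℝ => extChartAt I x x + s • u) (𝓝[>] 0)
      (𝓝 (extChartAt I x x)) := by
    have : Continuous (fun s : ℝ => extChartAt I x x + s • u) := by fun_prop
    simpa using (this.tendsto 0).mono_left nhdsWithin_le_nhds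
  have hrn : 𝓝[range I] (extChartAt I x x) = 𝓝 (extChartAt I x x) := nhdsWithin_eq_nhds.2 hr
  have hsy := tendsto_extChartAt_symm (I := I) x
  rw [hrn] at hsy
  have htgt : (extChartAt I x).target ∈ 𝓝 (extChartAt I x x) := by
    rw [← hrn]; exact extChartAt_target_mem_nhdsWithin x
  have hlo := hder.isLittleO.def (show 0 < c / (2 * C) by positivity)
  obtain ⟨s, h1, h2, h3, hs⟩ := ((hts.eventually (hsy.eventually hall)).and
    ((hts.eventually htgt).and ((hts.eventually hlo).and self_mem_nhdsWithin))).exists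
  have hs : 0 < s := hs
  rw [(extChartAt I x).right_inv h2] at h1
  have hu' : chartHessian I φ x u = 0 := by ext v; exact hu v
  rw [h0, add_sub_cancel_left, map_smul, hu', smul_zero, sub_zero, sub_zero, norm_smul,
    Real.norm_of_nonneg hs.le] at h3
  rw [add_sub_cancel_left, norm_smul, Real.norm_of_nonneg hs.le] at h1
  have hsu : 0 < s * ‖u‖ := by positivity
  have h4 := h1.trans (mul_le_mul_of_nonneg_right h3 (by positivity))
  have h5 : c / (2 * C) * (s * ‖u‖) * (C * (s * ‖u‖)) = c * (s * ‖u‖) ^ 2 / 2 := by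
    field_simp
  rw [h5] at h4
  have : 0 < c * (s * ‖u‖) ^ 2 := by positivity
  linarith

end Morse

/-! ### Convex structures from pointwise conditions. -/

section Cobordism

variable {n : ℕ} {C : Cobordism n}

lemma ConvexStructure.lyapunovAt (S : ConvexStructure C) (x : C.carrier) :
    LyapunovAt (𝓡∂ (2 * n + 1)) S.X S.φ x :=
  lyapunovAt_of_isGradientLike S.smooth_fun S.gradient_like S.morse x

lemma ConvexStructure.contactFormAt (S : ConvexStructure C) (x : C.carrier) :
    ContactFormAt (𝓡∂ (2 * n + 1)) S.α x := S.contact_form x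

lemma ConvexStructure.contactFieldAt (S : ConvexStructure C) (x : C.carrier) :
    ContactFieldAt (𝓡∂ (2 * n + 1)) S.α S.X x :=
  let ⟨μ, h⟩ := S.contact_field
  ⟨μ x, h x⟩

lemma ConvexStructure.isInteriorPoint (S : ConvexStructure C) {x : C.carrier}
    (hx : dfun (𝓡∂ (2 * n + 1)) S.φ x = 0) : (𝓡∂ (2 * n + 1)).IsInteriorPoint x := by
  rw [ModelWithCorners.isInteriorPoint_iff_not_isBoundaryPoint]
  intro hb
  have hb : x ∈ (𝓡∂ (2 * n + 1)).boundary C.carrier := hb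
  rw [C.boundary_eq] at hb
  rcases hb with hb | hb
  · exact S.bot_regular x hb hx
  · exact S.top_regular x hb hx

/-- A convex structure from pointwise conditions; only a Riemannian metric has to be supplied. -/
def ConvexStructure.mk' (α : ∀ x : C.carrier, C.T x →L[ℝ] ℝ) (X : ∀ x : C.carrier, C.T x)
    (φ : C.carrier → ℝ)
    (g : ContMDiffRiemannianMetric (𝓡∂ (2 * n + 1)) ∞ (EuclideanSpace ℝ (Fin (2 * n + 1)))
      (fun x : C.carrier => C.T x))
    (hα : ∀ x, ContMDiffAt (𝓡∂ (2 * n + 1))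
      ((𝓡∂ (2 * n + 1)).prod 𝓘(ℝ, EuclideanSpace ℝ (Fin (2 * n + 1)) →L[ℝ] ℝ)) ∞
      (formSec (𝓡∂ (2 * n + 1)) (b := id) α) x)
    (hX : ∀ x, ContMDiffAt (𝓡∂ (2 * n + 1)) (𝓡∂ (2 * n + 1)).tangent ∞
      (fun x : C.carrier => (⟨x, X x⟩ : TangentBundle (𝓡∂ (2 * n + 1)) C.carrier)) x)
    (hφ : ∀ x, ContMDiffAt (𝓡∂ (2 * n + 1)) 𝓘(ℝ, ℝ) ∞ φ x)
    (hc : ∀ x, ContactFormAt (𝓡∂ (2 * n + 1)) α x)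
    (hf : ∀ x, ContactFieldAt (𝓡∂ (2 * n + 1)) α X x)
    (hL : ∀ x, LyapunovAt (𝓡∂ (2 * n + 1)) X φ x)
    (bot_level : C.bot = ∅ ∨ ∃ c : ℝ, C.bot = φ ⁻¹' {c} ∧ ∀ y, c ≤ φ y)
    (bot_regular : ∀ x ∈ C.bot, dfun (𝓡∂ (2 * n + 1)) φ x ≠ 0)
    (top_level : C.top = ∅ ∨ ∃ c : ℝ, C.top = φ ⁻¹' {c} ∧ ∀ y, φ y ≤ c)
    (top_regular : ∀ x ∈ C.top, dfun (𝓡∂ (2 * n + 1)) φ x ≠ 0) : ConvexStructure C where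
  α := α
  X := X
  φ := φ
  smooth_form := hα
  smooth_field := hX
  smooth_fun := hφ
  contact_form := hc
  contact_field := by
    choose μ hμ using hf
    exact ⟨μ, hμ⟩
  morse x hx u hu := by
    refine (hL x).hessian_nondegenerate (hX x) (hφ x) ?_ hx u hu
    rw [ModelWithCorners.isInteriorPoint_iff_not_isBoundaryPoint]
    intro hb
    have hb : x ∈ (𝓡∂ (2 * n + 1)).boundary C.carrier := hb
    rw [C.boundary_eq] at hb
    exact hb.elim (fun hb => bot_regular x hb hx) (fun hb => top_regular x hb hx)
  gradient_like := isGradientLike_of_lyapunovAt g hX hφ hL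
  bot_level := bot_level
  bot_regular := bot_regular
  top_level := top_level
  top_regular := top_regular

end Cobordism

/-! ### Smooth families of convex structures and composition of homotopies. -/

section Families

variable {n : ℕ} {C : Cobordism n}
  {EQ : Type*} [NormedAddCommGroup EQ] [NormedSpace ℝ EQ]
  {HQ : Type*} [TopologicalSpace HQ] {K : ModelWithCorners ℝ EQ HQ}
  {Q : Type*} [TopologicalSpace Q] [ChartedSpace HQ Q]
  {EP : Type*} [NormedAddCommGroup EP] [NormedSpace ℝ EP]
  {HP : Type*} [TopologicalSpace HP] {L : ModelWithCorners ℝ EP HP}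
  {P : Type*} [TopologicalSpace P] [ChartedSpace HP P]

variable (K) in
/-- Joint smoothness, at a point, of a family of convex structures over a parameter manifold. -/
def SmoothFamilyAt (F : Q → ConvexStructure C) (q : Q × C.carrier) : Prop :=
  ContMDiffAt (K.prod (𝓡∂ (2 * n + 1)))
      ((𝓡∂ (2 * n + 1)).prod 𝓘(ℝ, EuclideanSpace ℝ (Fin (2 * n + 1)) →L[ℝ] ℝ)) ∞
      (formSec (𝓡∂ (2 * n + 1)) (b := fun p : Q × C.carrier => p.2) fun p => (F p.1).α p.2) q ∧
    ContMDiffAt (K.prod (𝓡∂ (2 * n + 1))) (𝓡∂ (2 * n + 1)).tangent ∞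
      (fun p : Q × C.carrier =>
        (⟨p.2, (F p.1).X p.2⟩ : TangentBundle (𝓡∂ (2 * n + 1)) C.carrier)) q ∧
    ContMDiffAt (K.prod (𝓡∂ (2 * n + 1))) 𝓘(ℝ, ℝ) ∞
      (fun p : Q × C.carrier => (F p.1).φ p.2) q

lemma SmoothFamilyAt.comp {F : Q → ConvexStructure C} {h : P → Q} {p : P} {x : C.carrier}
    (hF : SmoothFamilyAt K F (h p, x)) (hh : ContMDiffAt L K ∞ h p) :
    SmoothFamilyAt L (fun p => F (h p)) (p, x) := by
  have hm : ContMDiffAt (L.prod (𝓡∂ (2 * n + 1))) (K.prod (𝓡∂ (2 * n + 1))) ∞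
      (fun q : P × C.carrier => (h q.1, q.2)) (p, x) :=
    (hh.comp (p, x) contMDiffAt_fst).prodMk contMDiffAt_snd
  exact ⟨hF.1.comp (p, x) hm, hF.2.1.comp (p, x) hm, hF.2.2.comp (p, x) hm⟩

lemma SmoothFamilyAt.congr {F G : Q → ConvexStructure C} {q : Q} {x : C.carrier}
    (hF : SmoothFamilyAt K F (q, x)) (h : ∀ᶠ q' in 𝓝 q, G q' = F q') :
    SmoothFamilyAt K G (q, x) := by
  have h' : ∀ᶠ p in 𝓝 (q, x), G p.1 = F p.1 := by
    rw [nhds_prod_eq]; exact h.prod_inl _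
  refine ⟨hF.1.congr_of_eventuallyEq ?_, hF.2.1.congr_of_eventuallyEq ?_,
    hF.2.2.congr_of_eventuallyEq ?_⟩ <;>
  · filter_upwards [h'] with p hp
    first | rw [hp] | simp only [formSec, hp]

/-- A strict homotopy, smooth over the real line and constant outside the unit interval. -/
def Homotopic (S S' : ConvexStructure C) : Prop :=
  ∃ F : ℝ → ConvexStructure C, (∀ t ≤ 0, F t = S) ∧ (∀ t, 1 ≤ t → F t = S') ∧
    ∀ q, SmoothFamilyAt 𝓘(ℝ, ℝ) F q

lemma Homotopic.strictlyConvexHomotopic {S S' : ConvexStructure C} (h : Homotopic S S') :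
    StrictlyConvexHomotopic S S' := by
  obtain ⟨F, h0, h1, hF⟩ := h
  have hs : ∀ q : Icc (0 : ℝ) 1 × C.carrier,
      SmoothFamilyAt (𝓡∂ 1) (fun t : Icc (0 : ℝ) 1 => F t) q := fun q =>
    SmoothFamilyAt.comp (hF _) contMDiff_subtypeVal_Icc.contMDiffAt
  exact ⟨fun t => F t, h0 _ (by simp), h1 _ (by simp), fun q => (hs q).1, fun q => (hs q).2.1,
    fun q => (hs q).2.2⟩

lemma Homotopic.refl (S : ConvexStructure C) : Homotopic S S :=
  ⟨fun _ => S, fun _ _ => rfl, fun _ _ => rfl, fun q =>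
    ⟨(S.smooth_form q.2).comp q contMDiffAt_snd, (S.smooth_field q.2).comp q contMDiffAt_snd,
      (S.smooth_fun q.2).comp q contMDiffAt_snd⟩⟩

lemma Homotopic.trans {S S' S'' : ConvexStructure C} (h : Homotopic S S')
    (h' : Homotopic S' S'') : Homotopic S S'' := by
  obtain ⟨F, h0, h1, hF⟩ := h
  obtain ⟨G, g0, g1, hG⟩ := h'
  -- Between times 1 and 2 the first homotopy has ended and the delayed second one has not begun, so
  -- switching at `3/2` is smooth. The factor 3 used afterwards compresses `[0, 3]` to `[0, 1]`.
  set A : ℝ → ConvexStructure C := fun t => if t ≤ 3 / 2 then F t else G (t - 2) with hA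
  have hG' : ∀ q : ℝ × C.carrier, SmoothFamilyAt 𝓘(ℝ, ℝ) (fun t => G (t - 2)) q := fun q =>
    SmoothFamilyAt.comp (h := fun t : ℝ => t - 2) (hG _)
      (contMDiffAt_iff_contDiffAt.2 (by fun_prop))
  have hAs : ∀ q, SmoothFamilyAt 𝓘(ℝ, ℝ) A q := by
    rintro ⟨t, x⟩
    rcases lt_or_ge t 2 with ht | ht
    · refine (hF (t, x)).congr ?_
      filter_upwards [gt_mem_nhds ht] with s hs
      by_cases h : s ≤ 3 / 2
      · simp [hA, h]
      · simp only [hA, h, if_false]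
        rw [g0 _ (by linarith), h1 _ (by linarith)]
    · refine (hG' (t, x)).congr ?_
      filter_upwards [lt_mem_nhds (show (3 / 2 : ℝ) < t by linarith)] with s hs
      simp [hA, not_le.2 hs]
  refine ⟨fun t => A (3 * t), fun t ht => ?_, fun t ht => ?_, fun q => ?_⟩
  · have : 3 * t ≤ 3 / 2 := by linarith
    simp only [hA, this, if_true]
    exact h0 _ (by linarith)
  · have : ¬ 3 * t ≤ 3 / 2 := by linarith
    simp only [hA, this, if_false]
    exact g1 _ (by linarith)
  · exact SmoothFamilyAt.comp (h := fun t : ℝ => 3 * t) (hAs _)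
      (contMDiffAt_iff_contDiffAt.2 (by fun_prop))

end Families

/-! ### The pointwise conditions on a vector space. -/

section Model

variable {W : Type*} [NormedAddCommGroup W] [NormedSpace ℝ W]

lemma extDer_model (a : W → W →L[ℝ] ℝ) (w u v : W) :
    extDer 𝓘(ℝ, W) a w u v = fderiv ℝ a w u v - fderiv ℝ a w v u := by
  have h : chartForm 𝓘(ℝ, W) (M := W) a w = a := by
    ext y v
    simp only [chartForm, extChartAt_model_space_eq_id, PartialEquiv.refl_symm,
      PartialEquiv.refl_coe, modelWithCornersSelf_coe, range_id, mfderivWithin_univ]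
    erw [mfderiv_id]
    rfl
  have h1 : mfderiv 𝓘(ℝ, W) 𝓘(ℝ, W) (extChartAt 𝓘(ℝ, W) w) w = ContinuousLinearMap.id ℝ W :=
    chartD_model w w
  unfold extDer
  rw [h1, h]
  simp only [range_id, modelWithCornersSelf_coe, fderivWithin_univ]
  rw [extChartAt_model_space_eq_id]
  rfl

lemma dfun_model (f : W → ℝ) (w : W) : dfun 𝓘(ℝ, W) f w = fderiv ℝ f w := by
  rw [dfun, mfderiv_eq_fderiv]

lemma contactFormAt_model (a : W → W →L[ℝ] ℝ) (w : W) :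
    ContactFormAt 𝓘(ℝ, W) a w ↔ a w ≠ 0 ∧ ∀ v : W, a w v = 0 →
      (∀ u : W, a w u = 0 → fderiv ℝ a w v u - fderiv ℝ a w u v = 0) → v = 0 := by
  refine and_congr Iff.rfl (forall_congr' fun v => imp_congr Iff.rfl (imp_congr ?_ Iff.rfl))
  exact forall_congr' fun u => imp_congr Iff.rfl
    (iff_of_eq (congrArg (· = 0) (extDer_model a w v u)))

lemma contactFieldAt_model (a : W → W →L[ℝ] ℝ) (Y : W → W) (w : W) :
    ContactFieldAt 𝓘(ℝ, W) a Y w ↔ ∃ m : ℝ, ∀ v : W, fderiv ℝ (fun y => a y (Y y)) w v +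
      (fderiv ℝ a w (Y w) v - fderiv ℝ a w v (Y w)) = m * a w v := by
  refine exists_congr fun m => forall_congr' fun v => ?_
  refine iff_of_eq (congrArg (· = m * a w v) ?_)
  exact congrArg₂ (· + ·) (congrArg (fun D => D v) (dfun_model (fun y => a y (Y y)) w))
    (extDer_model a w (Y w) v)

lemma lyapunovAt_model (Y : W → W) (f : W → ℝ) (w : W) :
    LyapunovAt 𝓘(ℝ, W) Y f w ↔ 0 < fderiv ℝ f w (Y w) ∨ (Y w = 0 ∧ fderiv ℝ f w = 0 ∧
      ∃ c : ℝ, 0 < c ∧ ∀ᶠ y in 𝓝 w, c * ‖y - w‖ ^ 2 ≤ fderiv ℝ f y (Y y)) := by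
  simp only [LyapunovAt]
  simp_rw [dfun_model]
  simp only [extChartAt_model_space_eq_id]
  exact Iff.rfl

lemma contMDiffAt_form_model
    {EQ : Type*} [NormedAddCommGroup EQ] [NormedSpace ℝ EQ]
    {HQ : Type*} [TopologicalSpace HQ] {K : ModelWithCorners ℝ EQ HQ}
    {Q : Type*} [TopologicalSpace Q] [ChartedSpace HQ Q] {b : Q → W} {α : Q → W →L[ℝ] ℝ} {q : Q}
    (hb : ContMDiffAt K 𝓘(ℝ, W) ∞ b q) (hα : ContMDiffAt K 𝓘(ℝ, W →L[ℝ] ℝ) ∞ α q) :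
    ContMDiffAt K (𝓘(ℝ, W).prod 𝓘(ℝ, W →L[ℝ] ℝ)) ∞ (formSec 𝓘(ℝ, W) (b := b) α) q := by
  refine contMDiffAt_form_iff.2 ⟨hb, hα.congr_of_eventuallyEq (.of_forall fun p => ?_)⟩
  have h : chartDsymm 𝓘(ℝ, W) (b q) (b p) = ContinuousLinearMap.id ℝ W := by
    have h1 := chartD_comp_chartDsymm 𝓘(ℝ, W) (x₀ := b q) (x := b p)
      (by rw [extChartAt_model_space_eq_id]; exact mem_univ _)
    rw [chartD_model] at h1
    exact h1
  simp only [h]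
  rfl

lemma contMDiffAt_field_model {EQ : Type*} [NormedAddCommGroup EQ] [NormedSpace ℝ EQ]
    {HQ : Type*} [TopologicalSpace HQ] {K : ModelWithCorners ℝ EQ HQ}
    {Q : Type*} [TopologicalSpace Q] [ChartedSpace HQ Q] {b : Q → W} {X : Q → W} {q : Q}
    (hb : ContMDiffAt K 𝓘(ℝ, W) ∞ b q) (hX : ContMDiffAt K 𝓘(ℝ, W) ∞ X q) :
    ContMDiffAt K 𝓘(ℝ, W).tangent ∞
      (fun q => (⟨b q, X q⟩ : TangentBundle 𝓘(ℝ, W) W)) q := by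
  refine contMDiffAt_field_iff.2 ⟨hb, hX.congr_of_eventuallyEq (.of_forall fun p => ?_)⟩
  simp only [chartD_model]
  rfl

end Model

/-! ### Local data and their compactly supported homotopies. -/

section LocalData

variable {W : Type*} [NormedAddCommGroup W] [NormedSpace ℝ W]

/-- A one-form, a vector field and a function on a vector space. -/
abbrev LocalData (W : Type*) [NormedAddCommGroup W] [NormedSpace ℝ W] : Type _ :=
  W → (W →L[ℝ] ℝ) × W × ℝ

namespace LocalData

/-- The conditions of a convex contact structure with the origin as only critical point, on an
open set, and with values in a given set. -/
structure Valid (d : LocalData W) (V : Set W) (J : Set ℝ) : Prop where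
  smooth : ∀ w ∈ V, ContDiffAt ℝ ∞ d w
  form : ∀ w ∈ V, ContactFormAt 𝓘(ℝ, W) (fun w => (d w).1) w
  field : ∀ w ∈ V, ContactFieldAt 𝓘(ℝ, W) (fun w => (d w).1) (fun w => (d w).2.1) w
  regular : ∀ w ∈ V, w ≠ 0 → 0 < fderiv ℝ (fun w => (d w).2.2) w (d w).2.1
  zero : (d 0).2.1 = 0
  critical : fderiv ℝ (fun w => (d w).2.2) 0 = 0
  growth : ∃ c : ℝ, 0 < c ∧ ∀ᶠ w in 𝓝 0,
    c * ‖w‖ ^ 2 ≤ fderiv ℝ (fun w => (d w).2.2) w (d w).2.1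
  mem : ∀ w ∈ V, (d w).2.2 ∈ J

lemma Valid.lyapunovAt {d : LocalData W} {V : Set W} {J : Set ℝ} (h : d.Valid V J) {w : W}
    (hw : w ∈ V) : LyapunovAt 𝓘(ℝ, W) (fun w => (d w).2.1) (fun w => (d w).2.2) w := by
  rw [lyapunovAt_model]
  by_cases h0 : w = 0
  · subst h0
    obtain ⟨c, hc, hg⟩ := h.growth
    exact Or.inr ⟨h.zero, h.critical, c, hc, by simpa using hg⟩
  · exact Or.inl (h.regular w hw h0)

/-- `d'` is obtained from `d` by a strict homotopy with compact support in `V`. -/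
def Move (V : Set W) (J : Set ℝ) (d d' : LocalData W) : Prop :=
  ∃ (D : ℝ → LocalData W) (K : Set W), IsCompact K ∧ K ⊆ V ∧
    (∀ w ∈ V, D 0 w = d w) ∧ (∀ w ∈ V, D 1 w = d' w) ∧
    (∀ t ∈ Icc (0 : ℝ) 1, (D t).Valid V J) ∧
    (∀ t ∈ Icc (0 : ℝ) 1, ∀ w ∈ V, ContDiffAt ℝ ∞ (fun p : ℝ × W => D p.1 p.2) (t, w)) ∧
    (∀ t ∈ Icc (0 : ℝ) 1, ∀ w ∈ V \ K, D t w = d w)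

end LocalData
end LocalData

attribute [ext] ConvexStructure

/-! ### Gluing local changes into a global structure. -/

section Glue

variable {n : ℕ} {C : Cobordism n} {W : Type*} [NormedAddCommGroup W] [NormedSpace ℝ W]

/-- A smooth coordinate system on an open subset of the interior. -/
structure IsInteriorChart (κ : OpenPartialHomeomorph C.carrier W) : Prop where
  smooth : ∀ x ∈ κ.source, ContMDiffAt (𝓡∂ (2 * n + 1)) 𝓘(ℝ, W) ∞ κ x
  smooth_symm : ∀ w ∈ κ.target, ContMDiffAt 𝓘(ℝ, W) (𝓡∂ (2 * n + 1)) ∞ κ.symm w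
  interior : ∀ x ∈ κ.source, x ∉ C.bot ∪ C.top

lemma IsInteriorChart.mfderiv_symm_comp {κ : OpenPartialHomeomorph C.carrier W}
    (hκ : IsInteriorChart κ) {x : C.carrier} (hx : x ∈ κ.source) :
    (mfderiv 𝓘(ℝ, W) (𝓡∂ (2 * n + 1)) κ.symm (κ x)).comp
      (mfderiv (𝓡∂ (2 * n + 1)) 𝓘(ℝ, W) κ x) = ContinuousLinearMap.id ℝ (C.T x) := by
  have h1 := (hκ.smooth x hx).mdifferentiableAt (by simp)
  have h2 := (hκ.smooth_symm _ (κ.map_source hx)).mdifferentiableAt (by simp)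
  have h := mfderiv_comp x h2 h1
  rw [← h, ← mfderiv_id (I := 𝓡∂ (2 * n + 1)) (x := x)]
  apply Filter.EventuallyEq.mfderiv_eq
  filter_upwards [κ.open_source.mem_nhds hx] with y hy
  exact κ.left_inv hy

lemma IsInteriorChart.mfderiv_comp_symm {κ : OpenPartialHomeomorph C.carrier W}
    (hκ : IsInteriorChart κ) {w : W} (hw : w ∈ κ.target) :
    (mfderiv (𝓡∂ (2 * n + 1)) 𝓘(ℝ, W) κ (κ.symm w)).comp
      (mfderiv 𝓘(ℝ, W) (𝓡∂ (2 * n + 1)) κ.symm w) = ContinuousLinearMap.id ℝ W := by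
  have h1 := (hκ.smooth _ (κ.map_target hw)).mdifferentiableAt (by simp)
  have h2 := (hκ.smooth_symm _ hw).mdifferentiableAt (by simp)
  have h := mfderiv_comp w h1 h2
  rw [← h]
  refine Eq.trans ?_ (mfderiv_id (I := 𝓘(ℝ, W)) (x := w))
  apply Filter.EventuallyEq.mfderiv_eq
  filter_upwards [κ.open_target.mem_nhds hw] with y hy
  exact κ.right_inv hy

lemma IsInteriorChart.bijective {κ : OpenPartialHomeomorph C.carrier W}
    (hκ : IsInteriorChart κ) {x : C.carrier} (hx : x ∈ κ.source) :
    Function.Bijective (mfderiv (𝓡∂ (2 * n + 1)) 𝓘(ℝ, W) κ x) := by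
  have h1 := hκ.mfderiv_symm_comp hx
  have h2 := hκ.mfderiv_comp_symm (κ.map_source hx)
  rw [κ.left_inv hx] at h2
  exact Function.bijective_iff_has_inverse.2 ⟨_, fun v => congrArg (fun f : C.T x →L[ℝ] C.T x => f v) h1,
    fun v => congrArg (fun f : W →L[ℝ] W => f v) h2⟩

/-- The local data `d` are the coordinate expression of the convex structure. -/
def Presents (κ : OpenPartialHomeomorph C.carrier W) (S : ConvexStructure C) (d : LocalData W) :
    Prop :=
  ∀ x ∈ κ.source, S.α x = ContinuousLinearMap.comp (d (κ x)).1 (mfderiv (𝓡∂ (2 * n + 1)) 𝓘(ℝ, W) κ x) ∧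
    mfderiv (𝓡∂ (2 * n + 1)) 𝓘(ℝ, W) κ x (S.X x) = (d (κ x)).2.1 ∧ S.φ x = (d (κ x)).2.2

/-- The values which lie strictly between those on the two parts of the boundary. -/
def ConvexStructure.between (S : ConvexStructure C) : Set ℝ :=
  {y | (∀ x ∈ C.bot, S.φ x < y) ∧ ∀ x ∈ C.top, y < S.φ x}

lemma ConvexStructure.mem_between (S : ConvexStructure C) {x : C.carrier}
    (hx : x ∉ C.bot ∪ C.top) : S.φ x ∈ S.between := by
  rw [mem_union, not_or] at hx
  constructor
  · intro y hy
    rcases S.bot_level with h | ⟨c, h, hc⟩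
    · rw [h] at hy; exact absurd hy (notMem_empty _)
    · have hy' : S.φ y = c := by rw [h] at hy; exact hy
      rw [hy']
      refine lt_of_le_of_ne (hc x) fun e => hx.1 ?_
      rw [h]; exact e.symm
  · intro y hy
    rcases S.top_level with h | ⟨c, h, hc⟩
    · rw [h] at hy; exact absurd hy (notMem_empty _)
    · have hy' : S.φ y = c := by rw [h] at hy; exact hy
      rw [hy']
      refine lt_of_le_of_ne (hc x) fun e => hx.2 ?_
      rw [h]; exact e

lemma ConvexStructure.between_congr {S S' : ConvexStructure C}
    (h : ∀ x ∈ C.bot ∪ C.top, S'.φ x = S.φ x) : S'.between = S.between := by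
  ext y
  exact and_congr (forall₂_congr fun x hx => by rw [h x (Or.inl hx)])
    (forall₂_congr fun x hx => by rw [h x (Or.inr hx)])

lemma ConvexStructure.isOpen_between (S : ConvexStructure C) : IsOpen S.between := by
  have h1 : IsOpen {y | ∀ x ∈ C.bot, S.φ x < y} := by
    rcases C.bot.eq_empty_or_nonempty with he | ⟨x, hx⟩
    · simp [he]
    · obtain ⟨c, h, -⟩ := S.bot_level.resolve_left (nonempty_iff_ne_empty.1 ⟨x, hx⟩)
      convert isOpen_Ioi (a := c) using 1
      ext y
      rw [h] at hx ⊢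
      exact ⟨fun hy => (show S.φ x = c from hx) ▸ hy x hx,
        fun hy x' hx' => (show S.φ x' = c from hx') ▸ hy⟩
  have h2 : IsOpen {y | ∀ x ∈ C.top, y < S.φ x} := by
    rcases C.top.eq_empty_or_nonempty with he | ⟨x, hx⟩
    · simp [he]
    · obtain ⟨c, h, -⟩ := S.top_level.resolve_left (nonempty_iff_ne_empty.1 ⟨x, hx⟩)
      convert isOpen_Iio (a := c) using 1
      ext y
      rw [h] at hx ⊢
      exact ⟨fun hy => (show S.φ x = c from hx) ▸ hy x hx,
        fun hy x' hx' => (show S.φ x' = c from hx') ▸ hy⟩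
  exact h1.inter h2

open Classical in
/-- The form given by `a` in the coordinates `κ`, extended by `α`. -/
def glueForm (κ : OpenPartialHomeomorph C.carrier W) (α : ∀ x : C.carrier, C.T x →L[ℝ] ℝ)
    (a : W → W →L[ℝ] ℝ) (x : C.carrier) : C.T x →L[ℝ] ℝ :=
  if x ∈ κ.source then ContinuousLinearMap.comp (a (κ x)) (mfderiv (𝓡∂ (2 * n + 1)) 𝓘(ℝ, W) κ x) else α x

open Classical in
/-- The field given by `Y` in the coordinates `κ`, extended by `X`. -/
def glueField (κ : OpenPartialHomeomorph C.carrier W) (X : ∀ x : C.carrier, C.T x)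
    (Y : W → W) (x : C.carrier) : C.T x :=
  if x ∈ κ.source then (mfderiv (𝓡∂ (2 * n + 1)) 𝓘(ℝ, W) κ x).inverse (Y (κ x)) else X x

open Classical in
/-- The function given by `f` in the coordinates `κ`, extended by `φ`. -/
def glueFun (κ : OpenPartialHomeomorph C.carrier W) (φ : C.carrier → ℝ)
    (f : W → ℝ) (x : C.carrier) : ℝ :=
  if x ∈ κ.source then f (κ x) else φ x

variable {κ : OpenPartialHomeomorph C.carrier W} {S : ConvexStructure C} {d d' : LocalData W}

lemma glueForm_of_mem {α : ∀ x : C.carrier, C.T x →L[ℝ] ℝ} {a : W → W →L[ℝ] ℝ} {x : C.carrier}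
    (hx : x ∈ κ.source) : glueForm κ α a x =
      ContinuousLinearMap.comp (a (κ x)) (mfderiv (𝓡∂ (2 * n + 1)) 𝓘(ℝ, W) κ x) := if_pos hx

lemma mfderiv_glueField (hκ : IsInteriorChart κ) {X : ∀ x : C.carrier, C.T x} {Y : W → W}
    {x : C.carrier} (hx : x ∈ κ.source) :
    mfderiv (𝓡∂ (2 * n + 1)) 𝓘(ℝ, W) κ x (glueField κ X Y x) = Y (κ x) := by
  rw [glueField, if_pos hx]
  obtain ⟨e, he⟩ := isInvertible_of_bijective (E := EuclideanSpace ℝ (Fin (2 * n + 1))) (E' := W)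
    (D := mfderiv (𝓡∂ (2 * n + 1)) 𝓘(ℝ, W) κ x) (hκ.bijective hx)
  have key : ∀ D : EuclideanSpace ℝ (Fin (2 * n + 1)) →L[ℝ] W,
      (e : EuclideanSpace ℝ (Fin (2 * n + 1)) →L[ℝ] W) = D → D (D.inverse (Y (κ x))) = Y (κ x) := by
    rintro D rfl
    simp
  exact key _ he

lemma glueFun_of_mem {φ : C.carrier → ℝ} {f : W → ℝ} {x : C.carrier} (hx : x ∈ κ.source) :
    glueFun κ φ f x = f (κ x) := if_pos hx

lemma glueForm_eq (h : Presents κ S d) {x : C.carrier}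
    (hx : x ∈ κ.source → d' (κ x) = d (κ x)) :
    glueForm κ S.α (fun w => (d' w).1) x = S.α x := by
  by_cases hs : x ∈ κ.source
  · rw [glueForm_of_mem hs, hx hs, (h x hs).1]
  · exact if_neg hs

lemma glueField_eq (hκ : IsInteriorChart κ) (h : Presents κ S d) {x : C.carrier}
    (hx : x ∈ κ.source → d' (κ x) = d (κ x)) :
    glueField κ S.X (fun w => (d' w).2.1) x = S.X x := by
  by_cases hs : x ∈ κ.source
  · apply (hκ.bijective hs).1
    rw [mfderiv_glueField hκ hs, hx hs, (h x hs).2.1]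
  · exact if_neg hs

lemma glueFun_eq (h : Presents κ S d) {x : C.carrier}
    (hx : x ∈ κ.source → d' (κ x) = d (κ x)) :
    glueFun κ S.φ (fun w => (d' w).2.2) x = S.φ x := by
  by_cases hs : x ∈ κ.source
  · rw [glueFun_of_mem hs, hx hs, (h x hs).2.2]
  · exact if_neg hs

lemma isCompact_symm_image {K : Set W} (hK : IsCompact K) (hKV : K ⊆ κ.target) :
    IsCompact (κ.symm '' K) :=
  hK.image_of_continuousOn (κ.continuousOn_symm.mono hKV)

lemma eventually_notMem_support {K : Set W} (hK : IsCompact K) (hKV : K ⊆ κ.target)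
    {x : C.carrier} (hx : x ∉ κ.symm '' K) :
    ∀ᶠ y in 𝓝 x, y ∈ κ.source → κ y ∈ κ.target \ K := by
  filter_upwards [(isCompact_symm_image hK hKV).isClosed.isOpen_compl.mem_nhds hx] with y hy hys
  exact ⟨κ.map_source hys, fun hk => hy ⟨κ y, hk, κ.left_inv hys⟩⟩

/-- Replacing the data in a coordinate system. -/
def ConvexStructure.glue (S : ConvexStructure C) (hκ : IsInteriorChart κ) (h : Presents κ S d)
    (hd' : d'.Valid κ.target S.between) {K : Set W} (hK : IsCompact K) (hKV : K ⊆ κ.target)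
    (hdK : ∀ w ∈ κ.target \ K, d' w = d w) : ConvexStructure C := by
  have hout : ∀ x, x ∉ κ.symm '' K → ∀ᶠ y in 𝓝 x, y ∈ κ.source → d' (κ y) = d (κ y) :=
    fun x hx => (eventually_notMem_support hK hKV hx).mono fun y hy hys => hdK _ (hy hys)
  -- Two open sets cover the manifold: the complement of the support, where all germs are the old
  -- ones, and the domain of the coordinates, where all conditions are pulled back from `d'`. Each
  -- condition is checked on one of them.
  have hmem : ∀ x, x ∉ κ.symm '' K ∨ x ∈ κ.source := fun x => by
    by_cases hx : x ∈ κ.symm '' K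
    · obtain ⟨w, hw, rfl⟩ := hx
      exact Or.inr (κ.map_target (hKV hw))
    · exact Or.inl hx
  have hbd : ∀ x ∈ C.bot ∪ C.top, x ∉ κ.source := fun x hx hs => hκ.interior x hs hx
  have hα : ∀ x ∈ κ.source, ∀ᶠ y in 𝓝 x, glueForm κ S.α (fun w => (d' w).1) y =
      ContinuousLinearMap.comp (d' (κ y)).1 (mfderiv (𝓡∂ (2 * n + 1)) 𝓘(ℝ, W) κ y) :=
    fun x hx => (κ.open_source.eventually_mem hx).mono fun y hy => glueForm_of_mem hy
  have hX : ∀ x ∈ κ.source, ∀ᶠ y in 𝓝 x, mfderiv (𝓡∂ (2 * n + 1)) 𝓘(ℝ, W) κ y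
      (glueField κ S.X (fun w => (d' w).2.1) y) = (d' (κ y)).2.1 :=
    fun x hx => (κ.open_source.eventually_mem hx).mono fun y hy => mfderiv_glueField hκ hy
  have hφ : ∀ x ∈ κ.source, ∀ᶠ y in 𝓝 x, glueFun κ S.φ (fun w => (d' w).2.2) y = (d' (κ y)).2.2 :=
    fun x hx => (κ.open_source.eventually_mem hx).mono fun y hy => glueFun_of_mem hy
  have hκs : ∀ x ∈ κ.source, κ x ∈ κ.target := fun x hx => κ.map_source hx
  have sa : ∀ w ∈ κ.target, ContMDiffAt 𝓘(ℝ, W) (𝓘(ℝ, W).prod 𝓘(ℝ, W →L[ℝ] ℝ)) ∞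
      (formSec 𝓘(ℝ, W) (b := id) fun w => (d' w).1) w := fun w hw =>
    contMDiffAt_form_model contMDiffAt_id (contMDiffAt_iff_contDiffAt.2 (hd'.smooth w hw).fst)
  have sY : ∀ w ∈ κ.target, ContMDiffAt 𝓘(ℝ, W) 𝓘(ℝ, W).tangent ∞
      (fun w => (⟨w, (d' w).2.1⟩ : TangentBundle 𝓘(ℝ, W) W)) w := fun w hw =>
    contMDiffAt_field_model contMDiffAt_id (contMDiffAt_iff_contDiffAt.2 (hd'.smooth w hw).snd.fst)
  have sf : ∀ w ∈ κ.target, ContMDiffAt 𝓘(ℝ, W) 𝓘(ℝ, ℝ) ∞ (fun w => (d' w).2.2) w :=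
    fun w hw => contMDiffAt_iff_contDiffAt.2 (hd'.smooth w hw).snd.snd
  have hsf : ∀ x, ContMDiffAt (𝓡∂ (2 * n + 1)) 𝓘(ℝ, ℝ) ∞
      (glueFun κ S.φ (fun w => (d' w).2.2)) x := by
    intro x
    rcases hmem x with hx | hx
    · exact (S.smooth_fun x).congr_of_eventuallyEq ((hout x hx).mono fun y hy => glueFun_eq h hy)
    · exact ((sf _ (hκs x hx)).comp x (hκ.smooth x hx)).congr_of_eventuallyEq (hφ x hx)
  have hsX : ∀ x, ContMDiffAt (𝓡∂ (2 * n + 1)) (𝓡∂ (2 * n + 1)).tangent ∞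
      (fun x : C.carrier => (⟨x, glueField κ S.X (fun w => (d' w).2.1) x⟩ :
        TangentBundle (𝓡∂ (2 * n + 1)) C.carrier)) x := by
    intro x
    rcases hmem x with hx | hx
    · refine (S.smooth_field x).congr_of_eventuallyEq ((hout x hx).mono fun y hy => ?_)
      simp only [glueField_eq hκ h hy]
    · refine contMDiffAt_pullback_field (b := id) (F := κ) contMDiffAt_id (hκ.smooth x hx)
        (hκ.bijective hx) ?_
      refine ((sY _ (hκs x hx)).comp x (hκ.smooth x hx)).congr_of_eventuallyEq
        ((hX x hx).mono fun y hy => ?_)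
      simp only [id, hy]
      rfl
  have hsα : ∀ x, ContMDiffAt (𝓡∂ (2 * n + 1))
      ((𝓡∂ (2 * n + 1)).prod 𝓘(ℝ, EuclideanSpace ℝ (Fin (2 * n + 1)) →L[ℝ] ℝ)) ∞
      (formSec (𝓡∂ (2 * n + 1)) (b := id) (glueForm κ S.α (fun w => (d' w).1))) x := by
    intro x
    rcases hmem x with hx | hx
    · refine (S.smooth_form x).congr_of_eventuallyEq ((hout x hx).mono fun y hy => ?_)
      simp only [formSec, id, glueForm_eq h hy]
    · have := contMDiffAt_pullback_form (b := id) (F := κ) (q₀ := x) contMDiffAt_id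
        (hκ.smooth x hx) (β := fun y => (d' (κ y)).1)
        ((sa _ (hκs x hx)).comp x (hκ.smooth x hx))
      refine this.congr_of_eventuallyEq ((hα x hx).mono fun y hy => ?_)
      simp only [formSec, id, hy]
      rfl
  have heq : ∀ x ∈ C.bot ∪ C.top, glueFun κ S.φ (fun w => (d' w).2.2) x = S.φ x :=
    fun x hx => if_neg (hbd x hx)
  have hdeq : ∀ x ∈ C.bot ∪ C.top, dfun (𝓡∂ (2 * n + 1)) (glueFun κ S.φ (fun w => (d' w).2.2)) x
      = dfun (𝓡∂ (2 * n + 1)) S.φ x := fun x hx =>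
    Filter.EventuallyEq.mfderiv_eq ((hout x ((hmem x).resolve_right (hbd x hx))).mono
      fun y hy => glueFun_eq h hy)
  -- The new values in the interior stay strictly between the boundary values, so the boundary parts
  -- remain exactly the extremal level sets.
  have hval : ∀ x, x ∉ C.bot ∪ C.top → glueFun κ S.φ (fun w => (d' w).2.2) x ∈ S.between := by
    intro x hx
    by_cases hs : x ∈ κ.source
    · rw [glueFun_of_mem hs]
      exact hd'.mem _ (hκs x hs)
    · rw [glueFun, if_neg hs]
      exact S.mem_between hx
  -- The metric of `S` is reused; the Lyapunov condition does not refer to a metric.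
  refine ConvexStructure.mk' (glueForm κ S.α (fun w => (d' w).1))
    (glueField κ S.X (fun w => (d' w).2.1)) (glueFun κ S.φ (fun w => (d' w).2.2))
    S.gradient_like.choose hsα hsX hsf ?_ ?_ ?_ ?_
    (fun x hx => by rw [hdeq x (Or.inl hx)]; exact S.bot_regular x hx) ?_
    (fun x hx => by rw [hdeq x (Or.inr hx)]; exact S.top_regular x hx)
  · intro x
    rcases hmem x with hx | hx
    · refine (contactFormAt_pullback (F := id) contMDiffAt_id ?_ (S.smooth_form x) ?_).2
        (S.contactFormAt x)
      · rw [mfderiv_id]; exact Function.bijective_id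
      · filter_upwards [hout x hx] with y hy
        rw [glueForm_eq h hy, mfderiv_id]
        rfl
    · exact (contactFormAt_pullback (hκ.smooth x hx) (hκ.bijective hx) (sa _ (hκs x hx))
        (hα x hx)).2 (hd'.form _ (hκs x hx))
  · intro x
    rcases hmem x with hx | hx
    · refine (contactFieldAt_pullback (F := id) contMDiffAt_id ?_ (S.smooth_form x)
        (S.smooth_field x) ?_ ?_).2 (S.contactFieldAt x)
      · rw [mfderiv_id]; exact Function.bijective_id
      · filter_upwards [hout x hx] with y hy
        rw [glueForm_eq h hy, mfderiv_id]
        rfl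
      · filter_upwards [hout x hx] with y hy
        rw [glueField_eq hκ h hy, mfderiv_id]
        rfl
    · exact (contactFieldAt_pullback (hκ.smooth x hx) (hκ.bijective hx) (sa _ (hκs x hx))
        (sY _ (hκs x hx)) (hα x hx) (hX x hx)).2 (hd'.field _ (hκs x hx))
  · intro x
    rcases hmem x with hx | hx
    · refine LyapunovAt.pullback (F := id) contMDiffAt_id ?_ (.of_forall S.smooth_fun)
        ((hout x hx).mono fun y hy => glueFun_eq h hy) (.of_forall fun _ => contMDiffAt_id)
        ?_ (S.lyapunovAt x)
      · rw [mfderiv_id]; exact Function.bijective_id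
      · filter_upwards [hout x hx] with y hy
        rw [glueField_eq hκ h hy, mfderiv_id]
        rfl
    · refine LyapunovAt.pullback (hκ.smooth x hx) (hκ.bijective hx) ?_ (hφ x hx) ?_ (hX x hx)
        (hd'.lyapunovAt (hκs x hx))
      · exact (κ.open_target.eventually_mem (hκs x hx)).mono sf
      · exact (κ.open_source.eventually_mem hx).mono hκ.smooth
  · rcases S.bot_level with he | ⟨c, hc, hmin⟩
    · exact Or.inl he
    · by_cases he : C.bot = ∅
      · exact Or.inl he
      obtain ⟨x₀, hx₀⟩ := nonempty_iff_ne_empty.2 he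
      have hx₀c : S.φ x₀ = c := by rw [hc] at hx₀; exact hx₀
      refine Or.inr ⟨c, ?_, fun y => ?_⟩
      · ext x
        constructor
        · intro hx
          rw [mem_preimage, heq x (Or.inl hx)]
          rw [hc] at hx; exact hx
        · intro hx
          by_contra hxb
          by_cases hxt : x ∈ C.top
          · rw [mem_preimage, heq x (Or.inr hxt)] at hx
            exact hxb (hc ▸ hx)
          · have := (hval x (by simp [hxb, hxt])).1 x₀ hx₀
            rw [hx₀c] at this
            exact this.ne' hx
      · by_cases hy : y ∈ C.bot ∪ C.top
        · rw [heq y hy]; exact hmin y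
        · rw [← hx₀c]; exact ((hval y hy).1 x₀ hx₀).le
  · rcases S.top_level with he | ⟨c, hc, hmax⟩
    · exact Or.inl he
    · by_cases he : C.top = ∅
      · exact Or.inl he
      obtain ⟨x₀, hx₀⟩ := nonempty_iff_ne_empty.2 he
      have hx₀c : S.φ x₀ = c := by rw [hc] at hx₀; exact hx₀
      refine Or.inr ⟨c, ?_, fun y => ?_⟩
      · ext x
        constructor
        · intro hx
          rw [mem_preimage, heq x (Or.inr hx)]
          rw [hc] at hx; exact hx
        · intro hx
          by_contra hxt
          by_cases hxb : x ∈ C.bot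
          · rw [mem_preimage, heq x (Or.inl hxb)] at hx
            exact hxt (hc ▸ hx)
          · have := (hval x (by simp [hxb, hxt])).2 x₀ hx₀
            rw [hx₀c] at this
            exact this.ne hx
      · by_cases hy : y ∈ C.bot ∪ C.top
        · rw [heq y hy]; exact hmax y
        · rw [← hx₀c]; exact ((hval y hy).2 x₀ hx₀).le

/-- The two structures agree outside of a set. -/
def ConvexStructure.EqOff (U : Set C.carrier) (S S' : ConvexStructure C) : Prop :=
  ∀ x ∉ U, S'.α x = S.α x ∧ S'.X x = S.X x ∧ S'.φ x = S.φ x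

lemma ConvexStructure.EqOff.trans {U : Set C.carrier} {S S' S'' : ConvexStructure C}
    (h : ConvexStructure.EqOff U S S') (h' : ConvexStructure.EqOff U S' S'') :
    ConvexStructure.EqOff U S S'' := fun x hx =>
  ⟨(h' x hx).1.trans (h x hx).1, (h' x hx).2.1.trans (h x hx).2.1,
    (h' x hx).2.2.trans (h x hx).2.2⟩

/-- A local move in a coordinate system extends to a strict homotopy. -/
theorem Presents.exists_of_move (hκ : IsInteriorChart κ) (h : Presents κ S d)
    (hm : LocalData.Move κ.target S.between d d') :
    ∃ S' : ConvexStructure C, Homotopic S S' ∧ Presents κ S' d' ∧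
      ConvexStructure.EqOff κ.source S S' := by
  obtain ⟨D, K, hK, hKV, h0, h1, hv, hs, hoff⟩ := hm
  -- Reparametrising by the smooth transition makes the family constant outside the unit interval
  -- and thereby defined for all real times.
  have hτ : ∀ t, Real.smoothTransition t ∈ Icc (0 : ℝ) 1 := fun t =>
    ⟨Real.smoothTransition.nonneg t, Real.smoothTransition.le_one t⟩
  set F : ℝ → ConvexStructure C := fun t =>
    S.glue hκ h (hv _ (hτ t)) hK hKV (hoff _ (hτ t)) with hF
  have hFα : ∀ t x, (F t).α x = glueForm κ S.α (fun w => (D (Real.smoothTransition t) w).1) x :=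
    fun t x => rfl
  have hFX : ∀ t x, (F t).X x = glueField κ S.X (fun w => (D (Real.smoothTransition t) w).2.1) x :=
    fun t x => rfl
  have hFφ : ∀ t x, (F t).φ x = glueFun κ S.φ (fun w => (D (Real.smoothTransition t) w).2.2) x :=
    fun t x => rfl
  have hFd : ∀ t, Presents κ (F t) (D (Real.smoothTransition t)) := fun t x hx =>
    ⟨(hFα t x).trans (glueForm_of_mem hx), by rw [hFX]; exact mfderiv_glueField hκ hx,
      (hFφ t x).trans (glueFun_of_mem hx)⟩
  have hFoff : ∀ t x, (x ∈ κ.source → D (Real.smoothTransition t) (κ x) = d (κ x)) →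
      (F t).α x = S.α x ∧ (F t).X x = S.X x ∧ (F t).φ x = S.φ x := fun t x hx =>
    ⟨(hFα t x).trans (glueForm_eq h hx), (hFX t x).trans (glueField_eq hκ h hx),
      (hFφ t x).trans (glueFun_eq h hx)⟩
  have hsm : ∀ q, SmoothFamilyAt 𝓘(ℝ, ℝ) F q := by
    rintro ⟨t, x⟩
    by_cases hx : x ∈ κ.symm '' K
    · have hxs : x ∈ κ.source := by
        obtain ⟨w, hw, rfl⟩ := hx
        exact κ.map_target (hKV hw)
      have hev : ∀ᶠ p : ℝ × C.carrier in 𝓝 (t, x), p.2 ∈ κ.source :=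
        continuousAt_snd.eventually (κ.open_source.mem_nhds hxs)
      have ha : ContMDiffAt (𝓘(ℝ, ℝ).prod (𝓡∂ (2 * n + 1))) 𝓘(ℝ, ℝ) ∞
        (fun p : ℝ × C.carrier => p.1) (t, x) := contMDiffAt_fst
      have hb : ContMDiffAt (𝓘(ℝ, ℝ).prod (𝓡∂ (2 * n + 1))) (𝓡∂ (2 * n + 1)) ∞
        (fun p : ℝ × C.carrier => p.2) (t, x) := contMDiffAt_snd
      have hc : ContMDiffAt (𝓘(ℝ, ℝ).prod (𝓡∂ (2 * n + 1))) 𝓘(ℝ, ℝ × W) ∞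
          (fun p : ℝ × C.carrier => (Real.smoothTransition p.1, κ p.2)) (t, x) :=
        ((contMDiffAt_iff_contDiffAt.2 (Real.smoothTransition.contDiffAt (x := t))).comp
          (t, x) ha).prodMk_space ((hκ.smooth x hxs).comp (t, x) hb)
      have hD := (contMDiffAt_iff_contDiffAt.2 (hs _ (hτ t) _ (κ.map_source hxs))).comp
        (t, x) hc
      have hκb := (hκ.smooth x hxs).comp (t, x) hb
      refine ⟨?_, ?_, ?_⟩
      · have := contMDiffAt_pullback_form (b := fun p : ℝ × C.carrier => p.2) (F := κ)
          (q₀ := (t, x)) hb (hκ.smooth x hxs)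
          (β := fun p => (D (Real.smoothTransition p.1) (κ p.2)).1)
          (contMDiffAt_form_model hκb (contDiff_fst.contMDiff.contMDiffAt.comp (t, x) hD))
        refine this.congr_of_eventuallyEq (hev.mono fun p hp => ?_)
        simp only [formSec, (hFd p.1 p.2 hp).1]
        rfl
      · refine contMDiffAt_pullback_field (b := fun p : ℝ × C.carrier => p.2) (F := κ)
          hb (hκ.smooth x hxs) (hκ.bijective hxs) ?_
        have := contMDiffAt_field_model hκb
          ((contDiff_fst.comp contDiff_snd).contMDiff.contMDiffAt.comp (t, x) hD)
        refine this.congr_of_eventuallyEq (hev.mono fun p hp => ?_)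
        simp only [(hFd p.1 p.2 hp).2.1]
        rfl
      · refine ((contDiff_snd.comp contDiff_snd).contMDiff.contMDiffAt.comp (t, x)
          hD).congr_of_eventuallyEq (hev.mono fun p hp => ?_)
        simp only [(hFd p.1 p.2 hp).2.2]
        rfl
    · have hev : ∀ᶠ p : ℝ × C.carrier in 𝓝 (t, x), (F p.1).α p.2 = S.α p.2 ∧
          (F p.1).X p.2 = S.X p.2 ∧ (F p.1).φ p.2 = S.φ p.2 := by
        filter_upwards [continuousAt_snd.eventually (eventually_notMem_support hK hKV hx)]
          with p hp
        exact hFoff _ _ fun hps => hoff _ (hτ _) _ (hp hps)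
      refine ⟨?_, ?_, ?_⟩
      · refine ((S.smooth_form x).comp (t, x) contMDiffAt_snd).congr_of_eventuallyEq
          (hev.mono fun p hp => ?_)
        simp only [formSec, hp.1]
        rfl
      · refine ((S.smooth_field x).comp (t, x) contMDiffAt_snd).congr_of_eventuallyEq
          (hev.mono fun p hp => ?_)
        simp only [hp.2.1]
        rfl
      · refine ((S.smooth_fun x).comp (t, x) contMDiffAt_snd).congr_of_eventuallyEq
          (hev.mono fun p hp => ?_)
        simp only [hp.2.2]
        rfl
  have hF0 : ∀ t ≤ 0, F t = S := fun t ht => by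
    have : ∀ x, (F t).α x = S.α x ∧ (F t).X x = S.X x ∧ (F t).φ x = S.φ x := fun x =>
      hFoff t x fun hx => by
        rw [Real.smoothTransition.zero_of_nonpos ht, h0 _ (κ.map_source hx)]
    refine ConvexStructure.ext ?_ ?_ ?_
    · exact funext fun x => (this x).1
    · exact funext fun x => (this x).2.1
    · exact funext fun x => (this x).2.2
  have hF1 : ∀ t, 1 ≤ t → F t = F 1 := fun t ht => by
    simp only [hF, Real.smoothTransition.one_of_one_le ht, Real.smoothTransition.one_of_one_le le_rfl]
  refine ⟨F 1, ⟨F, hF0, hF1, hsm⟩, fun x hx => ?_, fun x hx => hFoff 1 x fun h => absurd h hx⟩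
  have := hFd 1 x hx
  rwa [Real.smoothTransition.one_of_one_le le_rfl, h1 _ (κ.map_source hx)] at this

lemma Presents.exists_of_moves (hκ : IsInteriorChart κ) (h : Presents κ S d)
    (hm : Relation.ReflTransGen (LocalData.Move κ.target S.between) d d') :
    ∃ S' : ConvexStructure C, Homotopic S S' ∧ Presents κ S' d' ∧
      ConvexStructure.EqOff κ.source S S' := by
  induction hm with
  | refl => exact ⟨S, .refl S, h, fun x _ => ⟨rfl, rfl, rfl⟩⟩
  | tail _ hm ih =>
    obtain ⟨S', hS, hp, ho⟩ := ih
    -- A local move does not touch the boundary values, so the admissible interval of values is the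
    -- same for all moves of the chain.
    have : S'.between = S.between := ConvexStructure.between_congr fun x hx =>
      (ho x fun hs => hκ.interior x hs hx).2.2
    obtain ⟨S'', hS', hp', ho'⟩ := hp.exists_of_move hκ (this ▸ hm)
    exact ⟨S'', hS.trans hS', hp', ho.trans ho'⟩

/-- The coordinate expression of a structure satisfies the conditions on local data. -/
lemma Presents.valid [FiniteDimensional ℝ W] (hκ : IsInteriorChart κ) (h : Presents κ S d)
    (hs : ∀ w ∈ κ.target, ContDiffAt ℝ ∞ d w) (h0 : (0 : W) ∈ κ.target)
    (hc : ∀ x ∈ κ.source, dfun (𝓡∂ (2 * n + 1)) S.φ x = 0 ↔ κ x = 0) :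
    d.Valid κ.target S.between := by
  have hcs : ∀ w ∈ κ.target, ∀ᶠ z in 𝓝 w, z ∈ κ.target := fun w hw =>
    κ.open_target.eventually_mem hw
  have hbij : ∀ w ∈ κ.target,
      Function.Bijective (mfderiv 𝓘(ℝ, W) (𝓡∂ (2 * n + 1)) κ.symm w) := by
    intro w hw
    have h1 := hκ.mfderiv_comp_symm hw
    have h2 := hκ.mfderiv_symm_comp (κ.map_target hw)
    rw [κ.right_inv hw] at h2
    exact Function.bijective_iff_has_inverse.2 ⟨_, fun v => congrArg (fun f : W →L[ℝ] W => f v) h1,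
      fun v => congrArg
        (fun f : C.T (κ.symm w) →L[ℝ] C.T (κ.symm w) => f v) h2⟩
  have hα : ∀ w ∈ κ.target, (d w).1 = ContinuousLinearMap.comp (S.α (κ.symm w))
      (mfderiv 𝓘(ℝ, W) (𝓡∂ (2 * n + 1)) κ.symm w) := by
    intro w hw
    rw [(h _ (κ.map_target hw)).1, κ.right_inv hw]
    exact ((congrArg (fun D : W →L[ℝ] W => (d w).1.comp D) (hκ.mfderiv_comp_symm hw)).trans
      (ContinuousLinearMap.comp_id _)).symm
  have hX : ∀ w ∈ κ.target, mfderiv 𝓘(ℝ, W) (𝓡∂ (2 * n + 1)) κ.symm w (d w).2.1 =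
      S.X (κ.symm w) := by
    intro w hw
    have h1 := (h _ (κ.map_target hw)).2.1
    rw [κ.right_inv hw] at h1
    rw [← h1]
    have h2 := hκ.mfderiv_symm_comp (κ.map_target hw)
    rw [κ.right_inv hw] at h2
    exact congrArg (fun D : C.T (κ.symm w) →L[ℝ] C.T (κ.symm w) => D (S.X (κ.symm w))) h2
  have hφ : ∀ w ∈ κ.target, (d w).2.2 = S.φ (κ.symm w) := by
    intro w hw
    rw [(h _ (κ.map_target hw)).2.2, κ.right_inv hw]
  have hcrit : ∀ w ∈ κ.target, fderiv ℝ (fun w => (d w).2.2) w = 0 ↔ w = 0 := by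
    intro w hw
    have e := dfun_comp (hκ.smooth_symm w hw) (S.smooth_fun (κ.symm w)) ((hcs w hw).mono hφ)
    rw [dfun_model] at e
    have h1 := hc _ (κ.map_target hw)
    rw [κ.right_inv hw] at h1
    rw [← h1, e]
    constructor
    · intro h0
      ext v
      obtain ⟨u, rfl⟩ := (hbij w hw).2 v
      exact congrArg (fun D : W →L[ℝ] ℝ => D u) h0
    · intro h0
      rw [h0]
      rfl
  have hL : ∀ w ∈ κ.target,
      LyapunovAt 𝓘(ℝ, W) (fun w => (d w).2.1) (fun w => (d w).2.2) w := fun w hw =>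
    LyapunovAt.pullback (hκ.smooth_symm w hw) (hbij w hw) (.of_forall S.smooth_fun)
      ((hcs w hw).mono hφ) ((hcs w hw).mono hκ.smooth_symm) ((hcs w hw).mono hX)
      (S.lyapunovAt _)
  have h00 := (hcrit 0 h0).2 rfl
  have hL0 := hL 0 h0
  rw [lyapunovAt_model, h00] at hL0
  have hL0 := hL0.resolve_left (by simp)
  refine ⟨hs, fun w hw => ?_, fun w hw => ?_, fun w hw hne => ?_, hL0.1, h00, ?_, fun w hw => ?_⟩
  · exact (contactFormAt_pullback (hκ.smooth_symm w hw) (hbij w hw) (S.smooth_form _)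
      ((hcs w hw).mono hα)).2 (S.contactFormAt _)
  · exact (contactFieldAt_pullback (hκ.smooth_symm w hw) (hbij w hw) (S.smooth_form _)
      (S.smooth_field _) ((hcs w hw).mono hα) ((hcs w hw).mono hX)).2 (S.contactFieldAt _)
  · have := hL w hw
    rw [lyapunovAt_model] at this
    exact this.resolve_right fun h => hne ((hcrit w hw).1 h.2.1)
  · simpa using hL0.2.2
  · rw [hφ w hw]
    exact S.mem_between (hκ.interior _ (κ.map_target hw))

end Glue

/-! ### Contact linear algebra: Reeb vector and Hamiltonian fields. -/

section ContactAlgebra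

lemma contDiff_flip {E F G : Type*} [NormedAddCommGroup E] [NormedSpace ℝ E]
    [NormedAddCommGroup F] [NormedSpace ℝ F] [NormedAddCommGroup G] [NormedSpace ℝ G] :
    ContDiff ℝ ∞ (fun D : E →L[ℝ] F →L[ℝ] G => D.flip) :=
  (ContinuousLinearMap.flipₗᵢ ℝ E F G).contDiff

lemma contDiff_smulRight_self {E G : Type*} [NormedAddCommGroup E] [NormedSpace ℝ E]
    [NormedAddCommGroup G] [NormedSpace ℝ G] :
    ContDiff ℝ ∞ (fun p : (E →L[ℝ] ℝ) × G => p.1.smulRight p.2) :=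
  contDiff_fst.smulRight contDiff_snd

variable {W : Type*} [NormedAddCommGroup W] [NormedSpace ℝ W]

/-- The map `v ↦ a(v) a + da(v, ·)` of a covector `a` and a bilinear form with
antisymmetrisation `da`. -/
def contactMap (a : W →L[ℝ] ℝ) (D : W →L[ℝ] W →L[ℝ] ℝ) : W →L[ℝ] W →L[ℝ] ℝ :=
  a.smulRight a + (D - D.flip)

@[simp] lemma contactMap_apply (a : W →L[ℝ] ℝ) (D : W →L[ℝ] W →L[ℝ] ℝ) (u v : W) :
    contactMap a D u v = a u * a v + (D u v - D v u) := by
  simp [contactMap]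

lemma contDiff_contactMap : ContDiff ℝ ∞
    (fun p : (W →L[ℝ] ℝ) × (W →L[ℝ] W →L[ℝ] ℝ) => contactMap p.1 p.2) := by
  have h1 : ContDiff ℝ ∞ (fun p : (W →L[ℝ] ℝ) × (W →L[ℝ] W →L[ℝ] ℝ) => p.1.smulRight p.1) :=
    contDiff_smulRight_self.comp (contDiff_fst.prodMk contDiff_fst)
  have h2 : ContDiff ℝ ∞ (fun p : (W →L[ℝ] ℝ) × (W →L[ℝ] W →L[ℝ] ℝ) => p.2 - p.2.flip) :=
    contDiff_snd.sub (contDiff_flip.comp contDiff_snd)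
  exact h1.add h2

/-- The contact condition for a covector and a bilinear form, in terms of the associated map. -/
structure IsContactPair (a : W →L[ℝ] ℝ) (D : W →L[ℝ] W →L[ℝ] ℝ) : Prop where
  invertible : (contactMap a D).IsInvertible
  apply_reeb : a ((contactMap a D).inverse a) = 1

lemma contactMap_inverse_self {a : W →L[ℝ] ℝ} {D : W →L[ℝ] W →L[ℝ] ℝ}
    (hL : (contactMap a D).IsInvertible) (e : W →L[ℝ] ℝ) :
    contactMap a D ((contactMap a D).inverse e) = e := by
  obtain ⟨L, hL⟩ := hL
  rw [← hL]
  simp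

lemma inverse_contactMap_self {a : W →L[ℝ] ℝ} {D : W →L[ℝ] W →L[ℝ] ℝ}
    (hL : (contactMap a D).IsInvertible) (v : W) :
    (contactMap a D).inverse (contactMap a D v) = v := by
  obtain ⟨L, hL⟩ := hL
  rw [← hL]
  simp

/-- The antisymmetric part of `contactMap` vanishes on the diagonal. So `a(R)` is 0 or 1 for `R` the
preimage of `a`; the value 0 does occur, for instance in the plane. To be a contact pair is
therefore an open condition: invertibility and `a(R) ≠ 0` suffice. -/
lemma apply_reeb_sq {a : W →L[ℝ] ℝ} {D : W →L[ℝ] W →L[ℝ] ℝ}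
    (hL : (contactMap a D).IsInvertible) :
    a ((contactMap a D).inverse a) ^ 2 = a ((contactMap a D).inverse a) := by
  have := DFunLike.congr_fun (contactMap_inverse_self hL a) ((contactMap a D).inverse a)
  rw [contactMap_apply, sub_self, add_zero] at this
  rw [sq, this]

lemma isContactPair_of_ne {a : W →L[ℝ] ℝ} {D : W →L[ℝ] W →L[ℝ] ℝ}
    (hL : (contactMap a D).IsInvertible) (h : a ((contactMap a D).inverse a) ≠ 0) :
    IsContactPair a D := by
  refine ⟨hL, ?_⟩
  have := apply_reeb_sq hL
  rw [sq] at this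
  exact mul_right_cancel₀ h (this.trans (one_mul _).symm)

lemma IsContactPair.reeb_antisymm {a : W →L[ℝ] ℝ} {D : W →L[ℝ] W →L[ℝ] ℝ}
    (h : IsContactPair a D) (v : W) :
    D ((contactMap a D).inverse a) v - D v ((contactMap a D).inverse a) = 0 := by
  have := DFunLike.congr_fun (contactMap_inverse_self h.invertible a) v
  rw [contactMap_apply, h.apply_reeb, one_mul] at this
  linarith

lemma IsContactPair.contactFormAt {a : W → W →L[ℝ] ℝ} {w : W}
    (h : IsContactPair (a w) (fderiv ℝ a w)) : ContactFormAt 𝓘(ℝ, W) a w := by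
  rw [contactFormAt_model]
  refine ⟨fun h0 => by simpa [h0] using h.apply_reeb, fun v hv hd => ?_⟩
  set R := (contactMap (a w) (fderiv ℝ a w)).inverse (a w) with hR
  have hL : contactMap (a w) (fderiv ℝ a w) v = 0 := by
    ext u
    rw [contactMap_apply, hv, zero_mul, zero_add]
    have h1 := hd (u - (a w u) • R) (by
      rw [map_sub, map_smul, hR, h.apply_reeb, smul_eq_mul, mul_one, sub_self])
    have h2 := h.reeb_antisymm v
    rw [← hR] at h2
    simp only [map_sub, map_smul, sub_apply, smul_apply,
      smul_eq_mul] at h1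
    change _ = (0 : ℝ)
    linear_combination h1 - (a w u) * h2
  rw [← inverse_contactMap_self h.invertible v, hL, map_zero]

lemma finrank_clm_dual [FiniteDimensional ℝ W] :
    Module.finrank ℝ (W →L[ℝ] ℝ) = Module.finrank ℝ W := by
  rw [← Subspace.dual_finrank_eq (K := ℝ) (V := W)]
  exact (LinearMap.toContinuousLinearMap (𝕜 := ℝ) (E := W) (F' := ℝ)).finrank_eq.symm

/-- If `contactMap v = 0`, evaluation at `v` gives `a(v) = 0`, and then `v` is in the kernel of `da`
on `ker a`. If the Reeb vector satisfied `a(R) = 0`, it would also lie in this kernel, so `R = 0`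
and `a = 0`. -/
lemma isContactPair_of_contactFormAt [FiniteDimensional ℝ W] {a : W → W →L[ℝ] ℝ} {w : W}
    (h : ContactFormAt 𝓘(ℝ, W) a w) : IsContactPair (a w) (fderiv ℝ a w) := by
  rw [contactFormAt_model] at h
  obtain ⟨h0, h⟩ := h
  have hinj : Function.Injective (contactMap (a w) (fderiv ℝ a w)) := by
    refine (injective_iff_map_eq_zero _).2 fun v hv => ?_
    have h1 := DFunLike.congr_fun hv v
    rw [contactMap_apply, sub_self, add_zero] at h1
    have h2 : a w v = 0 := mul_self_eq_zero.1 h1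
    refine h v h2 fun u _ => ?_
    have h3 := DFunLike.congr_fun hv u
    rwa [contactMap_apply, h2, zero_mul, zero_add] at h3
  have hbij : Function.Bijective (contactMap (a w) (fderiv ℝ a w)) :=
    ⟨hinj, (LinearMap.injective_iff_surjective_of_finrank_eq_finrank
      (f := (contactMap (a w) (fderiv ℝ a w)).toLinearMap) finrank_clm_dual.symm).1 hinj⟩
  have hL := isInvertible_of_bijective hbij
  refine isContactPair_of_ne hL fun hR => ?_
  set R := (contactMap (a w) (fderiv ℝ a w)).inverse (a w)
  have h1 := contactMap_inverse_self hL (a w)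
  have hR0 : R = 0 := h R hR fun u hu => by
    have := DFunLike.congr_fun h1 u
    rwa [contactMap_apply, hu, mul_zero, zero_add] at this
  apply h0
  change contactMap _ _ R = _ at h1
  rw [← h1, hR0, map_zero]

/-- The contact field with given value `h` of the form, and differential `e` of this value. -/
def hamField (a : W →L[ℝ] ℝ) (M : (W →L[ℝ] ℝ) →L[ℝ] W) (h : ℝ) (e : W →L[ℝ] ℝ) : W :=
  (h + e (M a)) • M a - M e

lemma hamField_sub (a : W →L[ℝ] ℝ) (M : (W →L[ℝ] ℝ) →L[ℝ] W) (h h' : ℝ) (e e' : W →L[ℝ] ℝ) :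
    hamField a M h e - hamField a M h' e' = hamField a M (h - h') (e - e') := by
  simp only [hamField, map_sub, sub_apply]
  module

variable {a : W →L[ℝ] ℝ} {D : W →L[ℝ] W →L[ℝ] ℝ}

lemma IsContactPair.apply_hamField (h : IsContactPair a D) (r : ℝ) (e : W →L[ℝ] ℝ) :
    a (hamField a (contactMap a D).inverse r e) = r := by
  have h1 := DFunLike.congr_fun (contactMap_inverse_self h.invertible e)
    ((contactMap a D).inverse a)
  have h2 := h.reeb_antisymm ((contactMap a D).inverse e)
  rw [contactMap_apply, h.apply_reeb, mul_one] at h1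
  simp only [hamField, map_sub, map_smul, smul_eq_mul, h.apply_reeb, mul_one]
  linear_combination -h1 - h2

lemma IsContactPair.antisymm_hamField (h : IsContactPair a D) (r : ℝ) (e : W →L[ℝ] ℝ) (v : W) :
    D (hamField a (contactMap a D).inverse r e) v - D v (hamField a (contactMap a D).inverse r e) =
      - e v + e ((contactMap a D).inverse a) * a v := by
  have h1 := DFunLike.congr_fun (contactMap_inverse_self h.invertible e) v
  have h3 := h.apply_hamField r e
  have h2 := h.reeb_antisymm v
  rw [contactMap_apply] at h1
  simp only [hamField, map_sub, map_smul, smul_eq_mul, h.apply_reeb, mul_one,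
    sub_apply, smul_apply] at h3 ⊢
  linear_combination (r + e ((contactMap a D).inverse a)) * h2 - h1 - h3 * a v

/-- This freedom allows replacing `dh` by `dh - m a`, which is small near a zero of the field
although `dh` is not; the estimates of `norm_hamField_sub_le` rest on it. -/
lemma IsContactPair.hamField_add_smul (h : IsContactPair a D) (r s : ℝ) (e : W →L[ℝ] ℝ) :
    hamField a (contactMap a D).inverse r (e + s • a) =
      hamField a (contactMap a D).inverse r e := by
  simp only [hamField, map_add, map_smul, add_apply,
    smul_apply, h.apply_reeb, smul_eq_mul]
  module

/-- The conformal factor is forced: evaluating the equation on the Reeb vector gives `m = e(R)`.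
Applying the inverse of `contactMap` then solves for `Y`. -/
lemma IsContactPair.eq_hamField (h : IsContactPair a D) {e : W →L[ℝ] ℝ} {Y : W} {m : ℝ}
    (hY : ∀ v, e v + (D Y v - D v Y) = m * a v) :
    Y = hamField a (contactMap a D).inverse (a Y) e := by
  have h1 : contactMap a D Y = a Y • a + (m • a - e) := by
    ext v
    simp only [contactMap_apply, add_apply, smul_apply,
      sub_apply, smul_eq_mul]
    linear_combination hY v
  have h2 := inverse_contactMap_self h.invertible Y
  rw [h1] at h2
  have h3 := hY ((contactMap a D).inverse a)
  have h4 := h.reeb_antisymm Y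
  rw [h.apply_reeb] at h3
  have hm : e ((contactMap a D).inverse a) = m := by linear_combination h3 + h4
  refine h2.symm.trans ?_
  rw [hamField, hm]
  simp only [map_add, map_smul, map_sub]
  module

lemma contactFieldAt_hamField {a : W → W →L[ℝ] ℝ} {Y : W → W} {h : W → ℝ} {w : W}
    (hc : IsContactPair (a w) (fderiv ℝ a w)) (hh : ∀ᶠ y in 𝓝 w, a y (Y y) = h y)
    (hY : Y w = hamField (a w) (contactMap (a w) (fderiv ℝ a w)).inverse (h w) (fderiv ℝ h w)) :
    ContactFieldAt 𝓘(ℝ, W) a Y w := by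
  rw [contactFieldAt_model]
  refine ⟨fderiv ℝ h w ((contactMap (a w) (fderiv ℝ a w)).inverse (a w)), fun v => ?_⟩
  have e : fderiv ℝ (fun y => a y (Y y)) w = fderiv ℝ h w := Filter.EventuallyEq.fderiv_eq hh
  rw [e, hY, hc.antisymm_hamField]
  ring

lemma ContactFieldAt.eq_hamField {a : W → W →L[ℝ] ℝ} {Y : W → W} {w : W}
    (hc : IsContactPair (a w) (fderiv ℝ a w)) (h : ContactFieldAt 𝓘(ℝ, W) a Y w) :
    Y w = hamField (a w) (contactMap (a w) (fderiv ℝ a w)).inverse (a w (Y w))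
      (fderiv ℝ (fun y => a y (Y y)) w) := by
  rw [contactFieldAt_model] at h
  obtain ⟨m, h⟩ := h
  exact hc.eq_hamField h

end ContactAlgebra

/-! ### Logarithmic cutoff functions. -/

section Cutoff

lemma exists_deriv_smoothTransition_bound :
    ∃ B : ℝ, 0 < B ∧ ∀ x, |deriv Real.smoothTransition x| ≤ B := by
  have hc : Continuous (deriv Real.smoothTransition) :=
    (Real.smoothTransition.contDiff (n := 1)).continuous_deriv le_rfl
  obtain ⟨B, hB⟩ := isCompact_Icc.exists_bound_of_continuousOn
    (s := Icc (0 : ℝ) 1) hc.continuousOn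
  refine ⟨max B 1, by positivity, fun x => ?_⟩
  by_cases hx : x ∈ Icc (0 : ℝ) 1
  · exact (hB x hx).trans (le_max_left _ _)
  · have : deriv Real.smoothTransition x = 0 := by
      rcases not_and_or.1 hx with h | h
      · have : Real.smoothTransition =ᶠ[𝓝 x] fun _ => 0 := by
          filter_upwards [gt_mem_nhds (not_le.1 h)] with y hy
          exact Real.smoothTransition.zero_of_nonpos hy.le
        rw [this.deriv_eq, deriv_const]
      · have : Real.smoothTransition =ᶠ[𝓝 x] fun _ => 1 := by
          filter_upwards [lt_mem_nhds (not_le.1 h)] with y hy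
          exact Real.smoothTransition.one_of_one_le hy.le
        rw [this.deriv_eq, deriv_const]
    rw [this]
    simp

/-- A cutoff function which varies slowly on the logarithmic scale. -/
lemma exists_log_cutoff {η τ₀ : ℝ} (hη : 0 < η) (hτ : 0 < τ₀) :
    ∃ l : ℝ → ℝ, ContDiff ℝ ∞ l ∧ (∀ τ, l τ ∈ Icc (0 : ℝ) 1) ∧ (∀ᶠ τ in 𝓝 0, l τ = 1) ∧
      (∀ τ, τ₀ ≤ τ → l τ = 0) ∧ ∀ τ, |τ * deriv l τ| ≤ η := by
  obtain ⟨B, hB, hbound⟩ := exists_deriv_smoothTransition_bound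
  -- For a transition function `s` of the variable `ε log τ` the quantity `τ l'(τ)` is `-ε s'`,
  -- bounded by `ε B = η`. The transition from 1 to 0 takes place for `log τ` in an interval of
  -- length `1/ε`, which gives the point `τ₁`.
  set ε : ℝ := η / B with hε
  have hε0 : 0 < ε := by positivity
  set τ₁ : ℝ := τ₀ * Real.exp (-(1 / ε)) with hτ₁
  have hτ₁0 : 0 < τ₁ := by positivity
  set g : ℝ → ℝ := fun τ => Real.smoothTransition (ε * (Real.log τ₀ - Real.log τ)) with hg
  set l : ℝ → ℝ := fun τ => if τ < τ₁ then 1 else g τ with hl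
  have hg1 : ∀ τ, 0 < τ → τ ≤ τ₁ → g τ = 1 := fun τ h0 h1 => by
    refine Real.smoothTransition.one_of_one_le ?_
    have : Real.log τ ≤ Real.log τ₀ - 1 / ε := by
      have := Real.log_le_log h0 h1
      rwa [hτ₁, Real.log_mul hτ.ne' (Real.exp_ne_zero _), Real.log_exp, ← sub_eq_add_neg] at this
    calc (1 : ℝ) = ε * (1 / ε) := by field_simp
      _ ≤ _ := by gcongr; linarith
  have hlg : ∀ τ, 0 < τ → l =ᶠ[𝓝 τ] g := fun τ h0 => by
    filter_upwards [lt_mem_nhds h0] with s hs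
    by_cases h : s < τ₁
    · simp only [hl, h, if_true, hg1 s hs h.le]
    · simp only [hl, h, if_false]
  have hl1 : ∀ τ, τ < τ₁ → l =ᶠ[𝓝 τ] fun _ => 1 := fun τ h0 => by
    filter_upwards [gt_mem_nhds h0] with s hs
    simp only [hl, hs, if_true]
  have hgd : ∀ τ, 0 < τ → HasDerivAt g
      (deriv Real.smoothTransition (ε * (Real.log τ₀ - Real.log τ)) * (ε * -τ⁻¹)) τ := by
    intro τ h0
    have h1 : HasDerivAt (fun τ => ε * (Real.log τ₀ - Real.log τ)) (ε * -τ⁻¹) τ := by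
      simpa using ((Real.hasDerivAt_log h0.ne').const_sub (Real.log τ₀)).const_mul ε
    exact HasDerivAt.comp τ ((Real.smoothTransition.contDiff (n := 1)).differentiable
      (by simp) _).hasDerivAt h1
  refine ⟨l, contDiff_iff_contDiffAt.2 fun τ => ?_, fun τ => ?_, ?_, fun τ h => ?_, fun τ => ?_⟩
  · rcases lt_or_ge τ τ₁ with h | h
    · exact contDiffAt_const.congr_of_eventuallyEq (hl1 τ h)
    · have h0 : 0 < τ := hτ₁0.trans_le h
      refine ContDiffAt.congr_of_eventuallyEq ?_ (hlg τ h0)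
      exact Real.smoothTransition.contDiffAt.comp τ
        (contDiffAt_const.mul (contDiffAt_const.sub (Real.contDiffAt_log.2 h0.ne')))
  · by_cases h : τ < τ₁
    · simp [hl, h]
    · simp only [hl, h, if_false]
      exact ⟨Real.smoothTransition.nonneg _, Real.smoothTransition.le_one _⟩
  · exact hl1 0 hτ₁0
  · have h1 : ¬ τ < τ₁ := by
      have : Real.exp (-(1 / ε)) ≤ 1 := Real.exp_le_one_iff.2 (by simp [hε0.le])
      have : τ₁ ≤ τ₀ := mul_le_of_le_one_right hτ.le this
      linarith
    simp only [hl, h1, if_false]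
    refine Real.smoothTransition.zero_of_nonpos ?_
    have := Real.log_le_log hτ h
    exact mul_nonpos_of_nonneg_of_nonpos hε0.le (by linarith)
  · rcases lt_or_ge τ τ₁ with h | h
    · rw [(hl1 τ h).deriv_eq, deriv_const]
      simp [hη.le]
    · have h0 : 0 < τ := hτ₁0.trans_le h
      rw [(hlg τ h0).deriv_eq, (hgd τ h0).deriv]
      have : τ * (deriv Real.smoothTransition (ε * (Real.log τ₀ - Real.log τ)) * (ε * -τ⁻¹)) =
          -(ε * deriv Real.smoothTransition (ε * (Real.log τ₀ - Real.log τ))) := by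
        field_simp
      rw [this, abs_neg, abs_mul, abs_of_pos hε0]
      calc _ ≤ ε * B := by gcongr; exact hbound _
        _ = η := by rw [hε]; field_simp

end Cutoff

/-! ### Taylor bounds at the origin, and cutoffs with small scale-invariant slope. -/

section Germs

variable {E F : Type*} [NormedAddCommGroup E] [NormedSpace ℝ E]
  [NormedAddCommGroup F] [NormedSpace ℝ F]

lemma exists_linear_bound {g : E → F} (hg : ContDiffAt ℝ 1 g 0) (h0 : g 0 = 0) :
    ∃ K : ℝ, 0 < K ∧ ∀ᶠ w in 𝓝 (0 : E), ‖g w‖ ≤ K * ‖w‖ := by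
  obtain ⟨K, hK, hb⟩ := (hg.differentiableAt (by simp)).hasFDerivAt.isBigO_sub.exists_pos
  refine ⟨K, hK, ?_⟩
  filter_upwards [hb.bound] with w hw
  simpa [h0] using hw

lemma exists_quadratic_bound {g : E → F} (hg : ContDiffAt ℝ 2 g 0) (h0 : g 0 = 0)
    (h1 : fderiv ℝ g 0 = 0) :
    ∃ K : ℝ, 0 < K ∧ ∀ᶠ w in 𝓝 (0 : E), ‖g w‖ ≤ K * ‖w‖ ^ 2 := by
  obtain ⟨K, hK, hb⟩ := exists_linear_bound (g := fderiv ℝ g) (hg.fderiv_right (by norm_num)) h1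
  have hd : ∀ᶠ w in 𝓝 (0 : E), DifferentiableAt ℝ g w :=
    (hg.eventually (by simp)).mono fun w hw => hw.differentiableAt (by simp)
  obtain ⟨r, hr, hball⟩ := Metric.eventually_nhds_iff_ball.1 (hb.and hd)
  refine ⟨K, hK, ?_⟩
  filter_upwards [Metric.ball_mem_nhds (0 : E) hr] with w hw
  have hsub : Metric.closedBall (0 : E) ‖w‖ ⊆ Metric.ball 0 r :=
    Metric.closedBall_subset_ball (by simpa using hw)
  have := (convex_closedBall (0 : E) ‖w‖).norm_image_sub_le_of_norm_fderiv_le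
    (f := g) (C := K * ‖w‖) (𝕜 := ℝ) (fun x hx => (hball x (hsub hx)).2)
    (fun x hx => (hball x (hsub hx)).1.trans (by
      gcongr; simpa using hx)) (x := 0) (y := w) (by simp) (by simp)
  rw [h0, sub_zero, sub_zero] at this
  calc _ ≤ _ := this
    _ = _ := by ring

/-- Composing the logarithmic cutoff with `N` gives `|w| |dσ| ≤ C |w|² |l'(N)| ≤ (C/c) N |l'(N)|`,
whence the slope `η c / C`. The bound on `|w| |dσ|` is invariant under scaling: it can be prescribed
independently of the radius `ρ`. -/
lemma exists_cutoff_of_quadratic {N : E → ℝ} (hN : ContDiff ℝ ∞ N) {c C : ℝ} (hc : 0 < c)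
    (hC : 0 < C) (hlow : ∀ w, c * ‖w‖ ^ 2 ≤ N w) (h0 : N 0 = 0)
    (hup : ∀ w, ‖fderiv ℝ N w‖ ≤ C * ‖w‖) {ρ η : ℝ} (hρ : 0 < ρ) (hη : 0 < η) :
    ∃ σ : E → ℝ, ContDiff ℝ ∞ σ ∧ (∀ w, σ w ∈ Icc (0 : ℝ) 1) ∧ (∀ᶠ w in 𝓝 0, σ w = 1) ∧
      (∀ w, ρ ≤ ‖w‖ → σ w = 0) ∧ ∀ w, ‖w‖ * ‖fderiv ℝ σ w‖ ≤ η := by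
  obtain ⟨l, hl, hl01, hl1, hl0, hlb⟩ := exists_log_cutoff (η := η * c / C) (τ₀ := c * ρ ^ 2)
    (by positivity) (by positivity)
  have hNc : Filter.Tendsto N (𝓝 0) (𝓝 0) := by
    simpa [h0] using hN.continuous.tendsto 0
  refine ⟨fun w => l (N w), hl.comp hN, fun w => hl01 _, hNc.eventually hl1,
    fun w hw => hl0 _ ((by gcongr : c * ρ ^ 2 ≤ c * ‖w‖ ^ 2).trans (hlow w)), fun w => ?_⟩
  have hd : fderiv ℝ (fun w => l (N w)) w = deriv l (N w) • fderiv ℝ N w := by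
    have h1 := (hl.differentiable (by simp) (N w)).hasDerivAt
    have h2 := (hN.differentiable (by simp) w).hasFDerivAt
    exact (h1.comp_hasFDerivAt w h2).fderiv
  rw [hd, norm_smul, Real.norm_eq_abs]
  have h1 := hlb (N w)
  have h2 : 0 ≤ N w := (by positivity : 0 ≤ c * ‖w‖ ^ 2).trans (hlow w)
  rw [abs_mul, abs_of_nonneg h2, le_div_iff₀ hC] at h1
  have h3 : c * (‖w‖ * (|deriv l (N w)| * ‖fderiv ℝ N w‖)) ≤ c * η := by
    calc _ ≤ c * (‖w‖ * (|deriv l (N w)| * (C * ‖w‖))) := by gcongr; exact hup w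
      _ = (c * ‖w‖ ^ 2) * |deriv l (N w)| * C := by ring
      _ ≤ N w * |deriv l (N w)| * C := by gcongr; exact hlow w
      _ ≤ _ := by linarith
  exact le_of_mul_le_mul_left h3 hc

/-- The norm of `E` need not be smooth (that of `Std n` is a maximum), so `N` is a squared Euclidean
norm in linear coordinates. -/
lemma exists_cutoff [FiniteDimensional ℝ E] {ρ η : ℝ} (hρ : 0 < ρ) (hη : 0 < η) :
    ∃ σ : E → ℝ, ContDiff ℝ ∞ σ ∧ (∀ w, σ w ∈ Icc (0 : ℝ) 1) ∧ (∀ᶠ w in 𝓝 0, σ w = 1) ∧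
      (∀ w, ρ ≤ ‖w‖ → σ w = 0) ∧ ∀ w, ‖w‖ * ‖fderiv ℝ σ w‖ ≤ η := by
  let e : E ≃L[ℝ] EuclideanSpace ℝ (Fin (Module.finrank ℝ E)) := toEuclidean
  obtain ⟨c, hc, hlow⟩ := exists_quadratic_lower_bound (f := fun v => ‖e v‖ ^ 2) (by fun_prop)
    (fun r v => by simp [norm_smul, mul_pow]) fun v hv => by
      have : e v ≠ 0 := fun h => hv (e.injective (by simpa using h))
      positivity
  refine exists_cutoff_of_quadratic (N := fun v => ‖e v‖ ^ 2)
    ((contDiff_norm_sq ℝ).comp e.contDiff) hc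
    (C := 2 * (‖(e : E →L[ℝ] EuclideanSpace ℝ (Fin (Module.finrank ℝ E)))‖ ^ 2 + 1)) (by positivity) hlow (by simp) (fun w => ?_) hρ hη
  have hd : HasFDerivAt (fun v => ‖e v‖ ^ 2)
      (2 • (innerSL ℝ (e w)).comp (e : E →L[ℝ] EuclideanSpace ℝ (Fin (Module.finrank ℝ E)))) w :=
    e.hasFDerivAt.norm_sq
  rw [hd.fderiv]
  calc _ ≤ 2 * (‖e w‖ * ‖(e : E →L[ℝ] EuclideanSpace ℝ (Fin (Module.finrank ℝ E)))‖) := by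
        rw [two_smul, two_mul]
        refine (norm_add_le _ _).trans (add_le_add ?_ ?_) <;>
        · refine (ContinuousLinearMap.opNorm_comp_le _ _).trans ?_
          rw [innerSL_apply_norm]
    _ ≤ 2 * ((‖(e : E →L[ℝ] EuclideanSpace ℝ (Fin (Module.finrank ℝ E)))‖ * ‖w‖) *
          ‖(e : E →L[ℝ] EuclideanSpace ℝ (Fin (Module.finrank ℝ E)))‖) := by
        gcongr; exact (e : E →L[ℝ] EuclideanSpace ℝ (Fin (Module.finrank ℝ E))).le_opNorm w
    _ ≤ _ := by nlinarith [norm_nonneg w]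

end Germs

/-! ### Moves given by families of local data. -/

section Families

variable {W : Type*} [NormedAddCommGroup W] [NormedSpace ℝ W]

lemma ContactFormAt.congr_model {a a' : W → W →L[ℝ] ℝ} {w : W}
    (h : ContactFormAt 𝓘(ℝ, W) a w) (he : a' =ᶠ[𝓝 w] a) : ContactFormAt 𝓘(ℝ, W) a' w := by
  rw [contactFormAt_model] at h ⊢
  rwa [he.fderiv_eq, he.self_of_nhds]

lemma ContactFieldAt.congr_model {a a' : W → W →L[ℝ] ℝ} {Y Y' : W → W} {w : W}
    (h : ContactFieldAt 𝓘(ℝ, W) a Y w) (he : a' =ᶠ[𝓝 w] a) (hY : Y' =ᶠ[𝓝 w] Y) :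
    ContactFieldAt 𝓘(ℝ, W) a' Y' w := by
  rw [contactFieldAt_model] at h ⊢
  have : (fun y => a' y (Y' y)) =ᶠ[𝓝 w] fun y => a y (Y y) := by
    filter_upwards [he, hY] with y h1 h2
    rw [h1, h2]
  rwa [he.fderiv_eq, he.self_of_nhds, hY.self_of_nhds, this.fderiv_eq]

/-- Only the ball of radius `ρ` has to be examined. Since `ρ' < ρ`, every point outside it has a
neighbourhood on which the family is constant, so the conditions, which involve derivatives, are
inherited from `d`. -/
lemma LocalData.move_of_family [FiniteDimensional ℝ W] {V : Set W} {J : Set ℝ} {d : LocalData W}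
    (hV : IsOpen V) (hd : d.Valid V J) (D : ℝ → LocalData W) {ρ' ρ : ℝ}
    (hρ : ρ' < ρ) (hb : Metric.ball 0 ρ ⊆ V) (h0 : ∀ w ∈ V, D 0 w = d w)
    (hout : ∀ t, ∀ w ∈ V, ρ' ≤ ‖w‖ → D t w = d w)
    (hs : ∀ t ∈ Icc (0 : ℝ) 1, ∀ w ∈ Metric.ball (0 : W) ρ,
      ContDiffAt ℝ ∞ (fun p : ℝ × W => D p.1 p.2) (t, w))
    (hform : ∀ t ∈ Icc (0 : ℝ) 1, ∀ w ∈ Metric.ball (0 : W) ρ,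
      ContactFormAt 𝓘(ℝ, W) (fun w => (D t w).1) w)
    (hfield : ∀ t ∈ Icc (0 : ℝ) 1, ∀ w ∈ Metric.ball (0 : W) ρ,
      ContactFieldAt 𝓘(ℝ, W) (fun w => (D t w).1) (fun w => (D t w).2.1) w)
    (hreg : ∀ t ∈ Icc (0 : ℝ) 1, ∀ w ∈ Metric.ball (0 : W) ρ, w ≠ 0 →
      0 < fderiv ℝ (fun w => (D t w).2.2) w (D t w).2.1)
    (hzero : ∀ t ∈ Icc (0 : ℝ) 1, (D t 0).2.1 = 0)
    (hcrit : ∀ t ∈ Icc (0 : ℝ) 1, fderiv ℝ (fun w => (D t w).2.2) 0 = 0)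
    (hgrowth : ∀ t ∈ Icc (0 : ℝ) 1, ∃ c : ℝ, 0 < c ∧ ∀ᶠ w in 𝓝 0,
      c * ‖w‖ ^ 2 ≤ fderiv ℝ (fun w => (D t w).2.2) w (D t w).2.1)
    (hmem : ∀ t ∈ Icc (0 : ℝ) 1, ∀ w ∈ Metric.ball (0 : W) ρ, (D t w).2.2 ∈ J) :
    Move V J d (D 1) := by
  have : ProperSpace W := FiniteDimensional.proper ℝ W
  have hKV : Metric.closedBall (0 : W) ρ' ⊆ V := (Metric.closedBall_subset_ball hρ).trans hb
  have hnear : ∀ w ∈ V, w ∉ Metric.ball (0 : W) ρ → ∀ᶠ y in 𝓝 w, ∀ t, D t y = d y := by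
    intro w hw hwb
    have : ρ' < ‖w‖ := by
      rw [mem_ball_zero_iff, not_lt] at hwb
      linarith
    filter_upwards [hV.mem_nhds hw, continuous_norm.continuousAt.eventually (lt_mem_nhds this)]
      with y hy1 hy2 t
    exact hout t y hy1 hy2.le
  refine ⟨D, Metric.closedBall 0 ρ', isCompact_closedBall _ _, hKV, h0, fun w _ => rfl,
    fun t ht => ⟨fun w hw => ?_, fun w hw => ?_, fun w hw => ?_, fun w hw hne => ?_, hzero t ht,
      hcrit t ht, hgrowth t ht, fun w hw => ?_⟩, fun t ht w hw => ?_, fun t ht w hw => ?_⟩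
  · by_cases hwb : w ∈ Metric.ball (0 : W) ρ
    · exact (hs t ht w hwb).comp w (contDiffAt_const.prodMk contDiffAt_id)
    · exact (hd.smooth w hw).congr_of_eventuallyEq ((hnear w hw hwb).mono fun y hy => hy t)
  · by_cases hwb : w ∈ Metric.ball (0 : W) ρ
    · exact hform t ht w hwb
    · exact (hd.form w hw).congr_model ((hnear w hw hwb).mono fun y hy => by simp only [hy t])
  · by_cases hwb : w ∈ Metric.ball (0 : W) ρ
    · exact hfield t ht w hwb
    · exact (hd.field w hw).congr_model ((hnear w hw hwb).mono fun y hy => by simp only [hy t])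
        ((hnear w hw hwb).mono fun y hy => by simp only [hy t])
  · by_cases hwb : w ∈ Metric.ball (0 : W) ρ
    · exact hreg t ht w hwb hne
    · have := hd.regular w hw hne
      have he : (fun w => (D t w).2.2) =ᶠ[𝓝 w] fun w => (d w).2.2 :=
        (hnear w hw hwb).mono fun y hy => by simp only [hy t]
      rwa [he.fderiv_eq, (hnear w hw hwb).self_of_nhds t]
  · by_cases hwb : w ∈ Metric.ball (0 : W) ρ
    · exact hmem t ht w hwb
    · rw [(hnear w hw hwb).self_of_nhds t]
      exact hd.mem w hw
  · by_cases hwb : w ∈ Metric.ball (0 : W) ρ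
    · exact hs t ht w hwb
    · have hc : ContDiffAt ℝ ∞ (fun p : ℝ × W => d p.2) (t, w) :=
        (hd.smooth w hw).comp (t, w) contDiffAt_snd
      refine hc.congr_of_eventuallyEq ?_
      filter_upwards [continuousAt_snd.eventually (hnear w hw hwb)] with p hp
      exact hp p.1
  · refine hout t w hw.1 (not_le.1 fun h => hw.2 ?_).le
    simpa using h

end Families

/-! ### Uniform estimates for Hamiltonian fields of nearby contact forms. -/

section Estimates

variable {W : Type*} [NormedAddCommGroup W] [NormedSpace ℝ W]

-- The map sending `(a, L)` to `(L⁻¹, L⁻¹ a)` is continuously differentiable at an invertible `L₀`,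
-- hence bounded and Lipschitz nearby. The open condition `U` is carried along to keep track of the
-- Reeb vector.
omit [NormedAddCommGroup W] [NormedSpace ℝ W] in
lemma exists_inverse_bounds {E F : Type*} [NormedAddCommGroup E] [NormedSpace ℝ E]
    [CompleteSpace E] [NormedAddCommGroup F] [NormedSpace ℝ F] {a₀ : F} {L₀ : E →L[ℝ] F}
    (h₀ : L₀.IsInvertible) {U : Set E} (hU : U ∈ 𝓝 (L₀.inverse a₀)) :
    ∃ r K : ℝ, 0 < r ∧ 0 < K ∧ ∀ (a : F) (L : E →L[ℝ] F), ‖a - a₀‖ < r → ‖L - L₀‖ < r →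
      L.IsInvertible ∧ L.inverse a ∈ U ∧ ‖L.inverse‖ ≤ K ∧ ‖L.inverse a‖ ≤ K ∧
      ∀ (a' : F) (L' : E →L[ℝ] F), ‖a' - a₀‖ < r → ‖L' - L₀‖ < r →
        ‖L.inverse - L'.inverse‖ ≤ K * (‖a - a'‖ + ‖L - L'‖) ∧
        ‖L.inverse a - L'.inverse a'‖ ≤ K * (‖a - a'‖ + ‖L - L'‖) := by
  obtain ⟨e₀, rfl⟩ := h₀
  set L₀ : E →L[ℝ] F := e₀.toContinuousLinearMap with hL₀
  let P : F × (E →L[ℝ] F) → (F →L[ℝ] E) × E := fun p => (p.2.inverse, p.2.inverse p.1)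
  have hinv : ContDiffAt ℝ 1 (fun p : F × (E →L[ℝ] F) => p.2.inverse) (a₀, L₀) :=
    (contDiffAt_map_inverse e₀).comp (a₀, L₀) contDiffAt_snd
  have hP : ContDiffAt ℝ 1 P (a₀, L₀) := hinv.prodMk (hinv.clm_apply contDiffAt_fst)
  obtain ⟨K, t, ht, hK⟩ := hP.exists_lipschitzOnWith
  have hbd : ∀ᶠ p in 𝓝 (a₀, L₀), ‖P p‖ < ‖P (a₀, L₀)‖ + 1 :=
    hP.continuousAt.norm.eventually (gt_mem_nhds (by linarith))
  have hap : ∀ᶠ p in 𝓝 (a₀, L₀), (P p).2 ∈ U := hP.continuousAt.snd.eventually hU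
  have hiv : ∀ᶠ p : F × (E →L[ℝ] F) in 𝓝 (a₀, L₀), p.2.IsInvertible := by
    have h1 : ∀ᶠ L in 𝓝 L₀, L.IsInvertible := by
      filter_upwards [ContinuousLinearEquiv.nhds (𝕜 := ℝ) e₀] with q hq
      obtain ⟨e', he'⟩ := hq
      exact ⟨e', he'⟩
    exact (continuousAt_snd (p := (a₀, L₀))).eventually h1
  obtain ⟨r, hr, hball⟩ := Metric.eventually_nhds_iff_ball.1
    ((Filter.eventually_of_mem ht fun p hp => hp).and (hbd.and (hap.and hiv)))
  have hm : ∀ (a : F) (L : E →L[ℝ] F), ‖a - a₀‖ < r → ‖L - L₀‖ < r →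
      (a, L) ∈ Metric.ball (a₀, L₀) r := by
    intro a D h1 h2
    rw [Metric.mem_ball, dist_eq_norm]
    exact max_lt h1 h2
  have hK0 : (0 : ℝ) ≤ K := K.2
  refine ⟨r, K + (‖P (a₀, L₀)‖ + 1), hr, by positivity, fun a L h1 h2 => ?_⟩
  obtain ⟨hp1, hp2, hp3, hp4⟩ := hball _ (hm a L h1 h2)
  refine ⟨hp4, hp3, ?_, ?_, fun a' L' h1' h2' => ?_⟩
  · exact ((norm_fst_le (P (a, L))).trans hp2.le).trans (by linarith)
  · exact ((norm_snd_le (P (a, L))).trans hp2.le).trans (by linarith)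
  · have hl : ‖P (a, L) - P (a', L')‖ ≤
        (K + (‖P (a₀, L₀)‖ + 1)) * (‖a - a'‖ + ‖L - L'‖) := by
      have := hK.dist_le_mul _ hp1 _ (hball _ (hm a' L' h1' h2')).1
      rw [dist_eq_norm, dist_eq_norm] at this
      refine this.trans ?_
      gcongr
      · linarith [norm_nonneg (P (a₀, L₀))]
      · exact max_le (le_add_of_nonneg_right (norm_nonneg _))
          (le_add_of_nonneg_left (norm_nonneg _))
    exact ⟨(norm_fst_le (P (a, L) - P (a', L'))).trans hl,
      (norm_snd_le (P (a, L) - P (a', L'))).trans hl⟩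

/-- Local boundedness and Lipschitz dependence of Hamiltonian fields on the contact form. -/
lemma IsContactPair.exists_bounds [FiniteDimensional ℝ W] {a₀ : W →L[ℝ] ℝ}
    {D₀ : W →L[ℝ] W →L[ℝ] ℝ} (h₀ : IsContactPair a₀ D₀) :
    ∃ r K : ℝ, 0 < r ∧ 0 < K ∧ ∀ (a : W →L[ℝ] ℝ) (D : W →L[ℝ] W →L[ℝ] ℝ), ‖a - a₀‖ < r →
      ‖contactMap a D - contactMap a₀ D₀‖ < r → IsContactPair a D ∧
      (∀ h e, ‖hamField a (contactMap a D).inverse h e‖ ≤ K * (|h| + ‖e‖)) ∧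
      ∀ (a' : W →L[ℝ] ℝ) (D' : W →L[ℝ] W →L[ℝ] ℝ), ‖a' - a₀‖ < r →
        ‖contactMap a' D' - contactMap a₀ D₀‖ < r → ∀ h e,
        ‖hamField a (contactMap a D).inverse h e - hamField a' (contactMap a' D').inverse h e‖ ≤
          K * (‖a - a'‖ + ‖contactMap a D - contactMap a' D'‖) * (|h| + ‖e‖) := by
  have : CompleteSpace W := FiniteDimensional.complete ℝ W
  set L₀ := contactMap a₀ D₀ with hL₀
  -- The preimage `R` of `a` satisfies `a₀(R) > 1/2` and `‖R‖ ≤ B`. With `‖a - a₀‖ < 1/(4B)` this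
  -- leaves `a(R) > 1/4`, so that `isContactPair_of_ne` applies.
  obtain ⟨r, B, hr, hB, hball⟩ := exists_inverse_bounds (a₀ := a₀) h₀.invertible
    (U := {R | 1 / 2 < a₀ R}) (by
      have : ContinuousAt a₀ (L₀.inverse a₀) := a₀.continuous.continuousAt
      refine this.eventually (lt_mem_nhds ?_)
      rw [h₀.apply_reeb]; norm_num)
  refine ⟨min r (1 / (4 * B)), B * B + B + 2 * (B * B) + B, by positivity, by positivity,
    fun a D h1 h2 => ?_⟩
  have h1' := h1.trans_le (min_le_right _ _)
  have h1 := h1.trans_le (min_le_left _ _)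
  have h2 := h2.trans_le (min_le_left _ _)
  obtain ⟨hp4, hp3, hM, hR, hlip⟩ := hball _ _ h1 h2
  have hp3 : a ((contactMap a D).inverse a) ≠ 0 := by
    have h3 := (a - a₀).le_opNorm ((contactMap a D).inverse a)
    rw [lt_div_iff₀ (by positivity)] at h1'
    have h4 : ‖a - a₀‖ * ‖(contactMap a D).inverse a‖ ≤ ‖a - a₀‖ * B := by gcongr
    rw [Real.norm_eq_abs, sub_apply] at h3
    have h5 := (abs_le.1 h3).1
    have hp3 : 1 / 2 < a₀ ((contactMap a D).inverse a) := hp3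
    intro h6
    rw [h6] at h5
    linarith
  refine ⟨isContactPair_of_ne hp4 hp3, fun h e => ?_, fun a' D' h1' h2' h e => ?_⟩
  · have h3 : |e ((contactMap a D).inverse a)| ≤ ‖e‖ * B :=
      (e.le_opNorm _).trans (by gcongr)
    have h4 : ‖(contactMap a D).inverse e‖ ≤ B * ‖e‖ :=
      ((contactMap a D).inverse.le_opNorm _).trans (by gcongr)
    rw [hamField]
    calc _ ≤ ‖(h + e ((contactMap a D).inverse a)) • (contactMap a D).inverse a‖ +
          ‖(contactMap a D).inverse e‖ := norm_sub_le _ _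
      _ ≤ (|h| + ‖e‖ * B) * B + B * ‖e‖ := by
        rw [norm_smul, Real.norm_eq_abs]
        gcongr
        exact (abs_add_le _ _).trans (by gcongr)
      _ ≤ _ := by
        have := abs_nonneg h
        have := norm_nonneg e
        nlinarith [mul_nonneg (abs_nonneg h) (by positivity : 0 ≤ B * B),
          mul_nonneg (abs_nonneg h) (by positivity : 0 ≤ B * B + B),
          mul_nonneg (norm_nonneg e) (by positivity : 0 ≤ B * B + B)]
  · have h1' := h1'.trans_le (min_le_left _ _)
    have h2' := h2'.trans_le (min_le_left _ _)
    have hR' : ‖(contactMap a' D').inverse a'‖ ≤ B := (hball _ _ h1' h2').2.2.2.1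
    obtain ⟨hdM, hdR⟩ := hlip _ _ h1' h2'
    set δ := ‖a - a'‖ + ‖contactMap a D - contactMap a' D'‖ with hδ
    set M := (contactMap a D).inverse
    set M' := (contactMap a' D').inverse
    have key : hamField a M h e - hamField a' M' h e =
        (h + e (M a)) • (M a - M' a') + (e (M a - M' a')) • M' a' - (M - M') e := by
      simp only [hamField, map_sub, sub_apply]
      module
    have hδ0 : 0 ≤ δ := by positivity
    rw [key]
    calc _ ≤ ‖(h + e (M a)) • (M a - M' a')‖ + ‖(e (M a - M' a')) • M' a'‖ + ‖(M - M') e‖ :=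
        (norm_sub_le _ _).trans (add_le_add_left (norm_add_le _ _) _)
      _ ≤ (|h| + ‖e‖ * B) * (B * δ) + (‖e‖ * (B * δ)) * B + (B * δ) * ‖e‖ := by
        rw [norm_smul, norm_smul, Real.norm_eq_abs]
        gcongr
        · exact (abs_add_le _ _).trans (by gcongr; exact (e.le_opNorm _).trans (by gcongr))
        · exact (e.le_opNorm _).trans (by gcongr)
        · exact ((M - M').le_opNorm _).trans (by gcongr)
      _ ≤ _ := by
        have e1 : 0 ≤ |h| * δ := by positivity
        have e2 : 0 ≤ ‖e‖ * δ := by positivity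
        have : (B * B + B + 2 * (B * B) + B) * δ * (|h| + ‖e‖) -
          ((|h| + ‖e‖ * B) * (B * δ) + (‖e‖ * (B * δ)) * B + (B * δ) * ‖e‖) =
          (B * B + B) * (|h| * δ + ‖e‖ * δ) + 2 * (B * B) * (|h| * δ) := by ring
        have : 0 ≤ (B * B + B) * (|h| * δ + ‖e‖ * δ) + 2 * (B * B) * (|h| * δ) := by positivity
        linarith

end Estimates

/-! ### Making the contact form standard. -/

section FormMove

variable {W : Type*} [NormedAddCommGroup W] [NormedSpace ℝ W]

/-- The form `a + s b` has a cutoff `s` with differential `e`, so its derivative contains `e ⊗ b + s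
Db`. Because `B` is symmetric, only `Db - B = O(p)` matters after antisymmetrising; and `b = O(p)`
turns `e ⊗ b` into a multiple of `‖e‖ p`, which is small for a slowly varying cutoff. -/
lemma norm_contactMap_sub_le {a b : W →L[ℝ] ℝ} {D Db B : W →L[ℝ] W →L[ℝ] ℝ} {e : W →L[ℝ] ℝ}
    (hB : ∀ u v, B u v = B v u) {s K p q A : ℝ} (hs : s ∈ Icc (0 : ℝ) 1) (hp : 0 ≤ p) (hp1 : p ≤ 1)
    (hK : 0 ≤ K) (hb : ‖b‖ ≤ K * p) (hDb : ‖Db - B‖ ≤ K * p) (he : ‖e‖ * p ≤ q) (ha : ‖a‖ ≤ A) :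
    ‖contactMap (a + s • b) (D + (e.smulRight b + s • Db)) - contactMap a D‖ ≤
      (K * (2 * A + K) + 4 * K) * (p + q) := by
  have hA : 0 ≤ A := (norm_nonneg a).trans ha
  have hq : 0 ≤ q := le_trans (by positivity) he
  refine ContinuousLinearMap.opNorm_le_bound₂ _ (by positivity) fun u v => ?_
  have e1 : (contactMap (a + s • b) (D + (e.smulRight b + s • Db)) - contactMap a D) u v =
      s * (b u * a v + a u * b v + s * (b u * b v)) + (e u * b v - e v * b u) +
        s * ((Db - B) u v - (Db - B) v u) := by
    simp only [sub_apply, contactMap_apply, add_apply,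
      smul_apply, ContinuousLinearMap.smulRight_apply, smul_eq_mul]
    rw [hB v u]
    ring
  have n1 : ∀ (g : W →L[ℝ] ℝ) (k : ℝ), ‖g‖ ≤ k → ∀ x, |g x| ≤ k * ‖x‖ := fun g k hk x =>
    (g.le_opNorm x).trans (by gcongr)
  have n2 : ∀ x y, |(Db - B) x y| ≤ K * p * ‖x‖ * ‖y‖ := fun x y =>
    ((Db - B).le_opNorm₂ x y).trans (by gcongr)
  have n3 := n1 b _ hb
  have n4 := n1 a _ ha
  have n5 := n1 e _ le_rfl
  have hs1 : |s| ≤ 1 := by rw [abs_of_nonneg hs.1]; exact hs.2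
  rw [e1, Real.norm_eq_abs]
  have t1 : |b u * a v + a u * b v + s * (b u * b v)| ≤ K * p * (2 * A + K) * (‖u‖ * ‖v‖) := by
    calc _ ≤ |b u| * |a v| + |a u| * |b v| + |s| * (|b u| * |b v|) := by
          rw [← abs_mul, ← abs_mul, ← abs_mul, ← abs_mul]
          exact (abs_add_le _ _).trans (by gcongr; exact abs_add_le _ _)
      _ ≤ (K * p * ‖u‖) * (A * ‖v‖) + (A * ‖u‖) * (K * p * ‖v‖) +
          1 * ((K * p * ‖u‖) * (K * 1 * ‖v‖)) := by
          gcongr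
          · exact n3 _
          · exact n4 _
          · exact n4 _
          · exact n3 _
          · exact n3 _
          · exact (n3 _).trans (by gcongr)
      _ = _ := by ring
  have t2 : |e u * b v - e v * b u| ≤ 2 * K * q * (‖u‖ * ‖v‖) := by
    calc _ ≤ |e u| * |b v| + |e v| * |b u| := by
          rw [← abs_mul, ← abs_mul]; exact abs_sub _ _
      _ ≤ (‖e‖ * ‖u‖) * (K * p * ‖v‖) + (‖e‖ * ‖v‖) * (K * p * ‖u‖) := by
          gcongr
          · exact n5 _
          · exact n3 _
          · exact n5 _
          · exact n3 _
      _ = 2 * K * (‖e‖ * p) * (‖u‖ * ‖v‖) := by ring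
      _ ≤ _ := by gcongr
  have t3 : |(Db - B) u v - (Db - B) v u| ≤ 2 * K * p * (‖u‖ * ‖v‖) := by
    calc _ ≤ |(Db - B) u v| + |(Db - B) v u| := abs_sub _ _
      _ ≤ K * p * ‖u‖ * ‖v‖ + K * p * ‖v‖ * ‖u‖ := add_le_add (n2 _ _) (n2 _ _)
      _ = _ := by ring
  calc _ ≤ |s| * |b u * a v + a u * b v + s * (b u * b v)| + |e u * b v - e v * b u| +
        |s| * |(Db - B) u v - (Db - B) v u| := by
        rw [← abs_mul, ← abs_mul]
        exact (abs_add_le _ _).trans (by gcongr; exact abs_add_le _ _)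
    _ ≤ 1 * (K * p * (2 * A + K) * (‖u‖ * ‖v‖)) + 2 * K * q * (‖u‖ * ‖v‖) +
        1 * (2 * K * p * (‖u‖ * ‖v‖)) := by gcongr
    _ ≤ _ := by
        have h1 : 0 ≤ ‖u‖ * ‖v‖ := by positivity
        have : 0 ≤ K * (2 * A + K) * q * (‖u‖ * ‖v‖) := by positivity
        have : 0 ≤ 2 * K * p * (‖u‖ * ‖v‖) := by positivity
        have : 0 ≤ 2 * K * q * (‖u‖ * ‖v‖) := by positivity
        nlinarith

lemma contDiffAt_inverse_of_isInvertible {P E F : Type*} [NormedAddCommGroup P] [NormedSpace ℝ P]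
    [NormedAddCommGroup E] [NormedSpace ℝ E] [CompleteSpace E] [NormedAddCommGroup F]
    [NormedSpace ℝ F] {D : P → E →L[ℝ] F} {p : P} (h : (D p).IsInvertible)
    (hD : ContDiffAt ℝ ∞ D p) : ContDiffAt ℝ ∞ (fun p => (D p).inverse) p := by
  obtain ⟨L, hL⟩ := h
  have c4 := contDiffAt_map_inverse (n := ∞) (𝕜 := ℝ) L
  rw [hL] at c4
  exact c4.comp p hD

lemma add_smulRight_of_zero {E F : Type*} [NormedAddCommGroup E] [NormedSpace ℝ E]
    [NormedAddCommGroup F] [NormedSpace ℝ F] (x y : E →L[ℝ] F) {e : E →L[ℝ] ℝ} (he : e = 0)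
    {s : ℝ} (hs : s = 0) (b : F) : x + (e.smulRight b + s • y) = x := by
  ext v
  simp [he, hs]

lemma contDiffAt_contactMap {P : Type*} [NormedAddCommGroup P] [NormedSpace ℝ P]
    {a : P → W →L[ℝ] ℝ} {D : P → W →L[ℝ] W →L[ℝ] ℝ} {p : P} (ha : ContDiffAt ℝ ∞ a p)
    (hD : ContDiffAt ℝ ∞ D p) : ContDiffAt ℝ ∞ (fun p => contactMap (a p) (D p)) p :=
  contDiff_contactMap.contDiffAt.comp p (ha.prodMk hD)

lemma contDiffAt_add_smulRight {P E F : Type*} [NormedAddCommGroup P] [NormedSpace ℝ P]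
    [NormedAddCommGroup E] [NormedSpace ℝ E] [NormedAddCommGroup F] [NormedSpace ℝ F]
    {x y : P → E →L[ℝ] F} {e : P → E →L[ℝ] ℝ} {s : P → ℝ} {b : P → F} {p : P}
    (hx : ContDiffAt ℝ ∞ x p) (hy : ContDiffAt ℝ ∞ y p) (he : ContDiffAt ℝ ∞ e p)
    (hs : ContDiffAt ℝ ∞ s p) (hb : ContDiffAt ℝ ∞ b p) :
    ContDiffAt ℝ ∞ (fun p => x p + ((e p).smulRight (b p) + s p • y p)) p :=
  hx.add ((he.smulRight hb).add (hs.smul hy))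

lemma contDiffAt_hamField {P : Type*} [NormedAddCommGroup P] [NormedSpace ℝ P]
    {a : P → W →L[ℝ] ℝ} {M : P → (W →L[ℝ] ℝ) →L[ℝ] W} {h : P → ℝ} {e : P → W →L[ℝ] ℝ} {p : P}
    (ha : ContDiffAt ℝ ∞ a p) (hM : ContDiffAt ℝ ∞ M p) (hh : ContDiffAt ℝ ∞ h p)
    (he : ContDiffAt ℝ ∞ e p) :
    ContDiffAt ℝ ∞ (fun p => hamField (a p) (M p) (h p) (e p)) p := by
  have hR : ContDiffAt ℝ ∞ (fun p => M p (a p)) p := hM.clm_apply ha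
  exact ((hh.add (he.clm_apply hR)).smul hR).sub (hM.clm_apply he)

/-- The differential of `w ↦ a w + c w • b w`. -/
lemma hasFDerivAt_add_smul {F : Type*} [NormedAddCommGroup F] [NormedSpace ℝ F] {a b : W → F}
    {c : W → ℝ} {w : W} {a' b' : W →L[ℝ] F} {c' : W →L[ℝ] ℝ} (ha : HasFDerivAt a a' w)
    (hb : HasFDerivAt b b' w) (hc : HasFDerivAt c c' w) :
    HasFDerivAt (fun w => a w + c w • b w) (a' + (c'.smulRight (b w) + c w • b')) w := by
  refine (ha.add (hc.smul hb)).congr_fderiv ?_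
  rw [add_comm (c w • b')]

lemma IsContactPair.hamField_sub_smul {a : W →L[ℝ] ℝ} {D : W →L[ℝ] W →L[ℝ] ℝ}
    (h : IsContactPair a D) (r s : ℝ) (e : W →L[ℝ] ℝ) :
    hamField a (contactMap a D).inverse r (e - s • a) =
      hamField a (contactMap a D).inverse r e := by
  have e1 : e - s • a = e + (-s) • a := by module
  rw [e1]
  exact h.hamField_add_smul r (-s) e

/-- Comparison of the Hamiltonian fields of two nearby contact forms. -/
lemma norm_hamField_sub_le {a b bl e dh : W →L[ℝ] ℝ} {D Ds : W →L[ℝ] W →L[ℝ] ℝ}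
    {s p m h β Kb C E k₁ k₂ : ℝ} (hs : s ∈ Icc (0 : ℝ) 1) (hp : 0 ≤ p) (hKb : 0 ≤ Kb)
    (hk₂ : 0 ≤ k₂)
    (c1 : IsContactPair a D) (c2 : IsContactPair (a + s • b) Ds)
    (hbd : ∀ h e, ‖hamField (a + s • b) (contactMap (a + s • b) Ds).inverse h e‖ ≤
      Kb * (|h| + ‖e‖))
    (hlip : ∀ h e, ‖hamField (a + s • b) (contactMap (a + s • b) Ds).inverse h e -
      hamField a (contactMap a D).inverse h e‖ ≤ Kb * (C * (p + E)) * (|h| + ‖e‖))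
    (hC : 0 ≤ C) (hE : ‖e‖ * p ≤ E) (hh : |h| + ‖dh - m • a‖ ≤ k₁ * p)
    (hβ : |β| ≤ k₂ * p ^ 2) (hbl : ‖bl - b‖ ≤ k₂ * p ^ 2) :
    ‖hamField (a + s • b) (contactMap (a + s • b) Ds).inverse (h + m * (s * β))
      (dh + m • (s • bl + β • e)) - hamField a (contactMap a D).inverse h dh‖ ≤
      (Kb * C * k₁ + 3 * Kb * |m| * k₂) * (p + E) * p := by
  have hE0 : 0 ≤ E := le_trans (by positivity) hE
  have hsa : |s| ≤ 1 := by rw [abs_of_nonneg hs.1]; exact hs.2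
  -- Multiples of the respective form are removed from both differentials: `m a` here, `m (a + s b)`
  -- in the next equation. What is left of `dh` is `O(p)`, and the correction `m s bl` cancels `m s
  -- b` up to `O(p²)`.
  have e1 : hamField a (contactMap a D).inverse h dh =
      hamField a (contactMap a D).inverse h (dh - m • a) := (c1.hamField_sub_smul _ _ _).symm
  have e2 : hamField (a + s • b) (contactMap (a + s • b) Ds).inverse (h + m * (s * β))
      (dh + m • (s • bl + β • e)) =
      hamField (a + s • b) (contactMap (a + s • b) Ds).inverse h (dh - m • a) +
      hamField (a + s • b) (contactMap (a + s • b) Ds).inverse (m * (s * β))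
        (m • (s • (bl - b) + β • e)) := by
    rw [← c2.hamField_add_smul _ (-m) (dh + _), ← sub_eq_iff_eq_add', hamField_sub]
    congr 1
    · ring
    · module
  have n1 : |m * (s * β)| ≤ |m| * (k₂ * p ^ 2) := by
    rw [abs_mul, abs_mul]
    have : |s| * |β| ≤ 1 * (k₂ * p ^ 2) := mul_le_mul hsa hβ (abs_nonneg _) zero_le_one
    rw [one_mul] at this
    gcongr
  have n2 : ‖m • (s • (bl - b) + β • e)‖ ≤ |m| * (k₂ * p ^ 2 + k₂ * p * E) := by
    rw [norm_smul, Real.norm_eq_abs]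
    have h1 : |s| * ‖bl - b‖ ≤ 1 * (k₂ * p ^ 2) := mul_le_mul hsa hbl (norm_nonneg _) zero_le_one
    have h2 : |β| * ‖e‖ ≤ k₂ * p * E := by
      calc _ ≤ k₂ * p ^ 2 * ‖e‖ := by gcongr
        _ = k₂ * p * (‖e‖ * p) := by ring
        _ ≤ _ := by gcongr
    rw [one_mul] at h1
    gcongr
    refine (norm_add_le _ _).trans ?_
    rw [norm_smul, norm_smul, Real.norm_eq_abs, Real.norm_eq_abs]
    exact add_le_add h1 h2
  rw [e1, e2, add_sub_right_comm]
  calc _ ≤ Kb * (C * (p + E)) * (|h| + ‖dh - m • a‖) +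
        Kb * (|m * (s * β)| + ‖m • (s • (bl - b) + β • e)‖) :=
        (norm_add_le _ _).trans (add_le_add (hlip _ _) (hbd _ _))
    _ ≤ Kb * (C * (p + E)) * (k₁ * p) +
        Kb * (|m| * (k₂ * p ^ 2) + |m| * (k₂ * p ^ 2 + k₂ * p * E)) := by
        gcongr
    _ = (Kb * C * k₁) * (p + E) * p + Kb * |m| * k₂ * p * (2 * p + E) := by ring
    _ ≤ _ := by
        have : 0 ≤ Kb * |m| * k₂ * p * (p + 2 * E) := by positivity
        linarith

variable [FiniteDimensional ℝ W] {V : Set W} {J : Set ℝ} {d : LocalData W}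

set_option maxHeartbeats 1000000 in
/-- The Hamiltonian fields of interpolations between two contact forms which agree to first
order at the origin, up to a closed form. -/
lemma exists_form_estimate (hV : IsOpen V) (h0V : (0 : W) ∈ V) {a b : W → W →L[ℝ] ℝ} {Y : W → W}
    {h β : W → ℝ} {B : W →L[ℝ] W →L[ℝ] ℝ} {m : ℝ}
    (sa : ∀ w ∈ V, ContDiffAt ℝ ∞ a w) (sb : ∀ w ∈ V, ContDiffAt ℝ ∞ b w)
    (sh : ∀ w ∈ V, ContDiffAt ℝ ∞ h w) (hb0 : b 0 = 0) (hB : fderiv ℝ b 0 = B)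
    (hBs : ∀ u v, B u v = B v u) (hh0 : h 0 = 0) (hm : fderiv ℝ h 0 = m • a 0)
    (hβ : ∀ w, β w = 1 / 2 * B w w) (hc0 : IsContactPair (a 0) (fderiv ℝ a 0))
    (hY : ∀ w ∈ V, IsContactPair (a w) (fderiv ℝ a w) →
      Y w = hamField (a w) (contactMap (a w) (fderiv ℝ a w)).inverse (h w) (fderiv ℝ h w)) :
    ∃ K η : ℝ, 0 < K ∧ 0 < η ∧ ∀ᶠ w in 𝓝 (0 : W), w ∈ V ∧
      ∀ s ∈ Icc (0 : ℝ) 1, ∀ (e : W →L[ℝ] ℝ), ‖e‖ * ‖w‖ ≤ η →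
      IsContactPair (a w + s • b w) (fderiv ℝ a w + (e.smulRight (b w) + s • fderiv ℝ b w)) ∧
      ‖hamField (a w + s • b w) (contactMap (a w + s • b w)
          (fderiv ℝ a w + (e.smulRight (b w) + s • fderiv ℝ b w))).inverse
        (h w + m * (s * β w)) (fderiv ℝ h w + m • (s • B w + β w • e)) - Y w‖ ≤
        K * (‖w‖ + ‖e‖ * ‖w‖) * ‖w‖ := by
  have hle1 : ((1 : ℕ∞) : WithTop ℕ∞) ≤ ∞ := by simp
  have hle2 : ((2 : ℕ∞) : WithTop ℕ∞) ≤ ∞ := by exact_mod_cast le_top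
  have sDa : ContDiffAt ℝ ∞ (fderiv ℝ a) 0 := (sa 0 h0V).fderiv_right (by simp)
  have sDb : ContDiffAt ℝ ∞ (fderiv ℝ b) 0 := (sb 0 h0V).fderiv_right (by simp)
  have sDh : ContDiffAt ℝ ∞ (fderiv ℝ h) 0 := (sh 0 h0V).fderiv_right (by simp)
  have sL : ContDiffAt ℝ ∞ (fun w => contactMap (a w) (fderiv ℝ a w)) 0 :=
    contDiff_contactMap.contDiffAt.comp 0 ((sa 0 h0V).prodMk sDa)
  obtain ⟨r, Kb, hr, hKb, hbounds⟩ := hc0.exists_bounds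
  obtain ⟨K1, hK1, e1⟩ := exists_linear_bound (g := fun w => a w - a 0)
    (((sa 0 h0V).sub contDiffAt_const).of_le hle1) (sub_self _)
  obtain ⟨K2, hK2, e2⟩ := exists_linear_bound
    (g := fun w => contactMap (a w) (fderiv ℝ a w) - contactMap (a 0) (fderiv ℝ a 0))
    ((sL.sub contDiffAt_const).of_le hle1) (sub_self _)
  obtain ⟨K3, hK3, e3⟩ := exists_linear_bound (g := b) ((sb 0 h0V).of_le hle1) hb0
  obtain ⟨K4, hK4, e4⟩ := exists_linear_bound (g := fun w => fderiv ℝ b w - B)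
    ((sDb.sub contDiffAt_const).of_le hle1) (by rw [hB, sub_self])
  obtain ⟨K5, hK5, e5⟩ := exists_quadratic_bound (g := fun w => B w - b w)
    ((B.contDiff.contDiffAt.sub (sb 0 h0V)).of_le hle2) (by simp [hb0]) (by
      rw [fderiv_fun_sub B.differentiableAt ((sb 0 h0V).differentiableAt (by simp)), B.fderiv, hB]
      exact sub_self _)
  obtain ⟨K6, hK6, e6⟩ := exists_linear_bound (g := h) ((sh 0 h0V).of_le hle1) hh0
  obtain ⟨K7, hK7, e7⟩ := exists_linear_bound (g := fun w => fderiv ℝ h w - m • a w)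
    ((sDh.sub ((sa 0 h0V).const_smul m)).of_le hle1) (sub_eq_zero.2 hm)
  obtain ⟨A, hA⟩ : ∃ A, A = ‖a 0‖ + K1 := ⟨_, rfl⟩
  obtain ⟨K, hK⟩ : ∃ K, K = K3 + K4 := ⟨_, rfl⟩
  obtain ⟨K', hK'⟩ : ∃ K', K' = K * (2 * A + K) + 4 * K := ⟨_, rfl⟩
  have hK0 : 0 < K := by rw [hK]; positivity
  have hA0 : 0 < A := by rw [hA]; positivity
  have hK'0 : 0 < K' := by rw [hK']; positivity
  -- The radius `r` of the uniform estimates is shared out: the cutoff term `K' ‖e‖ ‖w‖` takes at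
  -- most `r/4`, and the restriction on `‖w‖` below leaves less than another `r/4` for the sum of
  -- the others.
  refine ⟨Kb * (K + K') * (K6 + K7) + 3 * Kb * |m| * (K5 + ‖B‖), r / (4 * K'), by positivity,
    by positivity, ?_⟩
  have hsm : ∀ᶠ w in 𝓝 (0 : W), ‖w‖ < min 1 (r / (4 * (K1 + K2 + K + K'))) := by
    have : Filter.Tendsto (fun w : W => ‖w‖) (𝓝 0) (𝓝 0) := by
      simpa using continuous_norm.tendsto (0 : W)
    exact this.eventually (gt_mem_nhds (by positivity))
  filter_upwards [hV.mem_nhds h0V, e1, e2, e3, e4, e5, e6, e7, hsm]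
    with w hw e1 e2 e3 e4 e5 e6 e7 hsm
  refine ⟨hw, fun s hs e he => ?_⟩
  obtain ⟨p, hp⟩ : ∃ p, p = ‖w‖ := ⟨_, rfl⟩
  rw [← hp] at e1 e2 e3 e4 e5 e6 e7 hsm he ⊢
  have hp0 : 0 ≤ p := hp ▸ norm_nonneg w
  have hp1 : p ≤ 1 := (hsm.trans_le (min_le_left _ _)).le
  have hp2 := hsm.trans_le (min_le_right _ _)
  rw [lt_div_iff₀ (by positivity)] at hp2
  rw [le_div_iff₀ (by positivity)] at he
  have hbK : ‖b w‖ ≤ K * p := e3.trans (by gcongr; linarith)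
  have hDK : ‖fderiv ℝ b w - B‖ ≤ K * p := e4.trans (by gcongr; linarith)
  have haA : ‖a w‖ ≤ A := by
    have h1 : ‖a w‖ ≤ ‖a w - a 0‖ + ‖a 0‖ := norm_le_norm_sub_add _ _
    have h2 : K1 * p ≤ K1 := mul_le_of_le_one_right hK1.le hp1
    linarith
  have hcm := norm_contactMap_sub_le (D := fderiv ℝ a w) hBs hs hp0 hp1 hK0.le hbK hDK
    (e := e) le_rfl haA
  rw [← hK'] at hcm
  obtain ⟨Ds, hDs⟩ : ∃ Ds, Ds = fderiv ℝ a w + (e.smulRight (b w) + s • fderiv ℝ b w) := ⟨_, rfl⟩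
  rw [← hDs] at hcm ⊢
  have has1 : ‖a w + s • b w - a w‖ ≤ K * p := by
    rw [add_sub_cancel_left, norm_smul, Real.norm_of_nonneg hs.1]
    exact (mul_le_mul hs.2 hbK (norm_nonneg _) zero_le_one).trans_eq (one_mul _)
  have q1 : 0 ≤ K1 * p := by positivity
  have q2 : 0 ≤ K2 * p := by positivity
  have q3 : 0 ≤ K * p := by positivity
  have q4 : 0 ≤ K' * p := by positivity
  have hep : 0 ≤ ‖e‖ * p := by positivity
  have g1 : ‖a w - a 0‖ < r := by linarith
  have g2 : ‖contactMap (a w) (fderiv ℝ a w) - contactMap (a 0) (fderiv ℝ a 0)‖ < r := by linarith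
  have g3 : ‖a w + s • b w - a 0‖ < r := by
    have := norm_sub_le_norm_sub_add_norm_sub (a w + s • b w) (a w) (a 0)
    linarith
  have g4 : ‖contactMap (a w + s • b w) Ds - contactMap (a 0) (fderiv ℝ a 0)‖ < r := by
    have h1 := norm_sub_le_norm_sub_add_norm_sub (contactMap (a w + s • b w) Ds)
      (contactMap (a w) (fderiv ℝ a w)) (contactMap (a 0) (fderiv ℝ a 0))
    have h2 : K' * (p + ‖e‖ * p) = K' * p + (‖e‖ * p) * K' := by ring
    linarith
  have c1 := (hbounds _ _ g1 g2).1
  obtain ⟨c2, c3, c4⟩ := hbounds _ _ g3 g4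
  refine ⟨c2, ?_⟩
  rw [hY w hw c1]
  have hβw : |β w| ≤ (K5 + ‖B‖) * p ^ 2 := by
    have h1 := B.le_opNorm₂ w w
    rw [Real.norm_eq_abs, ← hp] at h1
    rw [hβ, abs_mul, abs_of_pos (by norm_num : (0 : ℝ) < 1 / 2)]
    have h2 : 0 ≤ K5 * p ^ 2 := by positivity
    have h3 : ‖B‖ * p * p = ‖B‖ * p ^ 2 := by ring
    linarith [abs_nonneg (B w w)]
  refine norm_hamField_sub_le hs hp0 hKb.le (by positivity) c1 c2 c3
    (fun h e' => ?_) (by positivity) le_rfl ?_ hβw ?_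
  · refine (c4 _ _ g1 g2 h e').trans ?_
    gcongr
    have : 0 ≤ K * (‖e‖ * p) := by positivity
    linarith
  · have : |h w| ≤ K6 * p := e6
    linarith
  · refine e5.trans ?_
    gcongr
    linarith [norm_nonneg B]

/-! ### The interpolated form with its compensated Hamiltonian. -/

section Deformation

variable (a b : W → W →L[ℝ] ℝ) (σ h β : W → ℝ) (B : W →L[ℝ] W →L[ℝ] ℝ) (m t : ℝ) (w : W)

/-- Interpolation of contact forms with a cutoff. -/
def deformForm : W →L[ℝ] ℝ := a w + (t * σ w) • b w

/-- The derivative of the interpolation of contact forms. -/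
def deformFormDeriv : W →L[ℝ] W →L[ℝ] ℝ :=
  fderiv ℝ a w + ((t • fderiv ℝ σ w).smulRight (b w) + (t * σ w) • fderiv ℝ b w)

/-- The Hamiltonian which compensates the deformation of the contact form. -/
def deformHam : ℝ := h w + m * ((t * σ w) * β w)

/-- The derivative of the compensating Hamiltonian. -/
def deformHamDeriv : W →L[ℝ] ℝ :=
  fderiv ℝ h w + m • ((t * σ w) • B w + β w • (t • fderiv ℝ σ w))

/-- The contact field of the compensating Hamiltonian. -/
def deformField : W :=
  hamField (deformForm a b σ t w)
    (contactMap (deformForm a b σ t w) (deformFormDeriv a b σ t w)).inverse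
    (deformHam σ h β m t w) (deformHamDeriv σ h β B m t w)

end Deformation

section Deformation

variable {a b : W → W →L[ℝ] ℝ} {σ h β : W → ℝ} {B : W →L[ℝ] W →L[ℝ] ℝ} {m t : ℝ} {w : W}

omit [FiniteDimensional ℝ W] in
lemma hasFDerivAt_deformForm (sa : ContDiffAt ℝ ∞ a w) (sb : ContDiffAt ℝ ∞ b w)
    (sσ : ContDiff ℝ ∞ σ) : HasFDerivAt (deformForm a b σ t) (deformFormDeriv a b σ t w) w :=
  hasFDerivAt_add_smul (sa.differentiableAt (by simp)).hasFDerivAt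
    (sb.differentiableAt (by simp)).hasFDerivAt
    ((sσ.differentiable (by simp) w).hasFDerivAt.const_mul t)

omit [FiniteDimensional ℝ W] in
lemma hasFDerivAt_deformHam (sh : ContDiffAt ℝ ∞ h w) (dβ : HasFDerivAt β (B w) w)
    (sσ : ContDiff ℝ ∞ σ) : HasFDerivAt (deformHam σ h β m t) (deformHamDeriv σ h β B m t w) w :=
  (sh.differentiableAt (by simp)).hasFDerivAt.add
    ((((sσ.differentiable (by simp) w).hasFDerivAt.const_mul t).mul dβ).const_mul m)

omit [FiniteDimensional ℝ W] in
lemma deform_of_cutoff_zero (h1 : t * σ w = 0) (h2 : t • fderiv ℝ σ w = 0)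
    {Y : W} (hY : Y = hamField (a w) (contactMap (a w) (fderiv ℝ a w)).inverse (h w)
      (fderiv ℝ h w)) :
    deformForm a b σ t w = a w ∧ deformField a b σ h β B m t w = Y := by
  have e1 : deformForm a b σ t w = a w := by rw [deformForm, h1, zero_smul, add_zero]
  have e2 : deformFormDeriv a b σ t w = fderiv ℝ a w := by
    exact add_smulRight_of_zero _ _ h2 h1 _
  have e3 : deformHam σ h β m t w = h w := by
    rw [deformHam, h1, zero_mul, mul_zero, add_zero]
  have e4 : deformHamDeriv σ h β B m t w = fderiv ℝ h w := by
    rw [deformHamDeriv, h1, h2, zero_smul, smul_zero, add_zero, smul_zero, add_zero]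
  exact ⟨e1, by rw [deformField, e1, e2, e3, e4, hY]⟩

set_option maxHeartbeats 800000 in
lemma contDiffAt_deform (sa : ContDiffAt ℝ ∞ a w) (sb : ContDiffAt ℝ ∞ b w)
    (sh : ContDiffAt ℝ ∞ h w) (sβ : ContDiff ℝ ∞ β) (sσ : ContDiff ℝ ∞ σ)
    (hL : (contactMap (deformForm a b σ t w) (deformFormDeriv a b σ t w)).IsInvertible) :
    ContDiffAt ℝ ∞ (fun p : ℝ × W => deformForm a b σ p.1 p.2) (t, w) ∧
      ContDiffAt ℝ ∞ (fun p : ℝ × W => deformField a b σ h β B m p.1 p.2) (t, w) := by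
  have : CompleteSpace W := FiniteDimensional.complete ℝ W
  have sσ' : ContDiff ℝ ∞ (fderiv ℝ σ) := sσ.fderiv_right (by simp)
  have sDa : ContDiffAt ℝ ∞ (fderiv ℝ a) w := sa.fderiv_right (by simp)
  have sDb : ContDiffAt ℝ ∞ (fderiv ℝ b) w := sb.fderiv_right (by simp)
  have sDh : ContDiffAt ℝ ∞ (fderiv ℝ h) w := sh.fderiv_right (by simp)
  have c1 : ContDiffAt ℝ ∞ (fun p : ℝ × W => p.1 * σ p.2) (t, w) :=
    contDiffAt_fst.mul (sσ.contDiffAt.comp (t, w) contDiffAt_snd)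
  have c2 : ContDiffAt ℝ ∞ (fun p : ℝ × W => p.1 • fderiv ℝ σ p.2) (t, w) :=
    contDiffAt_fst.smul (sσ'.contDiffAt.comp (t, w) contDiffAt_snd)
  have ca : ContDiffAt ℝ ∞ (fun p : ℝ × W => deformForm a b σ p.1 p.2) (t, w) :=
    (sa.comp (t, w) contDiffAt_snd).add (c1.smul (sb.comp (t, w) contDiffAt_snd))
  have cD : ContDiffAt ℝ ∞ (fun p : ℝ × W => deformFormDeriv a b σ p.1 p.2) (t, w) :=
    contDiffAt_add_smulRight (sDa.comp (t, w) contDiffAt_snd) (sDb.comp (t, w) contDiffAt_snd) c2 c1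
      (sb.comp (t, w) contDiffAt_snd)
  have cβ : ContDiffAt ℝ ∞ (fun p : ℝ × W => β p.2) (t, w) :=
    sβ.contDiffAt.comp (t, w) contDiffAt_snd
  have cB : ContDiffAt ℝ ∞ (fun p : ℝ × W => B p.2) (t, w) :=
    B.contDiff.contDiffAt.comp (t, w) contDiffAt_snd
  have ch : ContDiffAt ℝ ∞ (fun p : ℝ × W => deformHam σ h β m p.1 p.2) (t, w) :=
    (sh.comp (t, w) contDiffAt_snd).add (contDiffAt_const.mul (c1.mul cβ))
  have ce : ContDiffAt ℝ ∞ (fun p : ℝ × W => deformHamDeriv σ h β B m p.1 p.2) (t, w) :=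
    (sDh.comp (t, w) contDiffAt_snd).add (((c1.smul cB).add (cβ.smul c2)).const_smul m)
  have cM : ContDiffAt ℝ ∞ (fun p : ℝ × W =>
      (contactMap (deformForm a b σ p.1 p.2) (deformFormDeriv a b σ p.1 p.2)).inverse) (t, w) := by
    obtain ⟨L, hL⟩ := hL
    exact contDiffAt_inverse_of_isInvertible ⟨L, hL⟩ (contDiffAt_contactMap ca cD)
  exact ⟨ca, contDiffAt_hamField ca cM ch ce⟩

end Deformation

/-- Normalisation of the contact form near the critical point, keeping the function and the
linear part of the field. -/
theorem LocalData.Valid.exists_move_form (hV : IsOpen V) (h0V : (0 : W) ∈ V) (hd : d.Valid V J)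
    {a₀ : W → W →L[ℝ] ℝ} (ha₀ : ContDiff ℝ ∞ a₀) (h00 : a₀ 0 = (d 0).1)
    (hD₀ : ∀ u v, fderiv ℝ a₀ 0 u v - fderiv ℝ a₀ 0 v u =
      fderiv ℝ (fun w => (d w).1) 0 u v - fderiv ℝ (fun w => (d w).1) 0 v u) :
    ∃ d' : LocalData W, LocalData.Move V J d d' ∧
      (∀ᶠ w in 𝓝 0, (d' w).1 = a₀ w ∧ (d' w).2.2 = (d w).2.2) ∧
      ∃ K : ℝ, ∀ᶠ w in 𝓝 0, ‖(d' w).2.1 - (d w).2.1‖ ≤ K * ‖w‖ ^ 2 := by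
  obtain ⟨a, ha⟩ : ∃ a : W → W →L[ℝ] ℝ, a = fun w => (d w).1 := ⟨_, rfl⟩
  obtain ⟨Y, hY⟩ : ∃ Y : W → W, Y = fun w => (d w).2.1 := ⟨_, rfl⟩
  obtain ⟨f, hf⟩ : ∃ f : W → ℝ, f = fun w => (d w).2.2 := ⟨_, rfl⟩
  have haw : ∀ w, (d w).1 = a w := fun w => by rw [ha]
  have hYw : ∀ w, (d w).2.1 = Y w := fun w => by rw [hY]
  have hfw : ∀ w, (d w).2.2 = f w := fun w => by rw [hf]
  have sa : ∀ w ∈ V, ContDiffAt ℝ ∞ a w := fun w hw => ha ▸ (hd.smooth w hw).fst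
  have sY : ∀ w ∈ V, ContDiffAt ℝ ∞ Y w := fun w hw => hY ▸ (hd.smooth w hw).snd.fst
  have sf : ∀ w ∈ V, ContDiffAt ℝ ∞ f w := fun w hw => hf ▸ (hd.smooth w hw).snd.snd
  have hform := hd.form
  have hfield := hd.field
  have hcrit := hd.critical
  have hzero := hd.zero
  obtain ⟨c, hc, hgr⟩ := hd.growth
  simp only [haw, hYw, hfw] at hform hfield hcrit hzero hgr hD₀ h00
  obtain ⟨b, hb⟩ : ∃ b : W → W →L[ℝ] ℝ, b = fun w => a₀ w - a w := ⟨_, rfl⟩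
  have sb : ∀ w ∈ V, ContDiffAt ℝ ∞ b w := fun w hw => hb ▸ ha₀.contDiffAt.sub (sa w hw)
  have hb0 : b 0 = 0 := by rw [hb]; exact sub_eq_zero.2 h00
  obtain ⟨B, hB⟩ : ∃ B : W →L[ℝ] W →L[ℝ] ℝ, fderiv ℝ b 0 = B := ⟨_, rfl⟩
  have hBs : ∀ u v, B u v = B v u := fun u v => by
    have e : B = fderiv ℝ a₀ 0 - fderiv ℝ a 0 := by
      rw [← hB, hb]
      exact fderiv_sub (ha₀.contDiffAt.differentiableAt (by simp))
        ((sa 0 h0V).differentiableAt (by simp))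
    have := hD₀ u v
    rw [e]
    simp only [sub_apply]
    linarith
  obtain ⟨h, hh⟩ : ∃ h : W → ℝ, h = fun w => a w (Y w) := ⟨_, rfl⟩
  have sh : ∀ w ∈ V, ContDiffAt ℝ ∞ h w := fun w hw => hh ▸ (sa w hw).clm_apply (sY w hw)
  have hh0 : h 0 = 0 := by simp only [hh, hzero, map_zero]
  obtain ⟨m, hm⟩ : ∃ m : ℝ, fderiv ℝ h 0 = m • a 0 := by
    have := hfield 0 h0V
    rw [contactFieldAt_model] at this
    obtain ⟨m, hm⟩ := this
    refine ⟨m, ?_⟩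
    ext v
    have h1 := hm v
    rw [hzero] at h1
    simp only [map_zero, zero_apply, sub_zero, add_zero] at h1
    rw [hh]
    exact h1
  -- The exterior derivatives agree at the origin, so the derivative `B` of `b` is symmetric and `b`
  -- has the same 1-jet as `dβ`. Since `dh = m a` at the origin, adding `m t σ β` to the Hamiltonian
  -- compensates the change `t σ b` of the form to first order, and the field keeps its linear part.
  obtain ⟨β, hβ⟩ : ∃ β : W → ℝ, β = fun w => 1 / 2 * B w w := ⟨_, rfl⟩
  have sβ : ContDiff ℝ ∞ β := hβ ▸ contDiff_const.mul (B.contDiff.clm_apply contDiff_id)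
  have dβ : ∀ w, HasFDerivAt β (B w) w := fun w => by
    have h1 := (B.hasFDerivAt (x := w)).clm_apply (hasFDerivAt_id (𝕜 := ℝ) w)
    rw [hβ]
    refine (h1.const_mul (1 / 2)).congr_fderiv ?_
    ext v
    simp only [smul_apply, add_apply,
      ContinuousLinearMap.flip_apply, smul_eq_mul, ContinuousLinearMap.comp_apply,
      ContinuousLinearMap.id_apply, id, hBs v w]
    ring
  have hham : ∀ w ∈ V, IsContactPair (a w) (fderiv ℝ a w) →
      Y w = hamField (a w) (contactMap (a w) (fderiv ℝ a w)).inverse (h w) (fderiv ℝ h w) :=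
    fun w hw hc => hh ▸ (hfield w hw).eq_hamField hc
  obtain ⟨K, η, hK, hη, est⟩ := exists_form_estimate (β := β) hV h0V sa sb sh hb0 hB hBs hh0 hm
    (fun w => by rw [hβ]) (isContactPair_of_contactFormAt (hform 0 h0V)) hham
  obtain ⟨Kf, hKf, ef⟩ := exists_linear_bound (g := fderiv ℝ f)
    (((sf 0 h0V).fderiv_right (m := ∞) (by simp)).of_le (by simp)) hcrit
  obtain ⟨ρ₀, hρ₀, hest⟩ := Metric.eventually_nhds_iff_ball.1 (est.and (ef.and hgr))
  -- Both `‖w‖` and `‖w‖ ‖dσ‖` are bounded by `c / (4 Kf K)`. The change of `df(Y)` is then at most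
  -- `Kf ‖w‖ · K · c/(2 Kf K) · ‖w‖`, which is half of the growth `c ‖w‖²`.
  obtain ⟨ρ, hρ⟩ : ∃ ρ, ρ = min ρ₀ (c / (4 * Kf * K)) := ⟨_, rfl⟩
  have hρ0 : 0 < ρ := by rw [hρ]; positivity
  have hest := fun w (hw : w ∈ Metric.ball (0 : W) ρ) =>
    hest w (Metric.ball_subset_ball (by rw [hρ]; exact min_le_left _ _) hw)
  have hbV : Metric.ball (0 : W) ρ ⊆ V := fun w hw => (hest w hw).1.1
  obtain ⟨σ, sσ, hσ01, hσ1, hσ0, hση⟩ := exists_cutoff (E := W) (ρ := ρ / 2)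
    (η := min η (c / (4 * Kf * K))) (by positivity) (by positivity)
  have hne : ∀ t ∈ Icc (0 : ℝ) 1, ∀ w, ‖t • fderiv ℝ σ w‖ * ‖w‖ ≤ min η (c / (4 * Kf * K)) :=
    fun t ht w => by
      refine le_trans ?_ (hση w)
      rw [norm_smul, Real.norm_of_nonneg ht.1, mul_comm ‖w‖]
      gcongr
      exact mul_le_of_le_one_left (norm_nonneg _) ht.2
  have hest' : ∀ t ∈ Icc (0 : ℝ) 1, ∀ w ∈ Metric.ball (0 : W) ρ,
      IsContactPair (deformForm a b σ t w) (deformFormDeriv a b σ t w) ∧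
        ‖deformField a b σ h β B m t w - Y w‖ ≤
          K * (‖w‖ + ‖t • fderiv ℝ σ w‖ * ‖w‖) * ‖w‖ := fun t ht w hw =>
    (hest w hw).1.2 _ ⟨mul_nonneg ht.1 (hσ01 w).1, mul_le_one₀ ht.2 (hσ01 w).1 (hσ01 w).2⟩ _
      ((hne t ht w).trans (min_le_left _ _))
  have hreg : ∀ t ∈ Icc (0 : ℝ) 1, ∀ w ∈ Metric.ball (0 : W) ρ,
      c / 2 * ‖w‖ ^ 2 ≤ fderiv ℝ f w (deformField a b σ h β B m t w) := fun t ht w hw => by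
    obtain ⟨-, h2, h3⟩ := hest w hw
    obtain ⟨-, h4⟩ := hest' t ht w hw
    have h5 := (fderiv ℝ f w).le_opNorm (deformField a b σ h β B m t w - Y w)
    rw [Real.norm_eq_abs, map_sub] at h5
    have h6 := (abs_le.1 h5).1
    have h7 : ‖w‖ ≤ c / (4 * Kf * K) := by
      rw [mem_ball_zero_iff, hρ] at hw
      exact (hw.trans_le (min_le_right _ _)).le
    have h8 := (hne t ht w).trans (min_le_right _ _)
    have h9 : ‖fderiv ℝ f w‖ * ‖deformField a b σ h β B m t w - Y w‖ ≤ c / 2 * ‖w‖ ^ 2 := by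
      calc _ ≤ (Kf * ‖w‖) * (K * (c / (4 * Kf * K) + c / (4 * Kf * K)) * ‖w‖) :=
            mul_le_mul h2 (h4.trans (by gcongr)) (norm_nonneg _) (by positivity)
        _ = _ := by field_simp; ring
    linarith
  have hball : ∀ w ∈ Metric.ball (0 : W) ρ, ∀ᶠ y in 𝓝 w, y ∈ Metric.ball (0 : W) ρ :=
    fun w hw => Metric.isOpen_ball.mem_nhds hw
  have hfar : ∀ w, ρ / 2 < ‖w‖ → fderiv ℝ σ w = 0 := fun w hw => by
    have : σ =ᶠ[𝓝 w] fun _ => 0 := by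
      filter_upwards [continuous_norm.continuousAt.eventually (lt_mem_nhds hw)] with y hy
      exact hσ0 y hy.le
    rw [this.fderiv_eq, fderiv_const_apply]
  have hoff : ∀ t, ∀ w ∈ V, t * σ w = 0 → t • fderiv ℝ σ w = 0 →
      (deformForm a b σ t w, deformField a b σ h β B m t w, f w) = d w := by
    intro t w hw h1 h2
    obtain ⟨e1, e2⟩ := deform_of_cutoff_zero (a := a) (b := b) (β := β) (B := B) (m := m) h1 h2
      (hham w hw (isContactPair_of_contactFormAt (hform w hw)))
    rw [e1, e2, ha, hY, hf]
  refine ⟨_, LocalData.move_of_family (ρ' := 3 / 4 * ρ) (ρ := ρ) hV hd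
    (fun t w => (deformForm a b σ t w, deformField a b σ h β B m t w, f w))
    (by linarith) hbV ?_ ?_ ?_ ?_ ?_ ?_ ?_
    (fun _ _ => hcrit) ?_ (fun t ht w hw => hf ▸ hd.mem w (hbV hw)), ?_, ?_⟩
  · exact fun w hw => hoff 0 w hw (zero_mul _) (zero_smul _ _)
  · exact fun t w hw hwρ => hoff t w hw (by rw [hσ0 w (by linarith), mul_zero])
      (by rw [hfar w (by linarith), smul_zero])
  · intro t ht' w hw
    obtain ⟨c1, c2⟩ := contDiffAt_deform (B := B) (m := m) (sa w (hbV hw)) (sb w (hbV hw))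
      (sh w (hbV hw)) sβ sσ (hest' t ht' w hw).1.invertible
    exact c1.prodMk (c2.prodMk ((sf w (hbV hw)).comp (t, w) contDiffAt_snd))
  · intro t ht' w hw
    refine IsContactPair.contactFormAt (a := deformForm a b σ t) ?_
    rw [(hasFDerivAt_deformForm (sa w (hbV hw)) (sb w (hbV hw)) sσ).fderiv]
    exact (hest' t ht' w hw).1
  · intro t ht' w hw
    have h1 := (hest' t ht' w hw).1
    have h2 := (hasFDerivAt_deformForm (t := t) (sa w (hbV hw)) (sb w (hbV hw)) sσ).fderiv
    refine contactFieldAt_hamField (a := deformForm a b σ t) (Y := deformField a b σ h β B m t)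
      (h := deformHam σ h β m t) ?_ ?_ ?_
    · rw [h2]; exact h1
    · filter_upwards [hball w hw] with y hy
      exact (hest' t ht' y hy).1.apply_hamField _ _
    · rw [h2, (hasFDerivAt_deformHam (sh w (hbV hw)) (dβ w) sσ).fderiv]
      rfl
  · intro t ht' w hw hw0
    have : 0 < ‖w‖ := norm_pos_iff.2 hw0
    exact lt_of_lt_of_le (by positivity) (hreg t ht' w hw)
  · intro t ht
    have := (hest' t ht 0 (Metric.mem_ball_self hρ0)).2
    rw [norm_zero, mul_zero, hzero, sub_zero] at this
    exact norm_le_zero_iff.1 this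
  · intro t ht'
    exact ⟨c / 2, by positivity, (hball 0 (Metric.mem_ball_self hρ0)).mono
      fun w hw => hreg t ht' w hw⟩
  · filter_upwards [hσ1] with w hw
    refine ⟨?_, (hfw w).symm⟩
    simp only [deformForm, hw, mul_one, one_smul, hb, add_sub_cancel]
  · refine ⟨K, ?_⟩
    filter_upwards [hσ1.eventually_nhds, hball 0 (Metric.mem_ball_self hρ0)] with w hw hwb
    have h1 : fderiv ℝ σ w = 0 := by
      have : σ =ᶠ[𝓝 w] fun _ => 1 := hw
      rw [this.fderiv_eq, fderiv_const_apply]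
    have h2 := (hest' 1 ⟨zero_le_one, le_rfl⟩ w hwb).2
    rw [h1, smul_zero, norm_zero, zero_mul, add_zero] at h2
    rw [hYw]
    calc _ ≤ K * ‖w‖ * ‖w‖ := h2
      _ = _ := by ring

end FormMove

/-! ### The standard contact form and its Hamiltonian fields. -/

section StdModel

variable {n : ℕ}

/-- The coordinate vectors of the standard model. -/
def vecX (i : Fin n) : Std n := (Pi.single i 1, 0, 0)

def vecY (i : Fin n) : Std n := (0, Pi.single i 1, 0)

def vecZ : Std n := (0, 0, 1)

lemma clm_apply_std (e : Std n →L[ℝ] ℝ) (v : Std n) :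
    e v = ∑ i, (v.1 i * e (vecX i) + v.2.1 i * e (vecY i)) + v.2.2 * e vecZ := by
  have hv : v = ∑ i, (v.1 i • vecX i + v.2.1 i • vecY i) + v.2.2 • vecZ := by
    refine Prod.ext ?_ (Prod.ext ?_ ?_)
    · ext j
      simp [vecX, vecY, vecZ, Prod.fst_sum, Finset.sum_apply, Pi.single_apply]
    · ext j
      simp [vecX, vecY, vecZ, Prod.snd_sum, Prod.fst_sum, Finset.sum_apply, Pi.single_apply]
    · simp [vecX, vecY, vecZ, Prod.snd_sum]
  conv_lhs => rw [hv]
  simp only [map_add, map_sum, map_smul, smul_eq_mul]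

lemma norm_vecX_le (i : Fin n) : ‖(vecX i : Std n)‖ ≤ 1 := by
  simp [vecX, Prod.norm_def, Pi.norm_single]

lemma norm_vecY_le (i : Fin n) : ‖(vecY i : Std n)‖ ≤ 1 := by
  simp [vecY, Prod.norm_def, Pi.norm_single]

lemma norm_vecZ_le : ‖(vecZ : Std n)‖ ≤ 1 := by
  simp [vecZ, Prod.norm_def]

def coordX (i : Fin n) : Std n →L[ℝ] ℝ :=
  (ContinuousLinearMap.proj i).comp (ContinuousLinearMap.fst ℝ _ _)

def coordY (i : Fin n) : Std n →L[ℝ] ℝ :=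
  (ContinuousLinearMap.proj i).comp
    ((ContinuousLinearMap.fst ℝ _ _).comp (ContinuousLinearMap.snd ℝ _ _))

def coordZ : Std n →L[ℝ] ℝ :=
  (ContinuousLinearMap.snd ℝ _ _).comp (ContinuousLinearMap.snd ℝ _ _)

@[simp] lemma coordX_apply (i : Fin n) (v : Std n) : coordX i v = v.1 i := rfl
@[simp] lemma coordY_apply (i : Fin n) (v : Std n) : coordY i v = v.2.1 i := rfl
@[simp] lemma coordZ_apply (v : Std n) : coordZ v = v.2.2 := rfl

/-- The linear part of the standard contact form. -/
def stdBilin : Std n →L[ℝ] Std n →L[ℝ] ℝ :=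
  (1 / 2 : ℝ) • ∑ i, ((coordX i).smulRight (coordY i) - (coordY i).smulRight (coordX i))

lemma stdBilin_apply (u v : Std n) :
    stdBilin u v = 1 / 2 * ∑ i, (u.1 i * v.2.1 i - u.2.1 i * v.1 i) := by
  simp only [stdBilin, smul_apply, sum_apply,
    sub_apply, ContinuousLinearMap.smulRight_apply, smul_eq_mul,
    coordX_apply, coordY_apply]

/-- The standard contact form as a family of covectors. -/
def stdCovector (p : Std n) : Std n →L[ℝ] ℝ := coordZ + stdBilin p

lemma stdCovector_apply (p v : Std n) : stdCovector p v = stdForm p v := by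
  simp only [stdCovector, add_apply, stdBilin_apply, coordZ_apply, stdForm]

lemma contDiff_stdCovector : ContDiff ℝ ∞ (stdCovector : Std n → Std n →L[ℝ] ℝ) :=
  contDiff_const.add stdBilin.contDiff

lemma fderiv_stdCovector (p : Std n) : fderiv ℝ stdCovector p = stdBilin := by
  have : HasFDerivAt (fun p : Std n => coordZ + stdBilin p) stdBilin p :=
    stdBilin.hasFDerivAt.const_add _
  exact this.fderiv

lemma stdBilin_antisymm (u v : Std n) :
    stdBilin u v - stdBilin v u = ∑ i, (u.1 i * v.2.1 i - u.2.1 i * v.1 i) := by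
  rw [stdBilin_apply, stdBilin_apply, ← mul_sub, ← Finset.sum_sub_distrib, Finset.mul_sum]
  refine Finset.sum_congr rfl fun i _ => by ring

/-- The contact field of the standard contact form with given Hamiltonian, in terms of the
1-jet of the Hamiltonian. -/
def stdHam (p : Std n) (r : ℝ) (e : Std n →L[ℝ] ℝ) : Std n :=
  (fun i => e vecZ * p.1 i / 2 - e (vecY i), fun i => e vecZ * p.2.1 i / 2 + e (vecX i),
    r - 1 / 2 * ∑ i, (p.1 i * e (vecX i) + p.2.1 i * e (vecY i)))

lemma stdHam_add_smul (p : Std n) (r r' s : ℝ) (e e' : Std n →L[ℝ] ℝ) :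
    stdHam p (r + s * r') (e + s • e') = stdHam p r e + s • stdHam p r' e' := by
  refine Prod.ext ?_ (Prod.ext ?_ ?_)
  · ext i
    simp [stdHam]
    ring
  · ext i
    simp [stdHam]
    ring
  · simp only [stdHam, Prod.snd_add, Prod.smul_snd, add_apply,
      smul_apply, smul_eq_mul, mul_add, Finset.sum_add_distrib,
      Finset.mul_sum]
    simp only [mul_sub, mul_add, Finset.mul_sum, mul_left_comm s]
    ring

lemma norm_stdHam_le {p : Std n} (hp : ‖p‖ ≤ 1) (r : ℝ) (e : Std n →L[ℝ] ℝ) :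
    ‖stdHam p r e‖ ≤ |r| + 2 * ‖e‖ := by
  have he : ∀ v : Std n, ‖v‖ ≤ 1 → |e v| ≤ ‖e‖ := fun v hv => e.unit_le_opNorm v hv
  have h1 : ∀ i, |p.1 i| ≤ 1 := fun i =>
    (norm_le_pi_norm p.1 i).trans ((norm_fst_le p).trans hp)
  have h2 : ∀ i, |p.2.1 i| ≤ 1 := fun i =>
    (norm_le_pi_norm p.2.1 i).trans ((norm_fst_le p.2).trans ((norm_snd_le p).trans hp))
  have hn := norm_nonneg e
  have hr := abs_nonneg r
  have key : ∀ q : ℝ, |q| ≤ 1 → |e vecZ * q / 2| ≤ ‖e‖ := fun q hq => by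
    rw [abs_div, abs_mul, abs_of_pos (by norm_num : (0 : ℝ) < 2)]
    have := mul_le_mul (he _ norm_vecZ_le) hq (abs_nonneg _) hn
    linarith
  refine norm_prod_le_iff.2 ⟨(pi_norm_le_iff_of_nonneg (by positivity)).2 fun i => ?_,
    norm_prod_le_iff.2 ⟨(pi_norm_le_iff_of_nonneg (by positivity)).2 fun i => ?_, ?_⟩⟩
  · have := abs_sub (e vecZ * p.1 i / 2) (e (vecY i))
    have h3 := key _ (h1 i)
    have h4 := he _ (norm_vecY_le i)
    change |e vecZ * p.1 i / 2 - e (vecY i)| ≤ _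
    linarith
  · have := abs_add_le (e vecZ * p.2.1 i / 2) (e (vecX i))
    have h3 := key _ (h2 i)
    have h4 := he _ (norm_vecX_le i)
    change |e vecZ * p.2.1 i / 2 + e (vecX i)| ≤ _
    linarith
  · have h5 : ∑ i, (p.1 i * e (vecX i) + p.2.1 i * e (vecY i)) = e (p.1, p.2.1, 0) := by
      rw [clm_apply_std e (p.1, p.2.1, 0), zero_mul, add_zero]
    have h6 : ‖((p.1, p.2.1, 0) : Std n)‖ ≤ 1 := by
      refine norm_prod_le_iff.2 ⟨(norm_fst_le p).trans hp, norm_prod_le_iff.2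
        ⟨(norm_fst_le p.2).trans ((norm_snd_le p).trans hp), by simp⟩⟩
    change |r - 1 / 2 * ∑ i, (p.1 i * e (vecX i) + p.2.1 i * e (vecY i))| ≤ _
    rw [h5]
    have h7 := he _ h6
    have := abs_sub r (1 / 2 * e (p.1, p.2.1, 0))
    rw [abs_mul, abs_of_pos (by norm_num : (0 : ℝ) < 1 / 2)] at this
    linarith

lemma stdCovector_stdHam (p : Std n) (r : ℝ) (e : Std n →L[ℝ] ℝ) :
    stdCovector p (stdHam p r e) = r := by
  rw [stdCovector_apply, stdForm]
  have : ∑ i, (p.1 i * (stdHam p r e).2.1 i - p.2.1 i * (stdHam p r e).1 i) =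
      ∑ i, (p.1 i * e (vecX i) + p.2.1 i * e (vecY i)) :=
    Finset.sum_congr rfl fun i _ => by simp only [stdHam]; ring
  rw [this]
  simp [stdHam]

lemma contDiffAt_stdHam {r : Std n → ℝ} {e : Std n → Std n →L[ℝ] ℝ} {w : Std n}
    (hr : ContDiffAt ℝ ∞ r w) (he : ContDiffAt ℝ ∞ e w) :
    ContDiffAt ℝ ∞ (fun w => stdHam w (r w) (e w)) w := by
  have hev : ∀ v : Std n, ContDiffAt ℝ ∞ (fun w => e w v) w := fun v =>
    he.clm_apply contDiffAt_const
  have hx : ∀ i, ContDiffAt ℝ ∞ (fun w : Std n => w.1 i) w := fun i =>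
    (coordX i).contDiff.contDiffAt
  have hy : ∀ i, ContDiffAt ℝ ∞ (fun w : Std n => w.2.1 i) w := fun i =>
    (coordY i).contDiff.contDiffAt
  refine (contDiffAt_pi.2 fun i => ?_).prodMk ((contDiffAt_pi.2 fun i => ?_).prodMk ?_)
  · exact (((hev _).mul (hx i)).div_const _).sub (hev _)
  · exact (((hev _).mul (hy i)).div_const _).add (hev _)
  · exact hr.sub (contDiffAt_const.mul (ContDiffAt.sum fun i _ =>
      ((hx i).mul (hev _)).add ((hy i).mul (hev _))))

/-- The conformal factor is the derivative of the Hamiltonian along `∂_z`, the Reeb field of the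
standard form. -/
lemma contactFieldAt_stdHam {h : Std n → ℝ} {w : Std n} :
    ContactFieldAt 𝓘(ℝ, Std n) stdCovector (fun w => stdHam w (h w) (fderiv ℝ h w)) w := by
  rw [contactFieldAt_model]
  refine ⟨fderiv ℝ h w vecZ, fun v => ?_⟩
  simp_rw [stdCovector_stdHam]
  rw [fderiv_stdCovector, stdBilin_antisymm, clm_apply_std (fderiv ℝ h w) v, stdCovector_apply,
    stdForm, mul_add, mul_left_comm, Finset.mul_sum, Finset.mul_sum]
  have e : ∀ a b c d : ℝ, a + d = c → a + b + d = c + b := fun a b c d h => by rw [← h]; ring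
  rw [add_comm (fderiv ℝ h w vecZ * v.2.2), mul_comm (fderiv ℝ h w vecZ)]
  refine e _ _ _ _ ?_
  rw [← Finset.sum_add_distrib]
  refine Finset.sum_congr rfl fun i _ => ?_
  simp only [stdHam]
  ring

/-- Testing the equation on `∂_z` determines the factor, on `∂_{x_i}` the `y`-components and on
`∂_{y_i}` the `x`-components. -/
lemma ContactFieldAt.eq_stdHam {Y : Std n → Std n} {w : Std n}
    (h : ContactFieldAt 𝓘(ℝ, Std n) stdCovector Y w) :
    Y w = stdHam w (stdCovector w (Y w)) (fderiv ℝ (fun y => stdCovector y (Y y)) w) := by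
  rw [contactFieldAt_model] at h
  obtain ⟨m, hm⟩ := h
  obtain ⟨e, he⟩ : ∃ e, e = fderiv ℝ (fun y => stdCovector y (Y y)) w := ⟨_, rfl⟩
  rw [← he] at hm ⊢
  simp only [fderiv_stdCovector, stdBilin_antisymm, stdCovector_apply, stdForm] at hm
  have hz := hm vecZ
  have hx := fun i => hm (vecX i)
  have hy := fun i => hm (vecY i)
  simp [vecZ, vecX, vecY, Pi.single_apply] at hz hx hy
  change e vecZ = m at hz
  have hx' : ∀ i, e (vecX i) = (Y w).2.1 i - m * w.2.1 i / 2 := fun i => by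
    have := hx i
    simp only [vecX] at *
    linarith
  have hy' : ∀ i, e (vecY i) = - (Y w).1 i + m * w.1 i / 2 := fun i => by
    have := hy i
    simp only [vecY] at *
    linarith
  refine Prod.ext ?_ (Prod.ext ?_ ?_)
  · ext i
    simp only [stdHam, hz, hy']
    ring
  · ext i
    simp only [stdHam, hz, hx']
    ring
  · simp only [stdHam, hx', hy', stdCovector_apply, stdForm]
    have : ∀ i, w.1 i * ((Y w).2.1 i - m * w.2.1 i / 2) + w.2.1 i * (-(Y w).1 i + m * w.1 i / 2) =
        w.1 i * (Y w).2.1 i - w.2.1 i * (Y w).1 i := fun i => by ring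
    simp only [this]
    ring

end StdModel

/-! ### Moves which add a field and a function linearly in time. -/

section Moves

variable {W : Type*} [NormedAddCommGroup W] [NormedSpace ℝ W]

/-- For a fixed form the equation is linear in the field, so factors combine like the fields. -/
lemma ContactFieldAt.add_smul_model {a : W → W →L[ℝ] ℝ} {Y Z : W → W} {w : W} (t : ℝ)
    (ha : DifferentiableAt ℝ a w) (hY : DifferentiableAt ℝ Y w) (hZ : DifferentiableAt ℝ Z w)
    (h : ContactFieldAt 𝓘(ℝ, W) a Y w) (h' : ContactFieldAt 𝓘(ℝ, W) a Z w) :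
    ContactFieldAt 𝓘(ℝ, W) a (fun w => Y w + t • Z w) w := by
  rw [contactFieldAt_model] at h h' ⊢
  obtain ⟨m, hm⟩ := h
  obtain ⟨m', hm'⟩ := h'
  refine ⟨m + t * m', fun v => ?_⟩
  have h1 := (ha.hasFDerivAt.clm_apply hY.hasFDerivAt).differentiableAt
  have h2 := (ha.hasFDerivAt.clm_apply hZ.hasFDerivAt).differentiableAt
  have e : fderiv ℝ (fun y => a y (Y y + t • Z y)) w =
      fderiv ℝ (fun y => a y (Y y)) w + t • fderiv ℝ (fun y => a y (Z y)) w := by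
    simp only [map_add, map_smul, smul_eq_mul]
    exact (h1.hasFDerivAt.add (h2.hasFDerivAt.const_mul t)).fderiv
  have e1 := hm v
  have e2 := hm' v
  rw [e]
  simp only [add_apply, smul_apply, map_add, map_smul,
    smul_eq_mul]
  linear_combination e1 + t * e2

variable [FiniteDimensional ℝ W] {V : Set W} {J : Set ℝ} {d : LocalData W}

lemma fderiv_eq_zero_of_far {F : Type*} [NormedAddCommGroup F] [NormedSpace ℝ F] {g : W → F}
    {ρ : ℝ} (hg : ∀ w, ρ ≤ ‖w‖ → g w = 0) {w : W} (hw : ρ < ‖w‖) : fderiv ℝ g w = 0 := by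
  have : g =ᶠ[𝓝 w] fun _ => 0 := by
    filter_upwards [continuous_norm.continuousAt.eventually (lt_mem_nhds hw)] with y hy
    exact hg y hy.le
  rw [this.fderiv_eq, fderiv_const_apply]

/-- Adding a contact field and a function with compact support. -/
lemma LocalData.Valid.move_add (hV : IsOpen V) (hd : d.Valid V J) {ρ : ℝ} (hρ : 0 < ρ)
    (hb : Metric.ball 0 ρ ⊆ V) {Z : W → W} {ψ : W → ℝ}
    (sZ : ∀ w ∈ Metric.ball (0 : W) ρ, ContDiffAt ℝ ∞ Z w)
    (sψ : ∀ w ∈ Metric.ball (0 : W) ρ, ContDiffAt ℝ ∞ ψ w)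
    (hZ : ∀ w ∈ Metric.ball (0 : W) ρ, ContactFieldAt 𝓘(ℝ, W) (fun w => (d w).1) Z w)
    (hZf : ∀ w, ρ / 2 < ‖w‖ → Z w = 0) (hψf : ∀ w, ρ / 2 < ‖w‖ → ψ w = 0)
    (hZ0 : Z 0 = 0) (hψ0 : fderiv ℝ ψ 0 = 0)
    (hpos : ∀ t ∈ Icc (0 : ℝ) 1, ∃ c : ℝ, 0 < c ∧ ∀ w ∈ Metric.ball (0 : W) ρ, c * ‖w‖ ^ 2 ≤
      (fderiv ℝ (fun w => (d w).2.2) w + t • fderiv ℝ ψ w) ((d w).2.1 + t • Z w))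
    (hmem : ∀ t ∈ Icc (0 : ℝ) 1, ∀ w ∈ Metric.ball (0 : W) ρ, (d w).2.2 + t * ψ w ∈ J) :
    LocalData.Move V J d fun w => ((d w).1, (d w).2.1 + Z w, (d w).2.2 + ψ w) := by
  have sf : ∀ w ∈ V, ContDiffAt ℝ ∞ (fun w => (d w).2.2) w := fun w hw => (hd.smooth w hw).snd.snd
  have sY : ∀ w ∈ V, ContDiffAt ℝ ∞ (fun w => (d w).2.1) w := fun w hw => (hd.smooth w hw).snd.fst
  have sa : ∀ w ∈ V, ContDiffAt ℝ ∞ (fun w => (d w).1) w := fun w hw => (hd.smooth w hw).fst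
  have hfd : ∀ t : ℝ, ∀ w ∈ Metric.ball (0 : W) ρ, fderiv ℝ (fun w => (d w).2.2 + t * ψ w) w =
      fderiv ℝ (fun w => (d w).2.2) w + t • fderiv ℝ ψ w := fun t w hw =>
    (((sf w (hb hw)).differentiableAt (by simp)).hasFDerivAt.add
      (((sψ w hw).differentiableAt (by simp)).hasFDerivAt.const_mul t)).fderiv
  have hball := fun w (hw : w ∈ Metric.ball (0 : W) ρ) => Metric.isOpen_ball.mem_nhds hw
  have h0 := Metric.mem_ball_self (x := (0 : W)) hρ
  have := LocalData.move_of_family (ρ' := 3 / 4 * ρ) (ρ := ρ) hV hd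
    (fun t w => ((d w).1, (d w).2.1 + t • Z w, (d w).2.2 + t * ψ w)) (by linarith)
    hb (fun w _ => by simp) (fun t w _ hw => by
      simp [hZf w (by linarith), hψf w (by linarith)]) ?_ (fun t _ w hw => hd.form w (hb hw)) ?_ ?_
    ?_ ?_ ?_ hmem
  · simpa using this
  · intro t _ w hw
    have h2 := contDiffAt_snd (𝕜 := ℝ) (n := ∞) (E := ℝ) (F := W) (p := (t, w))
    exact ((sa w (hb hw)).comp (t, w) h2).prodMk
      ((((sY w (hb hw)).comp (t, w) h2).add (contDiffAt_fst.smul ((sZ w hw).comp (t, w) h2))).prodMk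
      (((sf w (hb hw)).comp (t, w) h2).add (contDiffAt_fst.mul ((sψ w hw).comp (t, w) h2))))
  · exact fun t _ w hw => ContactFieldAt.add_smul_model t
      ((sa w (hb hw)).differentiableAt (by simp)) ((sY w (hb hw)).differentiableAt (by simp))
      ((sZ w hw).differentiableAt (by simp)) (hd.field w (hb hw)) (hZ w hw)
  · intro t ht w hw hne
    obtain ⟨c, hc, h⟩ := hpos t ht
    have : 0 < ‖w‖ := norm_pos_iff.2 hne
    simp only [hfd t w hw]
    exact lt_of_lt_of_le (by positivity) (h w hw)
  · intro t _
    simp [hd.zero, hZ0]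
  · intro t _
    simp only [hfd t 0 h0, hd.critical, hψ0, smul_zero, add_zero]
  · intro t ht
    obtain ⟨c, hc, h⟩ := hpos t ht
    refine ⟨c, hc, ?_⟩
    filter_upwards [hball 0 h0] with w hw
    simp only [hfd t w hw]
    exact h w hw

/-- The critical value can be changed by any small constant. -/
lemma LocalData.Valid.exists_move_shift (hV : IsOpen V) (h0V : (0 : W) ∈ V) (hJ : IsOpen J)
    (hd : d.Valid V J) : ∃ ε : ℝ, 0 < ε ∧ ∀ r : ℝ, |r| < ε →
      ∃ d' : LocalData W, LocalData.Move V J d d' ∧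
        ∀ᶠ w in 𝓝 0, d' w = ((d w).1, (d w).2.1, (d w).2.2 + r) := by
  obtain ⟨c, hc, hgr⟩ := hd.growth
  have sf : ContDiffAt ℝ ∞ (fun w => (d w).2.2) 0 := (hd.smooth 0 h0V).snd.snd
  obtain ⟨K, hK, hYK⟩ := exists_linear_bound (g := fun w => (d w).2.1)
    ((hd.smooth 0 h0V).snd.fst.of_le (by simp)) hd.zero
  obtain ⟨δ, hδ, hJδ⟩ := Metric.isOpen_iff.1 hJ _ (hd.mem 0 h0V)
  have hfδ : ∀ᶠ w in 𝓝 (0 : W), (d w).2.2 ∈ Metric.ball (d 0).2.2 (δ / 2) :=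
    sf.continuousAt.eventually (Metric.ball_mem_nhds _ (by positivity))
  obtain ⟨ρ, hρ, hest⟩ := Metric.eventually_nhds_iff_ball.1
    (hgr.and (hYK.and (hfδ.and (hV.mem_nhds h0V))))
  obtain ⟨σ, sσ, hσ01, hσ1, hσ0, hση⟩ := exists_cutoff (E := W) (ρ := ρ / 2)
    (η := 1) (by positivity) one_pos
  obtain ⟨r₀, hr₀, hσr⟩ := Metric.eventually_nhds_iff_ball.1 hσ1.eventually_nhds
  -- Where `σ` is not locally constant, `‖w‖ ≥ r₀` and the Lyapunov derivative is at least `c r₀²`,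
  -- while the slope of `r σ` along the field contributes at most `|r| K`. The bound `δ / 2` keeps
  -- the values in `J`.
  refine ⟨min (δ / 2) (c * r₀ ^ 2 / (2 * K)), by positivity, fun r hr => ?_⟩
  have hr1 : |r| < δ / 2 := hr.trans_le (min_le_left _ _)
  have hr2 : |r| ≤ c * r₀ ^ 2 / (2 * K) := (hr.trans_le (min_le_right _ _)).le
  rw [le_div_iff₀ (by positivity)] at hr2
  have hσn : ∀ w ∈ Metric.ball (0 : W) r₀, fderiv ℝ σ w = 0 := fun w hw => by
    have : σ =ᶠ[𝓝 w] fun _ => 1 := hσr w hw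
    rw [this.fderiv_eq, fderiv_const_apply]
  have hdψ : ∀ w, fderiv ℝ (fun w => σ w * r) w = r • fderiv ℝ σ w := fun w =>
    ((sσ.differentiable (by simp) w).hasFDerivAt.mul_const r).fderiv
  refine ⟨_, hd.move_add hV hρ (fun w hw => (hest w hw).2.2.2) (Z := fun _ => 0)
    (ψ := fun w => σ w * r) (fun _ _ => contDiffAt_const)
    (fun w _ => sσ.contDiffAt.mul contDiffAt_const) (fun w _ => ?_) (fun _ _ => rfl)
    (fun w hw => by rw [hσ0 w hw.le, zero_mul]) rfl
    (by rw [hdψ, hσn 0 (Metric.mem_ball_self hr₀), smul_zero]) (fun t ht => ?_)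
    (fun t ht w hw => ?_), ?_⟩
  · rw [contactFieldAt_model]
    exact ⟨0, fun v => by simp⟩
  · refine ⟨c / 2, by positivity, fun w hw => ?_⟩
    obtain ⟨h1, h2, -⟩ := hest w hw
    rw [smul_zero, add_zero, hdψ]
    simp only [add_apply, smul_apply, smul_eq_mul]
    by_cases hwr : w ∈ Metric.ball (0 : W) r₀
    · rw [hσn w hwr]
      simp only [zero_apply, mul_zero, add_zero]
      have : 0 ≤ c * ‖w‖ ^ 2 := by positivity
      linarith
    · rw [mem_ball_zero_iff, not_lt] at hwr
      have h3 : |fderiv ℝ σ w (d w).2.1| ≤ K := by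
        calc _ ≤ ‖fderiv ℝ σ w‖ * ‖(d w).2.1‖ := (fderiv ℝ σ w).le_opNorm _
          _ ≤ ‖fderiv ℝ σ w‖ * (K * ‖w‖) := by gcongr
          _ = (‖w‖ * ‖fderiv ℝ σ w‖) * K := by ring
          _ ≤ 1 * K := by gcongr; exact hση w
          _ = K := one_mul _
      have h4 : |t * (r * fderiv ℝ σ w (d w).2.1)| ≤ |r| * K := by
        rw [abs_mul, abs_mul, abs_of_nonneg ht.1]
        exact (mul_le_of_le_one_left (by positivity) ht.2).trans (by gcongr)
      have h5 : c * r₀ ^ 2 ≤ c * ‖w‖ ^ 2 := by gcongr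
      linarith [(abs_le.1 h4).1]
  · have h1 := (hest w hw).2.2.1
    refine hJδ ?_
    rw [Metric.mem_ball, Real.dist_eq] at h1 ⊢
    have h2 : |t * (σ w * r)| ≤ |r| := by
      rw [abs_mul, abs_mul, abs_of_nonneg ht.1, abs_of_nonneg (hσ01 w).1]
      exact mul_le_of_le_one_left (mul_nonneg (hσ01 w).1 (abs_nonneg r)) ht.2 |>.trans
        (mul_le_of_le_one_left (abs_nonneg _) (hσ01 w).2)
    have h3 := abs_add_le ((d w).2.2 - (d 0).2.2) (t * (σ w * r))
    rw [show (d w).2.2 + t * (σ w * r) - (d 0).2.2 = (d w).2.2 - (d 0).2.2 + t * (σ w * r) by ring]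
    linarith
  · filter_upwards [hσ1] with w hw
    simp only [hw, one_mul, add_zero]

end Moves

/-! ### Moves with the standard contact form, and the diagonal model fields. -/

section StdMoves

variable {n : ℕ} {V : Set (Std n)} {J : Set ℝ} {d : LocalData (Std n)}

lemma LocalData.Move.valid {W : Type*} [NormedAddCommGroup W] [NormedSpace ℝ W] {V : Set W}
    {J : Set ℝ} {d d' : LocalData W} (hV : IsOpen V) (h0V : (0 : W) ∈ V)
    (h : LocalData.Move V J d d') : d'.Valid V J := by
  obtain ⟨D, K, -, -, -, h1, hv, -, -⟩ := h
  have hd := hv 1 ⟨zero_le_one, le_rfl⟩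
  have he : ∀ w ∈ V, d' =ᶠ[𝓝 w] D 1 := fun w hw => by
    filter_upwards [hV.mem_nhds hw] with y hy
    exact (h1 y hy).symm
  have ha := fun w hw => (he w hw).fun_comp Prod.fst
  have hY := fun w hw => (he w hw).fun_comp fun q => q.2.1
  have hf : ∀ w ∈ V, fderiv ℝ (fun w => (d' w).2.2) w = fderiv ℝ (fun w => (D 1 w).2.2) w :=
    fun w hw => ((he w hw).fun_comp fun q => q.2.2).fderiv_eq
  refine ⟨fun w hw => (hd.smooth w hw).congr_of_eventuallyEq (he w hw),
    fun w hw => (hd.form w hw).congr_model (ha w hw),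
    fun w hw => (hd.field w hw).congr_model (ha w hw) (hY w hw), fun w hw hne => ?_,
    (hY 0 h0V).self_of_nhds.trans hd.zero, (hf 0 h0V).trans hd.critical, ?_,
    fun w hw => by rw [← h1 w hw]; exact hd.mem w hw⟩
  · have := hd.regular w hw hne
    rwa [h1 w hw, ← hf w hw] at this
  · obtain ⟨c, hc, hg⟩ := hd.growth
    refine ⟨c, hc, ?_⟩
    filter_upwards [hg, hV.mem_nhds h0V] with w hw hwV
    rwa [h1 w hwV, ← hf w hwV] at hw

lemma stdHam_zero (p : Std n) : stdHam p 0 0 = 0 := by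
  refine Prod.ext ?_ (Prod.ext ?_ ?_)
  · ext i; simp [stdHam]
  · ext i; simp [stdHam]
  · simp [stdHam]

lemma stdHam_smul (p : Std n) (r s : ℝ) (e : Std n →L[ℝ] ℝ) :
    stdHam p (s * r) (s • e) = s • stdHam p r e := by
  simpa [stdHam_zero] using stdHam_add_smul p 0 r s 0 e

lemma stdHam_add (p : Std n) (r r' : ℝ) (e e' : Std n →L[ℝ] ℝ) :
    stdHam p (r + r') (e + e') = stdHam p r e + stdHam p r' e' := by
  simpa using stdHam_add_smul p r r' 1 e e'

/-- The error made by a cutoff in the Lyapunov estimate. -/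
lemma lyapunov_cutoff_estimate {W : Type*} [NormedAddCommGroup W] [NormedSpace ℝ W]
    {df dψ dσ : W →L[ℝ] ℝ} {Y T U : W} {g ψ σ t r K η c : ℝ} (hr0 : 0 ≤ r)
    (hη1 : η ≤ 1) (hηc : η * (20 * K ^ 2) ≤ c) (ht : t ∈ Icc (0 : ℝ) 1) (hσ : σ ∈ Icc (0 : ℝ) 1)
    (hK : 0 < K) (hdf : ‖df‖ ≤ K * r) (hdψ : ‖dψ‖ ≤ K * r) (hY : ‖Y‖ ≤ K * r)
    (hT : ‖T‖ ≤ 3 * K * r) (hU : ‖U‖ ≤ 2 * ‖dσ‖) (hg : |g| ≤ K * r ^ 2) (hψ : |ψ| ≤ K * r ^ 2)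
    (hdσ : r * ‖dσ‖ ≤ η)
    (hpos : c * r ^ 2 ≤ (df + (t * σ) • dψ) (Y + (t * σ) • T)) :
    c / 2 * r ^ 2 ≤ (df + t • (σ • dψ + ψ • dσ)) (Y + t • (σ • T + g • U)) := by
  have hs : t * σ ∈ Icc (0 : ℝ) 1 := ⟨mul_nonneg ht.1 hσ.1, mul_le_one₀ ht.2 hσ.1 hσ.2⟩
  have hη0 : 0 ≤ η := le_trans (by positivity) hdσ
  -- The main term is the uncut inequality at the parameter `t σ`. Each of the three errors contains
  -- `dσ` and, by `r ‖dσ‖ ≤ η`, is bounded by `4 K² η r²`, `4 K² η r²` and `2 K² η r²`; the total of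
  -- `10 K² η r²` is at most half of `c r²`.
  have e1 : (df + t • (σ • dψ + ψ • dσ)) (Y + t • (σ • T + g • U)) =
      (df + (t * σ) • dψ) (Y + (t * σ) • T) + (t * (ψ * dσ (Y + (t * σ) • T)) +
        t * (g * (df + (t * σ) • dψ) U) + t * t * (ψ * (g * dσ U))) := by
    simp only [add_apply, smul_apply, map_add, map_smul,
      smul_eq_mul]
    ring
  have ns : ∀ {F : Type _} [SeminormedAddCommGroup F] [NormedSpace ℝ F] (x : F),
      ‖(t * σ) • x‖ ≤ ‖x‖ := fun x => by
    rw [norm_smul, Real.norm_of_nonneg hs.1]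
    exact mul_le_of_le_one_left (norm_nonneg _) hs.2
  have n1 : ‖Y + (t * σ) • T‖ ≤ 4 * K * r := by
    have := (norm_add_le Y ((t * σ) • T)).trans (add_le_add_right (ns T) _)
    linarith
  have n2 : ‖df + (t * σ) • dψ‖ ≤ 2 * K * r := by
    have := (norm_add_le df ((t * σ) • dψ)).trans (add_le_add_right (ns dψ) _)
    linarith
  have m1 : |t * (ψ * dσ (Y + (t * σ) • T))| ≤ 4 * K ^ 2 * η * r ^ 2 := by
    rw [abs_mul, abs_mul, abs_of_nonneg ht.1]
    have h1 : |dσ (Y + (t * σ) • T)| ≤ ‖dσ‖ * (4 * K * r) :=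
      (dσ.le_opNorm _).trans (by gcongr)
    calc _ ≤ 1 * (K * r ^ 2 * (‖dσ‖ * (4 * K * r))) := by gcongr; exact ht.2
      _ = 4 * K ^ 2 * (r * ‖dσ‖) * r ^ 2 := by ring
      _ ≤ _ := by gcongr
  have m2 : |t * (g * (df + (t * σ) • dψ) U)| ≤ 4 * K ^ 2 * η * r ^ 2 := by
    rw [abs_mul, abs_mul, abs_of_nonneg ht.1]
    have h1 : |(df + (t * σ) • dψ) U| ≤ (2 * K * r) * (2 * ‖dσ‖) :=
      ((df + (t * σ) • dψ).le_opNorm _).trans (by gcongr)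
    calc _ ≤ 1 * (K * r ^ 2 * ((2 * K * r) * (2 * ‖dσ‖))) := by gcongr; exact ht.2
      _ = 4 * K ^ 2 * (r * ‖dσ‖) * r ^ 2 := by ring
      _ ≤ _ := by gcongr
  have m3 : |t * t * (ψ * (g * dσ U))| ≤ 2 * K ^ 2 * η * r ^ 2 := by
    rw [abs_mul, abs_mul, abs_mul, abs_mul, abs_of_nonneg ht.1]
    have h1 : |dσ U| ≤ ‖dσ‖ * (2 * ‖dσ‖) := (dσ.le_opNorm _).trans (by gcongr)
    obtain ⟨ht0, ht1⟩ := ht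
    calc _ ≤ 1 * 1 * (K * r ^ 2 * (K * r ^ 2 * (‖dσ‖ * (2 * ‖dσ‖)))) := by gcongr
      _ = 2 * K ^ 2 * ((r * ‖dσ‖) * (r * ‖dσ‖)) * r ^ 2 := by ring
      _ ≤ 2 * K ^ 2 * (η * 1) * r ^ 2 := by gcongr; exact hdσ.trans hη1
      _ = _ := by ring
  have h10 : η * (20 * K ^ 2) * r ^ 2 ≤ c * r ^ 2 := by gcongr
  rw [e1]
  linarith [(abs_le.1 m1).1, (abs_le.1 m2).1, (abs_le.1 m3).1]

/-- Changing Hamiltonian and function by terms of second order, for the standard contact form. -/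
lemma LocalData.Valid.exists_move_ham (hV : IsOpen V) (h0V : (0 : Std n) ∈ V) (hJ : IsOpen J)
    (hd : d.Valid V J) (ha : ∀ᶠ w in 𝓝 0, (d w).1 = stdCovector w) {g ψ : Std n → ℝ}
    (sg : ∀ᶠ w in 𝓝 0, ContDiffAt ℝ ∞ g w) (sψ : ∀ᶠ w in 𝓝 0, ContDiffAt ℝ ∞ ψ w)
    (g0 : g 0 = 0) (dg0 : fderiv ℝ g 0 = 0) (ψ0 : ψ 0 = 0) (dψ0 : fderiv ℝ ψ 0 = 0) {c : ℝ}
    (hc : 0 < c) (hpos : ∀ᶠ w in 𝓝 0, ∀ s ∈ Icc (0 : ℝ) 1, c * ‖w‖ ^ 2 ≤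
      (fderiv ℝ (fun w => (d w).2.2) w + s • fderiv ℝ ψ w)
        ((d w).2.1 + s • stdHam w (g w) (fderiv ℝ g w))) :
    ∃ d' : LocalData (Std n), LocalData.Move V J d d' ∧ ∀ᶠ w in 𝓝 0,
      d' w = ((d w).1, (d w).2.1 + stdHam w (g w) (fderiv ℝ g w), (d w).2.2 + ψ w) := by
  have hle2 : ((2 : ℕ∞) : WithTop ℕ∞) ≤ ∞ := by exact_mod_cast le_top
  have sf : ContDiffAt ℝ ∞ (fun w => (d w).2.2) 0 := (hd.smooth 0 h0V).snd.snd
  have sg' := sg.self_of_nhds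
  have sψ' := sψ.self_of_nhds
  obtain ⟨K1, hK1, e1⟩ := exists_linear_bound (g := fun w => (d w).2.1)
    ((hd.smooth 0 h0V).snd.fst.of_le (by simp)) hd.zero
  obtain ⟨K2, hK2, e2⟩ := exists_linear_bound (g := fderiv ℝ (fun w => (d w).2.2))
    ((sf.fderiv_right (m := ∞) (by simp)).of_le (by simp)) hd.critical
  obtain ⟨K3, hK3, e3⟩ := exists_linear_bound (g := fderiv ℝ g)
    ((sg'.fderiv_right (m := ∞) (by simp)).of_le (by simp)) dg0
  obtain ⟨K4, hK4, e4⟩ := exists_linear_bound (g := fderiv ℝ ψ)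
    ((sψ'.fderiv_right (m := ∞) (by simp)).of_le (by simp)) dψ0
  obtain ⟨K5, hK5, e5⟩ := exists_quadratic_bound (sg'.of_le hle2) g0 dg0
  obtain ⟨K6, hK6, e6⟩ := exists_quadratic_bound (sψ'.of_le hle2) ψ0 dψ0
  obtain ⟨K, hK⟩ : ∃ K, K = K1 + K2 + K3 + K4 + K5 + K6 := ⟨_, rfl⟩
  have hK0 : 0 < K := by rw [hK]; positivity
  obtain ⟨δ, hδ, hJδ⟩ := Metric.isOpen_iff.1 hJ _ (hd.mem 0 h0V)
  have hfδ : ∀ᶠ w in 𝓝 (0 : Std n), (d w).2.2 ∈ Metric.ball (d 0).2.2 (δ / 2) :=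
    sf.continuousAt.eventually (Metric.ball_mem_nhds _ (by positivity))
  have hψδ : ∀ᶠ w in 𝓝 (0 : Std n), ψ w ∈ Metric.ball 0 (δ / 2) := by
    refine sψ'.continuousAt.eventually ?_
    rw [ψ0]
    exact Metric.ball_mem_nhds _ (by positivity)
  have h1 : ∀ᶠ w in 𝓝 (0 : Std n), w ∈ Metric.ball (0 : Std n) 1 := Metric.ball_mem_nhds _ one_pos
  obtain ⟨ρ, hρ, hest⟩ := Metric.eventually_nhds_iff_ball.1 (h1.and ((hV.eventually_mem h0V).and
    (ha.eventually_nhds.and (sg.and (sψ.and (hpos.and (hfδ.and (hψδ.and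
    (e1.and (e2.and (e3.and (e4.and (e5.and e6)))))))))))))
  obtain ⟨σ, sσ, hσ01, hσ1, hσ0, hση⟩ := exists_cutoff (E := Std n) (ρ := ρ / 2)
    (η := min 1 (c / (20 * K ^ 2))) (by positivity) (by positivity)
  have hfd : ∀ (u : Std n → ℝ) (w : Std n), ContDiffAt ℝ ∞ u w →
      fderiv ℝ (fun w => σ w * u w) w = σ w • fderiv ℝ u w + u w • fderiv ℝ σ w := fun u w hu =>
    ((sσ.differentiable (by simp) w).hasFDerivAt.mul
      (hu.differentiableAt (by simp)).hasFDerivAt).fderiv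
  -- `stdHam` is linear in the 1-jet `(g, dg)`. The product rule thus splits the field of `σ g` into
  -- `σ` times the field of `g` and an error `g` times the field of `(0, dσ)`, where `g = O(‖w‖²)`.
  have hZ : ∀ w ∈ Metric.ball (0 : Std n) ρ,
      stdHam w (σ w * g w) (fderiv ℝ (fun w => σ w * g w) w) =
        σ w • stdHam w (g w) (fderiv ℝ g w) + g w • stdHam w 0 (fderiv ℝ σ w) := fun w hw => by
    rw [hfd g w (hest w hw).2.2.2.1, ← stdHam_smul, ← stdHam_smul, ← stdHam_add, mul_zero, add_zero]
  have hfar : ∀ w : Std n, ρ / 2 < ‖w‖ → stdHam w (σ w * g w) (fderiv ℝ (fun w => σ w * g w) w) = 0 :=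
    fun w hw => by
      rw [fderiv_eq_zero_of_far (ρ := ρ / 2) (fun w hw => by rw [hσ0 w hw, zero_mul]) hw,
        hσ0 w hw.le, zero_mul, stdHam_zero]
  have hb0 := Metric.mem_ball_self (x := (0 : Std n)) hρ
  refine ⟨_, hd.move_add hV hρ (fun w hw => (hest w hw).2.1)
    (Z := fun w => stdHam w (σ w * g w) (fderiv ℝ (fun w => σ w * g w) w))
    (ψ := fun w => σ w * ψ w) (fun w hw => ?_)
    (fun w hw => sσ.contDiffAt.mul (hest w hw).2.2.2.2.1) (fun w hw => ?_) hfar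
    (fun w hw => by rw [hσ0 w hw.le, zero_mul])
    (by rw [hZ 0 hb0, g0, dg0, stdHam_zero, smul_zero, zero_smul, add_zero])
    (by rw [hfd ψ 0 (hest 0 hb0).2.2.2.2.1, dψ0, ψ0, smul_zero, zero_smul, add_zero])
    (fun t ht => ⟨c / 2, by positivity, fun w hw => ?_⟩) (fun t ht w hw => ?_), ?_⟩
  · have : ContDiffAt ℝ ∞ (fun w => σ w * g w) w := sσ.contDiffAt.mul (hest w hw).2.2.2.1
    exact contDiffAt_stdHam this (this.fderiv_right (by simp))
  · exact ContactFieldAt.congr_model contactFieldAt_stdHam (hest w hw).2.2.1 (.refl _ _)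
  · obtain ⟨w1, -, -, w3, w4, w5, -, -, b1, b2, b3, b4, b5, b6⟩ := hest w hw
    rw [hfd ψ w w4]
    rw [hZ w hw]
    have hw1 : ‖w‖ ≤ 1 := (mem_ball_zero_iff.1 w1).le
    have hr0 := norm_nonneg w
    have up : ∀ {k x : ℝ}, x ≤ k * ‖w‖ → k ≤ K → x ≤ K * ‖w‖ := fun h hk =>
      h.trans (by gcongr)
    have up2 : ∀ {k x : ℝ}, x ≤ k * ‖w‖ ^ 2 → k ≤ K → x ≤ K * ‖w‖ ^ 2 := fun h hk =>
      h.trans (by gcongr)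
    have b3' := up b3 (by linarith)
    have b5' : |g w| ≤ K * ‖w‖ ^ 2 := up2 b5 (by linarith)
    refine lyapunov_cutoff_estimate (K := K) hr0 (min_le_left _ (c / (20 * K ^ 2))) ?_ ht
      (hσ01 w) hK0 (up b2 (by linarith)) (up b4 (by linarith)) (up b1 (by linarith)) ?_ ?_ b5'
      (up2 b6 (by linarith)) (hση w) (w5 _ ⟨mul_nonneg ht.1 (hσ01 w).1,
        mul_le_one₀ ht.2 (hσ01 w).1 (hσ01 w).2⟩)
    · rw [← le_div_iff₀ (by positivity)]
      exact min_le_right _ _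
    · refine (norm_stdHam_le hw1 _ _).trans ?_
      have : K * ‖w‖ ^ 2 ≤ K * ‖w‖ := by
        gcongr
        exact pow_le_of_le_one hr0 hw1 two_ne_zero
      linarith
    · refine (norm_stdHam_le hw1 _ _).trans ?_
      rw [abs_zero, zero_add]
  · obtain ⟨-, -, -, -, -, -, w6, w7, -⟩ := hest w hw
    refine hJδ ?_
    rw [Metric.mem_ball, Real.dist_eq] at w6 w7 ⊢
    rw [sub_zero] at w7
    have h2 : |t * (σ w * ψ w)| ≤ |ψ w| := by
      rw [abs_mul, abs_mul, abs_of_nonneg ht.1, abs_of_nonneg (hσ01 w).1]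
      exact mul_le_of_le_one_left (mul_nonneg (hσ01 w).1 (abs_nonneg _)) ht.2 |>.trans
        (mul_le_of_le_one_left (abs_nonneg _) (hσ01 w).2)
    have h3 := abs_add_le ((d w).2.2 - (d 0).2.2) (t * (σ w * ψ w))
    rw [show (d w).2.2 + t * (σ w * ψ w) - (d 0).2.2 =
      (d w).2.2 - (d 0).2.2 + t * (σ w * ψ w) by ring]
    linarith
  · filter_upwards [hσ1.eventually_nhds] with w hw
    have h2 : (fun w => σ w * g w) =ᶠ[𝓝 w] g := by
      filter_upwards [hw] with y hy
      rw [hy, one_mul]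
    rw [h2.fderiv_eq, hw.self_of_nhds, one_mul, one_mul]

/-- The squared radius in the `(x, y)` directions. -/
def sqRad (p : Std n) : ℝ := ∑ i, ((p.1 i) ^ 2 + (p.2.1 i) ^ 2)

lemma sqRad_nonneg (p : Std n) : 0 ≤ sqRad p := Finset.sum_nonneg fun i _ => by positivity

lemma contDiff_sqRad : ContDiff ℝ ∞ (sqRad : Std n → ℝ) :=
  ContDiff.sum fun i _ => ((coordX i).contDiff.pow 2).add ((coordY i).contDiff.pow 2)

lemma norm_le_sqRad (p : Std n) : ‖p‖ ≤ max (Real.sqrt (sqRad p)) |p.2.2| := by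
  have h : ∀ i, p.1 i ^ 2 + p.2.1 i ^ 2 ≤ sqRad p := fun i =>
    Finset.single_le_sum (f := fun i => p.1 i ^ 2 + p.2.1 i ^ 2) (fun i _ => by positivity)
      (Finset.mem_univ i)
  refine norm_prod_le_iff.2 ⟨le_max_of_le_left ((pi_norm_le_iff_of_nonneg (by positivity)).2
    fun i => Real.abs_le_sqrt ?_), norm_prod_le_iff.2 ⟨le_max_of_le_left
    ((pi_norm_le_iff_of_nonneg (by positivity)).2 fun i => Real.abs_le_sqrt ?_),
    le_max_right _ _⟩⟩
  · exact le_trans (le_add_of_nonneg_right (by positivity)) (h i)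
  · exact le_trans (le_add_of_nonneg_left (by positivity)) (h i)

lemma norm_sq_le_sqRad (p : Std n) : ‖p‖ ^ 2 ≤ sqRad p + p.2.2 ^ 2 := by
  have h1 := norm_nonneg p
  have h2 := sqRad_nonneg p
  have h3 := sq_nonneg p.2.2
  rcases le_max_iff.1 (norm_le_sqRad p) with h | h
  · have := pow_le_pow_left₀ h1 h 2
    rw [Real.sq_sqrt h2] at this
    linarith
  · have := pow_le_pow_left₀ h1 h 2
    rw [sq_abs] at this
    linarith

/-- The Hamiltonian `m z + (3c/2) ∑_{i<k} x_i y_i`. -/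
def diagHam (k : ℕ) (m c : ℝ) (p : Std n) : ℝ :=
  m * p.2.2 + c * ∑ i : Fin n, if (i : ℕ) < k then 3 / 2 * (p.1 i * p.2.1 i) else 0

/-- The linear diagonal field with Hamiltonian `diagHam`. -/
def diagField (k : ℕ) (m c : ℝ) (p : Std n) : Std n :=
  (fun i => if (i : ℕ) < k then (m / 2 - 3 * c / 2) * p.1 i else m / 2 * p.1 i,
   fun i => if (i : ℕ) < k then (m / 2 + 3 * c / 2) * p.2.1 i else m / 2 * p.2.1 i,
   m * p.2.2)

lemma diagField_one (k : ℕ) (p : Std n) : diagField k 1 1 p = subField k p := by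
  refine Prod.ext ?_ (Prod.ext ?_ ?_)
  · ext i; simp only [diagField, subField]; split_ifs <;> ring
  · ext i; simp only [diagField, subField]; split_ifs <;> ring
  · simp [diagField, subField]

lemma diagField_add_smul (k : ℕ) (m c m' c' s : ℝ) (p : Std n) :
    diagField k (m + s * m') (c + s * c') p = diagField k m c p + s • diagField k m' c' p := by
  refine Prod.ext ?_ (Prod.ext ?_ ?_)
  · ext i; simp only [diagField, Prod.fst_add, Prod.smul_fst, Pi.add_apply, Pi.smul_apply, smul_eq_mul]
    split_ifs <;> ring
  · ext i; simp only [diagField, Prod.fst_add, Prod.smul_fst, Prod.snd_add, Prod.smul_snd, Pi.add_apply,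
      Pi.smul_apply, smul_eq_mul]
    split_ifs <;> ring
  · simp only [diagField, Prod.snd_add, Prod.smul_snd, smul_eq_mul]
    ring

lemma hasFDerivAt_diagHam (k : ℕ) (m c : ℝ) (p : Std n) :
    HasFDerivAt (diagHam k m c) (m • coordZ + c • ∑ i : Fin n, if (i : ℕ) < k then
      (3 / 2 : ℝ) • (p.1 i • coordY i + p.2.1 i • coordX i) else 0) p := by
  refine ((coordZ.hasFDerivAt (x := p)).const_mul m).add (HasFDerivAt.const_mul ?_ c)
  refine HasFDerivAt.fun_sum fun i _ => ?_
  split_ifs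
  · exact (((coordX i).hasFDerivAt (x := p)).mul ((coordY i).hasFDerivAt (x := p))).const_mul _
  · exact hasFDerivAt_const _ _

lemma contDiff_diagHam (k : ℕ) (m c : ℝ) : ContDiff ℝ ∞ (diagHam k m c : Std n → ℝ) := by
  refine (contDiff_const.mul coordZ.contDiff).add (contDiff_const.mul (ContDiff.sum fun i _ => ?_))
  split_ifs
  · exact contDiff_const.mul ((coordX i).contDiff.mul (coordY i).contDiff)
  · exact contDiff_const

lemma stdHam_diagHam (k : ℕ) (m c : ℝ) (p : Std n) :
    stdHam p (diagHam k m c p) (fderiv ℝ (diagHam k m c) p) = diagField k m c p := by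
  rw [(hasFDerivAt_diagHam k m c p).fderiv]
  obtain ⟨e, he⟩ : ∃ e : Std n →L[ℝ] ℝ, e = (m • coordZ + c • ∑ i : Fin n, if (i : ℕ) < k then
      (3 / 2 : ℝ) • (p.1 i • coordY i + p.2.1 i • coordX i) else 0) := ⟨_, rfl⟩
  have hv : ∀ v : Std n, e v = m * v.2.2 + c * ∑ i : Fin n, if (i : ℕ) < k then
        3 / 2 * (p.1 i * v.2.1 i + p.2.1 i * v.1 i) else 0 := fun v => by
    simp only [he, add_apply, smul_apply, smul_eq_mul,
      sum_apply, coordZ_apply]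
    congr 3
    ext i
    split_ifs <;> simp [mul_add]
  rw [← he]
  have hz : e vecZ = m := by simp [hv, vecZ]
  have hx : ∀ j, e (vecX j) = if (j : ℕ) < k then 3 / 2 * c * p.2.1 j else 0 := fun j => by
    rw [hv]
    simp [vecX, Pi.single_apply, ← ite_and]
    rw [Finset.sum_eq_single j]
    · split_ifs <;> simp_all; ring
    · intro i _ hij
      rw [if_neg]
      rintro ⟨_, rfl⟩
      exact hij rfl
    · simp
  have hy : ∀ j, e (vecY j) = if (j : ℕ) < k then 3 / 2 * c * p.1 j else 0 := fun j => by
    rw [hv]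
    simp [vecY, Pi.single_apply, ← ite_and]
    rw [Finset.sum_eq_single j]
    · split_ifs <;> simp_all; ring
    · intro i _ hij
      rw [if_neg]
      rintro ⟨_, rfl⟩
      exact hij rfl
    · simp
  refine Prod.ext ?_ (Prod.ext ?_ ?_)
  · ext i; simp only [stdHam, diagField, hz, hy]; split_ifs <;> ring
  · ext i; simp only [stdHam, diagField, hz, hx]; split_ifs <;> ring
  · simp only [stdHam, diagField, hx, hy, diagHam]
    rw [add_sub_assoc, add_eq_left, sub_eq_zero, Finset.mul_sum, Finset.mul_sum]
    refine Finset.sum_congr rfl fun i _ => ?_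
    split_ifs <;> ring

lemma hasFDerivAt_subFun (k : ℕ) (p : Std n) :
    HasFDerivAt (subFun k) ((2 * p.2.2) • coordZ + ∑ i : Fin n,
      ((if (i : ℕ) < k then -(2 * p.1 i) else 2 * p.1 i) • coordX i +
        (2 * p.2.1 i) • coordY i)) p := by
  have sq : ∀ e : Std n →L[ℝ] ℝ, HasFDerivAt (fun p => e p ^ 2) ((2 * e p) • e) p := fun e => by
    simpa using (e.hasFDerivAt (x := p)).pow 2
  refine (sq coordZ).add (HasFDerivAt.fun_sum fun i _ => HasFDerivAt.add ?_ (sq (coordY i)))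
  split_ifs
  · exact (sq (coordX i)).neg.congr_fderiv (by rw [coordX_apply]; module)
  · exact sq (coordX i)

lemma contDiff_subFun (k : ℕ) : ContDiff ℝ ∞ (subFun k : Std n → ℝ) := by
  refine (coordZ.contDiff.pow 2).add (ContDiff.sum fun i _ => ContDiff.add ?_
    ((coordY i).contDiff.pow 2))
  split_ifs
  · exact ((coordX i).contDiff.pow 2).neg
  · exact (coordX i).contDiff.pow 2

lemma fderiv_subFun_apply (k : ℕ) (p v : Std n) : fderiv ℝ (subFun k) p v =
    2 * p.2.2 * v.2.2 + ∑ i : Fin n,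
      ((if (i : ℕ) < k then -(2 * p.1 i) else 2 * p.1 i) * v.1 i + 2 * p.2.1 i * v.2.1 i) := by
  rw [(hasFDerivAt_subFun k p).fderiv]
  simp only [add_apply, smul_apply, smul_eq_mul,
    sum_apply, coordX_apply, coordY_apply, coordZ_apply]

/-- Everything is diagonal: the rates are `2m` on `z`, `3c - m` and `m + 3c` on `x_i` and `y_i` with
`i < k`, and `m` on the other coordinates. -/
lemma diagField_lyapunov {k : ℕ} {m c r : ℝ} (hr : 0 ≤ r) (h1 : r ≤ m) (h2 : r ≤ 3 * c - m)
    (p : Std n) : r * (sqRad p + p.2.2 ^ 2) ≤ fderiv ℝ (subFun k) p (diagField k m c p) := by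
  rw [fderiv_subFun_apply, mul_add, add_comm, sqRad, Finset.mul_sum]
  refine add_le_add ?_ (Finset.sum_le_sum fun i _ => ?_)
  · simp only [diagField]
    nlinarith [sq_nonneg p.2.2]
  · simp only [diagField]
    have hx := sq_nonneg (p.1 i)
    have hy := sq_nonneg (p.2.1 i)
    have a1 : r * (p.1 i) ^ 2 ≤ m * (p.1 i) ^ 2 := by gcongr
    have a2 : r * (p.2.1 i) ^ 2 ≤ m * (p.2.1 i) ^ 2 := by gcongr
    have a3 : r * (p.1 i) ^ 2 ≤ (3 * c - m) * (p.1 i) ^ 2 := by gcongr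
    have a4 : r * (p.2.1 i) ^ 2 ≤ (m + 3 * c) * (p.2.1 i) ^ 2 := by
      gcongr; linarith
    split_ifs <;> linarith

end StdMoves

/-! ### The chain of moves from adapted coordinates to the standard model. -/

section StdChain

variable {n : ℕ} {V : Set (Std n)} {J : Set ℝ} {d : LocalData (Std n)}

lemma contDiff_coordZ_sq_add : ContDiff ℝ ∞ (fun p : Std n => sqRad p ^ 2 + p.2.2 ^ 2) :=
  (contDiff_sqRad.pow 2).add (coordZ.contDiff.pow 2)

lemma hasFDerivAt_sqRad (p : Std n) : HasFDerivAt sqRad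
    (∑ i, ((2 * p.1 i) • coordX i + (2 * p.2.1 i) • coordY i)) p := by
  have sq : ∀ e : Std n →L[ℝ] ℝ, HasFDerivAt (fun p => e p ^ 2) ((2 * e p) • e) p := fun e => by
    simpa using (e.hasFDerivAt (x := p)).pow 2
  exact HasFDerivAt.fun_sum fun i _ => (sq (coordX i)).add (sq (coordY i))

/-- The error term of a cutoff in `sqRad ^ 2 + z ^ 2` of the Reeb flow. -/
lemma reeb_cutoff_estimate {k : ℕ} {l : ℝ → ℝ} (hl : ContDiff ℝ ∞ l) {η : ℝ}
    (hη : ∀ τ, |τ * deriv l τ| ≤ η) {p : Std n} (hp : sqRad p ≤ 1) :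
    |p.2.2 * fderiv ℝ (subFun k) p
      (stdHam p 0 (fderiv ℝ (fun p => l (sqRad p ^ 2 + p.2.2 ^ 2)) p))| ≤ 14 * η * sqRad p := by
  obtain ⟨q, hq⟩ : ∃ q, q = sqRad p := ⟨_, rfl⟩
  obtain ⟨z, hz⟩ : ∃ z, z = p.2.2 := ⟨_, rfl⟩
  -- In `N = q² + z²` the coordinate `z` has the same weight as the squared radius `q`. All terms of
  -- the error then have the form `D` times a quadratic expression in `q` and `z`, up to bounded
  -- factors, times `q`; the slow variation `N |l'(N)| ≤ η` absorbs the quadratic part and leaves a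
  -- multiple of `η q`. An isotropic cutoff would not do this, because the Hamiltonian `z` is only
  -- of first order.
  obtain ⟨D, hD⟩ : ∃ D, D = deriv l (q ^ 2 + z ^ 2) := ⟨_, rfl⟩
  have hN : HasFDerivAt (fun p : Std n => sqRad p ^ 2 + p.2.2 ^ 2)
      ((2 * q) • (∑ i, ((2 * p.1 i) • coordX i + (2 * p.2.1 i) • coordY i)) +
        (2 * z) • coordZ) p := by
    have h1 := (hasFDerivAt_sqRad p).pow 2
    have h2 := (coordZ.hasFDerivAt (x := p)).pow 2
    refine (h1.add h2).congr_fderiv ?_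
    simp [hq, hz]
  have hd := ((hl.differentiable (by simp) (q ^ 2 + z ^ 2)).hasDerivAt)
  rw [hq, hz] at hd
  obtain ⟨e, he⟩ : ∃ e, e = fderiv ℝ (fun p => l (sqRad p ^ 2 + p.2.2 ^ 2)) p := ⟨_, rfl⟩
  have he' := (hd.comp_hasFDerivAt p hN).fderiv
  have hev : ∀ v : Std n, e v = D * (2 * q * (∑ i, (2 * p.1 i * v.1 i + 2 * p.2.1 i * v.2.1 i)) +
      2 * z * v.2.2) := fun v => by
    rw [he]
    refine (congrArg (fun L => L v) he').trans ?_
    simp [hD, hq, hz, sum_apply, mul_add]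
  have hx : ∀ i, e (vecX i) = D * (4 * q * p.1 i) := fun i => by
    rw [hev]
    simp only [vecX, Pi.single_apply, Pi.zero_apply, mul_zero, add_zero, mul_ite, mul_one,
      Finset.sum_ite_eq', Finset.mem_univ, if_true]
    ring
  have hy : ∀ i, e (vecY i) = D * (4 * q * p.2.1 i) := fun i => by
    rw [hev]
    simp only [vecY, Pi.single_apply, Pi.zero_apply, mul_zero, zero_add, add_zero, mul_ite, mul_one,
      Finset.sum_ite_eq', Finset.mem_univ, if_true]
    ring
  have hzz : e vecZ = D * (2 * z) := by
    rw [hev]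
    simp [vecZ]
  have hqs : ∑ i, (p.1 i * e (vecX i) + p.2.1 i * e (vecY i)) = D * (4 * q) * q := by
    rw [show D * (4 * q) * q = D * (4 * q) * ∑ i, (p.1 i ^ 2 + p.2.1 i ^ 2) by rw [← sqRad, ← hq],
      Finset.mul_sum]
    refine Finset.sum_congr rfl fun i _ => ?_
    rw [hx, hy]
    ring
  have hq0 : 0 ≤ q := hq ▸ sqRad_nonneg p
  rw [← he, fderiv_subFun_apply, ← hq, ← hz]
  rw [← hq] at hp
  obtain ⟨S, hS⟩ : ∃ S, S = ∑ i : Fin n, ((if (i : ℕ) < k then -(2 * p.1 i) else 2 * p.1 i) *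
    (stdHam p 0 e).1 i + 2 * p.2.1 i * (stdHam p 0 e).2.1 i) := ⟨_, rfl⟩
  have hSb : |S| ≤ |D| * (2 * |z| + 8 * q) * q := by
    rw [hS]
    refine (Finset.abs_sum_le_sum_abs _ _).trans ?_
    rw [show |D| * (2 * |z| + 8 * q) * q = |D| * (2 * |z| + 8 * q) *
      ∑ i, (p.1 i ^ 2 + p.2.1 i ^ 2) by rw [← sqRad, ← hq], Finset.mul_sum]
    refine Finset.sum_le_sum fun i _ => ?_
    have e1 : (stdHam p 0 e).1 i = D * (z * p.1 i - 4 * q * p.2.1 i) := by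
      simp only [stdHam, hzz, hy]
      ring
    have e2 : (stdHam p 0 e).2.1 i = D * (z * p.2.1 i + 4 * q * p.1 i) := by
      simp only [stdHam, hzz, hx]
      ring
    rw [e1, e2]
    have key : ∀ s : ℝ, |s| ≤ 1 → |s * (2 * p.1 i) * (D * (z * p.1 i - 4 * q * p.2.1 i)) +
        2 * p.2.1 i * (D * (z * p.2.1 i + 4 * q * p.1 i))| ≤
        |D| * (2 * |z| + 8 * q) * (p.1 i ^ 2 + p.2.1 i ^ 2) := by
      intro s hs
      have e3 : s * (2 * p.1 i) * (D * (z * p.1 i - 4 * q * p.2.1 i)) +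
          2 * p.2.1 i * (D * (z * p.2.1 i + 4 * q * p.1 i)) =
          D * (2 * z * (s * p.1 i ^ 2 + p.2.1 i ^ 2) + 8 * q * ((1 - s) * (p.1 i * p.2.1 i))) := by
        ring
      have hxs : |s * p.1 i ^ 2 + p.2.1 i ^ 2| ≤ p.1 i ^ 2 + p.2.1 i ^ 2 := by
        refine (abs_add_le _ _).trans ?_
        rw [abs_mul, abs_of_nonneg (sq_nonneg (p.1 i)), abs_of_nonneg (sq_nonneg (p.2.1 i))]
        have := mul_le_of_le_one_left (sq_nonneg (p.1 i)) hs
        linarith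
      have hxy : |(1 - s) * (p.1 i * p.2.1 i)| ≤ p.1 i ^ 2 + p.2.1 i ^ 2 := by
        rw [abs_mul]
        have h1 : |1 - s| ≤ 2 := by
          rw [abs_le] at hs ⊢
          constructor <;> linarith [hs.1, hs.2]
        have h2 : 2 * |p.1 i * p.2.1 i| ≤ p.1 i ^ 2 + p.2.1 i ^ 2 := by
          rw [abs_mul]
          have := two_mul_le_add_sq |p.1 i| |p.2.1 i|
          rw [sq_abs, sq_abs] at this
          linarith
        have := mul_le_mul_of_nonneg_right h1 (abs_nonneg (p.1 i * p.2.1 i))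
        linarith
      rw [e3, abs_mul, mul_assoc |D|]
      refine mul_le_mul_of_nonneg_left ?_ (abs_nonneg D)
      refine (abs_add_le _ _).trans ?_
      rw [abs_mul (2 * z), abs_mul 2 z, abs_mul (8 * q), abs_of_nonneg (by positivity : 0 ≤ 8 * q),
        abs_of_pos (by norm_num : (0 : ℝ) < 2), add_mul]
      gcongr
    split_ifs
    · have := key (-1) (by norm_num)
      rwa [neg_one_mul] at this
    · have := key 1 (by norm_num)
      rwa [one_mul] at this
  rw [← hS]
  have e3 : (stdHam p 0 e).2.2 = -(2 * D * q ^ 2) := by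
    simp only [stdHam, hqs]
    ring
  rw [e3]
  have hη' : (q ^ 2 + z ^ 2) * |D| ≤ η := by
    have := hη (q ^ 2 + z ^ 2)
    rwa [abs_mul, ← hD, abs_of_nonneg (by positivity)] at this
  have hD0 := abs_nonneg D
  have hz0 := abs_nonneg z
  have hzz' : |z| * |z| = z ^ 2 := by rw [← sq, sq_abs]
  calc |z * (2 * z * -(2 * D * q ^ 2) + S)| ≤
        |z| * (4 * |z| * |D| * q ^ 2 + |D| * (2 * |z| + 8 * q) * q) := by
        rw [abs_mul]
        gcongr
        refine (abs_add_le _ _).trans (add_le_add (le_of_eq ?_) hSb)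
        rw [show 2 * z * -(2 * D * q ^ 2) = -(4 * z * D * q ^ 2) by ring, abs_neg, abs_mul, abs_mul,
          abs_mul, abs_of_nonneg (sq_nonneg q)]
        norm_num
    _ = |D| * (4 * z ^ 2 * q + 2 * z ^ 2 + 8 * (|z| * q)) * q := by
        rw [← hzz']; ring
    _ ≤ |D| * (14 * (q ^ 2 + z ^ 2)) * q := by
        gcongr
        have h1 : 4 * z ^ 2 * q ≤ 4 * z ^ 2 := mul_le_of_le_one_right (by positivity) hp
        have h2 := two_mul_le_add_sq |z| q
        rw [sq_abs] at h2
        have := sq_nonneg q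
        have := sq_nonneg z
        linarith
    _ = 14 * ((q ^ 2 + z ^ 2) * |D|) * q := by ring
    _ ≤ 14 * η * q := by gcongr

/-- Changing the rate of contraction along the Reeb direction to its standard value. -/
lemma LocalData.Valid.exists_move_reeb {k : ℕ} {m c r : ℝ} (hV : IsOpen V) (h0V : (0 : Std n) ∈ V)
    (hd : d.Valid V J) (hm : 0 < m) (hc : max 1 m ≤ c)
    (hd0 : ∀ᶠ w in 𝓝 0, d w = (stdCovector w, diagField k m c w, subFun k w + r)) :
    ∃ d' : LocalData (Std n), LocalData.Move V J d d' ∧ ∀ᶠ w in 𝓝 0,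
      d' w = (stdCovector w, diagField k 1 c w, subFun k w + r) := by
  have hq1 : ∀ᶠ w in 𝓝 (0 : Std n), sqRad w < 1 := by
    have := (contDiff_sqRad (n := n)).continuous.continuousAt (x := 0)
    exact this.eventually (gt_mem_nhds (by simp [sqRad]))
  obtain ⟨ρ, hρ, hest⟩ := Metric.eventually_nhds_iff_ball.1
    ((hV.eventually_mem h0V).and (hd0.eventually_nhds.and hq1))
  obtain ⟨ρ₁, hρ₁⟩ : ∃ ρ₁, ρ₁ = min 1 (ρ / 2) := ⟨_, rfl⟩
  have hρ₁0 : 0 < ρ₁ := by rw [hρ₁]; positivity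
  have hρ₁1 : ρ₁ ≤ 1 := hρ₁ ▸ min_le_left _ _
  have hρ₁2 : ρ₁ ≤ ρ / 2 := hρ₁ ▸ min_le_right _ _
  obtain ⟨c', hc'⟩ : ∃ c', c' = min 1 m := ⟨_, rfl⟩
  have hc'0 : 0 < c' := by rw [hc']; positivity
  have hc'1 : c' ≤ 1 := hc' ▸ min_le_left _ _
  have hc'm : c' ≤ m := hc' ▸ min_le_right _ _
  have hc1 := (le_max_left 1 m).trans hc
  have hcm := (le_max_right 1 m).trans hc
  -- The slope is such that the error `14 η |1 - m| sqRad` is at most half of `c' sqRad`. For `‖w‖ ≥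
  -- ρ₁` either `sqRad ≥ ρ₁²` or `|z| ≥ ρ₁ ≥ ρ₁²`, as `ρ₁ ≤ 1`; so the cutoff variable is then at
  -- least `ρ₁⁴`.
  obtain ⟨l, hl, hl01, hl1, hl0, hlb⟩ := exists_log_cutoff (η := c' / (28 * (|1 - m| + 1)))
    (τ₀ := ρ₁ ^ 4) (by positivity) (by positivity)
  obtain ⟨σ, hσ⟩ : ∃ σ : Std n → ℝ, σ = fun w => l (sqRad w ^ 2 + w.2.2 ^ 2) := ⟨_, rfl⟩
  have sσ : ContDiff ℝ ∞ σ := hσ ▸ hl.comp contDiff_coordZ_sq_add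
  have hσ1 : ∀ᶠ w in 𝓝 0, σ w = 1 := by
    have := (contDiff_coordZ_sq_add (n := n)).continuous.continuousAt (x := 0)
    simp only [hσ]
    refine this.eventually (p := fun τ => l τ = 1) ?_
    simpa [sqRad] using hl1
  have hσ0 : ∀ w, ρ / 2 ≤ ‖w‖ → σ w = 0 := fun w hw => by
    rw [hσ]
    refine hl0 _ ?_
    have h1 := (hρ₁2.trans hw).trans (norm_le_sqRad w)
    have h2 := sqRad_nonneg w
    rcases le_max_iff.1 h1 with h | h
    · have := pow_le_pow_left₀ hρ₁0.le h 4
      rw [show Real.sqrt (sqRad w) ^ 4 = (Real.sqrt (sqRad w) ^ 2) ^ 2 by ring, Real.sq_sqrt h2]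
        at this
      linarith [sq_nonneg w.2.2]
    · have := pow_le_pow_left₀ hρ₁0.le h 2
      rw [sq_abs] at this
      have h4 : ρ₁ ^ 4 ≤ ρ₁ ^ 2 := pow_le_pow_of_le_one hρ₁0.le hρ₁1 (by norm_num)
      linarith [sq_nonneg (sqRad w)]
  obtain ⟨g, hg⟩ : ∃ g : Std n → ℝ, g = fun w => σ w * diagHam k (1 - m) 0 w := ⟨_, rfl⟩
  have sg : ContDiff ℝ ∞ g := hg ▸ sσ.mul (contDiff_diagHam k _ _)
  have hZ : ∀ w, stdHam w (g w) (fderiv ℝ g w) = σ w • diagField k (1 - m) 0 w +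
      ((1 - m) * w.2.2) • stdHam w 0 (fderiv ℝ σ w) := fun w => by
    have e1 : fderiv ℝ g w = σ w • fderiv ℝ (diagHam k (1 - m) 0) w +
        diagHam k (1 - m) 0 w • fderiv ℝ σ w := by
      rw [hg]
      exact ((sσ.differentiable (by simp) w).hasFDerivAt.mul
        ((contDiff_diagHam k _ _).differentiable (by simp) w).hasFDerivAt).fderiv
    have e2 : diagHam k (1 - m) 0 w = (1 - m) * w.2.2 := by simp [diagHam]
    have e3 : stdHam w (g w) (fderiv ℝ g w) =
        stdHam w (σ w * diagHam k (1 - m) 0 w + diagHam k (1 - m) 0 w * 0)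
          (σ w • fderiv ℝ (diagHam k (1 - m) 0) w + diagHam k (1 - m) 0 w • fderiv ℝ σ w) := by
      rw [e1, hg, mul_zero, add_zero]
    rw [e3, stdHam_add, stdHam_smul, stdHam_smul, stdHam_diagHam, e2]
  have hf : ∀ w ∈ Metric.ball (0 : Std n) ρ,
      fderiv ℝ (fun w => (d w).2.2) w = fderiv ℝ (subFun k) w := fun w hw => by
    have : (fun w => (d w).2.2) =ᶠ[𝓝 w] fun w => subFun k w + r := by
      filter_upwards [(hest w hw).2.1] with y hy
      rw [hy]
    rw [this.fderiv_eq, fderiv_add_const]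
  refine ⟨_, hd.move_add hV hρ (fun w hw => (hest w hw).1)
    (Z := fun w => stdHam w (g w) (fderiv ℝ g w)) (ψ := fun _ => 0)
    (fun w _ => contDiffAt_stdHam sg.contDiffAt (sg.contDiffAt.fderiv_right (by simp)))
    (fun _ _ => contDiffAt_const) (fun w hw => ?_) (fun w hw => ?_) (fun _ _ => rfl) ?_
    (fderiv_const_apply _) (fun t ht => ⟨c' / 2, by positivity, fun w hw => ?_⟩)
    (fun t _ w hw => by rw [mul_zero, add_zero]; exact hd.mem w (hest w hw).1), ?_⟩
  · refine ContactFieldAt.congr_model contactFieldAt_stdHam ?_ (.refl _ _)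
    filter_upwards [(hest w hw).2.1] with y hy
    rw [hy]
  · rw [fderiv_eq_zero_of_far (g := g) (ρ := ρ / 2)
      (fun w hw => by rw [hg]; simp only [hσ0 w hw, zero_mul]) hw, hg]
    simp only [hσ0 w hw.le, zero_mul, stdHam_zero]
  · simp only [hZ]
    have : (0 : Std n).2.2 = 0 := rfl
    rw [this, mul_zero, zero_smul, add_zero]
    have : diagField k (1 - m) 0 (0 : Std n) = 0 := by
      refine Prod.ext ?_ (Prod.ext ?_ ?_) <;> simp [diagField] <;> rfl
    rw [this, smul_zero]
  · obtain ⟨-, w1, w2⟩ := hest w hw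
    have hσw : σ w ∈ Icc (0 : ℝ) 1 := by rw [hσ]; exact hl01 _
    have hs : t * σ w ∈ Icc (0 : ℝ) 1 := ⟨mul_nonneg ht.1 hσw.1, mul_le_one₀ ht.2 hσw.1 hσw.2⟩
    rw [hf w hw, hZ, w1.self_of_nhds]
    simp only
    rw [fderiv_const_apply, smul_zero, add_zero, smul_add, smul_smul, smul_smul, ← add_assoc,
      ← diagField_add_smul, mul_zero, add_zero, map_add, map_smul, smul_eq_mul]
    -- The intermediate factor `m + s(1 - m)` lies between `m` and 1, and `c ≥ max 1 m`, so `c'`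
    -- bounds all rates below along the whole interpolation.
    have b1 := diagField_lyapunov (n := n) (k := k) (m := m + t * σ w * (1 - m)) (c := c) hc'0.le
      (by nlinarith [hs.1, hs.2]) (by nlinarith [hs.1, hs.2]) w
    have b2 := reeb_cutoff_estimate (k := k) hl hlb w2.le
    rw [← hσ] at b2
    have b3 : |t * ((1 - m) * w.2.2) * fderiv ℝ (subFun k) w (stdHam w 0 (fderiv ℝ σ w))| ≤
        c' / 2 * sqRad w := by
      rw [mul_assoc, mul_assoc (1 - m), abs_mul, abs_mul, abs_of_nonneg ht.1]
      calc _ ≤ 1 * ((|1 - m| + 1) * (14 * (c' / (28 * (|1 - m| + 1))) * sqRad w)) := by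
            gcongr
            · exact ht.2
            · linarith
        _ = _ := by field_simp; ring
    have b4 := norm_sq_le_sqRad w
    have b5 := sq_nonneg w.2.2
    have b6 := (abs_le.1 b3).1
    nlinarith
  · filter_upwards [hσ1.eventually_nhds, hd0] with w hw hdw
    have h1 : fderiv ℝ σ w = 0 := by
      have : σ =ᶠ[𝓝 w] fun _ => 1 := hw
      rw [this.fderiv_eq, fderiv_const_apply]
    rw [hZ, h1, stdHam_zero, hw.self_of_nhds, hdw]
    simp only
    rw [smul_zero, add_zero, ← diagField_add_smul]
    simp

/-- A quadratic Lyapunov function for the linear part is one for the field, near the origin. -/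
lemma eventually_bilin_lyapunov {W : Type*} [NormedAddCommGroup W] [NormedSpace ℝ W]
    {B : W →L[ℝ] W →L[ℝ] ℝ} {A : W →L[ℝ] W} {Y : W → W} {c K : ℝ} (hc : 0 < c)
    (hB : ∀ v, c * ‖v‖ ^ 2 ≤ B v (A v)) (hY : ∀ᶠ w in 𝓝 0, ‖Y w - A w‖ ≤ K * ‖w‖ ^ 2) :
    ∀ᶠ w in 𝓝 0, c / 2 * ‖w‖ ^ 2 ≤ B w (Y w) := by
  have hK : K ≤ |K| + 1 := (le_abs_self K).trans (by linarith)
  have hsm : ∀ᶠ w in 𝓝 (0 : W), ‖w‖ < c / (2 * ((‖B‖ + 1) * (|K| + 1))) := by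
    have : Filter.Tendsto (fun w : W => ‖w‖) (𝓝 0) (𝓝 0) := by
      simpa using continuous_norm.tendsto (0 : W)
    exact this.eventually (gt_mem_nhds (by positivity))
  filter_upwards [hY, hsm] with w h1 h2
  rw [lt_div_iff₀ (by positivity)] at h2
  have h3 := B.le_opNorm₂ w (Y w - A w)
  rw [Real.norm_eq_abs, map_sub] at h3
  have h4 : ‖B‖ * ‖w‖ * ‖Y w - A w‖ ≤ c / 2 * ‖w‖ ^ 2 := by
    calc _ ≤ (‖B‖ + 1) * ‖w‖ * ((|K| + 1) * ‖w‖ ^ 2) := by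
          gcongr
          · linarith
          · exact h1.trans (by gcongr)
      _ = ‖w‖ * (2 * ((‖B‖ + 1) * (|K| + 1))) / 2 * ‖w‖ ^ 2 := by ring
      _ ≤ _ := by gcongr
  linarith [hB w, (abs_le.1 h3).1]

/-- Normalisation of a convex contact structure at a critical point where the Reeb direction
expands, in coordinates which are adapted to the linearisation. -/
theorem LocalData.Valid.exists_moves_std {k : ℕ} (hV : IsOpen V) (h0V : (0 : Std n) ∈ V)
    (hJ : IsOpen J) (hd : d.Valid V J) (ha0 : (d 0).1 = coordZ)
    (hD : ∀ u v : Std n, fderiv ℝ (fun w => (d w).1) 0 u v - fderiv ℝ (fun w => (d w).1) 0 v u =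
      ∑ i, (u.1 i * v.2.1 i - u.2.1 i * v.1 i))
    {m : ℝ} (hm : 0 < m) (hA : ∀ v, (fderiv ℝ (fun w => (d w).2.1) 0 v).2.2 = m * v.2.2)
    {B : Std n →L[ℝ] Std n →L[ℝ] ℝ} (hB : ∀ u v, B u v = B v u) {c : ℝ} (hc : 0 < c)
    (hBA : ∀ v, c * ‖v‖ ^ 2 ≤ B v (fderiv ℝ (fun w => (d w).2.1) 0 v))
    (hBD : ∀ v, c * ‖v‖ ^ 2 ≤ B v (diagField k m (max 1 m) v)) :
    ∃ d' : LocalData (Std n), Relation.ReflTransGen (LocalData.Move V J) d d' ∧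
      ∀ᶠ w in 𝓝 0, d' w = (stdCovector w, subField k w, subFun k w + (d 0).2.2) := by
  obtain ⟨A, hAdef⟩ : ∃ A, A = fderiv ℝ (fun w => (d w).2.1) 0 := ⟨_, rfl⟩
  obtain ⟨f₀, hf₀⟩ : ∃ f₀, f₀ = (d 0).2.2 := ⟨_, rfl⟩
  obtain ⟨M, hM⟩ : ∃ M, M = max 1 m := ⟨_, rfl⟩
  have hM1 : 1 ≤ M := hM ▸ le_max_left _ _
  have hMm : m ≤ M := hM ▸ le_max_right _ _
  rw [← hAdef] at hA hBA
  rw [← hM] at hBD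
  have hle2 : ((2 : ℕ∞) : WithTop ℕ∞) ≤ ∞ := by exact_mod_cast le_top
  have sY : ContDiffAt ℝ ∞ (fun w => (d w).2.1) 0 := (hd.smooth 0 h0V).snd.fst
  obtain ⟨K₁, -, hK₁⟩ := exists_quadratic_bound (g := fun w => (d w).2.1 - A w)
    ((sY.sub A.contDiff.contDiffAt).of_le hle2) (by simp [hd.zero]) (by
      rw [fderiv_fun_sub (sY.differentiableAt (by simp)) A.differentiableAt, A.fderiv, hAdef, sub_self])
  -- the contact form
  obtain ⟨d₁, hm₁, hd₁, K₂, hK₂⟩ := hd.exists_move_form hV h0V contDiff_stdCovector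
    (by rw [ha0]; simp [stdCovector]) (fun u v => by
      rw [fderiv_stdCovector, stdBilin_antisymm, hD])
  have v₁ := hm₁.valid hV h0V
  have hY₁ : ∀ᶠ w in 𝓝 0, ‖(d₁ w).2.1 - A w‖ ≤ (K₂ + K₁) * ‖w‖ ^ 2 := by
    filter_upwards [hK₁, hK₂] with w h1 h2
    have := norm_add_le ((d₁ w).2.1 - (d w).2.1) ((d w).2.1 - A w)
    rw [sub_add_sub_cancel] at this
    linarith
  -- the quadratic function
  obtain ⟨Q, hQ⟩ : ∃ Q : Std n → ℝ, Q = fun w => 1 / 2 * B w w := ⟨_, rfl⟩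
  have sQ : ContDiff ℝ ∞ Q := hQ ▸ contDiff_const.mul (B.contDiff.clm_apply contDiff_id)
  have dQ : ∀ w, HasFDerivAt Q (B w) w := fun w => by
    have h1 := (B.hasFDerivAt (x := w)).clm_apply (hasFDerivAt_id (𝕜 := ℝ) w)
    rw [hQ]
    refine (h1.const_mul (1 / 2)).congr_fderiv ?_
    refine ContinuousLinearMap.ext fun v => ?_
    simp only [smul_apply, add_apply,
      ContinuousLinearMap.flip_apply, smul_eq_mul, ContinuousLinearMap.comp_apply,
      ContinuousLinearMap.id_apply, id, hB v w]
    ring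
  have hQ0 : Q 0 = 0 := by simp [hQ]
  have hBY₁ := eventually_bilin_lyapunov hc hBA hY₁
  have hT0 : ∀ w : Std n, stdHam w 0 (fderiv ℝ (fun _ : Std n => (0 : ℝ)) w) = 0 := fun w => by
    rw [fderiv_const_apply, stdHam_zero]
  have hf₁ : ∀ᶠ w in 𝓝 0, (d₁ w).2.2 = (d w).2.2 := hd₁.mono fun w hw => hw.2
  -- With the field fixed, the inequality is linear in the function, so the segment from the old
  -- function to `F` consists of Lyapunov functions. This is applied to `Q` and, once the field is
  -- diagonal, to `subFun k`.
  have hfun : ∀ {d₁ : LocalData (Std n)} (v₁ : d₁.Valid V J) {F : Std n → ℝ}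
      (_ : ContDiff ℝ ∞ F) (_ : F 0 = 0) (_ : fderiv ℝ F 0 = 0)
      (_ : ∀ᶠ w in 𝓝 0, (d₁ w).1 = stdCovector w) {c' : ℝ} (_ : 0 < c')
      (_ : ∀ᶠ w in 𝓝 0, c' * ‖w‖ ^ 2 ≤ fderiv ℝ F w (d₁ w).2.1),
      ∃ d' : LocalData (Std n), LocalData.Move V J d₁ d' ∧ ∀ᶠ w in 𝓝 0,
        d' w = ((d₁ w).1, (d₁ w).2.1, F w + (d₁ 0).2.2) := by
    intro d₁ v₁ F sF F0 dF0 ha₁ c' hc' hF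
    obtain ⟨c₂, hc₂, hg⟩ := v₁.growth
    have sf : ∀ w ∈ V, ContDiffAt ℝ ∞ (fun w => (d₁ w).2.2) w := fun w hw =>
      (v₁.smooth w hw).snd.snd
    have sF' : ContDiff ℝ ∞ (fun w => F w + (d₁ 0).2.2) := sF.add contDiff_const
    have dψ : ∀ w ∈ V, fderiv ℝ (fun w => F w + (d₁ 0).2.2 - (d₁ w).2.2) w =
        fderiv ℝ F w - fderiv ℝ (fun w => (d₁ w).2.2) w := fun w hw => by
      rw [fderiv_fun_sub (sF'.differentiable (by simp) w) ((sf w hw).differentiableAt (by simp)),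
        fderiv_add_const]
    obtain ⟨d', h1, h2⟩ := v₁.exists_move_ham hV h0V hJ ha₁ (g := fun _ => 0)
      (ψ := fun w => F w + (d₁ 0).2.2 - (d₁ w).2.2) (c := min c' c₂)
      (.of_forall fun w => contDiffAt_const)
      ((hV.eventually_mem h0V).mono fun w hw => sF'.contDiffAt.sub (sf w hw)) rfl
      (fderiv_const_apply _) (by simp only [F0, zero_add, sub_self])
      (by rw [dψ 0 h0V, dF0, v₁.critical, sub_zero]) (by positivity) (by
        filter_upwards [hF, hg, hV.eventually_mem h0V] with w h1 h2 h3 s hs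
        rw [dψ w h3, hT0, smul_zero, add_zero]
        simp only [add_apply, smul_apply, smul_eq_mul,
          sub_apply]
        have h4 : min c' c₂ * ‖w‖ ^ 2 ≤ c' * ‖w‖ ^ 2 := by gcongr; exact min_le_left _ _
        have h5 : min c' c₂ * ‖w‖ ^ 2 ≤ c₂ * ‖w‖ ^ 2 := by gcongr; exact min_le_right _ _
        nlinarith [hs.1, hs.2])
    refine ⟨d', h1, ?_⟩
    filter_upwards [h2] with w hw
    rw [hw, hT0, add_zero, add_sub_cancel]
  obtain ⟨d₂, hm₂, hd₂⟩ := hfun v₁ sQ hQ0 (by rw [(dQ 0).fderiv, map_zero])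
    (hd₁.mono fun w hw => hw.1) (half_pos hc) (by simpa only [(dQ _).fderiv] using hBY₁)
  have v₂ := hm₂.valid hV h0V
  have ha₂ : ∀ᶠ w in 𝓝 0, (d₂ w).1 = stdCovector w := by
    filter_upwards [hd₁, hd₂] with w h1 h2
    rw [h2]
    exact h1.1
  have hY₂ : ∀ᶠ w in 𝓝 0, ‖(d₂ w).2.1 - A w‖ ≤ (K₂ + K₁) * ‖w‖ ^ 2 := by
    filter_upwards [hY₁, hd₂] with w h1 h2
    rw [h2]
    exact h1
  -- the field
  have sY₂ : ∀ w ∈ V, ContDiffAt ℝ ∞ (fun w => (d₂ w).2.1) w := fun w hw =>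
    (v₂.smooth w hw).snd.fst
  -- The moves so far changed the field by `O(‖w‖²)` only, so its linearisation is still `A`. In
  -- particular the Hamiltonian `h` has differential `m dz` at the origin, like `diagHam k m M`.
  have dY₂ : HasFDerivAt (fun w => (d₂ w).2.1) A 0 := by
    have h1 : (fun w => (d₂ w).2.1 - A w) =O[𝓝 0] fun w => ‖w - 0‖ ^ 2 :=
      Asymptotics.IsBigO.of_bound (K₂ + K₁) (by
        filter_upwards [hY₂] with w hw
        simpa using hw)
    have := (h1.hasFDerivAt (by norm_num : 1 < 2)).fun_add (A.hasFDerivAt (x := (0 : Std n)))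
    simpa using this
  obtain ⟨h, hh⟩ : ∃ h : Std n → ℝ, h = fun w => stdCovector w (d₂ w).2.1 := ⟨_, rfl⟩
  have sh : ∀ w ∈ V, ContDiffAt ℝ ∞ h w := fun w hw =>
    hh ▸ contDiff_stdCovector.contDiffAt.clm_apply (sY₂ w hw)
  have dh : fderiv ℝ h 0 = m • coordZ := by
    have h1 := ((contDiff_stdCovector.differentiable (by simp) 0).hasFDerivAt).clm_apply dY₂
    rw [hh, h1.fderiv]
    refine ContinuousLinearMap.ext fun v => ?_
    simp [v₂.zero, stdCovector, hA]
  have hham : ∀ᶠ w in 𝓝 0, (d₂ w).2.1 = stdHam w (h w) (fderiv ℝ h w) := by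
    filter_upwards [ha₂.eventually_nhds, hV.eventually_mem h0V] with w h1 h2
    have := (v₂.field w h2).congr_model (a' := stdCovector) (by
      filter_upwards [h1] with y hy
      exact hy.symm) (.refl _ _)
    rw [hh]
    exact this.eq_stdHam
  have hfd₂ : ∀ᶠ w in 𝓝 0, fderiv ℝ (fun w => (d₂ w).2.2) w = B w := by
    filter_upwards [hd₂.eventually_nhds] with w hw
    have : (fun w => (d₂ w).2.2) =ᶠ[𝓝 w] fun w => Q w + (d₁ 0).2.2 := by
      filter_upwards [hw] with y hy
      rw [hy]
    rw [this.fderiv_eq, fderiv_add_const, (dQ w).fderiv]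
  have dg : ∀ w ∈ V, fderiv ℝ (fun w => diagHam k m M w - h w) w =
      fderiv ℝ (diagHam k m M) w + (-1 : ℝ) • fderiv ℝ h w := fun w hw => by
    rw [fderiv_fun_sub ((contDiff_diagHam k m M).differentiable (by simp) w)
      ((sh w hw).differentiableAt (by simp))]
    module
  have hTg : ∀ᶠ w in 𝓝 0, stdHam w (diagHam k m M w - h w)
      (fderiv ℝ (fun w => diagHam k m M w - h w) w) = diagField k m M w - (d₂ w).2.1 := by
    filter_upwards [hham, hV.eventually_mem h0V] with w h1 h2
    rw [dg w h2, h1, sub_eq_add_neg, ← neg_one_mul, stdHam_add_smul, stdHam_diagHam]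
    module
  -- The quadratic function is Lyapunov for the present field and for the diagonal one, hence for
  -- the segment between them. The difference of the Hamiltonians has vanishing 1-jet, as
  -- `exists_move_ham` requires.
  obtain ⟨d₃, hm₃, hd₃⟩ := v₂.exists_move_ham hV h0V hJ ha₂ (g := fun w => diagHam k m M w - h w)
    (ψ := fun _ => 0) (c := c / 2)
    ((hV.eventually_mem h0V).mono fun w hw => (contDiff_diagHam k m M).contDiffAt.sub (sh w hw))
    (.of_forall fun w => contDiffAt_const) (by simp [hh, v₂.zero, diagHam])
    (by
      rw [dg 0 h0V, dh, (hasFDerivAt_diagHam k m M 0).fderiv]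
      have : (∑ i : Fin n, if (i : ℕ) < k then
        (3 / 2 : ℝ) • ((0 : Std n).1 i • coordY i + (0 : Std n).2.1 i • coordX i) else
          (0 : Std n →L[ℝ] ℝ)) = 0 := Finset.sum_eq_zero fun i _ => by simp
      rw [this]
      module) rfl (fderiv_const_apply _) (half_pos hc) (by
      filter_upwards [hTg, hfd₂, eventually_bilin_lyapunov hc hBA hY₂] with w h1 h2 h3 s hs
      rw [fderiv_const_apply, smul_zero, add_zero, h1, h2, map_add, map_smul, map_sub, smul_eq_mul]
      have h4 := hBD w
      have h5 : 0 ≤ c * ‖w‖ ^ 2 := by positivity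
      nlinarith [hs.1, hs.2])
  have v₃ := hm₃.valid hV h0V
  have hd₃' : ∀ᶠ w in 𝓝 0, (d₃ w).1 = stdCovector w ∧ (d₃ w).2.1 = diagField k m M w := by
    filter_upwards [hd₃, hTg, ha₂] with w h1 h2 h3
    rw [h1]
    exact ⟨h3, by simp only [h2, add_sub_cancel]⟩
  have hsub : ∀ p : Std n, m * ‖p‖ ^ 2 ≤ fderiv ℝ (subFun k) p (diagField k m M p) := fun p => by
    refine le_trans ?_ (diagField_lyapunov hm.le le_rfl (by linarith) p)
    gcongr
    exact norm_sq_le_sqRad p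
  have dsub0 : fderiv ℝ (subFun k : Std n → ℝ) 0 = 0 := by
    refine ContinuousLinearMap.ext fun v => ?_
    rw [fderiv_subFun_apply]
    simp
  have sub0 : subFun k (0 : Std n) = 0 := by simp [subFun]
  -- the standard function
  obtain ⟨d₄, hm₄, hd₄⟩ := hfun v₃ (contDiff_subFun k) sub0 dsub0 (hd₃'.mono fun w hw => hw.1) hm
    (by
      filter_upwards [hd₃'] with w hw
      rw [hw.2]
      exact hsub w)
  have v₄ := hm₄.valid hV h0V
  have hr : (d₃ 0).2.2 = f₀ := by
    rw [hd₃.self_of_nhds, hd₂.self_of_nhds]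
    simp only [hQ0, zero_add, add_zero, hf₁.self_of_nhds, hf₀]
  have hd₄' : ∀ᶠ w in 𝓝 0, d₄ w = (stdCovector w, diagField k m M w, subFun k w + f₀) := by
    filter_upwards [hd₄, hd₃'] with w h1 h2
    rw [h1, h2.1, h2.2, hr]
  -- the remaining parameters
  obtain ⟨d₅, hm₅, hd₅⟩ := v₄.exists_move_reeb hV h0V hm hM.ge hd₄'
  have v₅ := hm₅.valid hV h0V
  have hTc : ∀ w : Std n, stdHam w (diagHam k 0 (1 - M) w) (fderiv ℝ (diagHam k 0 (1 - M)) w) =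
      diagField k 0 (1 - M) w := stdHam_diagHam k 0 (1 - M)
  -- The parameter `c` enters the Hamiltonian only through the quadratic term in `x_i y_i`, so
  -- changing it from `M` to 1 is a move of second order.
  obtain ⟨d₆, hm₆, hd₆⟩ := v₅.exists_move_ham hV h0V hJ (hd₅.mono fun w hw => by rw [hw])
    (g := diagHam k 0 (1 - M)) (ψ := fun _ => 0) (c := 1)
    (.of_forall fun w => (contDiff_diagHam _ _ _).contDiffAt)
    (.of_forall fun w => contDiffAt_const) (by simp [diagHam]) (by
      rw [(hasFDerivAt_diagHam k 0 (1 - M) 0).fderiv]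
      have : (∑ i : Fin n, if (i : ℕ) < k then
        (3 / 2 : ℝ) • ((0 : Std n).1 i • coordY i + (0 : Std n).2.1 i • coordX i) else
          (0 : Std n →L[ℝ] ℝ)) = 0 := Finset.sum_eq_zero fun i _ => by simp
      rw [this]
      module) rfl (fderiv_const_apply _) one_pos (by
      filter_upwards [hd₅.eventually_nhds] with w hw s hs
      have e1 : (fun w => (d₅ w).2.2) =ᶠ[𝓝 w] fun w => subFun k w + f₀ := by
        filter_upwards [hw] with y hy
        rw [hy]
      rw [fderiv_const_apply, smul_zero, add_zero, hTc, e1.fderiv_eq, fderiv_add_const,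
        hw.self_of_nhds]
      simp only
      rw [← diagField_add_smul]
      refine le_trans ?_ (diagField_lyapunov zero_le_one (by simp) (by nlinarith [hs.1, hs.2]) w)
      rw [one_mul, one_mul]
      exact norm_sq_le_sqRad w)
  refine ⟨d₆, ?_, ?_⟩
  · exact (((((Relation.ReflTransGen.single hm₁).tail hm₂).tail hm₃).tail hm₄).tail hm₅).tail hm₆
  · filter_upwards [hd₆, hd₅] with w h1 h2
    rw [h1, hTc, h2]
    have := diagField_add_smul k 1 M 0 (1 - M) 1 w
    rw [one_smul, one_mul, one_mul, add_zero, add_sub_cancel, diagField_one] at this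
    simp only [← this, add_zero, hf₀]

end StdChain

/-! ### Operators with a Lyapunov form. -/

section LyapunovAlgebra

variable {V : Type*} [AddCommGroup V] [Module ℝ V]

/-- Representation of the restrictions of linear functionals by a form which is nondegenerate
on a subspace. -/
lemma exists_representing_map [FiniteDimensional ℝ V] (E : Submodule ℝ V) (q b : V →ₗ[ℝ] V →ₗ[ℝ] ℝ)
    (h : ∀ e ∈ E, (∀ e' ∈ E, q e' e = 0) → e = 0) :
    ∃ u : V →ₗ[ℝ] V, ∀ y, u y ∈ E ∧ ∀ e ∈ E, q e (u y) = b e y := by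
  let res : (V →ₗ[ℝ] V →ₗ[ℝ] ℝ) → V →ₗ[ℝ] Module.Dual ℝ E := fun c =>
    (LinearMap.lcomp ℝ ℝ E.subtype).comp c.flip
  let Φ : E →ₗ[ℝ] Module.Dual ℝ E := (res q).comp E.subtype
  have hinj : Function.Injective Φ := by
    refine (injective_iff_map_eq_zero Φ).2 fun e he => ?_
    refine Subtype.ext (h e e.2 fun e' he' => ?_)
    exact DFunLike.congr_fun he ⟨e', he'⟩
  have hsurj : Function.Surjective Φ :=
    (LinearMap.injective_iff_surjective_of_finrank_eq_finrank
      (Subspace.dual_finrank_eq (K := ℝ) (V := E)).symm).1 hinj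
  let e₁ := LinearEquiv.ofBijective Φ ⟨hinj, hsurj⟩
  refine ⟨E.subtype.comp (e₁.symm.toLinearMap.comp (res b)), fun y => ⟨Subtype.coe_prop _,
    fun e he => ?_⟩⟩
  have := DFunLike.congr_fun (e₁.apply_symm_apply (res b y)) ⟨e, he⟩
  exact this

/-- The sign of a Lyapunov form on the kernel of an irreducible polynomial in the operator depends
only on the polynomial. -/
lemma exists_sign_of_irreducible {p : Polynomial ℝ} (hp : Irreducible p) :
    ∃ s : ℝ, (s = 1 ∨ s = -1) ∧ ∀ (A : Module.End ℝ V) (q : V →ₗ[ℝ] V →ₗ[ℝ] ℝ)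
      (_ : ∀ u v, q u v = q v u) (_ : ∀ v, v ≠ 0 → 0 < q v (A v)) (v : V), v ≠ 0 →
      Polynomial.aeval A p v = 0 → 0 < s * q v v := by
  have hdeg := hp.natDegree_le_two
  have hpos := hp.natDegree_pos
  obtain ⟨p₀, h₀⟩ : ∃ r, r = p.coeff 0 := ⟨_, rfl⟩
  obtain ⟨p₁, h₁⟩ : ∃ r, r = p.coeff 1 := ⟨_, rfl⟩
  obtain ⟨p₂, h₂⟩ : ∃ r, r = p.coeff 2 := ⟨_, rfl⟩
  have hA : ∀ (A : Module.End ℝ V) (v : V), Polynomial.aeval A p v =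
      p₀ • v + p₁ • A v + p₂ • A (A v) := fun A v => by
    rw [Polynomial.aeval_eq_sum_range' (Nat.lt_succ_of_le hdeg), Finset.sum_range_succ,
      Finset.sum_range_succ, Finset.sum_range_one, ← h₀, ← h₁, ← h₂]
    simp [sq]
  simp only [hA]
  have hpp : p.leadingCoeff ≠ 0 := Polynomial.leadingCoeff_ne_zero.2 hp.ne_zero
  have fin : ∀ x y : ℝ, x * y < 0 → 0 < (if x < 0 then (1 : ℝ) else -1) * y := fun x y h => by
    split_ifs with hx
    · nlinarith
    · nlinarith
  by_cases hp2 : p₂ = 0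
  · have hp1 : p₁ ≠ 0 := by
      intro h
      rcases Nat.le_succ_iff.1 hdeg with h' | h'
      · have h3 : p.natDegree = 1 := le_antisymm h' hpos
        rw [Polynomial.leadingCoeff, h3, ← h₁] at hpp
        exact hpp h
      · rw [Polynomial.leadingCoeff, h', ← h₂] at hpp
        exact hpp hp2
    -- In degree one, `p₁ A v = -p₀ v`, so `p₀ p₁ q(v, v)` is a negative multiple of `q(v, A v)`.
    refine ⟨if p₀ * p₁ < 0 then 1 else -1, by split_ifs <;> simp, fun A q hq hA v hv h => fin _ _ ?_⟩
    have h3 := congrArg (q v) h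
    simp only [hp2, zero_smul, add_zero, map_add, map_smul, smul_eq_mul, map_zero] at h3
    have h4 : p₀ * p₁ * q v v = -(p₁ ^ 2 * q v (A v)) := by linear_combination p₁ * h3
    have h5 := hA v hv
    rw [h4, neg_lt_zero]
    positivity
  · have hn : p.natDegree = 2 := le_antisymm hdeg
      (Polynomial.le_natDegree_of_ne_zero (by rwa [← h₂]))
    have hdisc : p₁ ^ 2 - 4 * p₂ * p₀ < 0 := by
      by_contra hcon
      rw [not_lt] at hcon
      obtain ⟨x, hx⟩ := exists_quadratic_eq_zero hp2 (b := p₁) (c := p₀)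
        ⟨Real.sqrt (p₁ ^ 2 - 4 * p₂ * p₀), by rw [Real.mul_self_sqrt hcon, discrim]⟩
      have hr : p.IsRoot x := by
        rw [Polynomial.IsRoot, Polynomial.eval_eq_sum_range, hn, Finset.sum_range_succ,
          Finset.sum_range_succ, Finset.sum_range_one, ← h₀, ← h₁, ← h₂]
        linear_combination hx
      have : p.natDegree = 1 := Polynomial.natDegree_eq_of_degree_eq_some
        (Polynomial.degree_eq_one_of_irreducible_of_root hp hr)
      omega
    have h02 : 0 < p₀ * p₂ := by nlinarith [sq_nonneg p₁]
    have hp0 : p₀ ≠ 0 := fun h => by simp [h] at h02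
    refine ⟨if p₁ * p₂ < 0 then 1 else -1, by split_ifs <;> simp, fun A q hq hA v hv h => fin _ _ ?_⟩
    -- The relation `p(A) v = 0` provides a preimage `w` of `v` under `A`, and `q(v, w) = q(w, A w)
    -- > 0`. Pairing `p₀ w + p₁ v + p₂ A v = 0` with `v`, where `p₀ p₂ > 0` by the negative
    -- discriminant, shows that `q(v, v)` has the sign of `-p₁ p₂`.
    obtain ⟨w, hw⟩ : ∃ w, w = (-p₀⁻¹) • (p₁ • v + p₂ • A v) := ⟨_, rfl⟩
    have hAw : A w = v := by
      have : A w = (-p₀⁻¹) • ((p₀ • v + p₁ • A v + p₂ • A (A v)) - p₀ • v) := by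
        rw [hw]
        simp only [map_smul, map_add]
        module
      rw [this, h, zero_sub, smul_neg, neg_smul, neg_neg, smul_smul, inv_mul_cancel₀ hp0, one_smul]
    have hw0 : w ≠ 0 := fun h => hv (by rw [← hAw, h, map_zero])
    have hw1 : p₀ • w + p₁ • v + p₂ • A v = 0 := by
      rw [hw, smul_smul, mul_neg, mul_inv_cancel₀ hp0]
      module
    have h3 := congrArg (q v) hw1
    simp only [map_add, map_smul, smul_eq_mul, map_zero] at h3
    have h4 := hA v hv
    have h5 := hA w hw0
    rw [hAw, hq] at h5
    have h6 : p₁ * p₂ * q v v = -(p₀ * p₂ * q v w + p₂ ^ 2 * q v (A v)) := by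
      linear_combination p₂ * h3
    rw [h6, neg_lt_zero]
    positivity

/-- If `p(A)` were injective, the factor `p` could be cancelled from the minimal polynomial, leaving
an annihilating polynomial of smaller degree. -/
lemma ker_aeval_ne_bot [FiniteDimensional ℝ V] {A : Module.End ℝ V} {p : Polynomial ℝ}
    (hp : Irreducible p) (hd : p ∣ minpoly ℝ A) : LinearMap.ker (Polynomial.aeval A p) ≠ ⊥ := by
  intro h
  obtain ⟨r, hr⟩ := hd
  have h0 : minpoly ℝ A ≠ 0 := minpoly.ne_zero (Algebra.IsIntegral.isIntegral A)
  have hr0 : r ≠ 0 := fun h => h0 (by rw [hr, h, mul_zero])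
  have h1 : Polynomial.aeval A r = 0 := by
    have h2 := minpoly.aeval ℝ A
    rw [hr, map_mul] at h2
    ext v
    exact LinearMap.ker_eq_bot'.1 h _ (DFunLike.congr_fun h2 v)
  have h3 := Polynomial.natDegree_le_of_dvd (minpoly.dvd ℝ A h1) hr0
  rw [hr, Polynomial.natDegree_mul hp.ne_zero hr0] at h3
  have := hp.natDegree_pos
  omega

/-- An operator with a Lyapunov form has an invariant subspace on which the form is negative
and whose orthogonal complement is positive. -/
theorem exists_invariant_negative (N : ℕ) : ∀ (V : Type*) [AddCommGroup V] [Module ℝ V]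
    [FiniteDimensional ℝ V], Module.finrank ℝ V = N → ∀ (A : Module.End ℝ V)
    (q : V →ₗ[ℝ] V →ₗ[ℝ] ℝ), (∀ u v, q u v = q v u) → (∀ v, v ≠ 0 → 0 < q v (A v)) →
    ∃ E : Submodule ℝ V, (∀ v ∈ E, A v ∈ E) ∧ (∀ v ∈ E, v ≠ 0 → q v v < 0) ∧
      ∀ v, (∀ e ∈ E, q e v = 0) → v ≠ 0 → 0 < q v v := by
  induction N using Nat.strong_induction_on with
  | _ N ih =>
  intro V _ _ _ hN A q hq hA
  by_cases hV : Subsingleton V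
  · exact ⟨⊥, fun v _ => by simp [Subsingleton.elim (A v) 0], fun v _ h => (h (Subsingleton.elim _ _)).elim,
      fun v _ h => (h (Subsingleton.elim _ _)).elim⟩
  have : Nontrivial V := not_subsingleton_iff_nontrivial.1 hV
  obtain ⟨p, hp, hpd⟩ := WfDvdMonoid.exists_irreducible_factor (minpoly.not_isUnit ℝ A)
    (minpoly.ne_zero (Algebra.IsIntegral.isIntegral A))
  -- The sign is independent of operator and form, so it also applies to the `q`-adjoint of `A`,
  -- which is needed when it is positive.
  obtain ⟨s, hs, hsign⟩ := exists_sign_of_irreducible (V := V) hp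
  have hker := ker_aeval_ne_bot hp hpd
  -- the orthogonal complement of a definite subspace
  let F : Submodule ℝ V → Submodule ℝ V := fun U =>
    { carrier := {v | ∀ u ∈ U, q u v = 0}
      add_mem' := fun {a b} ha hb u hu => by rw [map_add, ha u hu, hb u hu, add_zero]
      zero_mem' := fun u _ => map_zero _
      smul_mem' := fun r v hv u hu => by rw [map_smul, hv u hu, smul_zero] }
  have hproj : ∀ U : Submodule ℝ V, (∀ v ∈ U, v ≠ 0 → q v v ≠ 0) → ∃ P : V →ₗ[ℝ] V,
      ∀ v, P v ∈ U ∧ v - P v ∈ F U := fun U hU => by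
    obtain ⟨P, hP⟩ := exists_representing_map U q q fun e he h => by
      by_contra hne
      exact hU e he hne (h e he)
    exact ⟨P, fun v => ⟨(hP v).1, fun u hu => by rw [map_sub, (hP v).2 u hu, sub_self]⟩⟩
  have hfin : ∀ U : Submodule ℝ V, U ≠ ⊥ → (∀ v ∈ U, v ≠ 0 → q v v ≠ 0) →
      Module.finrank ℝ (F U) < N := fun U hU hdef => by
    rw [← hN]
    refine Submodule.finrank_lt fun htop => ?_
    obtain ⟨v, hv, hv0⟩ := Submodule.exists_mem_ne_zero_of_ne_bot hU
    have : v ∈ F U := htop ▸ Submodule.mem_top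
    exact hdef v hv hv0 (this v hv)
  let qF : ∀ G : Submodule ℝ V, G →ₗ[ℝ] G →ₗ[ℝ] ℝ := fun G => q.domRestrict₁₂ G G
  rcases hs with hs | hs
  · -- the positive case
    obtain ⟨A', hA'⟩ := exists_representing_map (⊤ : Submodule ℝ V) q (q.comp A) fun e _ h => by
      by_contra hne
      have := hA e hne
      rw [hq, h (A e) trivial] at this
      exact this.false
    have hAA : ∀ e y, q e (A' y) = q (A e) y := fun e y => (hA' y).2 e trivial
    have hpow : ∀ (i : ℕ) (e y : V), q e ((A' ^ i) y) = q ((A ^ i) e) y := fun i => by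
      induction i with
      | zero => intro e y; rfl
      | succ i ih =>
        intro e y
        rw [pow_succ, pow_succ', Module.End.mul_apply, ih, hAA]
        rfl
    have haev : ∀ e y, q e (Polynomial.aeval A' p y) = q (Polynomial.aeval A p e) y := fun e y => by
      simp only [Polynomial.aeval_eq_sum_range, LinearMap.sum_apply, map_sum, LinearMap.smul_apply,
        map_smul, hpow]
    have hker' : LinearMap.ker (Polynomial.aeval A' p) ≠ ⊥ := fun h => by
      obtain ⟨e, he, he0⟩ := Submodule.exists_mem_ne_zero_of_ne_bot hker
      obtain ⟨y, hy⟩ := LinearMap.injective_iff_surjective.1 (LinearMap.ker_eq_bot.1 h) (A e)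
      have h1 := haev e y
      rw [hy, LinearMap.mem_ker.1 he, map_zero] at h1
      exact (hA e he0).ne' h1
    have hA'pos : ∀ v, v ≠ 0 → 0 < q v (A' v) := fun v hv => by
      rw [hAA, hq]
      exact hA v hv
    -- The kernel is taken for the adjoint `A'`: being `A'`-invariant, it has an `A`-invariant
    -- orthogonal complement, to which the induction applies. The positive space `U` only enlarges
    -- the orthogonal complement of `E`.
    obtain ⟨U, hU⟩ : ∃ U, U = LinearMap.ker (Polynomial.aeval A' p) := ⟨_, rfl⟩
    rw [← hU] at hker'
    have hUpos : ∀ v ∈ U, v ≠ 0 → 0 < q v v := fun v hv h0 => by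
      have := hsign A' q hq hA'pos v h0 (by rw [hU] at hv; exact hv)
      rwa [hs, one_mul] at this
    have hUinv : ∀ u ∈ U, A' u ∈ U := fun u hu => by
      rw [hU, LinearMap.mem_ker] at hu ⊢
      have h1 : Commute (Polynomial.aeval A' p) A' := by
        simpa using (Polynomial.commute_X p).symm.map (Polynomial.aeval (R := ℝ) A')
      have h2 := DFunLike.congr_fun h1.eq u
      rw [Module.End.mul_apply, Module.End.mul_apply, hu, map_zero] at h2
      exact h2
    obtain ⟨P, hP⟩ := hproj U fun v hv h0 => (hUpos v hv h0).ne'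
    have hAF : ∀ v ∈ F U, A v ∈ F U := fun v hv u hu => by
      rw [hq, ← hAA, hq]
      exact hv _ (hUinv u hu)
    obtain ⟨E, hE1, hE2, hE3⟩ := ih _ (hfin U hker' fun v hv h0 => (hUpos v hv h0).ne') (F U) rfl
      (A.restrict hAF) (qF (F U)) (fun u v => hq u v) fun v hv => hA v fun h => hv (Subtype.ext h)
    refine ⟨E.map (F U).subtype, ?_, ?_, fun v hv hv0 => ?_⟩
    · rintro _ ⟨e, he, rfl⟩
      exact ⟨_, hE1 e he, rfl⟩
    · rintro _ ⟨e, he, rfl⟩ h0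
      exact hE2 e he fun h => h0 (by rw [h]; rfl)
    · obtain ⟨h1, h2⟩ := hP v
      obtain ⟨w, hw⟩ : ∃ w, w = v - P v := ⟨_, rfl⟩
      rw [← hw] at h2
      have hvw : v = P v + w := by rw [hw]; abel
      have e1 : q v v = q (P v) (P v) + q w w := by
        conv_lhs => rw [hvw]
        simp only [map_add, LinearMap.add_apply]
        rw [h2 _ h1, hq w (P v), h2 _ h1]
        ring
      have h3 : w ≠ 0 → 0 < q w w := fun h => hE3 ⟨w, h2⟩ (fun e he => by
        have h4 := hv e ⟨e, he, rfl⟩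
        rw [hvw, map_add, hq, e.2 _ h1, zero_add] at h4
        exact h4) fun h' => h (congrArg Subtype.val h')
      have h4 := hUpos _ h1
      rw [e1]
      by_cases hw0 : w = 0
      · have : P v ≠ 0 := fun h => hv0 (by rw [hvw, h, hw0, add_zero])
        rw [hw0, map_zero, add_zero]
        exact h4 this
      · by_cases hP0 : P v = 0
        · rw [hP0, map_zero, zero_add]
          exact h3 hw0
        · exact add_pos (h4 hP0) (h3 hw0)
  · -- the negative case
    obtain ⟨U, hU⟩ : ∃ U, U = LinearMap.ker (Polynomial.aeval A p) := ⟨_, rfl⟩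
    rw [← hU] at hker
    have hUneg : ∀ v ∈ U, v ≠ 0 → q v v < 0 := fun v hv h0 => by
      have := hsign A q hq hA v h0 (by rw [hU] at hv; exact hv)
      rw [hs] at this
      linarith
    have hUinv : ∀ u ∈ U, A u ∈ U := fun u hu => by
      rw [hU, LinearMap.mem_ker] at hu ⊢
      have h1 : Commute (Polynomial.aeval A p) A := by
        simpa using (Polynomial.commute_X p).symm.map (Polynomial.aeval (R := ℝ) A)
      have h2 := DFunLike.congr_fun h1.eq u
      rw [Module.End.mul_apply, Module.End.mul_apply, hu, map_zero] at h2
      exact h2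
    obtain ⟨P, hP⟩ := hproj U fun v hv h0 => (hUneg v hv h0).ne
    -- The complement of the negative invariant space `U` need not be `A`-invariant, so `A` is
    -- compressed to it. On the complement `q(v, A₁ v) = q(v, A v)`, as the discarded part is
    -- orthogonal to `v`; and since `A` and `A₁` agree modulo `U`, the sum of `U` with an
    -- `A₁`-invariant space is `A`-invariant.
    let A₁ : F U →ₗ[ℝ] F U := LinearMap.codRestrict (F U) ((A - P.comp A).comp (F U).subtype)
      fun v => (hP (A v)).2
    have hA₁ : ∀ v : F U, A v = P (A v) + A₁ v := fun v => by
      have : ((A₁ v : F U) : V) = A v - P (A v) := rfl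
      rw [this, add_sub_cancel]
    obtain ⟨E, hE1, hE2, hE3⟩ := ih _ (hfin U hker fun v hv h0 => (hUneg v hv h0).ne) (F U) rfl
      A₁ (qF (F U)) (fun u v => hq u v) fun v hv => by
        have h1 := hA v fun h => hv (Subtype.ext h)
        rw [hA₁ v, map_add, hq, v.2 _ (hP _).1, zero_add] at h1
        exact h1
    refine ⟨U ⊔ E.map (F U).subtype, fun v hv => ?_, fun v hv hv0 => ?_, fun v hv hv0 => ?_⟩
    · obtain ⟨u, hu, _, ⟨e, he, rfl⟩, rfl⟩ := Submodule.mem_sup.1 hv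
      rw [map_add]
      refine add_mem (Submodule.mem_sup_left (hUinv u hu)) ?_
      change A e ∈ _
      rw [hA₁ e]
      exact add_mem (Submodule.mem_sup_left (hP _).1)
        (Submodule.mem_sup_right ⟨A₁ e, hE1 e he, rfl⟩)
    · obtain ⟨u, hu, _, ⟨e, he, rfl⟩, rfl⟩ := Submodule.mem_sup.1 hv
      change u + (e : V) ≠ 0 at hv0
      change q (u + (e : V)) (u + (e : V)) < 0
      have e1 : q (u + (e : V)) (u + (e : V)) = q u u + q (e : V) (e : V) := by
        simp only [map_add, LinearMap.add_apply]
        rw [e.2 u hu, hq (e : V) u, e.2 u hu]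
        ring
      have h3 : e ≠ 0 → q (e : V) (e : V) < 0 := hE2 e he
      rw [e1]
      by_cases he0 : e = 0
      · have : u ≠ 0 := fun h => hv0 (by rw [h, he0]; simp)
        have := hUneg u hu this
        rw [he0]
        simpa using this
      · by_cases hu0 : u = 0
        · simpa [hu0] using h3 he0
        · exact add_neg (hUneg u hu hu0) (h3 he0)
    · have hvF : v ∈ F U := fun u hu => hv u (Submodule.mem_sup_left hu)
      exact hE3 ⟨v, hvF⟩ (fun e he => hv e (Submodule.mem_sup_right ⟨e, he, rfl⟩))
        fun h => hv0 (congrArg Subtype.val h)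

end LyapunovAlgebra

/-! ### The negative invariant subspace is isotropic. -/

section Isotropic

variable {V : Type*} [NormedAddCommGroup V] [NormedSpace ℝ V] [FiniteDimensional ℝ V]

/-- The value at `s = -b / (|c| + 1)` is negative unless `b = 0`. This is the first order condition
at an extremum, stated without derivatives. -/
lemma eq_zero_of_forall_quadratic {b c : ℝ} (h : ∀ s : ℝ, 0 ≤ 2 * s * b + s ^ 2 * c) : b = 0 := by
  by_contra hb
  have h1 := h (-b / (|c| + 1))
  have hc : 0 < |c| + 1 := by positivity
  have h2 : 2 * (-b / (|c| + 1)) * b + (-b / (|c| + 1)) ^ 2 * c =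
      b ^ 2 / (|c| + 1) ^ 2 * (c - 2 * (|c| + 1)) := by
    field_simp
    ring
  rw [h2] at h1
  have h3 : 0 < b ^ 2 / (|c| + 1) ^ 2 := by positivity
  have h4 : c - 2 * (|c| + 1) < 0 := by linarith [le_abs_self c, abs_nonneg c]
  exact absurd h1 (not_le.2 (mul_neg_of_pos_of_neg h3 h4))

/-- A conformally symplectic contraction of a definite form preserves only the zero form. -/
theorem eq_zero_of_conformal_contraction {q σ : V →L[ℝ] V →L[ℝ] ℝ} {A : V →ₗ[ℝ] V} {m : ℝ}
    (hm : 0 ≤ m) (hq : ∀ u v, q u v = q v u) (hneg : ∀ v, v ≠ 0 → q v v < 0)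
    (hpos : ∀ v, v ≠ 0 → 0 < q v (A v)) (hσ : ∀ u v, σ (A u) v + σ u (A v) = m * σ u v) :
    ∀ u v, σ u v = 0 := by
  have : ProperSpace V := FiniteDimensional.proper ℝ V
  obtain ⟨c, hc, hlow⟩ := exists_quadratic_lower_bound (f := fun v => -q v v) (by fun_prop)
    (fun s v => by simp; ring) fun v hv => neg_pos.2 (hneg v hv)
  by_contra! hcon
  obtain ⟨u₀, v₀, h0⟩ := hcon
  let K : Set (V × V) := {x | -q x.1 x.1 = 1 ∧ -q x.2 x.2 = 1}
  have hKc : IsCompact K := by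
    refine Metric.isCompact_of_isClosed_isBounded ?_ ?_
    · exact (isClosed_eq (by fun_prop) continuous_const).inter
        (isClosed_eq (by fun_prop) continuous_const)
    · refine (Metric.isBounded_closedBall (x := (0 : V × V)) (r := Real.sqrt (1 / c))).subset
        fun x hx => ?_
      rw [mem_closedBall_zero_iff]
      have h1 : ∀ v : V, -q v v = 1 → ‖v‖ ≤ Real.sqrt (1 / c) := fun v hv => by
        refine Real.le_sqrt_of_sq_le ?_
        rw [le_div_iff₀ hc, mul_comm, ← hv]
        exact hlow v
      exact norm_prod_le_iff.2 ⟨h1 _ hx.1, h1 _ hx.2⟩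
  have hqn : ∀ x, q (-x) (-x) = q x x := fun x => by simp
  have hnz : ∀ u v, σ u v ≠ 0 → u ≠ 0 ∧ v ≠ 0 := fun u v h =>
    ⟨fun h' => h (by simp [h']), fun h' => h (by simp [h'])⟩
  have hscale : ∀ u : V, u ≠ 0 → -q ((Real.sqrt (-q u u))⁻¹ • u) ((Real.sqrt (-q u u))⁻¹ • u) = 1 :=
    fun u hu => by
      have h1 : 0 < -q u u := neg_pos.2 (hneg u hu)
      have h2 := Real.sq_sqrt h1.le
      have h3 := Real.sqrt_pos.2 h1
      simp only [map_smul, smul_apply, smul_eq_mul]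
      field_simp
      linarith
  -- The bilinear form attains its maximum on pairs of unit vectors of `-q`. It is positive if the
  -- form is nonzero, as one vector may be replaced by its negative.
  obtain ⟨⟨u, v⟩, hK, hmax⟩ := hKc.exists_isMaxOn (f := fun x : V × V => σ x.1 x.2)
    ⟨(_, _), hscale u₀ (hnz _ _ h0).1, hscale v₀ (hnz _ _ h0).2⟩ (by fun_prop)
  obtain ⟨M, hM⟩ : ∃ M, M = σ u v := ⟨_, rfl⟩
  have hM1 : ∀ x y : V, -q x x = 1 → -q y y = 1 → σ x y ≤ M := fun x y hx hy =>
    hM ▸ hmax (show (x, y) ∈ K from ⟨hx, hy⟩)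
  have hM0 : 0 < M := by
    have h1 := hM1 _ _ (hscale u₀ (hnz _ _ h0).1) (hscale v₀ (hnz _ _ h0).2)
    have h2 := hM1 (-((Real.sqrt (-q u₀ u₀))⁻¹ • u₀)) _ (by
      rw [hqn]
      exact hscale u₀ (hnz _ _ h0).1) (hscale v₀ (hnz _ _ h0).2)
    rw [map_neg, neg_apply] at h2
    simp only [map_smul, smul_apply, smul_eq_mul] at h1 h2
    have h3 : (Real.sqrt (-q v₀ v₀))⁻¹ * ((Real.sqrt (-q u₀ u₀))⁻¹ * σ u₀ v₀) ≠ 0 := by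
      have a1 := Real.sqrt_pos.2 (neg_pos.2 (hneg u₀ (hnz _ _ h0).1))
      have a2 := Real.sqrt_pos.2 (neg_pos.2 (hneg v₀ (hnz _ _ h0).2))
      positivity
    rcases lt_or_gt_of_ne h3 with h | h <;> linarith
  have hsq : ∀ x y : V, (σ x y) ^ 2 ≤ M ^ 2 * ((-q x x) * (-q y y)) := fun x y => by
    by_cases hxy : σ x y = 0
    · rw [hxy]
      have h1 : ∀ z : V, 0 ≤ -q z z := fun z => le_trans (by positivity) (hlow z)
      rw [zero_pow two_ne_zero]
      exact mul_nonneg (sq_nonneg M) (mul_nonneg (h1 x) (h1 y))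
    · obtain ⟨hx, hy⟩ := hnz _ _ hxy
      have b1 := neg_pos.2 (hneg x hx)
      have b2 := neg_pos.2 (hneg y hy)
      have c1 := Real.sqrt_pos.2 b1
      have c2 := Real.sqrt_pos.2 b2
      have h1 := hM1 _ _ (hscale x hx) (hscale y hy)
      have h2 := hM1 (-((Real.sqrt (-q x x))⁻¹ • x)) _ (by
        rw [hqn]
        exact hscale x hx) (hscale y hy)
      rw [map_neg, neg_apply] at h2
      simp only [map_smul, smul_apply, smul_eq_mul] at h1 h2
      have h3 : |(Real.sqrt (-q y y))⁻¹ * ((Real.sqrt (-q x x))⁻¹ * σ x y)| ≤ M :=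
        abs_le.2 ⟨by linarith, h1⟩
      have h4 := pow_le_pow_left₀ (abs_nonneg _) h3 2
      rw [sq_abs, mul_pow, mul_pow, inv_pow, inv_pow, Real.sq_sqrt b1.le, Real.sq_sqrt b2.le] at h4
      rw [← mul_assoc, ← mul_inv, inv_mul_le_iff₀ (by positivity)] at h4
      linarith
  -- The extremality conditions at the maximum: `σ(·, v)` and `σ(u, ·)` are `M` times the pairings
  -- of `-q` with `u` and with `v`.
  have hv1 : ∀ h, σ h v = M * -q u h := fun h => by
    have := eq_zero_of_forall_quadratic (b := M ^ 2 * -q u h - M * σ h v)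
      (c := M ^ 2 * -q h h - (σ h v) ^ 2) fun s => by
        have h1 := hsq (u + s • h) v
        simp only [map_add, map_smul, add_apply, smul_apply,
          smul_eq_mul, ← hM, hK.2, hq h u] at h1
        have h2 : -q u u = 1 := hK.1
        nlinarith
    have h2 : M * (σ h v - M * -q u h) = 0 := by linear_combination -this
    have := (mul_eq_zero.1 h2).resolve_left hM0.ne'
    linarith
  have hu1 : ∀ h, σ u h = M * -q v h := fun h => by
    have := eq_zero_of_forall_quadratic (b := M ^ 2 * -q v h - M * σ u h)
      (c := M ^ 2 * -q h h - (σ u h) ^ 2) fun s => by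
        have h1 := hsq u (v + s • h)
        simp only [map_add, map_smul, add_apply, smul_apply,
          smul_eq_mul, ← hM, hK.1, hq h v] at h1
        have h2 : -q v v = 1 := hK.2
        nlinarith
    have h2 : M * (σ u h - M * -q v h) = 0 := by linear_combination -this
    have := (mul_eq_zero.1 h2).resolve_left hM0.ne'
    linarith
  have hu0 : u ≠ 0 := (hnz u v (by rw [← hM]; exact hM0.ne')).1
  have hv0 : v ≠ 0 := (hnz u v (by rw [← hM]; exact hM0.ne')).2
  -- At the maximum the conformal equation reads `-M (q(u, Au) + q(v, Av)) = m M`. The left side is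
  -- negative and the right side is not.
  have h1 := hσ u v
  rw [hv1, hu1, ← hM] at h1
  have h2 := mul_pos hM0 (hpos u hu0)
  have h3 := mul_pos hM0 (hpos v hv0)
  have h4 := mul_nonneg hm hM0.le
  linarith

end Isotropic

/-! ### Symplectic bases. -/

section Symplectic

/-- A symplectic basis adapted to an isotropic subspace. -/
theorem exists_symplectic_basis (N : ℕ) : ∀ (V : Type*) [AddCommGroup V] [Module ℝ V]
    [FiniteDimensional ℝ V], Module.finrank ℝ V = N → ∀ (σ : V →ₗ[ℝ] V →ₗ[ℝ] ℝ),
    (∀ u v, σ u v = -σ v u) → (∀ v, (∀ u, σ u v = 0) → v = 0) → ∀ E : Submodule ℝ V,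
    (∀ u ∈ E, ∀ v ∈ E, σ u v = 0) →
    ∃ (n k : ℕ) (p q : Fin n → V), k ≤ n ∧ (∀ i j, σ (p i) (p j) = 0) ∧ (∀ i j, σ (q i) (q j) = 0) ∧
      (∀ i j, σ (p i) (q j) = if i = j then 1 else 0) ∧
      (∀ v, v = ∑ i, (σ v (q i) • p i + σ (p i) v • q i)) ∧
      (∀ i : Fin n, (i : ℕ) < k → p i ∈ E) ∧
      ∀ e ∈ E, ∀ i : Fin n, σ (p i) e = 0 ∧ (k ≤ (i : ℕ) → σ e (q i) = 0) := by
  induction N using Nat.strong_induction_on with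
  | _ N ih =>
  intro V _ _ _ hN σ hσ hnd E hE
  have hself : ∀ v, σ v v = 0 := fun v => by linarith [hσ v v]
  by_cases hV : Subsingleton V
  · exact ⟨0, 0, Fin.elim0, Fin.elim0, le_rfl, fun i => i.elim0, fun i => i.elim0, fun i => i.elim0,
      fun v => Subsingleton.elim _ _, fun i => i.elim0, fun _ _ i => i.elim0⟩
  have : Nontrivial V := not_subsingleton_iff_nontrivial.1 hV
  -- As long as `E` is nonzero the new vector is taken in `E`, so the basis vectors of `E` come
  -- first; the complement of the plane of `e` and `f` carries the induction with the intersection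
  -- of `E`.
  obtain ⟨e, he0, heE⟩ : ∃ e : V, e ≠ 0 ∧ (E ≠ ⊥ → e ∈ E) := by
    by_cases h : E = ⊥
    · obtain ⟨e, he⟩ := exists_ne (0 : V)
      exact ⟨e, he, fun h' => (h' h).elim⟩
    · obtain ⟨e, he, he0⟩ := Submodule.exists_mem_ne_zero_of_ne_bot h
      exact ⟨e, he0, fun _ => he⟩
  obtain ⟨f, hf⟩ : ∃ f, σ e f = 1 := by
    by_contra! hcon
    refine he0 (hnd e fun u => ?_)
    by_contra hne
    refine hcon ((σ e u)⁻¹ • u) ?_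
    rw [map_smul, smul_eq_mul, inv_mul_cancel₀]
    rw [hσ]
    exact neg_ne_zero.2 hne
  have hfe : σ f e = -1 := by rw [hσ, hf]
  let F : Submodule ℝ V := LinearMap.ker (σ e) ⊓ LinearMap.ker (σ f)
  have hF : ∀ v, v ∈ F ↔ σ e v = 0 ∧ σ f v = 0 := fun v => Iff.rfl
  have hdec : ∀ v, v - (σ v f • e + σ e v • f) ∈ F := fun v => by
    rw [hF]
    simp only [map_sub, map_add, map_smul, smul_eq_mul, hself, hf, hfe, hσ f v]
    constructor <;> ring
  have hlt : Module.finrank ℝ F < N := by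
    rw [← hN]
    refine Submodule.finrank_lt fun htop => ?_
    have : e ∈ F := htop ▸ Submodule.mem_top
    rw [hF, hfe] at this
    norm_num at this
  obtain ⟨n, k, p, q, hkn, hpp, hqq, hpq, hexp, hpE, hEp⟩ := ih _ hlt F rfl (σ.domRestrict₁₂ F F)
    (fun u v => hσ u v) (fun v hv => Subtype.ext (hnd v fun u => by
      have h1 := hv ⟨_, hdec u⟩
      change σ (u - (σ u f • e + σ e u • f)) v = 0 at h1
      rw [map_sub, map_add, map_smul, map_smul] at h1
      simpa [((hF v).1 v.2).1, ((hF v).1 v.2).2] using h1)) (E.comap F.subtype)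
    fun u hu v hv => hE u hu v hv
  have hpF := fun i => (hF _).1 (p i).2
  have hqF := fun i => (hF _).1 (q i).2
  have hx : ∀ (v : V) (w : F), σ (v - (σ v f • e + σ e v • f)) w = σ v w := fun v w => by
    simp [((hF w).1 w.2).1, ((hF w).1 w.2).2]
  have hx' : ∀ (v : V) (w : F), σ w (v - (σ v f • e + σ e v • f)) = σ w v := fun v w => by
    rw [hσ, hx, ← hσ]
  refine ⟨n + 1, if E = ⊥ then 0 else k + 1, Fin.cons e fun i => p i, Fin.cons f fun i => q i,
    by split_ifs <;> omega, ?_, ?_, ?_, fun v => ?_, ?_, ?_⟩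
  · refine Fin.cases (Fin.cases ?_ fun j => ?_) fun i => Fin.cases ?_ fun j => ?_
    · exact hself e
    · exact (hpF j).1
    · simp only [Fin.cons_succ, Fin.cons_zero]
      rw [hσ, (hpF i).1, neg_zero]
    · exact hpp i j
  · refine Fin.cases (Fin.cases ?_ fun j => ?_) fun i => Fin.cases ?_ fun j => ?_
    · exact hself f
    · exact (hqF j).2
    · simp only [Fin.cons_succ, Fin.cons_zero]
      rw [hσ, (hqF i).2, neg_zero]
    · exact hqq i j
  · refine Fin.cases (Fin.cases ?_ fun j => ?_) fun i => Fin.cases ?_ fun j => ?_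
    · simpa using hf
    · simpa [(Fin.succ_ne_zero j).symm] using (hqF j).1
    · simp only [Fin.cons_succ, Fin.cons_zero, Fin.succ_ne_zero, if_false]
      rw [hσ, (hpF i).2, neg_zero]
    · simp only [Fin.cons_succ, Fin.succ_inj]
      exact hpq i j
  · rw [Fin.sum_univ_succ]
    have h1 := congrArg Subtype.val (hexp ⟨_, hdec v⟩)
    simp only [Submodule.coe_sum, Submodule.coe_add, Submodule.coe_smul] at h1
    have h2 : ∀ i, (σ.domRestrict₁₂ F F) ⟨_, hdec v⟩ (q i) = σ v (q i) := fun i => hx v (q i)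
    have h3 : ∀ i, (σ.domRestrict₁₂ F F) (p i) ⟨_, hdec v⟩ = σ (p i) v := fun i => hx' v (p i)
    simp only [h2, h3] at h1
    simp only [Fin.cons_succ, Fin.cons_zero]
    rw [← h1, add_sub_cancel]
  · refine Fin.cases (fun h => ?_) fun i h => ?_
    · split_ifs at h with hb
      · exact (Nat.not_lt_zero _ h).elim
      · exact heE hb
    · split_ifs at h with hb
      · exact (Nat.not_lt_zero _ h).elim
      · exact hpE i (by simpa using h)
  · intro x hxE
    by_cases hb : E = ⊥
    · have hx0 : x = 0 := by rwa [hb, Submodule.mem_bot] at hxE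
      intro i
      simp [hx0]
    have hex : σ e x = 0 := hE e (heE hb) x hxE
    have hyE : (⟨_, hdec x⟩ : F) ∈ E.comap F.subtype := by
      change x - (σ x f • e + σ e x • f) ∈ E
      rw [hex, zero_smul, add_zero]
      exact sub_mem hxE (E.smul_mem _ (heE hb))
    refine Fin.cases ⟨hex, fun h => ?_⟩ fun i => ?_
    · rw [if_neg hb] at h
      simp at h
    · have h1 := hEp _ hyE i
      rw [if_neg hb]
      refine ⟨(hx' x (p i)).symm.trans h1.1, fun h => (hx x (q i)).symm.trans (h1.2 ?_)⟩
      simpa using h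

end Symplectic

/-! ### A common Lyapunov function for the linearisation and the diagonal field. -/

section BlockLyapunov

/-- On the part of the unit sphere where `f ≤ 0`, the function `g` has a positive minimum by
compactness, and a large multiple of it outweighs the minimum of `f`. This chooses the weights of
the blocks one after the other. -/
lemma exists_large_factor {X : Type*} [NormedAddCommGroup X] [NormedSpace ℝ X]
    [FiniteDimensional ℝ X] (L : Submodule ℝ X) {f g : X → ℝ} (hf : Continuous f)
    (hg : Continuous g) (hf2 : ∀ (r : ℝ) v, f (r • v) = r ^ 2 * f v)
    (hg2 : ∀ (r : ℝ) v, g (r • v) = r ^ 2 * g v) (hg0 : ∀ v ∈ L, 0 ≤ g v)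
    (hfg : ∀ v ∈ L, v ≠ 0 → g v = 0 → 0 < f v) :
    ∃ K₀ : ℝ, 0 < K₀ ∧ ∀ v ∈ L, v ≠ 0 → 0 < f v + K₀ * g v := by
  have : ProperSpace X := FiniteDimensional.proper ℝ X
  have hL : IsClosed (L : Set X) := L.closed_of_finiteDimensional
  have hS : IsCompact (Metric.sphere (0 : X) 1 ∩ L) := (isCompact_sphere _ _).inter_right hL
  suffices h : ∃ K₀ : ℝ, 0 < K₀ ∧ ∀ v ∈ Metric.sphere (0 : X) 1 ∩ L, 0 < f v + K₀ * g v by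
    obtain ⟨K₀, hK₀, h⟩ := h
    refine ⟨K₀, hK₀, fun v hv hv0 => ?_⟩
    have hn : 0 < ‖v‖ := norm_pos_iff.2 hv0
    have h1 := h (‖v‖⁻¹ • v) ⟨by simp [norm_smul, hn.ne'], L.smul_mem _ hv⟩
    rw [hf2, hg2, mul_left_comm, ← mul_add] at h1
    exact pos_of_mul_pos_right h1 (by positivity)
  have hS' : IsCompact ((Metric.sphere (0 : X) 1 ∩ L) ∩ {v | f v ≤ 0}) :=
    hS.inter_right (isClosed_le hf continuous_const)
  rcases ((Metric.sphere (0 : X) 1 ∩ L) ∩ {v | f v ≤ 0}).eq_empty_or_nonempty with he | hne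
  · refine ⟨1, one_pos, fun v hv => ?_⟩
    have h1 : 0 < f v := by
      by_contra hcon
      exact (he ▸ (⟨hv, not_lt.1 hcon⟩ : v ∈ (Metric.sphere (0 : X) 1 ∩ L) ∩ {v | f v ≤ 0}) :
        v ∈ (∅ : Set X))
    linarith [hg0 v hv.2]
  · obtain ⟨w, hw, hmin⟩ := hS'.exists_isMinOn hne hg.continuousOn
    obtain ⟨x, hx, hmin'⟩ := hS'.exists_isMinOn hne hf.continuousOn
    have hw0 : 0 < g w := by
      refine lt_of_le_of_ne (hg0 w hw.1.2) fun h => ?_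
      refine absurd (hfg w hw.1.2 (fun h0 => ?_) h.symm) (not_lt.2 hw.2)
      have := hw.1.1
      rw [h0] at this
      simp at this
    have hx0 : f x ≤ 0 := hx.2
    refine ⟨(1 - f x) / g w, div_pos (by linarith) hw0, fun v hv => ?_⟩
    by_cases hfv : f v ≤ 0
    · have h1 : g w ≤ g v := hmin ⟨hv, hfv⟩
      have h2 : f x ≤ f v := hmin' ⟨hv, hfv⟩
      have h3 : (1 - f x) / g w * g w ≤ (1 - f x) / g w * g v := by
        have : 0 ≤ (1 - f x) / g w := div_nonneg (by linarith) hw0.le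
        gcongr
      rw [div_mul_cancel₀ _ hw0.ne'] at h3
      linarith
    · have : 0 ≤ (1 - f x) / g w * g v := mul_nonneg (div_nonneg (by linarith) hw0.le) (hg0 v hv.2)
      linarith [not_le.1 hfv]

variable {n : ℕ} (k : ℕ)

/-- The projections to the blocks of coordinates `x_i` (`i < k`), `x_i, y_i` (`i ≥ k`), `y_i`
(`i < k`) and `z`. -/
def projE : Std n →L[ℝ] Std n :=
  LinearMap.toContinuousLinearMap
    { toFun := fun v => (fun i : Fin n => if (i : ℕ) < k then v.1 i else 0, 0, 0)
      map_add' := fun u v => by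
        refine Prod.ext (funext fun i => ?_) (by simp)
        by_cases h : (i : ℕ) < k <;> simp [h]
      map_smul' := fun r v => by
        refine Prod.ext (funext fun i => ?_) (by simp)
        by_cases h : (i : ℕ) < k <;> simp [h] }

def projM : Std n →L[ℝ] Std n :=
  LinearMap.toContinuousLinearMap
    { toFun := fun v => (fun i : Fin n => if (i : ℕ) < k then 0 else v.1 i,
        fun i : Fin n => if (i : ℕ) < k then 0 else v.2.1 i, 0)
      map_add' := fun u v => by
        refine Prod.ext (funext fun i => ?_) (Prod.ext (funext fun i => ?_) (by simp)) <;>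
        by_cases h : (i : ℕ) < k <;> simp [h]
      map_smul' := fun r v => by
        refine Prod.ext (funext fun i => ?_) (Prod.ext (funext fun i => ?_) (by simp)) <;>
        by_cases h : (i : ℕ) < k <;> simp [h] }

def projY : Std n →L[ℝ] Std n :=
  LinearMap.toContinuousLinearMap
    { toFun := fun v => (0, fun i : Fin n => if (i : ℕ) < k then v.2.1 i else 0, 0)
      map_add' := fun u v => by
        refine Prod.ext (by simp) (Prod.ext (funext fun i => ?_) (by simp))
        by_cases h : (i : ℕ) < k <;> simp [h]
      map_smul' := fun r v => by
        refine Prod.ext (by simp) (Prod.ext (funext fun i => ?_) (by simp))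
        by_cases h : (i : ℕ) < k <;> simp [h] }

lemma projE_apply (v : Std n) : projE k v = (fun i : Fin n => if (i : ℕ) < k then v.1 i else 0, 0, 0) := rfl

lemma projM_apply (v : Std n) : projM k v = (fun i : Fin n => if (i : ℕ) < k then 0 else v.1 i,
  fun i : Fin n => if (i : ℕ) < k then 0 else v.2.1 i, 0) := rfl

lemma projY_apply (v : Std n) : projY k v = (0, fun i : Fin n => if (i : ℕ) < k then v.2.1 i else 0, 0) := rfl

lemma proj_sum (v : Std n) : projE k v + projM k v + projY k v + v.2.2 • vecZ = v := by
  refine Prod.ext (funext fun i => ?_) (Prod.ext (funext fun i => ?_) ?_)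
  · by_cases h : (i : ℕ) < k <;> simp [projE_apply, projM_apply, projY_apply, vecZ, h]
  · by_cases h : (i : ℕ) < k <;> simp [projE_apply, projM_apply, projY_apply, vecZ, h]
  · simp [projE_apply, projM_apply, projY_apply, vecZ]

lemma proj_diagField (m c : ℝ) (v : Std n) :
    projE k (diagField k m c v) = (m / 2 - 3 * c / 2) • projE k v ∧
    projM k (diagField k m c v) = (m / 2) • projM k v ∧
    projY k (diagField k m c v) = (m / 2 + 3 * c / 2) • projY k v := by
  refine ⟨Prod.ext (funext fun i => ?_) (Prod.ext (funext fun i => ?_) ?_),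
    Prod.ext (funext fun i => ?_) (Prod.ext (funext fun i => ?_) ?_),
    Prod.ext (funext fun i => ?_) (Prod.ext (funext fun i => ?_) ?_)⟩
  all_goals simp only [projE_apply, projM_apply, projY_apply, diagField]
  all_goals try split_ifs
  all_goals simp_all

/-- The bilinear map underlying a continuous bilinear form. -/
def bilinOf {X : Type*} [NormedAddCommGroup X] [NormedSpace ℝ X] (q : X →L[ℝ] X →L[ℝ] ℝ) :
    X →ₗ[ℝ] X →ₗ[ℝ] ℝ :=
  LinearMap.mk₂ ℝ (fun u v => q u v) (fun _ _ _ => by simp) (fun _ _ _ => by simp)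
    (fun _ _ _ => by simp) (fun _ _ _ => by simp)

@[simp] lemma bilinOf_apply {X : Type*} [NormedAddCommGroup X] [NormedSpace ℝ X]
    (q : X →L[ℝ] X →L[ℝ] ℝ) (u v : X) : bilinOf q u v = q u v := rfl

/-- The standard symplectic form, extended by zero along the `z` axis. -/
def stdOmega : Std n →L[ℝ] Std n →L[ℝ] ℝ := stdBilin - stdBilin.flip

lemma stdOmega_apply (u v : Std n) :
    stdOmega u v = ∑ i, (u.1 i * v.2.1 i - u.2.1 i * v.1 i) := stdBilin_antisymm u v

lemma stdOmega_vecX (i : Fin n) (v : Std n) : stdOmega (vecX i) v = v.2.1 i := by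
  rw [stdOmega_apply]
  simp [vecX, Pi.single_apply]

variable {k}

/-- A block diagonal Lyapunov function for the linearisation at a critical point, in adapted
coordinates. -/
theorem exists_block_lyapunov {m : ℝ} (hm : 0 < m) {A : Std n →L[ℝ] Std n}
    {q : Std n →L[ℝ] Std n →L[ℝ] ℝ} (hq : ∀ u v, q u v = q v u)
    (hz : ∀ v, (A v).2.2 = m * v.2.2) (hE : ∀ v, projE k v = v → projE k (A v) = A v)
    (hσ : ∀ u v : Std n, u.2.2 = 0 → v.2.2 = 0 →
      stdOmega (A u) v + stdOmega u (A v) = m * stdOmega u v)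
    (hpos : ∀ v, v ≠ 0 → 0 < q v (A v)) (hneg : ∀ v, projE k v = v → v ≠ 0 → q v v < 0)
    (hperp : ∀ v, v.2.2 = 0 → (∀ e, projE k e = e → q e v = 0) → v ≠ 0 → 0 < q v v) :
    ∃ (B : Std n →L[ℝ] Std n →L[ℝ] ℝ) (c : ℝ), (∀ u v, B u v = B v u) ∧ 0 < c ∧
      (∀ v, c * ‖v‖ ^ 2 ≤ B v (A v)) ∧ ∀ v, c * ‖v‖ ^ 2 ≤ B v (diagField k m (max 1 m) v) := by
  have eEE : ∀ v : Std n, projE k (projE k v) = projE k v := fun v => by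
    simp only [projE_apply]
    refine Prod.ext (funext fun i => ?_) rfl
    by_cases h : (i : ℕ) < k <;> simp [h]
  have eEM : ∀ v : Std n, projE k (projM k v) = 0 := fun v => by
    simp only [projE_apply, projM_apply]
    refine Prod.ext (funext fun i => ?_) rfl
    by_cases h : (i : ℕ) < k <;> simp [h]
  have eYE : ∀ v : Std n, projY k (projE k v) = 0 := fun v => by
    simp only [projE_apply, projY_apply]
    refine Prod.ext rfl (Prod.ext (funext fun i => ?_) rfl)
    simp
  have eYM : ∀ v : Std n, projY k (projM k v) = 0 := fun v => by
    simp only [projM_apply, projY_apply]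
    refine Prod.ext rfl (Prod.ext (funext fun i => ?_) rfl)
    by_cases h : (i : ℕ) < k <;> simp [h]
  have eYY : ∀ v : Std n, projY k (projY k v) = projY k v := fun v => by
    simp only [projY_apply]
    refine Prod.ext rfl (Prod.ext (funext fun i => ?_) rfl)
    by_cases h : (i : ℕ) < k <;> simp [h]
  have eME : ∀ v : Std n, projM k (projE k v) = 0 := fun v => by
    simp only [projE_apply, projM_apply]
    refine Prod.ext (funext fun i => ?_) (Prod.ext (funext fun i => ?_) rfl)
    · by_cases h : (i : ℕ) < k <;> simp [h]
    · simp
  have zE : ∀ v : Std n, (projE k v).2.2 = 0 := fun v => rfl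
  have zM : ∀ v : Std n, (projM k v).2.2 = 0 := fun v => rfl
  have zY : ∀ v : Std n, (projY k v).2.2 = 0 := fun v => rfl
  have yz : ∀ (w : Std n), projY k w = 0 ↔ ∀ i : Fin n, (i : ℕ) < k → w.2.1 i = 0 := fun w => by
    rw [projY_apply]
    constructor
    · intro h i hi
      have := congrFun (congrArg (fun p : Std n => p.2.1) h) i
      simpa [hi] using this
    · intro h
      refine Prod.ext rfl (Prod.ext (funext fun i => ?_) rfl)
      by_cases hi : (i : ℕ) < k
      · simpa [hi] using h i hi
      · simp [hi]
  have hX : ∀ i : Fin n, (i : ℕ) < k → projE k (vecX i) = vecX i := fun i hi => by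
    rw [projE_apply, vecX]
    refine Prod.ext (funext fun j => ?_) rfl
    by_cases h : j = i
    · subst h; simp [hi]
    · simp [h]
  have hσE : ∀ e w : Std n, projE k e = e → projY k w = 0 → stdOmega e w = 0 := fun e w he hw => by
    rw [stdOmega_apply, ← he, projE_apply]
    refine Finset.sum_eq_zero fun i _ => ?_
    by_cases h : (i : ℕ) < k
    · simp [(yz w).1 hw i h]
    · simp [h]
  -- `E`, spanned by the `x_i` with `i < k`, is invariant. By conformality so is its symplectic
  -- complement in `ker dz`, which is given by `y_i = 0` for `i < k`. Thus `A` is block triangular.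
  have hAY : ∀ w : Std n, w.2.2 = 0 → projY k w = 0 → projY k (A w) = 0 := fun w hw0 hw =>
    (yz _).2 fun i hi => by
      have h1 := hσ (vecX i) w rfl hw0
      rwa [hσE _ w (hE _ (hX i hi)) hw, hσE _ w (hX i hi) hw, mul_zero, zero_add,
        stdOmega_vecX] at h1
  let EE : Submodule ℝ (Std n) := LinearMap.ker ((projE k).toLinearMap - LinearMap.id)
  have hEE : ∀ e, e ∈ EE ↔ projE k e = e := fun e => by
    rw [LinearMap.mem_ker, LinearMap.sub_apply, sub_eq_zero]
    rfl
  have hdef : ∀ e ∈ EE, (∀ e' ∈ EE, q e' e = 0) → e = 0 := fun e he h => by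
    by_contra h0
    exact (hneg e ((hEE e).1 he) h0).ne (h e he)
  -- `P₀` is the `q`-orthogonal projection to `E`. The map `u₀` below carries the `y`-block to `E`,
  -- by combining the symplectic pairing with `E` and the definite form `q` on `E`.
  obtain ⟨P₀, hP₀⟩ := exists_representing_map EE (bilinOf q) (bilinOf q) hdef
  obtain ⟨u₀, hu₀⟩ := exists_representing_map EE (bilinOf q) (bilinOf (-stdOmega)) hdef
  obtain ⟨S, hS⟩ : ∃ S : Std n →L[ℝ] Std n, ∀ v, S v = v - P₀ v :=
    ⟨.id ℝ _ - LinearMap.toContinuousLinearMap P₀, fun v => rfl⟩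
  obtain ⟨U, hU⟩ : ∃ U : Std n →L[ℝ] Std n, ∀ v, U v = u₀ v :=
    ⟨LinearMap.toContinuousLinearMap u₀, fun v => rfl⟩
  have hUE : ∀ v, projE k (U v) = U v := fun v => by rw [hU]; exact (hEE _).1 (hu₀ v).1
  have hUq : ∀ e v, projE k e = e → q e (U v) = -stdOmega e v := fun e v he => by
    rw [hU]
    exact (hu₀ v).2 e ((hEE e).2 he)
  have hqS : ∀ e v, projE k e = e → q e (S v) = 0 := fun e v he => by
    rw [hS, map_sub, sub_eq_zero]
    exact ((hP₀ v).2 e ((hEE e).2 he)).symm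
  have hSE : ∀ e, projE k e = e → S e = 0 := fun e he => by
    refine hdef _ ?_ fun e' he' => hqS e' e ((hEE e').1 he')
    rw [hS]
    exact EE.sub_mem ((hEE e).2 he) (hP₀ e).1
  have hPE : ∀ v, projE k (P₀ v) = P₀ v := fun v => (hEE _).1 (hP₀ v).1
  have hPz : ∀ v, (P₀ v).2.2 = 0 := fun v => by rw [← hPE]; exact zE _
  have hSz : ∀ v, (S v).2.2 = v.2.2 := fun v => by
    rw [hS]
    change v.2.2 - (P₀ v).2.2 = _
    rw [hPz, sub_zero]
  have hS0 : ∀ v, S (projM k v) = 0 → projM k v = 0 := fun v h => by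
    rw [hS, sub_eq_zero] at h
    rw [h, ← hPE, ← h, eEM]
  have hU0 : ∀ v, U (projY k v) = 0 → projY k v = 0 := fun v h => by
    have h1 : projY k (projY k v) = 0 := (yz _).2 fun i hi => by
      have h2 := hUq (vecX i) (projY k v) (hX i hi)
      rw [h, map_zero, stdOmega_vecX] at h2
      linarith
    rwa [eYY] at h1
  have hUY : ∀ v, U (projY k v) = U v := fun v => by
    rw [← sub_eq_zero, ← map_sub]
    refine hdef _ ((hEE _).2 (hUE _)) fun e he => ?_
    rw [hUq _ _ ((hEE e).1 he), hσE e _ ((hEE e).1 he) (by rw [map_sub, eYY, sub_self]), neg_zero]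
  -- The middle block is the quotient of the symplectic complement of `E` by `E`. The map `S`
  -- realises it as a `q`-orthogonal complement of `E`, where the component of `A` along `E` is
  -- invisible to `q`; so `q` is a Lyapunov form for the induced operator.
  have key1 : ∀ v : Std n, projY k v = 0 → v.2.2 = 0 →
      q (S (projM k v)) (S (projM k (A v))) = q (S (projM k v)) (A (S (projM k v))) := by
    intro v hv hv0
    have e1 : v = projE k v + projM k v := by
      conv_lhs => rw [← proj_sum k v, hv, hv0, zero_smul, add_zero, add_zero]
    have e2 : S (projM k (A v)) = S (A (projM k v)) := by
      have h1 : projM k (A v) = projM k (A (projM k v)) := by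
        conv_lhs => rw [e1, map_add, map_add, ← hE _ (eEE v), eME, zero_add]
      have h2 : A (projM k v) = projE k (A (projM k v)) + projM k (A (projM k v)) := by
        conv_lhs => rw [← proj_sum k (A (projM k v)), hAY _ (zM v) (eYM v), hz, zM, mul_zero,
          zero_smul, add_zero, add_zero]
      rw [h1]
      conv_rhs => rw [h2, map_add, hSE _ (eEE _), zero_add]
    have e3 : S (A (projM k v)) = S (A (S (projM k v))) := by
      rw [hS (projM k v), map_sub, map_sub, hSE _ (hE _ (hPE _)), sub_zero]
    rw [e2, e3, hS (A _), map_sub, hq _ (P₀ _), hqS _ _ (hPE _), sub_zero]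
  -- The `y`-block is dual to `E`, and conformality expresses the action of `A` on it by its action
  -- on `E`. Both terms are positive for a nonzero image: the first by the Lyapunov property, the
  -- second because `m > 0` and `q` is negative on `E`.
  have key2 : ∀ v : Std n, v.2.2 = 0 → -q (U (projY k v)) (U (projY k (A v))) =
      q (U (projY k v)) (A (U (projY k v))) - m * q (U (projY k v)) (U (projY k v)) := by
    intro v hv0
    have h1 : projY k (A v) = projY k (A (projY k v)) := by
      have e1 : v = (projE k v + projM k v) + projY k v := by
        conv_lhs => rw [← proj_sum k v, hv0, zero_smul, add_zero]
      conv_lhs => rw [e1, map_add, map_add, hAY _ (by simp [zE, zM])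
        (by rw [map_add, eYE, eYM, add_zero]), zero_add]
    have h2 := hσ (U (projY k v)) (projY k v) (by rw [← hUE]; exact zE _) (zY v)
    rw [h1, hUY (A _), hUq _ _ (hUE _)]
    have h3 := hUq (U (projY k v)) (projY k v) (hUE _)
    have h4 := hUq (A (U (projY k v))) (projY k v) (hE _ (hUE _))
    rw [hq] at h4
    rw [h3, h4]
    linarith
  -- The off-diagonal terms of the triangular operator are absorbed by giving each successive block,
  -- in the order `x`, middle, `y`, `z`, a sufficiently large weight.
  obtain ⟨K₁, hK₁, h₁⟩ := exists_large_factor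
    (L := LinearMap.ker (projY k).toLinearMap ⊓ LinearMap.ker (coordZ (n := n)).toLinearMap)
    (f := fun v => q (projE k v) (projE k (A v)))
    (g := fun v => q (S (projM k v)) (S (projM k (A v)))) (by fun_prop) (by fun_prop)
    (fun r v => by simp; ring) (fun r v => by simp; ring) (fun v hv => by
      rw [key1 v hv.1 hv.2]
      by_cases h0 : S (projM k v) = 0
      · simp [h0]
      · exact (hpos _ h0).le) (fun v hv hv0 hg => by
      rw [key1 v hv.1 hv.2] at hg
      have h0 : S (projM k v) = 0 := by
        by_contra h0
        exact (hpos _ h0).ne' hg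
      have e1 : projE k v = v := by
        conv_rhs => rw [← proj_sum k v, hS0 v h0, show projY k v = 0 from hv.1,
          show v.2.2 = 0 from hv.2, zero_smul, add_zero, add_zero, add_zero]
      simp only [e1, hE v e1]
      exact hpos v hv0)
  obtain ⟨K₂, hK₂, h₂⟩ := exists_large_factor (L := LinearMap.ker (coordZ (n := n)).toLinearMap)
    (f := fun v => q (projE k v) (projE k (A v)) + K₁ * q (S (projM k v)) (S (projM k (A v))))
    (g := fun v => -q (U (projY k v)) (U (projY k (A v)))) (by fun_prop) (by fun_prop)
    (fun r v => by simp; ring) (fun r v => by simp; ring) (fun v hv => by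
      rw [key2 v hv]
      by_cases h0 : U (projY k v) = 0
      · simp [h0]
      · have := mul_pos_of_neg_of_neg (neg_neg_of_pos hm) (hneg _ (hUE _) h0)
        linarith [hpos _ h0]) (fun v hv hv0 hg => by
      rw [key2 v hv] at hg
      have h0 : U (projY k v) = 0 := by
        by_contra h0
        have := mul_pos_of_neg_of_neg (neg_neg_of_pos hm) (hneg _ (hUE _) h0)
        linarith [hpos _ h0]
      exact h₁ v ⟨hU0 v h0, hv⟩ hv0)
  obtain ⟨K₃, hK₃, h₃⟩ := exists_large_factor (L := (⊤ : Submodule ℝ (Std n)))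
    (f := fun v => q (projE k v) (projE k (A v)) + K₁ * q (S (projM k v)) (S (projM k (A v))) +
      K₂ * -q (U (projY k v)) (U (projY k (A v))))
    (g := fun v => v.2.2 * (A v).2.2) (by fun_prop) (by fun_prop)
    (fun r v => by simp; ring) (fun r v => by simp; ring) (fun v _ => by
      rw [hz]
      nlinarith [mul_nonneg hm.le (sq_nonneg v.2.2)]) (fun v _ hv0 hg => by
      rw [hz] at hg
      have h0 : v.2.2 = 0 := by
        rcases mul_eq_zero.1 hg with h | h
        · exact h
        · exact (mul_eq_zero.1 h).resolve_left hm.ne'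
      exact h₂ v h0 hv0)
  obtain ⟨B, hB⟩ : ∃ B : Std n →L[ℝ] Std n →L[ℝ] ℝ, ∀ v w, B v w =
      q (projE k v) (projE k w) + K₁ * q (S (projM k v)) (S (projM k w)) +
      K₂ * -q (U (projY k v)) (U (projY k w)) + K₃ * (v.2.2 * w.2.2) :=
    ⟨q.bilinearComp (projE k) (projE k) +
      K₁ • q.bilinearComp (S.comp (projM k)) (S.comp (projM k)) +
      K₂ • -q.bilinearComp (U.comp (projY k)) (U.comp (projY k)) +
      K₃ • coordZ.smulRight coordZ, fun v w => by simp⟩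
  -- The form `B` is block diagonal, negative on `E` and positive on the other blocks, and the
  -- diagonal field contracts `E` (`m/2 - 3M/2 < 0`) and expands the rest.
  have hBD : ∀ v, v ≠ 0 → 0 < B v (diagField k m (max 1 m) v) := by
    intro v hv0
    obtain ⟨M, hM⟩ : ∃ M, M = max 1 m := ⟨_, rfl⟩
    have hMm : m ≤ M := hM ▸ le_max_right _ _
    obtain ⟨d1, d2, d3⟩ := proj_diagField k m M v
    rw [← hM, hB, d1, d2, d3, show (diagField k m M v).2.2 = m * v.2.2 from rfl]
    simp only [map_smul, smul_eq_mul]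
    have t1 : ∀ x : Std n, projE k x = x → q x x ≤ 0 := fun x hx => by
      by_cases h : x = 0
      · simp [h]
      · exact (hneg x hx h).le
    have t2 : ∀ x, 0 ≤ q (S (projM k x)) (S (projM k x)) := fun x => by
      by_cases h : S (projM k x) = 0
      · simp [h]
      · exact (hperp _ ((hSz _).trans (zM _)) (fun e he => hqS e _ he) h).le
    have a1 := t1 _ (eEE v)
    have a2 := t2 v
    have a3 := t1 _ (hUE (projY k v))
    have b1 : 0 ≤ (m / 2 - 3 * M / 2) * q (projE k v) (projE k v) :=
      mul_nonneg_of_nonpos_of_nonpos (by linarith) a1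
    have b2 : 0 ≤ K₁ * (m / 2 * q (S (projM k v)) (S (projM k v))) := by positivity
    have b3 : 0 ≤ K₂ * -((m / 2 + 3 * M / 2) * q (U (projY k v)) (U (projY k v))) := by
      have : 0 ≤ -((m / 2 + 3 * M / 2) * q (U (projY k v)) (U (projY k v))) :=
        neg_nonneg.2 (mul_nonpos_of_nonneg_of_nonpos (by linarith) a3)
      positivity
    have b4 : 0 ≤ K₃ * (v.2.2 * (m * v.2.2)) := by
      have : 0 ≤ v.2.2 * (m * v.2.2) := by nlinarith [mul_nonneg hm.le (sq_nonneg v.2.2)]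
      positivity
    by_contra hcon
    rw [not_lt] at hcon
    have z1 : projE k v = 0 := by
      by_contra h
      have := mul_pos_of_neg_of_neg (by linarith : m / 2 - 3 * M / 2 < 0) (hneg _ (eEE v) h)
      linarith
    have z2 : projM k v = 0 := hS0 v (by
      by_contra h
      have := hperp _ ((hSz _).trans (zM _)) (fun e he => hqS e _ he) h
      have : 0 < K₁ * (m / 2 * q (S (projM k v)) (S (projM k v))) := by positivity
      linarith)
    have z3 : projY k v = 0 := hU0 v (by
      by_contra h
      have h1 := hneg _ (hUE _) h
      have h2 := mul_neg_of_pos_of_neg (by linarith : 0 < m / 2 + 3 * M / 2) h1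
      have := mul_pos hK₂ (neg_pos.2 h2)
      linarith)
    have z4 : v.2.2 = 0 := by
      by_contra h
      have h1 : 0 < v.2.2 ^ 2 := by positivity
      have h2 := mul_pos hK₃ (mul_pos hm h1)
      have h3 : v.2.2 * (m * v.2.2) = m * v.2.2 ^ 2 := by ring
      rw [h3] at hcon
      linarith
    exact hv0 (by rw [← proj_sum k v, z1, z2, z3, z4]; simp)
  obtain ⟨c₁, hc₁, l₁⟩ := exists_quadratic_lower_bound (f := fun v => B v (A v)) (by fun_prop)
    (fun r v => by simp; ring) fun v hv => by
      rw [hB]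
      exact h₃ v trivial hv
  have hDlin : ∃ D : Std n →L[ℝ] Std n, ∀ v, D v = diagField k m (max 1 m) v :=
    ⟨(m / 2 - 3 * max 1 m / 2) • projE k + (m / 2) • projM k + (m / 2 + 3 * max 1 m / 2) • projY k +
      m • coordZ.smulRight vecZ, fun v => by
        obtain ⟨d1, d2, d3⟩ := proj_diagField k m (max 1 m) v
        rw [← proj_sum k (diagField k m (max 1 m) v), d1, d2, d3,
          show (diagField k m (max 1 m) v).2.2 = m * v.2.2 from rfl]
        simp [smul_smul]⟩
  obtain ⟨D, hD⟩ := hDlin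
  obtain ⟨c₂, hc₂, l₂⟩ := exists_quadratic_lower_bound (f := fun v => B v (D v)) (by fun_prop)
    (fun r v => by simp; ring) fun v hv => by
      rw [hD]
      exact hBD v hv
  refine ⟨B, min c₁ c₂, fun u v => ?_, by positivity, fun v => le_trans ?_ (l₁ v),
    fun v => le_trans ?_ ((l₂ v).trans_eq (by rw [hD]))⟩
  · rw [hB, hB, hq (projE k u), hq (S _), hq (U _)]
    ring
  · gcongr
    exact min_le_left _ _
  · gcongr
    exact min_le_right _ _

end BlockLyapunov

/-! ### Linear coordinates adapted to the linearisation. -/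

section LinearNormalForm

/-- Linear coordinates adapted to a covector and a bilinear form as at a point of a contact
manifold, and to a linear conformal contact field with a positive factor. -/
theorem exists_adapted_coordinates {W : Type*} [NormedAddCommGroup W] [NormedSpace ℝ W]
    [FiniteDimensional ℝ W] {a : W →L[ℝ] ℝ} {σ q : W →L[ℝ] W →L[ℝ] ℝ} {A : W →L[ℝ] W} {R : W}
    {m : ℝ} (hm : 0 < m) (haR : a R = 1) (hσ : ∀ u v, σ u v = -σ v u) (hσR : ∀ v, σ R v = 0)
    (hnd : ∀ v, a v = 0 → (∀ u, a u = 0 → σ v u = 0) → v = 0) (hA : ∀ v, a (A v) = m * a v)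
    (hσA : ∀ u v, a u = 0 → a v = 0 → σ (A u) v + σ u (A v) = m * σ u v)
    (hq : ∀ u v, q u v = q v u) (hpos : ∀ v, v ≠ 0 → 0 < q v (A v)) :
    ∃ (n k : ℕ) (ℓ : W ≃L[ℝ] Std n), k ≤ n ∧ (∀ v, (ℓ v).2.2 = a v) ∧
      (∀ u v, stdOmega (ℓ u) (ℓ v) = σ u v) ∧
      ∃ (B : Std n →L[ℝ] Std n →L[ℝ] ℝ) (c : ℝ), (∀ u v, B u v = B v u) ∧ 0 < c ∧
        (∀ v, c * ‖v‖ ^ 2 ≤ B v (ℓ (A (ℓ.symm v)))) ∧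
        ∀ v, c * ‖v‖ ^ 2 ≤ B v (diagField k m (max 1 m) v) := by
  let V : Submodule ℝ W := LinearMap.ker a.toLinearMap
  have hV : ∀ v, v ∈ V ↔ a v = 0 := fun v => Iff.rfl
  have hAV : ∀ v ∈ V, A.toLinearMap v ∈ V := fun v hv => by
    rw [hV] at hv ⊢
    exact (hA v).trans (by rw [hv, mul_zero])
  obtain ⟨E, hEA, hEneg, hEperp⟩ := exists_invariant_negative _ V rfl (A.toLinearMap.restrict hAV)
    (LinearMap.domRestrict₁₂ (bilinOf q) V V) (fun u v => hq u v)
    (fun v hv => hpos v fun h => hv (Subtype.ext h))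
  -- On `E` the form `-q` is definite and decreases along `A`, while `σ` is scaled by `m ≥ 0`.
  have hiso : ∀ u ∈ E, ∀ v ∈ E, σ (u : W) (v : W) = 0 := fun u hu v hv =>
    eq_zero_of_conformal_contraction (V := E) (q := bilPull q (V.subtypeL.comp E.subtypeL))
      (σ := bilPull σ (V.subtypeL.comp E.subtypeL))
      (A := (A.toLinearMap.restrict hAV).restrict hEA) hm.le (fun u v => hq _ _)
      (fun v hv => hEneg v v.2 fun h => hv (Subtype.ext h))
      (fun v hv => hpos _ fun h => hv (Subtype.ext (Subtype.ext h)))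
      (fun u v => hσA _ _ u.1.2 v.1.2) ⟨u, hu⟩ ⟨v, hv⟩
  obtain ⟨n, k, p, r, hkn, hpp, hrr, hpr, hexp, hpE, hEp⟩ := exists_symplectic_basis _ V rfl
    (LinearMap.domRestrict₁₂ (bilinOf σ) V V) (fun u v => hσ u v)
    (fun v hv => Subtype.ext (hnd v v.2 fun u hu => by rw [hσ, neg_eq_zero]; exact hv ⟨u, hu⟩)) E hiso
  have hσR' : ∀ v, σ v R = 0 := fun v => by rw [hσ, hσR, neg_zero]
  have hdec : ∀ v : W, v = ∑ i, (σ v (r i) • (p i : W) + σ (p i) v • (r i : W)) + a v • R := by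
    intro v
    have hv : v - a v • R ∈ V := by rw [hV, map_sub, map_smul, haR, smul_eq_mul, mul_one, sub_self]
    have h1 := congrArg (Subtype.val) (hexp ⟨_, hv⟩)
    rw [AddSubmonoidClass.coe_finsetSum] at h1
    rw [← sub_eq_iff_eq_add]
    refine h1.trans (Finset.sum_congr rfl fun i _ => ?_)
    change σ (v - a v • R) (r i) • (p i : W) + σ (p i) (v - a v • R) • (r i : W) = _
    rw [map_sub, map_sub, map_smul, map_smul, hσR', sub_apply,
      smul_apply, hσR]
    simp
  let g : Std n →ₗ[ℝ] W :=
    { toFun := fun w => ∑ i, (w.1 i • (p i : W) + w.2.1 i • (r i : W)) + w.2.2 • R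
      map_add' := fun u v => by
        simp only [Prod.fst_add, Prod.snd_add, Pi.add_apply, add_smul, Finset.sum_add_distrib]
        abel
      map_smul' := fun s v => by
        simp only [Prod.smul_fst, Prod.smul_snd, Pi.smul_apply, smul_eq_mul, mul_smul,
          RingHom.id_apply, smul_add, Finset.smul_sum] }
  have hg : ∀ w, g w = ∑ i, (w.1 i • (p i : W) + w.2.1 i • (r i : W)) + w.2.2 • R := fun w => rfl
  have hpp' : ∀ i j, σ (p i : W) (p j) = 0 := hpp
  have hrr' : ∀ i j, σ (r i : W) (r j) = 0 := hrr
  have hpr' : ∀ i j, σ (p i : W) (r j) = if i = j then 1 else 0 := hpr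
  have hga : ∀ w, a (g w) = w.2.2 := fun w => by
    have hap : ∀ i, a (p i) = 0 := fun i => (p i).2
    have har : ∀ i, a (r i) = 0 := fun i => (r i).2
    simp [hg, map_sum, hap, har, haR]
  have hgx : ∀ w i, σ (g w) (r i) = w.1 i := fun w i => by
    simp [hg, map_sum, sum_apply, hpr', hrr', hσR]
  have hgy : ∀ w i, σ (p i) (g w) = w.2.1 i := fun w i => by
    simp [hg, map_sum, hpr', hpp', hσR']
  let e : W ≃ₗ[ℝ] Std n :=
    { toFun := fun v => (fun i => σ v (r i), fun i => σ (p i) v, a v)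
      map_add' := fun u v => by simp [funext_iff]
      map_smul' := fun s v => by simp [funext_iff]
      invFun := g
      left_inv := fun v => (hdec v).symm
      right_inv := fun w => Prod.ext (funext (hgx w)) (Prod.ext (funext (hgy w)) (hga w)) }
  let ℓ : W ≃L[ℝ] Std n := e.toContinuousLinearEquiv
  have hℓ : ∀ v, ℓ v = (fun i => σ v (r i), fun i => σ (p i) v, a v) := fun v => rfl
  have hℓs : ∀ w, ℓ.symm w = g w := fun w => rfl
  have hω : ∀ u v, stdOmega (ℓ u) (ℓ v) = σ u v := fun u v => by
    rw [stdOmega_apply, hℓ, hℓ]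
    conv_rhs => rw [hdec u]
    simp only [map_add, map_sum, map_smul, add_apply,
      sum_apply, smul_apply, hσR, smul_eq_mul, mul_zero,
      add_zero]
    refine Finset.sum_congr rfl fun i _ => ?_
    rw [hσ (r i) v]
    ring
  have hEmem : ∀ w : Std n, projE k w = w → ∃ e ∈ E, (e : W) = ℓ.symm w := by
    intro w hw
    refine ⟨∑ i : Fin n, (if (i : ℕ) < k then w.1 i else 0) • p i, E.sum_mem fun i _ => ?_, ?_⟩
    · by_cases hi : (i : ℕ) < k
      · exact E.smul_mem _ (hpE i hi)
      · simp [hi]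
    · rw [hℓs, ← hw, hg, AddSubmonoidClass.coe_finsetSum]
      simp only [projE_apply, Pi.zero_apply, zero_smul, add_zero, ← ite_and, and_self]
      rfl
  have hEproj : ∀ e ∈ E, projE k (ℓ e) = ℓ e := by
    intro e he
    rw [hℓ, projE_apply]
    refine Prod.ext (funext fun i => ?_) (Prod.ext (funext fun i => ?_) ?_)
    · by_cases hi : (i : ℕ) < k
      · simp [hi]
      · have h1 : σ (e : W) (r i) = 0 := (hEp e he i).2 (not_lt.1 hi)
        simp [hi, h1]
    · exact ((hEp e he i).1).symm
    · exact (e.2 : a e = 0).symm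
  refine ⟨n, k, ℓ, hkn, fun v => rfl, hω, ?_⟩
  have hsz : ∀ w : Std n, a (ℓ.symm w) = w.2.2 := hga
  have hs0 : ∀ w : Std n, w ≠ 0 → ℓ.symm w ≠ 0 := fun w hw h => hw (by simpa using congrArg ℓ h)
  refine exists_block_lyapunov (k := k) hm
    (A := (ℓ : W →L[ℝ] Std n).comp (A.comp (ℓ.symm : Std n →L[ℝ] W)))
    (q := bilPull q (ℓ.symm : Std n →L[ℝ] W)) (fun u v => hq _ _)
    (fun v => (hA (ℓ.symm v)).trans (by rw [hsz])) (fun v hv => ?_) (fun u v hu hv => ?_)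
    (fun v hv => ?_) (fun v hv hv0 => ?_) (fun v hv h hv0 => ?_)
  · obtain ⟨e, he, hev⟩ := hEmem v hv
    change projE k (ℓ (A (ℓ.symm v))) = ℓ (A (ℓ.symm v))
    rw [← hev]
    exact hEproj _ (hEA e he)
  · have h1 := hσA (ℓ.symm u) (ℓ.symm v) (by rw [hsz, hu]) (by rw [hsz, hv])
    rw [← hω, ← hω, ← hω] at h1
    simpa using h1
  · have h1 := hpos _ (hs0 v hv)
    simpa using h1
  · obtain ⟨e, he, hev⟩ := hEmem v hv
    have h1 := hEneg e he fun h => hs0 v hv0 (by rw [← hev, h]; rfl)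
    have h2 : q (e : W) (e : W) < 0 := h1
    rwa [hev] at h2
  · have hmem : ℓ.symm v ∈ V := by rw [hV, hsz, hv]
    refine hEperp ⟨_, hmem⟩ (fun e he => ?_) fun h0 => hs0 v hv0 (congrArg Subtype.val h0)
    have h1 : q (e : W) (ℓ.symm v) = 0 := by simpa using h (ℓ e) (hEproj e he)
    exact h1

end LinearNormalForm

/-! ### Linearisation at a zero of the field. -/

section Derivatives

variable {W : Type*} [NormedAddCommGroup W] [NormedSpace ℝ W]

/-- The derivative of the equation of a contact field at a zero. -/
lemma exists_linear_factor {a : W → W →L[ℝ] ℝ} {Y : W → W} {R : W} (ha : ContDiffAt ℝ ∞ a 0)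
    (hY : ContDiffAt ℝ ∞ Y 0) (h0 : Y 0 = 0) (hR : a 0 R = 1)
    (h : ∀ᶠ w in 𝓝 0, ContactFieldAt 𝓘(ℝ, W) a Y w) :
    ∃ m : ℝ, (∀ v, a 0 (fderiv ℝ Y 0 v) = m * a 0 v) ∧ ∀ u v, a 0 u = 0 → a 0 v = 0 →
      fderiv ℝ a 0 (fderiv ℝ Y 0 u) v - fderiv ℝ a 0 v (fderiv ℝ Y 0 u) +
        (fderiv ℝ a 0 u (fderiv ℝ Y 0 v) - fderiv ℝ a 0 (fderiv ℝ Y 0 v) u) =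
      m * (fderiv ℝ a 0 u v - fderiv ℝ a 0 v u) := by
  have hle2 : ((2 : ℕ∞) : WithTop ℕ∞) ≤ ∞ := by exact_mod_cast le_top
  have hle1 : (1 : WithTop ℕ∞) ≤ ∞ := by exact_mod_cast le_top
  -- `θ` is the Lie derivative of the form, with the derivatives of `a` along the argument
  -- cancelled.
  obtain ⟨θ, hθ⟩ : ∃ θ : W → W → ℝ, ∀ w v, θ w v = a w (fderiv ℝ Y w v) + fderiv ℝ a w (Y w) v :=
    ⟨_, fun _ _ => rfl⟩
  have hev : ∀ᶠ w in 𝓝 0, ∃ m, ∀ v, θ w v = m * a w v := by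
    filter_upwards [h, (ha.of_le hle1).eventually (by simp),
      (hY.of_le hle1).eventually (by simp)] with w hw haw hYw
    rw [contactFieldAt_model] at hw
    obtain ⟨m, hm⟩ := hw
    refine ⟨m, fun v => ?_⟩
    rw [← hm v, fderiv_clm_apply (haw.differentiableAt (by simp)) (hYw.differentiableAt (by simp)), hθ]
    simp
  obtain ⟨m, hm⟩ := hev.self_of_nhds
  have hm' : ∀ v, a 0 (fderiv ℝ Y 0 v) = m * a 0 v := fun v => by
    rw [← hm v, hθ, h0]
    simp
  have hmR : θ 0 R = m := by rw [hm, hR, mul_one]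
  refine ⟨m, hm', ?_⟩
  have da : HasFDerivAt a (fderiv ℝ a 0) 0 := (ha.differentiableAt (by simp)).hasFDerivAt
  have dY : HasFDerivAt Y (fderiv ℝ Y 0) 0 := (hY.differentiableAt (by simp)).hasFDerivAt
  have dda : HasFDerivAt (fderiv ℝ a) (fderiv ℝ (fderiv ℝ a) 0) 0 :=
    ((ha.fderiv_right (m := ∞) (by simp)).differentiableAt (by simp)).hasFDerivAt
  have ddY : HasFDerivAt (fderiv ℝ Y) (fderiv ℝ (fderiv ℝ Y) 0) 0 :=
    ((hY.fderiv_right (m := ∞) (by simp)).differentiableAt (by simp)).hasFDerivAt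
  have hsymm : IsSymmSndFDerivAt ℝ Y 0 := hY.isSymmSndFDerivAt (by simpa using hle2)
  have dθ : ∀ v, HasFDerivAt (fun w => θ w v) ((fderiv ℝ a 0).flip (fderiv ℝ Y 0 v) +
      (a 0).comp ((fderiv ℝ (fderiv ℝ Y) 0).flip v) +
      ((fderiv ℝ a 0).flip v).comp (fderiv ℝ Y 0)) 0 := by
    intro v
    have h1 := da.clm_apply (ddY.clm_apply (hasFDerivAt_const v (0 : W)))
    have h2 := (dda.clm_apply dY).clm_apply (hasFDerivAt_const v (0 : W))
    have e : (fun w => θ w v) = fun w => a w (fderiv ℝ Y w v) + fderiv ℝ a w (Y w) v :=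
      funext fun w => hθ w v
    rw [e]
    refine (h1.fun_add h2).congr_fderiv (ContinuousLinearMap.ext fun u => ?_)
    simp [h0]
    ring
  have key : ∀ u v, a 0 v = 0 → fderiv ℝ a 0 (fderiv ℝ Y 0 u) v + fderiv ℝ a 0 u (fderiv ℝ Y 0 v) +
      a 0 (fderiv ℝ (fderiv ℝ Y) 0 u v) = m * fderiv ℝ a 0 u v := by
    intro u v hv
    -- The conformal factor is not known to be differentiable. Pairing with the fixed vector `R`
    -- eliminates it, and the resulting identity can be differentiated.
    have hz : (fun w => θ w v * a w R - θ w R * a w v) =ᶠ[𝓝 0] fun _ => 0 := by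
      filter_upwards [hev] with w ⟨m, hm⟩
      rw [hm, hm]
      ring
    have h1 := ((dθ v).mul (da.clm_apply (hasFDerivAt_const R (0 : W)))).sub
      ((dθ R).mul (da.clm_apply (hasFDerivAt_const v (0 : W))))
    have h2 := h1.unique ((hasFDerivAt_const (0 : ℝ) (0 : W)).congr_of_eventuallyEq hz)
    have h3 := DFunLike.congr_fun h2 u
    have hθv : θ 0 v = 0 := by rw [hm, hv, mul_zero]
    simp [hθv, hmR, hv, hR] at h3
    linear_combination h3
  intro u v hu hv
  have h1 := key u v hv
  have h2 := key v u hu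
  rw [hsymm u v] at h1
  linear_combination h1 - h2

/-- The Hessian is positive in the sense of Lyapunov, as the derivative of the function along the
field grows quadratically. -/
lemma fderiv_fderiv_pos {f : W → ℝ} {Y : W → W} (hf : ContDiffAt ℝ ∞ f 0)
    (hY : ContDiffAt ℝ ∞ Y 0) (h0 : Y 0 = 0) (hf0 : fderiv ℝ f 0 = 0) {c : ℝ} (hc : 0 < c)
    (h : ∀ᶠ w in 𝓝 0, c * ‖w‖ ^ 2 ≤ fderiv ℝ f w (Y w)) {v : W} (hv : v ≠ 0) :
    0 < fderiv ℝ (fderiv ℝ f) 0 v (fderiv ℝ Y 0 v) := by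
  have ddf : HasFDerivAt (fderiv ℝ f) (fderiv ℝ (fderiv ℝ f) 0) 0 :=
    ((hf.fderiv_right (m := ∞) (by simp)).differentiableAt (by simp)).hasFDerivAt
  have dY : HasFDerivAt Y (fderiv ℝ Y 0) 0 := (hY.differentiableAt (by simp)).hasFDerivAt
  have hline : HasDerivAt (fun t : ℝ => t • v) v 0 := by
    simpa using (hasDerivAt_id (0 : ℝ)).smul_const v
  have h1 : HasDerivAt (fun t : ℝ => fderiv ℝ f (t • v)) (fderiv ℝ (fderiv ℝ f) 0 v) 0 :=
    HasFDerivAt.comp_hasDerivAt (f := fun t : ℝ => t • v) 0 (by simpa using ddf) hline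
  have h2 : HasDerivAt (fun t : ℝ => Y (t • v)) (fderiv ℝ Y 0 v) 0 :=
    HasFDerivAt.comp_hasDerivAt (f := fun t : ℝ => t • v) 0 (by simpa using dY) hline
  have h3 := h1.tendsto_slope_zero
  have h4 := h2.tendsto_slope_zero
  simp only [zero_add, zero_smul, hf0, h0, sub_zero] at h3 h4
  -- The quotient of `df(Y)` at `t v` by `t²` converges to the Hessian paired with the linearised
  -- field, and it is at least `c ‖v‖²`.
  have h5 : Filter.Tendsto (fun t : ℝ => (t⁻¹ • fderiv ℝ f (t • v)) (t⁻¹ • Y (t • v))) (𝓝[≠] 0)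
      (𝓝 (fderiv ℝ (fderiv ℝ f) 0 v (fderiv ℝ Y 0 v))) :=
    (isBoundedBilinearMap_apply.continuous.tendsto _).comp (h3.prodMk_nhds h4)
  refine lt_of_lt_of_le (b := c * ‖v‖ ^ 2) (by positivity) (ge_of_tendsto h5 ?_)
  have hcont : Filter.Tendsto (fun t : ℝ => t • v) (𝓝[≠] 0) (𝓝 0) := by
    have := hline.continuousAt.tendsto
    rw [zero_smul] at this
    exact this.mono_left nhdsWithin_le_nhds
  filter_upwards [hcont.eventually h, self_mem_nhdsWithin] with t ht ht0
  have ht0 : t ≠ 0 := ht0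
  rw [norm_smul, mul_pow, Real.norm_eq_abs, sq_abs] at ht
  simp only [smul_apply, map_smul, smul_eq_mul]
  have e : c * ‖v‖ ^ 2 = t⁻¹ * (t⁻¹ * (c * (t ^ 2 * ‖v‖ ^ 2))) := by field_simp
  rw [e, ← mul_assoc, ← mul_assoc (t⁻¹)]
  exact mul_le_mul_of_nonneg_left ht (mul_self_nonneg _)

end Derivatives

/-! ### Opposite field and function. -/

section Negation

variable {W : Type*} [NormedAddCommGroup W] [NormedSpace ℝ W]

/-- The same form with the opposite field and function. -/
def LocalData.neg (d : LocalData W) : LocalData W := fun w => ((d w).1, -(d w).2.1, -(d w).2.2)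

lemma LocalData.contDiff_negMap :
    ContDiff ℝ ∞ (fun x : (W →L[ℝ] ℝ) × W × ℝ => (x.1, -x.2.1, -x.2.2)) :=
  contDiff_fst.prodMk (contDiff_snd.fst.neg.prodMk contDiff_snd.snd.neg)

lemma LocalData.Valid.neg {d : LocalData W} {V : Set W} {J : Set ℝ} (h : d.Valid V J) :
    d.neg.Valid V (Neg.neg ⁻¹' J) where
  smooth w hw := LocalData.contDiff_negMap.contDiffAt.comp w (h.smooth w hw)
  form := h.form
  field w hw := by
    have h1 := h.field w hw
    rw [contactFieldAt_model] at h1 ⊢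
    obtain ⟨m, hm⟩ := h1
    refine ⟨-m, fun v => ?_⟩
    have e : (fun y => (d.neg y).1 ((d.neg y).2.1)) = fun y => -((d y).1 (d y).2.1) :=
      funext fun y => map_neg _ _
    rw [e, fderiv_fun_neg]
    have := hm v
    simp only [LocalData.neg, map_neg, neg_apply] at this ⊢
    linear_combination -this
  regular w hw hw0 := by
    have := h.regular w hw hw0
    simpa [LocalData.neg, fderiv_fun_neg] using this
  zero := by simp [LocalData.neg, h.zero]
  critical := by simp [LocalData.neg, fderiv_fun_neg, h.critical]
  growth := by
    obtain ⟨c, hc, hg⟩ := h.growth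
    refine ⟨c, hc, ?_⟩
    filter_upwards [hg] with w hw
    simpa [LocalData.neg, fderiv_fun_neg] using hw
  mem w hw := by
    simpa [LocalData.neg] using h.mem w hw

lemma LocalData.Move.neg {d d' : LocalData W} {V : Set W} {J : Set ℝ}
    (h : LocalData.Move V J d d') : LocalData.Move V (Neg.neg ⁻¹' J) d.neg d'.neg := by
  obtain ⟨D, K, hK, hKV, h0, h1, hv, hs, hoff⟩ := h
  refine ⟨fun t => (D t).neg, K, hK, hKV, fun w hw => ?_, fun w hw => ?_, fun t ht => (hv t ht).neg,
    fun t ht w hw => ?_, fun t ht w hw => ?_⟩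
  · simp only [LocalData.neg, h0 w hw]
  · simp only [LocalData.neg, h1 w hw]
  · exact LocalData.contDiff_negMap.contDiffAt.comp (t, w) (hs t ht w hw)
  · simp only [LocalData.neg, hoff t ht w hw]

lemma LocalData.reflTransGen_move_neg {d d' : LocalData W} {V : Set W} {J : Set ℝ}
    (h : Relation.ReflTransGen (LocalData.Move V (Neg.neg ⁻¹' J)) d d') :
    Relation.ReflTransGen (LocalData.Move V J) d.neg d'.neg := by
  have e : Neg.neg ⁻¹' (Neg.neg ⁻¹' J) = J := by ext; simp
  refine h.lift LocalData.neg fun a b hab => ?_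
  have := hab.neg
  rwa [e] at this

end Negation

/-! ### Linear changes of coordinates. -/

section LinearChange

variable {W W' : Type*} [NormedAddCommGroup W] [NormedSpace ℝ W] [NormedAddCommGroup W']
  [NormedSpace ℝ W'] {d : LocalData W}

/-- Local data in other linear coordinates. -/
def LocalData.map (d : LocalData W) (ℓ : W ≃L[ℝ] W') : LocalData W' := fun w =>
  ((d (ℓ.symm w)).1.comp (ℓ.symm : W' →L[ℝ] W), ℓ (d (ℓ.symm w)).2.1, (d (ℓ.symm w)).2.2)

lemma LocalData.contDiffAt_map {ℓ : W ≃L[ℝ] W'} {w : W'} (h : ContDiffAt ℝ ∞ d (ℓ.symm w)) :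
    ContDiffAt ℝ ∞ (d.map ℓ) w := by
  have h1 : ContDiffAt ℝ ∞ (fun w => d (ℓ.symm w)) w :=
    h.comp w ℓ.symm.contDiff.contDiffAt
  exact (h1.fst.clm_comp contDiffAt_const).prodMk ((ℓ.contDiff.contDiffAt.comp w h1.snd.fst).prodMk
    h1.snd.snd)

lemma LocalData.fderiv_map_form {ℓ : W ≃L[ℝ] W'} {w : W'} (h : ContDiffAt ℝ ∞ d (ℓ.symm w))
    (u v : W') : fderiv ℝ (fun w => (d.map ℓ w).1) w u v =
      fderiv ℝ (fun w => (d w).1) (ℓ.symm w) (ℓ.symm u) (ℓ.symm v) := by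
  have h1 : HasFDerivAt (fun w => (d (ℓ.symm w)).1)
      ((fderiv ℝ (fun w => (d w).1) (ℓ.symm w)).comp (ℓ.symm : W' →L[ℝ] W)) w :=
    (h.fst.differentiableAt (by simp)).hasFDerivAt.comp w ℓ.symm.hasFDerivAt
  have h2 := h1.clm_comp (hasFDerivAt_const (ℓ.symm : W' →L[ℝ] W) w)
  have h3 := h2.fderiv
  refine (congrArg (fun D => D u v) h3).trans ?_
  simp

lemma LocalData.fderiv_map_field {ℓ : W ≃L[ℝ] W'} {w : W'} (h : ContDiffAt ℝ ∞ d (ℓ.symm w))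
    (u : W') : fderiv ℝ (fun w => (d.map ℓ w).2.1) w u =
      ℓ (fderiv ℝ (fun w => (d w).2.1) (ℓ.symm w) (ℓ.symm u)) := by
  have h1 : HasFDerivAt (fun w => (d (ℓ.symm w)).2.1)
      ((fderiv ℝ (fun w => (d w).2.1) (ℓ.symm w)).comp (ℓ.symm : W' →L[ℝ] W)) w :=
    (h.snd.fst.differentiableAt (by simp)).hasFDerivAt.comp w ℓ.symm.hasFDerivAt
  exact congrArg (fun D => D u) (ℓ.hasFDerivAt.comp w h1).fderiv

lemma LocalData.fderiv_map_fun {ℓ : W ≃L[ℝ] W'} {w : W'} (h : ContDiffAt ℝ ∞ d (ℓ.symm w))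
    (u : W') : fderiv ℝ (fun w => (d.map ℓ w).2.2) w u =
      fderiv ℝ (fun w => (d w).2.2) (ℓ.symm w) (ℓ.symm u) :=
  congrArg (fun D => D u) ((h.snd.snd.differentiableAt (by simp)).hasFDerivAt.comp w
    ℓ.symm.hasFDerivAt).fderiv

lemma LocalData.Valid.map {V : Set W} {J : Set ℝ} (h : d.Valid V J) (hV : IsOpen V)
    (h0V : (0 : W) ∈ V) (ℓ : W ≃L[ℝ] W') : (d.map ℓ).Valid (ℓ.symm ⁻¹' V) J where
  smooth w hw := LocalData.contDiffAt_map (h.smooth _ hw)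
  form w hw := by
    have h1 := h.form _ hw
    rw [contactFormAt_model] at h1 ⊢
    refine ⟨fun h0 => h1.1 (ContinuousLinearMap.ext fun v => ?_), fun v hv hd => ?_⟩
    · have := DFunLike.congr_fun h0 (ℓ v)
      simpa [LocalData.map] using this
    · have := h1.2 (ℓ.symm v) hv fun u hu => by
        have := hd (ℓ u) (by simpa [LocalData.map] using hu)
        rwa [LocalData.fderiv_map_form (h.smooth _ hw), LocalData.fderiv_map_form (h.smooth _ hw),
          ℓ.symm_apply_apply] at this
      simpa using congrArg ℓ this
  field w hw := by
    have h1 := h.field _ hw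
    rw [contactFieldAt_model] at h1 ⊢
    obtain ⟨m, hm⟩ := h1
    refine ⟨m, fun v => ?_⟩
    have e : (fun y => (d.map ℓ y).1 ((d.map ℓ y).2.1)) =
        (fun y => (d y).1 (d y).2.1) ∘ ℓ.symm := funext fun y => by simp [LocalData.map]
    rw [LocalData.fderiv_map_form (h.smooth _ hw), LocalData.fderiv_map_form (h.smooth _ hw), e,
      ℓ.symm.comp_right_fderiv]
    have := hm (ℓ.symm v)
    simpa [LocalData.map] using this
  regular w hw hw0 := by
    rw [LocalData.fderiv_map_fun (h.smooth _ hw)]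
    have := h.regular _ hw fun h0 => hw0 (by simpa using congrArg ℓ h0)
    simpa [LocalData.map] using this
  zero := by simp [LocalData.map, h.zero]
  critical := by
    refine ContinuousLinearMap.ext fun v => ?_
    have h0 : ContDiffAt ℝ ∞ d (ℓ.symm 0) := by rw [map_zero]; exact h.smooth 0 h0V
    rw [LocalData.fderiv_map_fun h0, map_zero, h.critical]
    rfl
  growth := by
    obtain ⟨c, hc, hg⟩ := h.growth
    refine ⟨c / (‖(ℓ : W →L[ℝ] W')‖ + 1) ^ 2, by positivity, ?_⟩
    have hcont : Filter.Tendsto ℓ.symm (𝓝 0) (𝓝 0) := by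
      simpa using ℓ.symm.continuous.tendsto 0
    filter_upwards [hcont.eventually hg, hcont.eventually (hV.eventually_mem h0V)] with w hw hwV
    rw [LocalData.fderiv_map_fun (h.smooth _ hwV)]
    have h1 : ‖w‖ ≤ (‖(ℓ : W →L[ℝ] W')‖ + 1) * ‖ℓ.symm w‖ := by
      have := (ℓ : W →L[ℝ] W').le_opNorm (ℓ.symm w)
      simp only [ContinuousLinearEquiv.coe_coe, ContinuousLinearEquiv.apply_symm_apply] at this
      nlinarith [norm_nonneg (ℓ.symm w)]
    have h2 : ‖w‖ ^ 2 ≤ (‖(ℓ : W →L[ℝ] W')‖ + 1) ^ 2 * ‖ℓ.symm w‖ ^ 2 := by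
      rw [← mul_pow]
      gcongr
    have h3 : c / (‖(ℓ : W →L[ℝ] W')‖ + 1) ^ 2 * ‖w‖ ^ 2 ≤ c * ‖ℓ.symm w‖ ^ 2 := by
      rw [div_mul_eq_mul_div, div_le_iff₀ (by positivity)]
      nlinarith
    refine h3.trans (hw.trans (le_of_eq ?_))
    simp [LocalData.map]
  mem w hw := h.mem _ hw

end LinearChange

/-! ### The local normal form. -/

section NormalForm

variable {n : ℕ}

/-- The local data of the standard model of index `k`, with the function shifted by a constant. -/
def stdData (n k : ℕ) (c : ℝ) : LocalData (Std n) := fun w =>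
  (stdCovector w, stdField k w, stdFun k w + c)

lemma finrank_std : Module.finrank ℝ (Std n) = 2 * n + 1 := by
  simp [Std]
  ring

/-- Normalisation of a convex contact structure at a critical point, when the Reeb direction
expands. -/
theorem LocalData.Valid.exists_moves_of_pos {W : Type*} [NormedAddCommGroup W] [NormedSpace ℝ W]
    [FiniteDimensional ℝ W] (hW : Module.finrank ℝ W = 2 * n + 1) {d : LocalData W} {V : Set W}
    {J : Set ℝ} (hV : IsOpen V) (h0V : (0 : W) ∈ V) (hJ : IsOpen J) (hd : d.Valid V J) {m : ℝ}
    (hm : 0 < m) (hA : ∀ v, (d 0).1 (fderiv ℝ (fun w => (d w).2.1) 0 v) = m * (d 0).1 v) :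
    ∃ (k : ℕ) (ℓ : W ≃L[ℝ] Std n) (d' : LocalData (Std n)), k ≤ n ∧
      Relation.ReflTransGen (LocalData.Move (ℓ.symm ⁻¹' V) J) (d.map ℓ) d' ∧
      ∀ᶠ w in 𝓝 0, d' w = (stdCovector w, subField k w, subFun k w + (d 0).2.2) := by
  have s0 := hd.smooth 0 h0V
  have hpair := isContactPair_of_contactFormAt (hd.form 0 h0V)
  obtain ⟨R, hR⟩ : ∃ R, R = (contactMap (d 0).1 (fderiv ℝ (fun w => (d w).1) 0)).inverse (d 0).1 :=
    ⟨_, rfl⟩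
  have haR : (d 0).1 R = 1 := hR ▸ hpair.apply_reeb
  obtain ⟨m', hm', hσ⟩ := exists_linear_factor s0.fst s0.snd.fst hd.zero haR
    (by filter_upwards [hV.eventually_mem h0V] with w hw using hd.field w hw)
  have hmm : m' = m := by
    have h1 := hm' R
    rw [hA R, haR, mul_one, mul_one] at h1
    exact h1.symm
  rw [hmm] at hσ
  obtain ⟨c₀, hc₀, hgr⟩ := hd.growth
  have hnd := ((contactFormAt_model _ _).1 (hd.form 0 h0V)).2
  have hle2 : ((2 : ℕ∞) : WithTop ℕ∞) ≤ ∞ := by exact_mod_cast le_top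
  have hsymm : IsSymmSndFDerivAt ℝ (fun w => (d w).2.2) 0 :=
    s0.snd.snd.isSymmSndFDerivAt (by simpa using hle2)
  obtain ⟨n', k, ℓ, hk, hℓa, hℓσ, B, c, hB, hc, hBA, hBD⟩ := exists_adapted_coordinates
    (a := (d 0).1) (σ := fderiv ℝ (fun w => (d w).1) 0 - (fderiv ℝ (fun w => (d w).1) 0).flip)
    (q := fderiv ℝ (fderiv ℝ (fun w => (d w).2.2)) 0) (A := fderiv ℝ (fun w => (d w).2.1) 0) (R := R)
    hm haR (fun u v => by simp) (fun v => by
      have := hpair.reeb_antisymm v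
      rwa [← hR] at this) (fun v hv h => hnd v hv fun u hu => h u hu) hA
    (fun u v hu hv => hσ u v hu hv) (fun u v => hsymm u v)
    (fun v hv => fderiv_fderiv_pos s0.snd.snd s0.snd.fst hd.zero hd.critical hc₀ hgr hv)
  have hn : n' = n := by
    have h1 := ℓ.toLinearEquiv.finrank_eq
    rw [hW, finrank_std] at h1
    omega
  subst hn
  have hs : ContDiffAt ℝ ∞ d (ℓ.symm 0) := by rw [map_zero]; exact s0
  obtain ⟨d', hd', hev⟩ := LocalData.Valid.exists_moves_std (k := k)
    (hV.preimage ℓ.symm.continuous) (by simpa using h0V) hJ (hd.map hV h0V ℓ) (by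
      refine ContinuousLinearMap.ext fun v => ?_
      have := hℓa (ℓ.symm v)
      rw [ℓ.apply_symm_apply] at this
      simpa [LocalData.map] using this.symm) (fun u v => by
      rw [LocalData.fderiv_map_form hs, LocalData.fderiv_map_form hs, ← stdOmega_apply]
      have := hℓσ (ℓ.symm u) (ℓ.symm v)
      rw [ℓ.apply_symm_apply, ℓ.apply_symm_apply] at this
      rw [this, map_zero]
      rfl) hm (fun v => by
      rw [LocalData.fderiv_map_field hs, hℓa, map_zero, hA, ← hℓa, ℓ.apply_symm_apply]) hB hc
    (fun v => by
      rw [LocalData.fderiv_map_field hs, map_zero]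
      exact hBA v) hBD
  refine ⟨k, ℓ, d', hk, hd', ?_⟩
  filter_upwards [hev] with w hw
  rw [hw]
  simp [LocalData.map]

/-- Normalisation of a convex contact structure at a critical point. -/
theorem LocalData.Valid.exists_moves {W : Type*} [NormedAddCommGroup W] [NormedSpace ℝ W]
    [FiniteDimensional ℝ W] (hW : Module.finrank ℝ W = 2 * n + 1) {d : LocalData W} {V : Set W}
    {J : Set ℝ} (hV : IsOpen V) (h0V : (0 : W) ∈ V) (hJ : IsOpen J) (hd : d.Valid V J) :
    ∃ (k : ℕ) (ℓ : W ≃L[ℝ] Std n) (d' : LocalData (Std n)), k ≤ 2 * n + 1 ∧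
      Relation.ReflTransGen (LocalData.Move (ℓ.symm ⁻¹' V) J) (d.map ℓ) d' ∧
      ∀ᶠ w in 𝓝 0, d' w = stdData n k (d 0).2.2 w := by
  have s0 := hd.smooth 0 h0V
  have ha0 := ((contactFormAt_model _ _).1 (hd.form 0 h0V)).1
  have hpair := isContactPair_of_contactFormAt (hd.form 0 h0V)
  obtain ⟨m, hm, -⟩ := exists_linear_factor s0.fst s0.snd.fst hd.zero hpair.apply_reeb
    (by filter_upwards [hV.eventually_mem h0V] with w hw using hd.field w hw)
  obtain ⟨c₀, hc₀, hgr⟩ := hd.growth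
  have hinj : Function.Injective (fderiv ℝ (fun w => (d w).2.1) 0).toLinearMap :=
    (injective_iff_map_eq_zero _).2 fun v hv => by
      by_contra h0
      have h1 := fderiv_fderiv_pos s0.snd.snd s0.snd.fst hd.zero hd.critical hc₀ hgr h0
      rw [show fderiv ℝ (fun w => (d w).2.1) 0 v = 0 from hv, map_zero] at h1
      exact lt_irrefl _ h1
  -- The linearisation is injective, since a vector in its kernel would contradict the Lyapunov
  -- inequality, hence surjective; so `m = 0` would make the form vanish at the point.
  have hm0 : m ≠ 0 := by
    rintro rfl
    refine ha0 (ContinuousLinearMap.ext fun v => ?_)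
    obtain ⟨u, rfl⟩ := LinearMap.surjective_of_injective hinj v
    exact (hm u).trans (zero_mul _)
  rcases lt_or_gt_of_ne hm0 with hneg | hpos
  · have hJ' : IsOpen (Neg.neg ⁻¹' J : Set ℝ) := hJ.preimage continuous_neg
    obtain ⟨k, ℓ, d', hk, hd', hev⟩ := hd.neg.exists_moves_of_pos hW hV h0V hJ' (m := -m)
      (by linarith) (fun v => by
        have h1 : fderiv ℝ (fun w => (d.neg w).2.1) 0 v = -fderiv ℝ (fun w => (d w).2.1) 0 v :=
          congrArg (fun D : W →L[ℝ] W => D v)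
            (fderiv_fun_neg (𝕜 := ℝ) (f := fun w => (d w).2.1) (x := 0))
        rw [h1, map_neg]
        exact (congrArg Neg.neg (hm v)).trans (neg_mul _ _).symm)
    have e : (d.neg.map ℓ).neg = d.map ℓ := by
      funext w
      simp [LocalData.neg, LocalData.map]
    refine ⟨2 * n + 1 - k, ℓ, d'.neg, Nat.sub_le _ _, ?_, ?_⟩
    · have := LocalData.reflTransGen_move_neg hd'
      rwa [e] at this
    · filter_upwards [hev] with w hw
      have h1 : ¬ 2 * n + 1 - k ≤ n := by omega
      have h2 : 2 * n + 1 - (2 * n + 1 - k) = k := by omega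
      simp only [LocalData.neg, hw, stdData, stdField, stdFun, h1, h2, if_false]
      simp
      ring
  · obtain ⟨k, ℓ, d', hk, hd', hev⟩ := hd.exists_moves_of_pos hW hV h0V hJ hpos hm
    refine ⟨k, ℓ, d', by omega, hd', ?_⟩
    filter_upwards [hev] with w hw
    simp only [hw, stdData, stdField, stdFun, hk, if_true]

end NormalForm

/-! ### Coordinates in the interior and local data in them. -/

section Coordinates

variable {n : ℕ} {C : Cobordism n} {W W' : Type*} [NormedAddCommGroup W] [NormedSpace ℝ W]
  [NormedAddCommGroup W'] [NormedSpace ℝ W'] {κ : OpenPartialHomeomorph C.carrier W}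
  {S S' : ConvexStructure C} {d : LocalData W}

lemma Presents.exists_data (hκ : IsInteriorChart κ) (S : ConvexStructure C) :
    ∃ d : LocalData W, Presents κ S d ∧ ∀ w ∈ κ.target, ContDiffAt ℝ ∞ d w := by
  refine ⟨fun w => (ContinuousLinearMap.comp (S.α (κ.symm w))
    (mfderiv 𝓘(ℝ, W) (𝓡∂ (2 * n + 1)) κ.symm w),
    mfderiv (𝓡∂ (2 * n + 1)) 𝓘(ℝ, W) κ (κ.symm w) (S.X (κ.symm w)), S.φ (κ.symm w)),
    fun x hx => ⟨?_, ?_, ?_⟩, fun w hw => ?_⟩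
  · have h := hκ.mfderiv_symm_comp hx
    dsimp only
    rw [κ.left_inv hx]
    refine Eq.trans ?_ (ContinuousLinearMap.comp_assoc _ _ _).symm
    refine Eq.trans ?_ (congrArg (fun f : C.T x →L[ℝ] C.T x => (S.α x).comp f) h).symm
    rfl
  · dsimp only
    rw [κ.left_inv hx]
  · dsimp only
    rw [κ.left_inv hx]
  · have hs := hκ.smooth_symm w hw
    have hk := hκ.smooth _ (κ.map_target hw)
    have h1 := contMDiffAt_pullback_form (K := 𝓘(ℝ, W)) (I := 𝓘(ℝ, W)) (J := 𝓡∂ (2 * n + 1))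
      (b := id) (q₀ := w) (F := κ.symm) (β := fun w => S.α (κ.symm w)) contMDiffAt_id hs
      ((S.smooth_form (κ.symm w)).comp w hs)
    have h2 := contMDiffAt_pushforward_field (K := 𝓘(ℝ, W)) (I := 𝓡∂ (2 * n + 1)) (J := 𝓘(ℝ, W))
      (b := κ.symm) (q₀ := w) (F := κ) (X := fun w => S.X (κ.symm w)) hk
      ((S.smooth_field (κ.symm w)).comp w hs)
    have h3 := (S.smooth_fun (κ.symm w)).comp w hs
    have h1' := (contMDiffAt_form_iff.1 h1).2
    have h2' := (contMDiffAt_field_iff.1 h2).2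
    have e : ∀ x y : W, chartDsymm 𝓘(ℝ, W) x y = ContinuousLinearMap.id ℝ W := fun x y => by
      have h1 := chartD_comp_chartDsymm 𝓘(ℝ, W) (x₀ := x) (x := y)
        (by rw [extChartAt_model_space_eq_id]; exact mem_univ _)
      rw [chartD_model] at h1
      exact h1
    simp only [e] at h1'
    simp only [chartD_model] at h2'
    exact ContDiffAt.prodMk (contMDiffAt_iff_contDiffAt.1 h1')
      (ContDiffAt.prodMk (contMDiffAt_iff_contDiffAt.1 h2') (contMDiffAt_iff_contDiffAt.1 h3))

lemma IsInteriorChart.transLinear (hκ : IsInteriorChart κ) (ℓ : W ≃L[ℝ] W') :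
    IsInteriorChart (κ.transHomeomorph ℓ.toHomeomorph) where
  smooth x hx := by
    have h := (ℓ.contDiff.contMDiff (n := ∞)).contMDiffAt (x := κ x)
    exact h.comp x (hκ.smooth x hx)
  smooth_symm w hw := by
    have h := (ℓ.symm.contDiff.contMDiff (n := ∞)).contMDiffAt (x := w)
    exact (hκ.smooth_symm _ hw).comp w h
  interior := hκ.interior

lemma Presents.transLinear (hκ : IsInteriorChart κ) (h : Presents κ S d) (ℓ : W ≃L[ℝ] W') :
    Presents (κ.transHomeomorph ℓ.toHomeomorph) S (d.map ℓ) := by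
  intro x hx
  obtain ⟨h1, h2, h3⟩ := h x hx
  have hk : HasMFDerivAt (𝓡∂ (2 * n + 1)) 𝓘(ℝ, W) κ x
      (mfderiv (𝓡∂ (2 * n + 1)) 𝓘(ℝ, W) κ x) :=
    ((hκ.smooth x hx).mdifferentiableAt (by simp)).hasMFDerivAt
  have hd : mfderiv (𝓡∂ (2 * n + 1)) 𝓘(ℝ, W') (κ.transHomeomorph ℓ.toHomeomorph) x =
      (ℓ : W →L[ℝ] W').comp (mfderiv (𝓡∂ (2 * n + 1)) 𝓘(ℝ, W) κ x) :=
    ((ℓ.hasFDerivAt (x := κ x)).hasMFDerivAt.comp x hk).mfderiv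
  have hs : ℓ.symm ((κ.transHomeomorph ℓ.toHomeomorph) x) = κ x := ℓ.symm_apply_apply _
  simp only [LocalData.map]
  rw [hs, hd]
  refine ⟨h1.trans (ContinuousLinearMap.ext fun v => ?_), congrArg ℓ h2, h3⟩
  exact congrArg (d (κ x)).1 (ℓ.symm_apply_apply _).symm

lemma IsInteriorChart.restr (hκ : IsInteriorChart κ) {U : Set C.carrier} (hU : IsOpen U) :
    IsInteriorChart (κ.restrOpen U hU) where
  smooth x hx := hκ.smooth x hx.1
  smooth_symm w hw := hκ.smooth_symm w hw.1
  interior x hx := hκ.interior x hx.1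

lemma ConvexStructure.isClosed_boundary (S : ConvexStructure C) : IsClosed (C.bot ∪ C.top) := by
  refine IsClosed.union ?_ ?_
  · rcases S.bot_level with h | ⟨c, h, -⟩
    · rw [h]; exact isClosed_empty
    · rw [h]; exact isClosed_singleton.preimage S.smooth_fun.continuous
  · rcases S.top_level with h | ⟨c, h, -⟩
    · rw [h]; exact isClosed_empty
    · rw [h]; exact isClosed_singleton.preimage S.smooth_fun.continuous

/-- Coordinates centred at an interior point. -/
lemma exists_isInteriorChart {p : C.carrier} (hp : (𝓡∂ (2 * n + 1)).IsInteriorPoint p)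
    {N : Set C.carrier} (hN : IsOpen N) (hpN : p ∈ N) (hNb : ∀ x ∈ N, x ∉ C.bot ∪ C.top) :
    ∃ κ : OpenPartialHomeomorph C.carrier (EuclideanSpace ℝ (Fin (2 * n + 1))),
      IsInteriorChart κ ∧ p ∈ κ.source ∧ κ p = 0 ∧ κ.source ⊆ N := by
  let E := EuclideanSpace ℝ (Fin (2 * n + 1))
  let e := extChartAt (𝓡∂ (2 * n + 1)) p
  let U : Set E := interior (range (𝓡∂ (2 * n + 1)))
  have hU : IsOpen U := isOpen_interior
  have hUr : U ⊆ range (𝓡∂ (2 * n + 1)) := interior_subset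
  have hsrc : IsOpen (e.source ∩ (N ∩ e ⁻¹' U)) := by
    have h1 : IsOpen (e.source ∩ e ⁻¹' U) :=
      (continuousOn_extChartAt p).isOpen_inter_preimage (isOpen_extChartAt_source p) hU
    have h2 := h1.inter hN
    rwa [inter_assoc, inter_comm (e ⁻¹' U)] at h2
  -- The chart is restricted to the points whose image lies in the interior of the half space, so
  -- that the target is open in the vector space.
  let κ₀ : OpenPartialHomeomorph C.carrier E :=
    { toFun := e
      invFun := e.symm
      source := e.source ∩ (N ∩ e ⁻¹' U)
      target := U ∩ (𝓡∂ (2 * n + 1)).symm ⁻¹' ((chartAt _ p).target ∩ (chartAt _ p).symm ⁻¹' N)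
      map_source' := fun x hx => by
        have h1 := e.map_source hx.1
        rw [extChartAt_target] at h1
        refine ⟨hx.2.2, h1.1, ?_⟩
        have := e.left_inv hx.1
        rw [← this] at hx
        exact hx.2.1
      map_target' := fun w hw => by
        have h1 : w ∈ e.target := by rw [extChartAt_target]; exact ⟨hw.2.1, hUr hw.1⟩
        refine ⟨e.map_target h1, hw.2.2, ?_⟩
        rw [mem_preimage, e.right_inv h1]
        exact hw.1
      left_inv' := fun x hx => e.left_inv hx.1
      right_inv' := fun w hw => e.right_inv (by
        rw [extChartAt_target]; exact ⟨hw.2.1, hUr hw.1⟩)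
      open_source := hsrc
      open_target := hU.inter (((chartAt _ p).symm.isOpen_inter_preimage hN).preimage
        (𝓡∂ (2 * n + 1)).continuous_symm)
      continuousOn_toFun := (continuousOn_extChartAt p).mono inter_subset_left
      continuousOn_invFun := (continuousOn_extChartAt_symm p).mono fun w hw => by
        rw [extChartAt_target]; exact ⟨hw.2.1, hUr hw.1⟩ }
  let τ : E ≃ₜ E := Homeomorph.subRight (e p)
  have hτ : ∀ x, (κ₀.transHomeomorph τ) x = e x - e p := fun x => rfl
  refine ⟨κ₀.transHomeomorph τ, ⟨fun x hx => ?_, fun w hw => ?_, fun x hx => hNb x hx.2.1⟩, ?_,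
    sub_self _, fun x hx => hx.2.1⟩
  · have h1 : ContMDiffAt (𝓡∂ (2 * n + 1)) 𝓘(ℝ, E) ∞ e x :=
      contMDiffAt_extChartAt' (by rw [← extChartAt_source (𝓡∂ (2 * n + 1))]; exact hx.1)
    exact h1.sub contMDiffAt_const
  · have hw' : w + e p ∈ κ₀.target := hw
    have h0 : w + e p ∈ e.target := by rw [extChartAt_target]; exact ⟨hw'.2.1, hUr hw'.1⟩
    have h1 : ContMDiffWithinAt 𝓘(ℝ, E) (𝓡∂ (2 * n + 1)) ∞ e.symm e.target (w + e p) :=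
      contMDiffOn_extChartAt_symm p _ h0
    have h2 : e.target ∈ 𝓝 (w + e p) := Filter.mem_of_superset (κ₀.open_target.mem_nhds hw')
      fun z hz => by rw [extChartAt_target]; exact ⟨hz.2.1, hUr hz.1⟩
    have h3 : ContMDiffAt 𝓘(ℝ, E) 𝓘(ℝ, E) ∞ (fun w : E => w + e p) w :=
      contMDiffAt_id.add contMDiffAt_const
    exact ContMDiffAt.comp (g := e.symm) (f := fun w : E => w + e p) w (h1.contMDiffAt h2) h3
  · exact ⟨mem_extChartAt_source p, hpN, hp⟩

end Coordinates

/-! ### Making the structure standard at one critical point. -/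

section Standard

variable {n : ℕ} {C : Cobordism n} {S S' : ConvexStructure C}

/-- Near the point `p`, the structure is isomorphic to a standard model. -/
def ConvexStructure.IsStandardAt (S : ConvexStructure C) (p : C.carrier) : Prop :=
  ∃ (k : ℕ) (c : ℝ) (κ : OpenPartialHomeomorph C.carrier (Std n)), k ≤ 2 * n + 1 ∧
    IsInteriorChart κ ∧ p ∈ κ.source ∧ κ p = 0 ∧ Presents κ S (stdData n k c)

lemma ConvexStructure.IsStandardAt.congr {p : C.carrier} (h : S.IsStandardAt p)
    {U : Set C.carrier} (hU : IsOpen U) (hp : p ∈ U)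
    (he : ∀ x ∈ U, S'.α x = S.α x ∧ S'.X x = S.X x ∧ S'.φ x = S.φ x) : S'.IsStandardAt p := by
  obtain ⟨k, c, κ, hk, hκ, hpκ, hp0, hS⟩ := h
  refine ⟨k, c, κ.restrOpen U hU, hk, hκ.restr hU, ⟨hpκ, hp⟩, hp0, fun x hx => ?_⟩
  obtain ⟨h1, h2, h3⟩ := hS x hx.1
  obtain ⟨e1, e2, e3⟩ := he x hx.2
  rw [e1, e2, e3]
  exact ⟨h1, h2, h3⟩

lemma ConvexStructure.dfun_eq_zero_iff (S : ConvexStructure C) (x : C.carrier) :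
    dfun (𝓡∂ (2 * n + 1)) S.φ x = 0 ↔ S.X x = 0 := by
  rcases S.lyapunovAt x with h | ⟨h1, h2, -⟩
  · constructor
    · intro h0
      rw [h0] at h
      exact absurd h (lt_irrefl _)
    · intro h0
      rw [h0, map_zero] at h
      exact absurd h (lt_irrefl _)
  · exact ⟨fun _ => h1, fun _ => h2⟩

/-- The structure can be made standard near a critical point, and the critical value can be moved
off a finite set. -/
theorem ConvexStructure.exists_isStandardAt (S : ConvexStructure C) {p : C.carrier}
    (hp : S.X p = 0) {N : Set C.carrier} (hN : IsOpen N) (hpN : p ∈ N)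
    (hcrit : ∀ x ∈ N, S.X x = 0 → x = p) {F : Set ℝ} (hF : F.Finite) :
    ∃ S' : ConvexStructure C, Homotopic S S' ∧ ConvexStructure.EqOff N S S' ∧
      (∀ x, S'.X x = 0 ↔ S.X x = 0) ∧ S'.IsStandardAt p ∧ S'.φ p ∉ F := by
  have hpi := S.isInteriorPoint ((S.dfun_eq_zero_iff p).2 hp)
  have hpb : p ∉ C.bot ∪ C.top := by
    rw [← C.boundary_eq]
    exact ModelWithCorners.isInteriorPoint_iff_not_isBoundaryPoint p |>.1 hpi
  obtain ⟨κ, hκ, hpκ, hp0, hκN⟩ := exists_isInteriorChart hpi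
    (hN.inter S.isClosed_boundary.isOpen_compl) ⟨hpN, hpb⟩ fun x hx => hx.2
  obtain ⟨d, hd, hds⟩ := Presents.exists_data hκ S
  have h0κ : (0 : EuclideanSpace ℝ (Fin (2 * n + 1))) ∈ κ.target := hp0 ▸ κ.map_source hpκ
  have hval : d.Valid κ.target S.between := hd.valid hκ hds h0κ fun x hx => by
    rw [S.dfun_eq_zero_iff]
    constructor
    · intro h
      rw [hcrit x (hκN hx).1 h, hp0]
    · intro h
      rw [← hp0] at h
      rw [κ.injOn hx hpκ h, hp]
  obtain ⟨ε, hε, hshift⟩ := hval.exists_move_shift κ.open_target h0κ S.isOpen_between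
  obtain ⟨r, hr, hrF⟩ : ∃ r : ℝ, |r| < ε ∧ (d 0).2.2 + r ∉ F := by
    have hinf : (Ioo (-ε) ε).Infinite := Ioo_infinite (by linarith)
    have hfin : ((fun r => (d 0).2.2 + r) ⁻¹' F).Finite := hF.preimage (add_right_injective _).injOn
    obtain ⟨r, hr, hrF⟩ := (hinf.sdiff hfin).nonempty
    exact ⟨r, abs_lt.2 hr, hrF⟩
  obtain ⟨d₁, hm₁, hd₁⟩ := hshift r hr
  have hval₁ := hm₁.valid κ.open_target h0κ
  obtain ⟨S₁, hS₁, hp₁, ho₁⟩ := hd.exists_of_move hκ hm₁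
  obtain ⟨k, ℓ, d₂, hk, hm₂, hev⟩ := hval₁.exists_moves (n := n) (by simp) κ.open_target h0κ
    S.isOpen_between
  have hb : S₁.between = S.between := ConvexStructure.between_congr fun x hx =>
    (ho₁ x fun hs => hκ.interior x hs hx).2.2
  have hκ' := hκ.transLinear ℓ
  obtain ⟨S₂, hS₂, hp₂, ho₂⟩ := (hp₁.transLinear hκ ℓ).exists_of_moves hκ'
    (d' := d₂) (by rw [hb]; exact hm₂)
  have hoff : ConvexStructure.EqOff κ.source S S₂ := ho₁.trans ho₂
  have hc₂ : (d₁ 0).2.2 = (d 0).2.2 + r := by rw [hd₁.self_of_nhds]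
  obtain ⟨O, hO, hO', h0O⟩ := eventually_nhds_iff.1 hev
  have hval₂ : d₂.Valid (κ.transHomeomorph ℓ.toHomeomorph).target S.between := by
    have h0 := hval₁.map κ.open_target h0κ ℓ
    have hVo := κ.open_target.preimage ℓ.symm.continuous
    have h0V : (0 : Std n) ∈ ℓ.symm ⁻¹' κ.target := by simpa using h0κ
    clear hev hO hp₂
    induction hm₂ with
    | refl => exact h0
    | tail _ h _ => exact h.valid hVo h0V
  have hκ'0 : κ.transHomeomorph ℓ.toHomeomorph p = 0 := by
    change ℓ (κ p) = 0
    rw [hp0, map_zero]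
  refine ⟨S₂, hS₁.trans hS₂, fun x hx => hoff x fun h => hx (hκN h).1, fun x => ?_, ?_, ?_⟩
  · by_cases hx : x ∈ κ.source
    · have h2 := (hp₂ x hx).2.1
      have hXS : S.X x = 0 ↔ x = p := ⟨hcrit x (hκN hx).1, fun h => h ▸ hp⟩
      rw [hXS]
      have hinj := (hκ'.bijective hx).1
      have hmem : κ.transHomeomorph ℓ.toHomeomorph x ∈ (κ.transHomeomorph ℓ.toHomeomorph).target :=
        (κ.transHomeomorph ℓ.toHomeomorph).map_source hx
      constructor
      · intro h
        by_contra hne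
        have h3 := hval₂.regular _ hmem fun h0 => hne ((κ.transHomeomorph ℓ.toHomeomorph).injOn hx hpκ
          (h0.trans hκ'0.symm))
        rw [← h2, h] at h3
        erw [map_zero, map_zero] at h3
        exact lt_irrefl _ h3
      · intro h
        subst h
        refine hinj (h2.trans ?_)
        rw [hκ'0, hval₂.zero]
        exact (map_zero _).symm
    · rw [(hoff x hx).2.1]
  · refine ⟨k, (d₁ 0).2.2, (κ.transHomeomorph ℓ.toHomeomorph).restrOpen
      ((κ.transHomeomorph ℓ.toHomeomorph).source ∩ (κ.transHomeomorph ℓ.toHomeomorph) ⁻¹' O)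
      ((κ.transHomeomorph ℓ.toHomeomorph).isOpen_inter_preimage hO'), hk, hκ'.restr _,
      ⟨hpκ, hpκ, ?_⟩, hκ'0, fun x hx => ?_⟩
    · rw [mem_preimage, hκ'0]
      exact h0O
    · have h := hp₂ x hx.1
      rw [hO _ hx.2.2] at h
      exact h
  · have h := (hp₂ p hpκ).2.2
    rw [hκ'0, hO 0 h0O] at h
    have h1 : S₂.φ p = (d 0).2.2 + r := by
      rw [h, ← hc₂]
      simp [stdData, stdFun, subFun]
    rw [h1]
    exact hrF

end Standard

/-! ### Making all critical points standard, with distinct values. -/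

section CriticalPoints

variable {n : ℕ} {C : Cobordism n} (S : ConvexStructure C)

lemma ConvexStructure.continuous_dfun_field :
    Continuous fun x => dfun (𝓡∂ (2 * n + 1)) S.φ x (S.X x) :=
  continuous_iff_continuousAt.2 fun x => (contMDiffAt_form_apply (b := id)
    (contMDiffAt_form_iff.2 ⟨contMDiffAt_id, contMDiffAt_dfun (S.smooth_fun x)⟩)
    (S.smooth_field x)).continuousAt

/-- The quadratic growth of `dφ(X)` isolates each zero; compactness does the rest. -/
lemma ConvexStructure.finite_zeros : {x | S.X x = 0}.Finite := by
  have h : ({x | S.X x = 0} ∩ univ).Finite := by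
    refine isCompact_univ.induction_on (p := fun s => ({x | S.X x = 0} ∩ s).Finite) (by simp)
      (fun s t hst ht => ht.subset (inter_subset_inter_right _ hst)) (fun s t hs ht => by
        rw [inter_union_distrib_left]
        exact hs.union ht) fun x _ => ?_
    rw [nhdsWithin_univ]
    rcases S.lyapunovAt x with h | ⟨h1, h2, c, hc, hev⟩
    · refine ⟨_, S.continuous_dfun_field.continuousAt.eventually (lt_mem_nhds h), ?_⟩
      refine finite_empty.subset fun y hy => ?_
      have h1 : S.X y = 0 := hy.1
      have h2 : 0 < dfun (𝓡∂ (2 * n + 1)) S.φ y (S.X y) := hy.2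
      rw [h1, map_zero] at h2
      exact (lt_irrefl _ h2).elim
    · refine ⟨_, hev.and (extChartAt_source_mem_nhds (I := 𝓡∂ (2 * n + 1)) x),
        (finite_singleton x).subset fun y hy => ?_⟩
      have h1 : S.X y = 0 := hy.1
      obtain ⟨h2, h3⟩ := hy.2
      rw [h1, map_zero] at h2
      have h4 : ‖extChartAt (𝓡∂ (2 * n + 1)) x y - extChartAt (𝓡∂ (2 * n + 1)) x x‖ ^ 2 ≤ 0 := by
        by_contra! hcon
        nlinarith
      have h5 := norm_eq_zero.1 (pow_eq_zero_iff two_ne_zero |>.1 (le_antisymm h4 (sq_nonneg _)))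
      exact (extChartAt (𝓡∂ (2 * n + 1)) x).injOn h3 (mem_extChartAt_source x) (sub_eq_zero.1 h5)
  rwa [inter_univ] at h

/-- Every convex contact structure is strictly homotopic to one which is standard near its
critical points and whose critical values are distinct. -/
theorem ConvexStructure.exists_standard : ∃ S' : ConvexStructure C, Homotopic S S' ∧
    (∀ p, S'.X p = 0 → S'.IsStandardAt p) ∧ InjOn S'.φ {x | S'.X x = 0} := by
  classical
  obtain ⟨U, hU, hdisj⟩ := S.finite_zeros.t2_separation
  -- The critical points are treated one at a time, inside disjoint neighbourhoods, so earlier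
  -- normalisations persist. Each new critical value avoids all critical values of the preceding
  -- structure.
  have key : ∀ T : Finset C.carrier, (∀ p ∈ T, S.X p = 0) → ∃ S' : ConvexStructure C,
      Homotopic S S' ∧ (∀ x, S'.X x = 0 ↔ S.X x = 0) ∧ (∀ p ∈ T, S'.IsStandardAt p) ∧
      ∀ p ∈ T, ∀ q, S.X q = 0 → q ≠ p → S'.φ p ≠ S'.φ q := by
    intro T
    induction T using Finset.induction_on with
    | empty => exact fun _ => ⟨S, .refl S, fun _ => Iff.rfl, by simp, by simp⟩
    | insert p T hpT ih =>
      intro hT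
      obtain ⟨S', hS', hz, hst, hval⟩ := ih fun q hq => hT q (Finset.mem_insert_of_mem hq)
      have hp := hT p (Finset.mem_insert_self _ _)
      have hnot : ∀ q x, S.X q = 0 → q ≠ p → x ∈ U q → x ∉ U p := fun q x hq hqp hx hxp =>
        (Set.disjoint_left.1 (hdisj hq hp hqp)) hx hxp
      obtain ⟨S'', hS'', hoff, hz', hst', hF⟩ := S'.exists_isStandardAt ((hz p).2 hp) (hU p).2
        (hU p).1 (fun x hx h0 => by
          by_contra hne
          exact hnot x x ((hz x).1 h0) hne (hU x).1 hx) (S.finite_zeros.image S'.φ)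
      refine ⟨S'', hS'.trans hS'', fun x => (hz' x).trans (hz x), fun q hq => ?_,
        fun q hq r hr hrq => ?_⟩
      · rcases Finset.mem_insert.1 hq with rfl | hq'
        · exact hst'
        · have hqp : q ≠ p := fun h => hpT (h ▸ hq')
          exact (hst q hq').congr (hU q).2 (hU q).1 fun x hx => hoff x (hnot q x (hT q hq) hqp hx)
      · have hoff' : ∀ q, S.X q = 0 → q ≠ p → S''.φ q = S'.φ q := fun q hq hqp =>
          (hoff q (hnot q q hq hqp (hU q).1)).2.2
        rcases Finset.mem_insert.1 hq with rfl | hq'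
        · rw [hoff' r hr hrq]
          exact fun h => hF ⟨r, hr, h.symm⟩
        · have hqp : q ≠ p := fun h => hpT (h ▸ hq')
          have hq0 := hT q hq
          rw [hoff' q hq0 hqp]
          by_cases hrp : r = p
          · subst hrp
            exact fun h => hF ⟨q, hq0, h⟩
          · rw [hoff' r hr hrp]
            exact hval q hq' r hr hrq
  obtain ⟨S', hS', hz, hst, hval⟩ := key S.finite_zeros.toFinset fun p hp => by simpa using hp
  refine ⟨S', hS', fun p hp => hst p (by simpa using (hz p).1 hp), fun p hp q hq hpq => ?_⟩
  by_contra hne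
  exact hval p (by simpa using (hz p).1 hp) q ((hz q).1 hq) (Ne.symm hne) hpq

end CriticalPoints

local notation:max "𝓑[" n "]" => 𝓡∂ (2 * n + 1)

local notation:max "𝔼[" n "]" => EuclideanSpace ℝ (Fin (2 * n + 1))

/-! ### Codimension-zero subsets as cobordisms. -/

section SubCobordism

variable {n : ℕ} {C : Cobordism n} {s : Set C.carrier}

/-- A chart of a subset which is compatible with the smooth structure of the ambient manifold. -/
structure IsSubChart (e : OpenPartialHomeomorph s (EuclideanHalfSpace (2 * n + 1))) : Prop where
  extend : ∀ y ∈ e.source, ∃ F : C.carrier → 𝔼[n],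
    ContMDiffAt 𝓑[n] 𝓘(ℝ, 𝔼[n]) ∞ F y ∧
      ∀ᶠ z in 𝓝 y, 𝓑[n] (e z) = F z
  symm : ∀ w ∈ e.target, ContMDiffWithinAt 𝓘(ℝ, 𝔼[n])
    𝓑[n] ∞ (fun u => (e.symm (𝓑[n].symm u) : C.carrier))
    (range 𝓑[n]) (𝓑[n] w)

/-- A transition map factors through the ambient manifold: the inverse of one chart is smooth into
it, and the other chart extends smoothly to it. -/
lemma IsSubChart.contDiffOn
    {e e' : OpenPartialHomeomorph s (EuclideanHalfSpace (2 * n + 1))} (he : IsSubChart e)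
    (he' : IsSubChart e') : ContDiffOn ℝ ∞ (𝓑[n] ∘ e.symm ≫ₕ e' ∘ 𝓑[n].symm)
      (𝓑[n].symm ⁻¹' (e.symm ≫ₕ e').source ∩ range 𝓑[n]) := by
  rintro _ ⟨hu, w, rfl⟩
  rw [mem_preimage, ModelWithCorners.left_inv] at hu
  have hw : w ∈ e.target := hu.1
  obtain ⟨F, hF, hev⟩ := he'.extend (e.symm w) hu.2
  have h1 := he.symm w hw
  have hF' : ContMDiffAt 𝓑[n] 𝓘(ℝ, 𝔼[n]) ∞ F
      (e.symm (𝓑[n].symm (𝓑[n] w)) : C.carrier) := by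
    rwa [ModelWithCorners.left_inv]
  have h2 := (ContMDiffAt.comp_contMDiffWithinAt (𝓑[n] w) hF' h1).contDiffWithinAt
  have hc : Filter.Tendsto (fun u => e.symm (𝓑[n].symm u))
      (𝓝 (𝓑[n] w)) (𝓝 (e.symm w)) := by
    have h3 := (e.continuousAt_symm hw).tendsto
    have h4 := 𝓑[n].continuous_symm.tendsto (𝓑[n] w)
    rw [ModelWithCorners.left_inv] at h4
    exact h3.comp h4
  refine (h2.congr_of_eventuallyEq_of_mem ((hc.eventually hev).filter_mono nhdsWithin_le_nhds)
    (mem_range_self w)).mono inter_subset_right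

/-- A closed subset with compatible charts, as a cobordism. -/
def Cobordism.sub (hs : IsClosed s)
    (e : s → OpenPartialHomeomorph s (EuclideanHalfSpace (2 * n + 1))) (he : ∀ x, IsSubChart (e x))
    (hx : ∀ x, x ∈ (e x).source) (bot top : Set s)
    (hb : ∀ x, 𝓑[n] (e x x) ∈ frontier (range 𝓑[n]) ↔ x ∈ bot ∪ top)
    (hd : Disjoint bot top) : Cobordism n :=
  letI : ChartedSpace (EuclideanHalfSpace (2 * n + 1)) s :=
    { atlas := range e
      chartAt := e
      mem_chart_source := hx
      chart_mem_atlas := mem_range_self }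
  { carrier := s
    charts := inferInstance
    smooth := isManifold_of_contDiffOn _ _ _ (by
      rintro _ _ ⟨x, rfl⟩ ⟨y, rfl⟩
      exact (he x).contDiffOn (he y))
    compact := isCompact_iff_compactSpace.1 hs.isCompact
    bot := bot
    top := top
    boundary_eq := Set.ext hb
    disjoint_bot_top := hd }

variable [ChartedSpace (EuclideanHalfSpace (2 * n + 1)) s] [IsManifold 𝓑[n] ∞ s]

lemma contMDiff_subtypeVal
    (h : ∀ x : s, IsSubChart (chartAt (EuclideanHalfSpace (2 * n + 1)) x)) :
    ContMDiff 𝓑[n] 𝓑[n] ∞ (Subtype.val : s → C.carrier) := fun x => by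
  rw [contMDiffAt_iff_source_of_mem_source (mem_chart_source _ x)]
  exact (h x).symm _ (mem_chart_target _ x)

/-- The derivative of an ambient extension of the chart is a left inverse, because the chart has
identity derivative in its own coordinates. The dimensions agree. -/
lemma bijective_mfderiv_subtypeVal
    (h : ∀ x : s, IsSubChart (chartAt (EuclideanHalfSpace (2 * n + 1)) x)) (x : s) :
    Function.Bijective
      (mfderiv 𝓑[n] 𝓑[n] (Subtype.val : s → C.carrier) x) := by
  obtain ⟨F, hF, hev⟩ := (h x).extend x (mem_chart_source _ x)
  have h1 := mfderiv_comp (I'' := 𝓘(ℝ, 𝔼[n])) x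
    (hF.mdifferentiableAt (by simp)) ((contMDiff_subtypeVal h x).mdifferentiableAt (by simp))
  have h2 : mfderiv 𝓑[n] 𝓘(ℝ, 𝔼[n])
      (extChartAt 𝓑[n] x) x = mfderiv 𝓑[n]
        𝓘(ℝ, 𝔼[n]) (F ∘ Subtype.val) x :=
    Filter.EventuallyEq.mfderiv_eq hev
  rw [h1] at h2
  have h3 := h2.symm.trans (chartD_self 𝓑[n] x)
  have hinj : Function.Injective
      (mfderiv 𝓑[n] 𝓑[n] (Subtype.val : s → C.carrier) x) :=
    fun u v huv => by
      have e := fun w => congrArg (fun f : 𝔼[n] →L[ℝ]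
        𝔼[n] => f w) h3
      exact (e u).symm.trans ((congrArg (mfderiv 𝓑[n]
        𝓘(ℝ, 𝔼[n]) F x) huv).trans (e v))
  have hsurj : ∀ D : 𝔼[n] →L[ℝ] 𝔼[n], Function.Injective D → Function.Surjective D :=
    fun D hD => LinearMap.surjective_of_injective (f := D.toLinearMap) hD
  exact ⟨hinj, hsurj _ hinj⟩

end SubCobordism

/-! ### Construction of charts adapted to a subset. -/

section SubChart

variable {n : ℕ} {C : Cobordism n} {s : Set C.carrier}

/-- Charts of a subset from coordinates of the ambient manifold which are adapted to it. -/
lemma exists_isSubChart {Z : Type*} [TopologicalSpace Z] (κ : OpenPartialHomeomorph C.carrier Z)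
    {j : EuclideanHalfSpace (2 * n + 1) → Z} {r : Z → EuclideanHalfSpace (2 * n + 1)}
    {J : Z → 𝔼[n]} (hj : Continuous j) (hr : Continuous r)
    (hrj : ∀ w, r (j w) = w) (hJ : ∀ w, J (j w) = 𝓑[n] w)
    (hs : ∀ y ∈ κ.source, y ∈ s ↔ κ y ∈ range j)
    (hF : ∀ y ∈ κ.source, ContMDiffAt 𝓑[n]
      𝓘(ℝ, 𝔼[n]) ∞ (J ∘ κ) y)
    (hB : ∀ w, j w ∈ κ.target → ContMDiffWithinAt 𝓘(ℝ, 𝔼[n])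
      𝓑[n] ∞ (fun u => κ.symm (j (𝓑[n].symm u)))
      (range 𝓑[n]) (𝓑[n] w)) (x : s) (hx : (x : C.carrier) ∈ κ.source) :
    ∃ e : OpenPartialHomeomorph s (EuclideanHalfSpace (2 * n + 1)), IsSubChart e ∧ x ∈ e.source ∧
      𝓑[n] (e x) = J (κ x) := by
  classical
  have hjr : ∀ y : s, (y : C.carrier) ∈ κ.source → j (r (κ y)) = κ y := fun y hy => by
    obtain ⟨w, hw⟩ := (hs y hy).1 y.2
    rw [← hw, hrj]
  -- The value `x` is a default, used only outside the target of the chart.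
  let inv : EuclideanHalfSpace (2 * n + 1) → s := fun w =>
    if h : κ.symm (j w) ∈ s then ⟨_, h⟩ else x
  have hinv : ∀ w, j w ∈ κ.target → (inv w : C.carrier) = κ.symm (j w) := fun w hw => by
    have h : κ.symm (j w) ∈ s := (hs _ (κ.map_target hw)).2 ⟨w, (κ.right_inv hw).symm⟩
    simp only [inv, h, dif_pos]
  let e : OpenPartialHomeomorph s (EuclideanHalfSpace (2 * n + 1)) :=
    { toFun := fun y => r (κ y)
      invFun := inv
      source := Subtype.val ⁻¹' κ.source
      target := j ⁻¹' κ.target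
      map_source' := fun y hy => by
        rw [mem_preimage, hjr y hy]
        exact κ.map_source hy
      map_target' := fun w hw => by
        rw [mem_preimage, hinv w hw]
        exact κ.map_target hw
      left_inv' := fun y hy => Subtype.ext (by
        rw [hinv _ (by rw [hjr y hy]; exact κ.map_source hy), hjr y hy, κ.left_inv hy])
      right_inv' := fun w hw => by rw [hinv w hw, κ.right_inv hw, hrj]
      open_source := κ.open_source.preimage continuous_subtype_val
      open_target := κ.open_target.preimage hj
      continuousOn_toFun := hr.comp_continuousOn
        (κ.continuousOn.comp continuous_subtype_val.continuousOn fun y hy => hy)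
      continuousOn_invFun := by
        rw [Topology.IsInducing.subtypeVal.continuousOn_iff]
        exact (κ.continuousOn_symm.comp hj.continuousOn fun w hw => hw).congr hinv }
  have heJ : ∀ y : s, (y : C.carrier) ∈ κ.source → 𝓑[n] (e y) = J (κ y) := fun y hy => by
    rw [← hJ]
    exact congrArg J (hjr y hy)
  refine ⟨e, ⟨fun y hy => ⟨J ∘ κ, hF y hy, ?_⟩, fun w hw => ?_⟩, hx, heJ x hx⟩
  · filter_upwards [e.open_source.mem_nhds hy] with z hz using heJ z hz
  · refine (hB w hw).congr_of_eventuallyEq_of_mem ?_ (mem_range_self w)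
    have h1 : ∀ᶠ u in 𝓝 (𝓑[n] w), j (𝓑[n].symm u) ∈ κ.target := by
      refine (κ.open_target.preimage (hj.comp 𝓑[n].continuous_symm)).mem_nhds ?_
      rw [mem_preimage, Function.comp_apply, ModelWithCorners.left_inv]
      exact hw
    filter_upwards [h1.filter_mono nhdsWithin_le_nhds] with u hu using hinv _ hu

/-- A function without critical points is a coordinate. -/
lemma exists_levelChart {E : Type*} [NormedAddCommGroup E] [NormedSpace ℝ E] [FiniteDimensional ℝ E]
    {l : E →L[ℝ] ℝ} (hl : l ≠ 0) {f : E → ℝ} {U : Set E} (hU : IsOpen U) {p : E} (hp : p ∈ U)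
    (hf : ∀ w ∈ U, ContDiffAt ℝ ∞ f w) (hp' : fderiv ℝ f p ≠ 0) :
    ∃ G : OpenPartialHomeomorph E E, p ∈ G.source ∧ G.source ⊆ U ∧ (∀ w ∈ G.source, l (G w) = f w) ∧
      (∀ w ∈ G.source, ContDiffAt ℝ ∞ G w) ∧ ∀ w ∈ G.target, ContDiffAt ℝ ∞ G.symm w := by
  have : CompleteSpace E := FiniteDimensional.complete ℝ E
  obtain ⟨u, hu⟩ : ∃ u, fderiv ℝ f p u ≠ 0 := by
    by_contra! h
    exact hp' (ContinuousLinearMap.ext h)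
  obtain ⟨e, he⟩ : ∃ e, l e ≠ 0 := by
    by_contra! h
    exact hl (ContinuousLinearMap.ext h)
  -- The isomorphism carries the kernel of `df` to the kernel of `l` and `u` to a multiple of `e`.
  obtain ⟨A, hA⟩ : ∃ A : E ≃L[ℝ] E, ∀ v, l (A v) = fderiv ℝ f p v := by
    obtain ⟨m, hm⟩ : ∃ m : E →ₗ[ℝ] ℝ, m = (fderiv ℝ f p).toLinearMap := ⟨_, rfl⟩
    have hmu : m u ≠ 0 := by rw [hm]; exact hu
    have h1 := Module.Dual.finrank_ker_add_one_of_ne_zero (f := m) fun h => hmu (by simp [h])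
    have h2 := Module.Dual.finrank_ker_add_one_of_ne_zero (f := l.toLinearMap) fun h =>
      he (by simpa using DFunLike.congr_fun h e)
    let ψ := LinearEquiv.ofFinrankEq (R := ℝ) (LinearMap.ker m) (LinearMap.ker l.toLinearMap) (by omega)
    let pr : E →ₗ[ℝ] LinearMap.ker m := LinearMap.codRestrict _
      (LinearMap.id - m.smulRight ((m u)⁻¹ • u)) fun v => by simp [hmu]
    let A : E →ₗ[ℝ] E := (LinearMap.ker l.toLinearMap).subtype ∘ₗ ψ.toLinearMap ∘ₗ pr +
      m.smulRight ((l e)⁻¹ • e)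
    have hlA : ∀ v, l (A v) = m v := fun v => by
      have h3 : l (ψ (pr v)) = 0 := (ψ (pr v)).2
      simp [A, h3, he]
    have hinj : Function.Injective A := (injective_iff_map_eq_zero A).2 fun v hv => by
      have h3 : m v = 0 := by rw [← hlA, hv, map_zero]
      have h4 : ψ (pr v) = 0 := by simpa [A, h3] using hv
      have h5 := congrArg Subtype.val (ψ.map_eq_zero_iff.1 h4)
      change v - m v • ((m u)⁻¹ • u) = 0 at h5
      simpa [h3] using h5
    exact ⟨(LinearEquiv.ofInjectiveEndo A hinj).toContinuousLinearEquiv, fun v => by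
      rw [hm] at hlA
      exact hlA v⟩
  -- Correcting `A` in the direction `e` makes `l ∘ G = f` exact. The correction has zero derivative
  -- at `p`, so the inverse function theorem applies with derivative `A`.
  let G : E → E := fun w => A w + (f w - l (A w)) • (l e)⁻¹ • e
  have hG : ∀ w ∈ U, ContDiffAt ℝ ∞ G w := fun w hw =>
    A.contDiff.contDiffAt.add (((hf w hw).sub (l.contDiff.comp A.contDiff).contDiffAt).smul
      contDiffAt_const)
  have hlG : ∀ w, l (G w) = f w := fun w => by simp [G, he]
  have hGp : HasFDerivAt G (A : E →L[ℝ] E) p := by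
    have h1 := ((hf p hp).differentiableAt (by simp)).hasFDerivAt
    have h2 := (A.hasFDerivAt (x := p)).add ((h1.sub ((l.hasFDerivAt (x := A p)).comp p
      (A.hasFDerivAt (x := p)))).smul_const ((l e)⁻¹ • e))
    refine h2.congr_fderiv (ContinuousLinearMap.ext fun v => ?_)
    simp [hA]
  have hinv : ∀ᶠ w in 𝓝 p, (fderiv ℝ G w).IsInvertible := by
    have h1 : ContinuousAt (fderiv ℝ G) p :=
      ((hG p hp).fderiv_right (m := 0) (by simp)).continuousAt
    exact eventually_isInvertible h1 ⟨A, hGp.fderiv.symm⟩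
  obtain ⟨O, hO, hOo, hpO⟩ := eventually_nhds_iff.1 hinv
  let G₀ := (hG p hp).toOpenPartialHomeomorph G hGp (by simp)
  have hG₀ : ∀ w, G₀ w = G w := fun w => rfl
  refine ⟨G₀.restrOpen (O ∩ U) (hOo.inter hU), ⟨(hG p hp).mem_toOpenPartialHomeomorph_source hGp
    (by simp), hpO, hp⟩, fun w hw => hw.2.2, fun w hw => hlG w, fun w hw => hG w hw.2.2,
    fun w hw => ?_⟩
  have hw' : G₀.symm w ∈ O ∩ U := hw.2
  obtain ⟨B, hB⟩ := hO _ hw'.1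
  refine G₀.contDiffAt_symm hw.1 (f₀' := B) ?_ (hG _ hw'.2)
  rw [hB]
  exact ((hG _ hw'.2).differentiableAt (by simp)).hasFDerivAt

end SubChart

/-! ### Sublevels of regular values as convex contact cobordisms. -/

section Sublevel

variable {n : ℕ} {C : Cobordism.{u} n} (S : ConvexStructure C) {c : ℝ}

lemma ConvexStructure.exists_isSubChart_of_lt (hc : c ∈ S.between) (x : {x | S.φ x ≤ c})
    (hx : S.φ x < c) : ∃ e : OpenPartialHomeomorph {x | S.φ x ≤ c} (EuclideanHalfSpace (2 * n + 1)),
      IsSubChart e ∧ x ∈ e.source ∧ (𝓑[n] (e x) ∈ frontier (range 𝓑[n]) ↔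
        (x : C.carrier) ∈ C.bot ∨ S.φ x = c) := by
  have hO : IsOpen {y | S.φ y < c} := isOpen_Iio.preimage S.smooth_fun.continuous
  obtain ⟨e, he, hxe, hex⟩ := exists_isSubChart (s := {x | S.φ x ≤ c})
    ((chartAt (EuclideanHalfSpace (2 * n + 1)) (x : C.carrier)).restrOpen _ hO) (j := id) (r := id)
    (J := 𝓑[n]) continuous_id continuous_id (fun _ => rfl) (fun _ => rfl)
    (fun y hy => iff_of_true (le_of_lt (show S.φ y < c from hy.2)) (mem_range_self _))
    (fun y hy => contMDiffAt_extChartAt' hy.1) (fun w hw => by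
      have h1 : 𝓑[n] w ∈ (extChartAt 𝓑[n] (x : C.carrier)).target := by
        rw [extChartAt_target]
        refine ⟨?_, mem_range_self w⟩
        rw [mem_preimage, ModelWithCorners.left_inv]
        exact hw.1
      exact (contMDiffOn_extChartAt_symm (x : C.carrier) _ h1).mono_of_mem_nhdsWithin
        (extChartAt_target_mem_nhdsWithin_of_mem h1)) x ⟨mem_chart_source _ _, hx⟩
  refine ⟨e, he, hxe, ?_⟩
  rw [hex]
  have h1 : (x : C.carrier) ∈ 𝓑[n].boundary C.carrier ↔ (x : C.carrier) ∈ C.bot ∪ C.top := by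
    rw [C.boundary_eq]
  refine h1.trans (or_congr Iff.rfl (iff_of_false (fun h => ?_) hx.ne))
  exact lt_asymm hx (hc.2 _ h)

/-- The point is interior in the ambient manifold and regular, so `c - φ` can serve as the boundary
coordinate of the half space. -/
lemma ConvexStructure.exists_isSubChart_of_eq (hc : c ∈ S.between) (x : {x | S.φ x ≤ c})
    (hx : S.φ x = c) (hX : S.X x ≠ 0) :
    ∃ e : OpenPartialHomeomorph {x | S.φ x ≤ c} (EuclideanHalfSpace (2 * n + 1)),
      IsSubChart e ∧ x ∈ e.source ∧ (𝓑[n] (e x) ∈ frontier (range 𝓑[n]) ↔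
        (x : C.carrier) ∈ C.bot ∨ S.φ x = c) := by
  have hxb : (x : C.carrier) ∉ C.bot ∪ C.top := fun h => by
    rcases h with h | h
    · exact (hc.1 _ h).ne hx
    · exact (hc.2 _ h).ne hx.symm
  have hint : 𝓑[n].IsInteriorPoint (x : C.carrier) := by
    rw [ModelWithCorners.isInteriorPoint_iff_not_isBoundaryPoint]
    intro h
    have h : (x : C.carrier) ∈ 𝓑[n].boundary C.carrier := h
    rw [C.boundary_eq] at h
    exact hxb h
  obtain ⟨κ, hκ, hxκ, -, -⟩ := exists_isInteriorChart hint S.isClosed_boundary.isOpen_compl hxb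
    fun y hy => hy
  obtain ⟨d, hd, hds⟩ := Presents.exists_data hκ S
  have hxt := κ.map_source hxκ
  have hf' : fderiv ℝ (fun w => c - (d w).2.2) (κ x) ≠ 0 := fun h => by
    rw [fderiv_const_sub, neg_eq_zero] at h
    refine hX ((S.dfun_eq_zero_iff _).1 ?_)
    rw [dfun_comp (hκ.smooth _ hxκ) (f := fun w => (d w).2.2) ((hds _ hxt).snd.snd).contMDiffAt
      (by filter_upwards [κ.open_source.mem_nhds hxκ] with y hy using (hd y hy).2.2), dfun_model, h]
    exact ContinuousLinearMap.zero_comp _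
  have hl : (EuclideanSpace.proj (0 : Fin (2 * n + 1)) : 𝔼[n] →L[ℝ] ℝ) ≠ 0 := fun h => by
    simpa using DFunLike.congr_fun h (EuclideanSpace.single 0 1)
  obtain ⟨G, hpG, hGU, hlG, hGs, hGs'⟩ := exists_levelChart hl κ.open_target hxt
    (fun w hw => contDiffAt_const.sub (hds w hw).snd.snd) hf'
  have hφ : ∀ y ∈ (κ.trans G).source, (G (κ y)) 0 = c - S.φ y := fun y hy => by
    rw [(hd y hy.1).2.2]
    exact hlG _ hy.2
  obtain ⟨e, he, hxe, hex⟩ := exists_isSubChart (s := {x | S.φ x ≤ c}) (κ.trans G) (j := 𝓑[n])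
    (r := 𝓑[n].symm) (J := id) 𝓑[n].continuous 𝓑[n].continuous_symm (fun w => 𝓑[n].left_inv w)
    (fun _ => rfl) (fun y hy => by
      rw [range_modelWithCornersEuclideanHalfSpace]
      change _ ↔ 0 ≤ (G (κ y)) 0
      rw [hφ y hy, sub_nonneg]
      rfl) (fun y hy => (hGs _ hy.2).contMDiffAt.comp y (hκ.smooth y hy.1)) (fun w hw => by
      have h1 : ContMDiffAt 𝓘(ℝ, 𝔼[n]) 𝓑[n] ∞ (κ.symm ∘ G.symm) (𝓑[n] w) :=
        (hκ.smooth_symm _ hw.2).comp _ (hGs' _ hw.1).contMDiffAt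
      exact h1.contMDiffWithinAt.congr_of_mem
        (fun u hu => congrArg (κ.symm ∘ G.symm) (𝓑[n].right_inv hu)) (mem_range_self w))
    x ⟨hxκ, hpG⟩
  refine ⟨e, he, hxe, iff_of_true ?_ (Or.inr hx)⟩
  rw [hex, frontier_range_modelWithCornersEuclideanHalfSpace]
  have h1 := hφ x ⟨hxκ, hpG⟩
  rw [hx, sub_self] at h1
  exact h1.symm

/-- Sublevels of regular values are cobordisms. -/
theorem ConvexStructure.exists_sublevel (hc : c ∈ S.between) (hreg : ∀ x, S.φ x = c → S.X x ≠ 0) :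
    ∃ (D : Cobordism.{u} n) (ι : D.carrier → C.carrier), ContMDiff 𝓑[n] 𝓑[n] ∞ ι ∧
      Topology.IsEmbedding ι ∧ (∀ x, Function.Bijective (mfderiv 𝓑[n] 𝓑[n] ι x)) ∧
      range ι = {x | S.φ x ≤ c} ∧ D.bot = ι ⁻¹' C.bot ∧ D.top = ι ⁻¹' {x | S.φ x = c} := by
  have key : ∀ x : {x | S.φ x ≤ c}, ∃ e : OpenPartialHomeomorph {x | S.φ x ≤ c}
      (EuclideanHalfSpace (2 * n + 1)), IsSubChart e ∧ x ∈ e.source ∧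
        (𝓑[n] (e x) ∈ frontier (range 𝓑[n]) ↔ (x : C.carrier) ∈ C.bot ∨ S.φ x = c) := fun x => by
    rcases lt_or_eq_of_le (show S.φ x ≤ c from x.2) with h | h
    · exact S.exists_isSubChart_of_lt hc x h
    · exact S.exists_isSubChart_of_eq hc x h (hreg x h)
  choose e he hxe hb using key
  have hcl : IsClosed {x | S.φ x ≤ c} := isClosed_Iic.preimage S.smooth_fun.continuous
  let D : Cobordism.{u} n := Cobordism.sub hcl e he hxe (Subtype.val ⁻¹' C.bot)
    (Subtype.val ⁻¹' {x | S.φ x = c}) hb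
    (Set.disjoint_left.2 fun x h1 h2 => (hc.1 _ h1).ne h2)
  let _ : ChartedSpace (EuclideanHalfSpace (2 * n + 1)) {x | S.φ x ≤ c} := D.charts
  have : IsManifold 𝓑[n] ∞ {x | S.φ x ≤ c} := D.smooth
  exact ⟨D, Subtype.val, contMDiff_subtypeVal he, Topology.IsEmbedding.subtypeVal,
    bijective_mfderiv_subtypeVal he, Subtype.range_val, rfl, rfl⟩

/-- The convex contact structure which is induced on a sublevel. -/
theorem ConvexStructure.exists_pullback
    (hreg : ∀ x, S.φ x = c → S.X x ≠ 0) {D : Cobordism n} {ι : D.carrier → C.carrier}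
    (hι : ContMDiff 𝓑[n] 𝓑[n] ∞ ι) (hbij : ∀ x, Function.Bijective (mfderiv 𝓑[n] 𝓑[n] ι x))
    (hle : ∀ x, S.φ (ι x) ≤ c) (hbot : D.bot = ι ⁻¹' C.bot)
    (htop : D.top = ι ⁻¹' {x | S.φ x = c}) : ∃ S₀ : ConvexStructure D,
      (∀ x, S₀.α x = (S.α (ι x)).comp (mfderiv 𝓑[n] 𝓑[n] ι x)) ∧
      (∀ x, mfderiv 𝓑[n] 𝓑[n] ι x (S₀.X x) = S.X (ι x)) ∧ ∀ x, S₀.φ x = S.φ (ι x) := by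
  choose X hX using fun x => (hbij x).2 (S.X (ι x))
  have hα : ∀ x, ContMDiffAt 𝓑[n] (𝓑[n].prod 𝓘(ℝ, 𝔼[n] →L[ℝ] ℝ)) ∞
      (formSec 𝓑[n] (b := id) S.α) (ι x) := fun x => S.smooth_form (ι x)
  have hreg' : ∀ x, S.X (ι x) ≠ 0 → dfun 𝓑[n] (fun x => S.φ (ι x)) x ≠ 0 := fun x h h0 => by
    rw [dfun_comp (hι x) (S.smooth_fun (ι x)) (.of_forall fun _ => rfl)] at h0
    refine h ((S.dfun_eq_zero_iff _).1 (ContinuousLinearMap.ext fun v => ?_))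
    obtain ⟨u, rfl⟩ := (hbij x).2 v
    exact congrArg (fun f : D.T x →L[ℝ] ℝ => f u) h0
  refine ⟨ConvexStructure.mk' (fun x => (S.α (ι x)).comp (mfderiv 𝓑[n] 𝓑[n] ι x)) X
    (fun x => S.φ (ι x)) (pullbackMetric hι (fun x => (hbij x).1) S.gradient_like.choose)
    (fun x => contMDiffAt_pullback_form (b := id) contMDiffAt_id (hι x)
      ((S.smooth_form (ι x)).comp x (hι x)))
    (fun x => contMDiffAt_pullback_field (b := id) contMDiffAt_id (hι x) (hbij x) ?_)
    (fun x => (S.smooth_fun (ι x)).comp x (hι x))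
    (fun x => (contactFormAt_pullback (hι x) (hbij x) (hα x) (.of_forall fun _ => rfl)).2
      (S.contactFormAt _))
    (fun x => (contactFieldAt_pullback (hι x) (hbij x) (hα x) (S.smooth_field (ι x))
      (.of_forall fun _ => rfl) (.of_forall hX)).2 (S.contactFieldAt _))
    (fun x => LyapunovAt.pullback (hι x) (hbij x) (.of_forall fun y => S.smooth_fun y)
      (.of_forall fun _ => rfl) (.of_forall fun y => hι y) (.of_forall hX) (S.lyapunovAt _))
    ?_ (fun x hx => hreg' x ?_) (Or.inr ⟨c, htop, hle⟩) (fun x hx => hreg' x ?_),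
    fun _ => rfl, hX, fun _ => rfl⟩
  · refine ((S.smooth_field (ι x)).comp x (hι x)).congr_of_eventuallyEq (.of_forall fun q => ?_)
    exact congrArg (TotalSpace.mk (ι q)) (hX q)
  · rcases S.bot_level with h | ⟨b, h, hb⟩
    · exact Or.inl (by rw [hbot, h, preimage_empty])
    · exact Or.inr ⟨b, by rw [hbot, h]; rfl, fun y => hb _⟩
  · rw [hbot] at hx
    exact fun h0 => S.bot_regular _ hx ((S.dfun_eq_zero_iff _).2 h0)
  · rw [htop] at hx
    exact hreg _ hx

end Sublevel

/-! ### Size and position of the standard handle. -/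

section Handle

variable {n : ℕ}

lemma radL_sq (k : ℕ) (p : Std n) :
    radL k p ^ 2 = ∑ i : Fin n, if (i : ℕ) < k then (p.1 i) ^ 2 else 0 :=
  Real.sq_sqrt (Finset.sum_nonneg fun i _ => by split_ifs <;> positivity)

lemma radC_sq (k : ℕ) (p : Std n) : radC k p ^ 2 = (p.2.2) ^ 2 + ∑ i : Fin n, (p.2.1 i) ^ 2 +
    ∑ i : Fin n, if (i : ℕ) < k then 0 else (p.1 i) ^ 2 := by
  refine Real.sq_sqrt (add_nonneg (by positivity) (Finset.sum_nonneg fun i _ => ?_))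
  split_ifs <;> positivity

lemma subFun_eq (k : ℕ) (p : Std n) : subFun k p = radC k p ^ 2 - radL k p ^ 2 := by
  rw [radC_sq, radL_sq, subFun, add_assoc, add_sub_assoc, ← Finset.sum_add_distrib,
    ← Finset.sum_sub_distrib]
  congr 1
  refine Finset.sum_congr rfl fun i _ => ?_
  split_ifs <;> ring

lemma stdFun_eq (k : ℕ) (p : Std n) :
    stdFun k p = (stdRadii k p).2 ^ 2 - (stdRadii k p).1 ^ 2 := by
  unfold stdFun stdRadii
  split_ifs
  · exact subFun_eq k p
  · rw [subFun_eq]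
    ring

lemma norm_sq_le_rad (k : ℕ) (p : Std n) : ‖p‖ ^ 2 ≤ radL k p ^ 2 + radC k p ^ 2 := by
  refine (norm_sq_le_sqRad p).trans (le_of_eq ?_)
  rw [radC_sq, radL_sq, sqRad, Finset.sum_add_distrib]
  have h : ∑ i : Fin n, (p.1 i) ^ 2 = ∑ i : Fin n, ((if (i : ℕ) < k then (p.1 i) ^ 2 else 0) +
      if (i : ℕ) < k then 0 else (p.1 i) ^ 2) :=
    Finset.sum_congr rfl fun i _ => by split_ifs <;> ring
  rw [h, Finset.sum_add_distrib]
  ring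

lemma norm_sq_le_stdRadii (k : ℕ) (p : Std n) :
    ‖p‖ ^ 2 ≤ (stdRadii k p).1 ^ 2 + (stdRadii k p).2 ^ 2 := by
  unfold stdRadii
  split_ifs
  · exact norm_sq_le_rad k p
  · rw [add_comm]
    exact norm_sq_le_rad _ p

lemma HandleProfile.χ_le (P : HandleProfile) {t : ℝ} (ht : |t| ≤ 1 + P.δ) :
    P.χ t ≤ P.χ (1 + P.δ) := by
  have h0 := P.δ_pos
  have h1 : P.χ t = P.χ |t| := by
    rcases abs_choice t with h | h
    · rw [h]
    · rw [h, P.even t (abs_le.1 ht)]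
  rw [h1]
  exact P.mono ⟨abs_nonneg t, ht⟩ ⟨by linarith, le_rfl⟩ ht

/-- Small handles are contained in small balls. -/
lemma eventually_handle_subset (P : HandleProfile) (k : ℕ) {U : Set (Std n)} (hU : U ∈ 𝓝 0) :
    ∀ᶠ ε in 𝓝[>] (0 : ℝ), handle P n k ε ⊆ U := by
  obtain ⟨r, hr, hrU⟩ := Metric.mem_nhds_iff.1 hU
  -- The two radii of a point of the handle are at most `ε (1 + δ)` and `ε χ(1 + δ)`, and the norm
  -- is bounded by their sum, hence by `ε b`.
  obtain ⟨b, hb⟩ : ∃ b, b = (1 + P.δ) + |P.χ (1 + P.δ)| + 1 := ⟨_, rfl⟩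
  have h0 := P.δ_pos
  have hb0 : 0 < b := by
    have := abs_nonneg (P.χ (1 + P.δ))
    linarith
  have hev : ∀ᶠ ε in 𝓝[>] (0 : ℝ), ε < r / b :=
    nhdsWithin_le_nhds (gt_mem_nhds (by positivity))
  filter_upwards [hev, self_mem_nhdsWithin] with ε hε hε0 p hp
  have hε0 : 0 < ε := hε0
  apply hrU
  rw [mem_ball_zero_iff]
  obtain ⟨h1, h2, -⟩ := hp
  have h3 := P.χ_le h1
  rw [abs_mul, abs_of_pos (inv_pos.2 hε0), inv_mul_le_iff₀ hε0] at h1 h2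
  have h4 := norm_sq_le_stdRadii k p
  have h5 : |(stdRadii k p).2| ≤ ε * |P.χ (1 + P.δ)| :=
    h2.trans (mul_le_mul_of_nonneg_left (h3.trans (le_abs_self _)) hε0.le)
  have h6 : ‖p‖ ≤ |(stdRadii k p).1| + |(stdRadii k p).2| := by
    refine abs_le_of_sq_le_sq' ?_ (by positivity) |>.2
    rw [← sq_abs (stdRadii k p).1, ← sq_abs (stdRadii k p).2] at h4
    nlinarith [mul_nonneg (abs_nonneg (stdRadii k p).1) (abs_nonneg (stdRadii k p).2)]
  rw [lt_div_iff₀ hb0] at hε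
  rw [hb] at hε
  linarith

lemma zero_mem_handle (P : HandleProfile) (k : ℕ) (ε : ℝ) : (0 : Std n) ∈ handle P n k ε := by
  have h : stdRadii k (0 : Std n) = (0, 0) := by
    unfold stdRadii
    split_ifs <;> simp [radL, radC]
  have h0 := P.δ_pos
  have h1 := P.pos
  refine ⟨?_, ?_, ?_⟩ <;> simp [h]
  · linarith
  · exact h1.le

/-- This is the hyperbola condition of the planar region, scaled by `ε`. It makes the handle meet
the sublevel of `-ε²` in its attaching region only. -/
lemma stdFun_ge_of_mem_handle {P : HandleProfile} {k : ℕ} {ε : ℝ} (hε : 0 < ε) {p : Std n}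
    (hp : p ∈ handle P n k ε) : -ε ^ 2 ≤ stdFun k p := by
  have h := hp.2.2
  simp only [mul_pow, ← mul_sub] at h
  rw [inv_pow, inv_mul_le_iff₀ (by positivity), mul_one] at h
  rw [stdFun_eq]
  linarith

end Handle

/-! ### Decomposition into handles. -/

section Induction

variable {n : ℕ}

/-- Near the point `p`, the structure is isomorphic to a standard model, on an open set `O` by an
open embedding `g`. -/
def ConvexStructure.IsStandardNear {C : Cobordism n} (S : ConvexStructure C) (p : C.carrier) : Prop :=
  ∃ (k : ℕ) (c : ℝ) (O : Set C.carrier) (g : C.carrier → Std n), k ≤ 2 * n + 1 ∧ IsOpen O ∧ p ∈ O ∧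
    g p = 0 ∧ ContMDiffOn 𝓑[n] 𝓘(ℝ, Std n) ∞ g O ∧ Topology.IsEmbedding (O.domRestrict g) ∧
    (∀ U ⊆ O, IsOpen U → IsOpen (g '' U)) ∧
    (∀ x ∈ O, Function.Bijective (mfderiv 𝓑[n] 𝓘(ℝ, Std n) g x)) ∧
    (∀ x ∈ O, S.α x = ContinuousLinearMap.comp (stdCovector (g x)) (mfderiv 𝓑[n] 𝓘(ℝ, Std n) g x)) ∧
    (∀ x ∈ O, mfderiv 𝓑[n] 𝓘(ℝ, Std n) g x (S.X x) = stdField k (g x)) ∧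
    ∀ x ∈ O, S.φ x = stdFun k (g x) + c

lemma ConvexStructure.IsStandardAt.isStandardNear {C : Cobordism n} {S : ConvexStructure C}
    {p : C.carrier} (h : S.IsStandardAt p) : S.IsStandardNear p := by
  obtain ⟨k, c, κ, hk, hκ, hpκ, hp0, hS⟩ := h
  exact ⟨k, c, κ.source, κ, hk, κ.open_source, hpκ, hp0, fun x hx => (hκ.smooth x hx).contMDiffWithinAt,
    κ.isOpenEmbedding_restrict.isEmbedding, fun U hU hUo => κ.isOpen_image_of_subset_source hUo hU,
    fun x hx => hκ.bijective hx, fun x hx => (hS x hx).1, fun x hx => (hS x hx).2.1,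
    fun x hx => (hS x hx).2.2⟩

/-- Standard models are inherited by sublevels. -/
lemma ConvexStructure.IsStandardNear.pullback {C D : Cobordism n} {S : ConvexStructure C}
    {S₀ : ConvexStructure D} {ι : D.carrier → C.carrier} {c : ℝ} (hι : ContMDiff 𝓑[n] 𝓑[n] ∞ ι)
    (hemb : Topology.IsEmbedding ι) (hbij : ∀ x, Function.Bijective (mfderiv 𝓑[n] 𝓑[n] ι x))
    (hrange : range ι = {x | S.φ x ≤ c})
    (hα : ∀ x, S₀.α x = (S.α (ι x)).comp (mfderiv 𝓑[n] 𝓑[n] ι x))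
    (hX : ∀ x, mfderiv 𝓑[n] 𝓑[n] ι x (S₀.X x) = S.X (ι x)) (hφ : ∀ x, S₀.φ x = S.φ (ι x))
    {p : D.carrier} (hp : S.φ (ι p) < c) (h : S.IsStandardNear (ι p)) : S₀.IsStandardNear p := by
  obtain ⟨k, b, O, g, hk, hO, hpO, hg0, hg, hge, hgo, hgb, hgα, hgX, hgφ⟩ := h
  -- Below the level `c` open subsets of the sublevel are open in the ambient manifold, so the image
  -- of an open set under `g` stays open.
  have hlt : IsOpen {x | S.φ x < c} := isOpen_Iio.preimage S.smooth_fun.continuous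
  have hU := (hO.inter hlt).preimage hemb.continuous
  have hd : ∀ x ∈ ι ⁻¹' (O ∩ {x | S.φ x < c}), mfderiv 𝓑[n] 𝓘(ℝ, Std n) (g ∘ ι) x =
      (mfderiv 𝓑[n] 𝓘(ℝ, Std n) g (ι x)).comp (mfderiv 𝓑[n] 𝓑[n] ι x) := fun x hx =>
    mfderiv_comp x (((hg _ hx.1).contMDiffAt (hO.mem_nhds hx.1)).mdifferentiableAt (by simp))
      ((hι x).mdifferentiableAt (by simp))
  refine ⟨k, b, ι ⁻¹' (O ∩ {x | S.φ x < c}), g ∘ ι, hk, hU, ⟨hpO, hp⟩, hg0,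
    hg.comp hι.contMDiffOn fun x hx => hx.1, ?_, fun U hU hUo => ?_, fun x hx => ?_, fun x hx => ?_,
    fun x hx => ?_, fun x hx => by rw [hφ]; exact hgφ _ hx.1⟩
  · exact hge.comp (g := O.domRestrict g)
      (f := fun x : ι ⁻¹' (O ∩ {x | S.φ x < c}) => (⟨ι x, x.2.1⟩ : O))
      ((hemb.comp Topology.IsEmbedding.subtypeVal).codRestrict O fun x => x.2.1)
  · rw [image_comp]
    obtain ⟨V, hV, rfl⟩ := hemb.isInducing.isOpen_iff.1 hUo
    refine hgo _ (fun y hy => ?_) ?_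
    · obtain ⟨x, hx, rfl⟩ := hy
      exact (hU hx).1
    · have e : ι '' (ι ⁻¹' V) = V ∩ {x | S.φ x < c} := by
        rw [image_preimage_eq_inter_range, hrange]
        refine Subset.antisymm (fun y hy => ?_) fun y hy => ⟨hy.1, le_of_lt (show S.φ y < c from hy.2)⟩
        obtain ⟨x, rfl⟩ : y ∈ range ι := hrange ▸ hy.2
        exact ⟨hy.1, (hU hy.1).2⟩
      rw [e]
      exact hV.inter hlt
  · rw [hd x hx]
    exact (hgb _ hx.1).comp (hbij x)
  · rw [hd x hx, hα, hgα _ hx.1]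
    rfl
  · rw [hd x hx]
    exact (congrArg (mfderiv 𝓑[n] 𝓘(ℝ, Std n) g (ι x)) (hX x)).trans (hgX _ hx.1)

/-- The cobordism above a sublevel with exactly one critical point is a handle attachment. -/
lemma ConvexStructure.IsStandardNear.exists_attach (P : HandleProfile) {C : Cobordism.{u} n}
    {S : ConvexStructure C} {p : C.carrier} (hp : S.X p = 0) (hst : S.IsStandardNear p)
    (hmax : ∀ x, S.X x = 0 → x ≠ p → S.φ x < S.φ p) :
    ∃ (D : Cobordism.{u} n) (S₀ : ConvexStructure D) (k : ℕ) (ι : D.carrier → C.carrier) (c : ℝ),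
      k ≤ 2 * n + 1 ∧ IsHandleAttachment P k S₀ S ∧ ContMDiff 𝓑[n] 𝓑[n] ∞ ι ∧
      Topology.IsEmbedding ι ∧ (∀ x, Function.Bijective (mfderiv 𝓑[n] 𝓑[n] ι x)) ∧
      range ι = {x | S.φ x ≤ c} ∧ (∀ x, S₀.α x = (S.α (ι x)).comp (mfderiv 𝓑[n] 𝓑[n] ι x)) ∧
      (∀ x, mfderiv 𝓑[n] 𝓑[n] ι x (S₀.X x) = S.X (ι x)) ∧ (∀ x, S₀.φ x = S.φ (ι x)) ∧
      c < S.φ p ∧ ∀ x, S.X x = 0 → x ≠ p → S.φ x < c := by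
  obtain ⟨k, b, O, g, hk, hO, hpO, hg0, hg, hge, hgo, hgb, hgα, hgX, hgφ⟩ := hst
  have hb : S.φ p = b := by
    rw [hgφ p hpO, hg0, stdFun_eq]
    unfold stdRadii
    split_ifs <;> simp [radL, radC]
  have hpb : p ∉ C.bot ∪ C.top := by
    rw [← C.boundary_eq]
    exact (ModelWithCorners.isInteriorPoint_iff_not_isBoundaryPoint p).1
      (S.isInteriorPoint ((S.dfun_eq_zero_iff p).2 hp))
  have hc : Filter.Tendsto (fun ε : ℝ => S.φ p - ε ^ 2) (𝓝[>] 0) (𝓝 (S.φ p)) := by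
    have h : Continuous fun ε : ℝ => S.φ p - ε ^ 2 := by fun_prop
    simpa using (h.tendsto 0).mono_left nhdsWithin_le_nhds
  have hfin : ∀ᶠ y in 𝓝 (S.φ p), ∀ x ∈ {x | S.X x = 0}, x ≠ p → S.φ x < y := by
    rw [S.finite_zeros.eventually_all]
    intro x hx
    by_cases hxp : x = p
    · exact .of_forall fun y h => (h hxp).elim
    · filter_upwards [lt_mem_nhds (hmax x hx hxp)] with y hy _ using hy
  have h0 : g '' O ∈ 𝓝 (0 : Std n) := (hgo O Subset.rfl hO).mem_nhds ⟨p, hpO, hg0⟩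
  -- The size `ε` is so small that the handle fits into the standard neighbourhood, and that the
  -- level `φ(p) - ε²` of its attaching region lies above all other critical values and strictly
  -- between the boundary values.
  obtain ⟨ε, ⟨⟨hsub, hε1⟩, hbet⟩, hε0⟩ := (((eventually_handle_subset P k h0).and
    (hc.eventually hfin)).and (hc.eventually (S.isOpen_between.mem_nhds (S.mem_between hpb)))
    |>.and self_mem_nhdsWithin).exists
  have hε0 : 0 < ε := hε0
  obtain ⟨c, hcdef⟩ : ∃ c, c = S.φ p - ε ^ 2 := ⟨_, rfl⟩
  rw [← hcdef] at hε1 hbet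
  have hcp : c < S.φ p := by rw [hcdef]; nlinarith
  have hreg : ∀ x, S.φ x = c → S.X x ≠ 0 := fun x hx hX => by
    by_cases hxp : x = p
    · rw [hxp] at hx
      exact hcp.ne hx.symm
    · exact (hε1 x hX hxp).ne hx
  obtain ⟨D, ι, hι, hemb, hbij, hrange, hbot, htop⟩ := S.exists_sublevel hbet hreg
  have hle : ∀ x, S.φ (ι x) ≤ c := fun x => by
    have : ι x ∈ {x | S.φ x ≤ c} := hrange ▸ mem_range_self x
    exact this
  obtain ⟨S₀, hα, hX, hφ⟩ := S.exists_pullback hreg hι hbij hle hbot htop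
  have hmem : ∀ x, x ∈ range ι ↔ S.φ x ≤ c := fun x => by rw [hrange]; rfl
  -- On the handle `φ ≥ c`, so it meets the sublevel only in the level `c`, that is, in its
  -- attaching region.
  have hatt : ∀ x ∈ O, g x ∈ handle P n k ε → (S.φ x ≤ c ↔ S.φ x = c) := fun x hx hgx => by
    have h1 := stdFun_ge_of_mem_handle hε0 hgx
    rw [hgφ x hx, hcdef, hb]
    exact ⟨fun h => by linarith, fun h => h.le⟩
  have hatt' : ∀ x ∈ O, S.φ x = c ↔ (stdRadii k (g x)).1 ^ 2 - (stdRadii k (g x)).2 ^ 2 = ε ^ 2 :=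
    fun x hx => by
      rw [hgφ x hx, hcdef, hb, stdFun_eq]
      constructor <;> intro h <;> linarith
  refine ⟨D, S₀, k, ι, c, hk, ⟨ι, O, g, ε, b, hι, hemb.injective, hbij, ?_, fun x => ⟨1, one_pos,
    fun v => ?_⟩, hX, fun x => (hφ x).symm, hε0, hO, hg, hge, hgb, hsub, fun x hx => ⟨1, one_pos,
    fun v => ?_⟩, hgX, fun x hx _ => hgφ x hx, ?_, fun x hx => ?_, fun x hx => ?_⟩, hι, hemb, hbij,
    hrange, hα, hX, hφ, hcp, fun x h1 h2 => hε1 x h1 h2⟩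
  · rw [hbot, image_preimage_eq_inter_range]
    exact inter_eq_left.2 fun x hx => (hmem x).2 (hbet.1 x hx).le
  · rw [hα, one_mul]
    rfl
  · rw [hgα x hx, one_mul]
    exact (stdCovector_apply _ _).symm
  · ext x
    constructor
    · rintro ⟨h1, h2, h3⟩
      exact ⟨h2, h3, (hatt' x h2).1 ((hatt x h2 h3).1 ((hmem x).1 h1))⟩
    · rintro ⟨h2, h3, h4⟩
      exact ⟨(hmem x).2 ((hatt' x h2).2 h4).le, h2, h3⟩
  · have h1 := (hatt' x hx.1).2 hx.2.2
    obtain ⟨y, rfl⟩ := (hmem x).2 h1.le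
    exact ⟨y, by rw [htop]; exact h1, rfl⟩
  · by_cases hxp : x = p
    · refine Or.inr ⟨hxp ▸ hpO, ?_⟩
      rw [mem_preimage, hxp, hg0]
      exact zero_mem_handle P k ε
    · exact Or.inl ((hmem x).2 (hε1 x ((S.dfun_eq_zero_iff x).1 hx) hxp).le)

/-- A convex contact cobordism which is standard near its critical points, and whose critical
values are distinct, is a handlebody. -/
theorem ConvexStructure.isHandlebody_of_standard (P : HandleProfile) (N : ℕ) :
    ∀ (C : Cobordism.{u} n) (S : ConvexStructure C), {x | S.X x = 0}.ncard = N →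
      (∀ p, S.X p = 0 → S.IsStandardNear p) → InjOn S.φ {x | S.X x = 0} → IsHandlebody P S := by
  induction N with
  | zero =>
    intro C S hN _ _
    rw [Set.ncard_eq_zero S.finite_zeros] at hN
    refine .cylinder S fun x hx => ?_
    have : x ∈ {x | S.X x = 0} := (S.dfun_eq_zero_iff x).1 hx
    rw [hN] at this
    exact this
  | succ N ih =>
    intro C S hN hst hinj
    have hne : {x | S.X x = 0}.Nonempty := Set.nonempty_of_ncard_ne_zero (by omega)
    -- The handle of the highest critical point is removed first; as the critical values are
    -- distinct, all others lie in the sublevel.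
    obtain ⟨p, hp, hmax⟩ := S.finite_zeros.exists_maximalFor S.φ _ hne
    have hlt : ∀ x, S.X x = 0 → x ≠ p → S.φ x < S.φ p := fun x hx hxp =>
      lt_of_le_of_ne (not_lt.1 fun h => h.not_ge (hmax hx h.le)) fun h => hxp (hinj hx hp h)
    obtain ⟨D, S₀, k, ι, c, hk, hatt, hι, hemb, hbij, hrange, hα, hX, hφ, hcp, hc⟩ :=
      (hst p hp).exists_attach P hp hlt
    have hzero : ∀ x, S₀.X x = 0 ↔ S.X (ι x) = 0 := fun x => by
      rw [← hX]
      exact ⟨fun h => by rw [h]; exact map_zero _, fun h => (hbij x).1 (h.trans (map_zero _).symm)⟩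
    have hle : ∀ x, S.φ (ι x) ≤ c := fun x => by
      have : ι x ∈ {x | S.φ x ≤ c} := hrange ▸ mem_range_self x
      exact this
    have hnp : ∀ x, ι x ≠ p := fun x h => (h ▸ hle x).not_gt hcp
    have himage : ι '' {x | S₀.X x = 0} = {x | S.X x = 0} \ {p} := by
      ext y
      constructor
      · rintro ⟨x, hx, rfl⟩
        exact ⟨(hzero x).1 hx, hnp x⟩
      · rintro ⟨hy, hyp⟩
        obtain ⟨x, rfl⟩ : y ∈ range ι := by rw [hrange]; exact (hc y hy hyp).le
        exact ⟨x, (hzero x).2 hy, rfl⟩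
    refine .attach S₀ S (ih D S₀ ?_ (fun x hx => ?_) fun x hx y hy hxy => ?_) k hk hatt
    · have h1 := Set.ncard_image_of_injective {x | S₀.X x = 0} hemb.injective
      have h2 := Set.ncard_sdiff_singleton_of_mem (s := {x | S.X x = 0}) hp
      rw [← himage, h1, hN] at h2
      exact h2
    · have hx' := (hzero x).1 hx
      exact (hst _ hx').pullback hι hemb hbij hrange hα hX hφ (hc _ hx' (hnp x))
    · rw [hφ, hφ] at hxy
      exact hemb.injective (hinj ((hzero x).1 hx) ((hzero y).1 hy) hxy)

end Induction

end ConvexContact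

end

theorem theorem1p1 (P : ConvexContact.HandleProfile) (n : ℕ) (C : ConvexContact.Cobordism.{u} n)
    (S : ConvexContact.ConvexStructure C) :
    ∃ S' : ConvexContact.ConvexStructure C,
      ConvexContact.StrictlyConvexHomotopic S S' ∧ ConvexContact.IsHandlebody P S' := by
  obtain ⟨S', hS', hst, hinj⟩ := S.exists_standard
  exact ⟨S', hS'.strictlyConvexHomotopic, ConvexContact.ConvexStructure.isHandlebody_of_standard P _ C
    S' rfl (fun p hp => (hst p hp).isStandardNear) hinj⟩
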